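/- For a finite group $G$ write $\rho_G$ for its real regular representation, $S^V$ for the one point compactification of a finite dimensional real representation $V$, and $H\underline{M}$ for the genuine $G$-equivariant Eilenberg--Mac Lane spectrum of the constant Mackey functor $\underline{M}$ (so $\underline{\pi}_0 H\underline M=\underline M$ and $\underline\pi_n H\underline M=0$ for $n\neq 0$). For a pointed $G$-space $X$ let $H^i_G(X;\underline{\mathbb Z})=[\Sigma^\infty X,\Sigma^iH\underline{\mathbb Z}]^G$ be the reduced equivariant cohomology. (1) Let $G$ be a nontrivial finite group and $n\ge 0$ an integer. Then $H^i_G(S^{n\rho_G};\underline{\mathbb Z})=0$ for $0<i<4$, except when $G=C_3$, $n=1$ and $i=3$. In the exceptional case $H^3_G(S^{\rho_{G}};\underline{\mathbb Z})\cong H^2_G(S^{\rho_{G}-1};\underline{\mathbb Z})\cong\mathbb Z$, where $\rho_G-1$ is the reduced regular representation. (2) (Cell Lemma) For $G=C_{2^r}$ with $r>0$, a slice cell is a $G$-spectrum of the form $\widehat S(m,K)=G_+\wedge_K S^{m\rho_K}$, of dimension $m|K|$, or $\Sigma^{-1}\widehat S(m,K)$, of dimension $m|K|-1$, where $m\in\mathbb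 Z$ and $K\subseteq G$ is a subgroup; it is isotropic if it is not free, that is, if $K$ is not the trivial subgroup. If $\widehat S$ is an isotropic slice cell of even dimension, then for $-4<k<0$ $$\pi^G_k(H\underline{\mathbb Z}\wedge\widehat S)=0\qquad\text{and}\qquad \pi^G_k(H\underline{\mathbb Z}_{(2)}\wedge\widehat S)=0 .$$ -/

import Mathlib

open CategoryTheory CategoryTheory.Limits

universe u

noncomputable section

namespace GStable

/-! ## Pointed `G`-spaces -/

/-- A pointed left `G`-space, for a discrete group `G`. -/
structure PtGSpace (G : Type u) [Group G] where
  carrier : Type u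
  [top : TopologicalSpace carrier]
  [act : MulAction G carrier]
  [cont : ContinuousConstSMul G carrier]
  pt : carrier
  smul_pt : ∀ g : G, g • pt = pt

attribute [instance] PtGSpace.top PtGSpace.act PtGSpace.cont

instance (G : Type u) [Group G] : CoeSort (PtGSpace G) (Type u) := ⟨PtGSpace.carrier⟩

section Representations

variable {G : Type u} [Group G]

/-- The permutation representation of `G` on `ℝ^T`, for a `G`-set `T`. -/
def permRep (G : Type u) [Group G] (T : Type u) [MulAction G T] :
    Representation ℝ G (T → ℝ) where
  toFun g := LinearMap.funLeft ℝ ℝ (fun t => g⁻¹ • t)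
  map_one' := by ext; simp [LinearMap.funLeft]
  map_mul' g h := by ext; simp [LinearMap.funLeft, mul_smul]

/-- The vectors of coordinate sum zero in the regular representation `ℝ^G`. -/
def sumZero (G : Type u) [Finite G] : Submodule ℝ (G → ℝ) :=
  letI := Fintype.ofFinite G
  LinearMap.ker (∑ t : G, LinearMap.proj (R := ℝ) (φ := fun _ : G => ℝ) t)

theorem permRep_mem_sumZero [Finite G] (g : G) :
    ∀ v ∈ sumZero G, permRep G G g v ∈ sumZero G := by
  let _ := Fintype.ofFinite G
  intro v hv
  simp only [sumZero, LinearMap.mem_ker, LinearMap.sum_apply, LinearMap.proj_apply] at hv ⊢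
  rw [← hv]
  exact Fintype.sum_equiv (Equiv.mulLeft g⁻¹) _ _ (fun t => rfl)

/-- The reduced regular representation `ρ_G - 1`. -/
def reducedRegRep (G : Type u) [Group G] [Finite G] : Representation ℝ G (sumZero G) where
  toFun g := (permRep G G g).restrict (permRep_mem_sumZero g)
  map_one' := by ext; simp [LinearMap.restrict_apply]
  map_mul' g h := by ext; simp [LinearMap.restrict_apply]

/-- The representation sphere `S^V`: the one point compactification of a finite dimensional real
representation `V`, pointed at infinity. -/
def repSphere {V : Type u} [AddCommGroup V] [Module ℝ V] [TopologicalSpace V]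
    [IsTopologicalAddGroup V] [ContinuousSMul ℝ V] [T2Space V] [FiniteDimensional ℝ V]
    (r : Representation ℝ G V) : PtGSpace G :=
  letI a : MulAction G (OnePoint V) :=
    { smul := fun g => OnePoint.map (r g)
      one_smul := fun x => by
        change OnePoint.map (r 1) x = x
        rw [map_one, show ⇑(1 : V →ₗ[ℝ] V) = id from rfl, OnePoint.map_id]; rfl
      mul_smul := fun g h x => by
        change OnePoint.map (r (g * h)) x = OnePoint.map (r g) (OnePoint.map (r h) x)
        rw [map_mul, show ⇑(r g * r h) = r g ∘ r h from rfl, OnePoint.map_comp]; rfl }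
  { carrier := OnePoint V
    act := a
    cont := ⟨fun g => by
      have hg : Continuous (r g) := LinearMap.continuous_of_finiteDimensional _
      have hg' : Continuous (r g⁻¹) := LinearMap.continuous_of_finiteDimensional _
      let e : V ≃ₜ V :=
        { toFun := r g, invFun := r g⁻¹
          left_inv := fun v => by simp
          right_inv := fun v => by simp
          continuous_toFun := hg
          continuous_invFun := hg' }
      exact e.onePointCongr.continuous⟩
    pt := OnePoint.infty
    smul_pt := fun _ => rfl }

end Representations

/-- The finite `G`-set consisting of `p` fixed points and `q` copies of `G`.  Its permutation
representation is `p + q ρ_G`. -/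
def Coord (G : Type u) (p q : ℕ) : Type u := Fin p ⊕ (Fin q × G)

namespace Coord

variable {G : Type u} {p q : ℕ}

instance [Finite G] : Finite (Coord G p q) := inferInstanceAs (Finite (Fin p ⊕ (Fin q × G)))

instance [Group G] : MulAction G (Coord G p q) where
  smul g := Sum.map id (Prod.map id (g * ·))
  one_smul x := by
    change Sum.map id (Prod.map id ((1 : G) * ·)) x = x
    rcases x with x | ⟨x, y⟩ <;> simp
  mul_smul g h x := by
    change Sum.map id (Prod.map id ((g * h) * ·)) x =
      Sum.map id (Prod.map id (g * ·)) (Sum.map id (Prod.map id (h * ·)) x)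
    rcases x with x | ⟨x, y⟩ <;> simp [mul_assoc]

/-- The inclusion of the first coordinates in `(p + q ρ_G) ⊕ (1 + ρ_G)`. -/
def old : Coord G p q → Coord G (p + 1) (q + 1) :=
  Sum.map Fin.castSucc (Prod.map Fin.castSucc id)

/-- The inclusion of the last coordinates in `(p + q ρ_G) ⊕ (1 + ρ_G)`. -/
def new : Coord G 1 1 → Coord G (p + 1) (q + 1) :=
  Sum.map (Fin.natAdd p) (Prod.map (Fin.natAdd q) id)

theorem old_smul [Group G] (g : G) (t : Coord G p q) : old (g • t) = g • old t := by
  rcases t with t | t <;> rfl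

theorem new_smul [Group G] (g : G) (t : Coord G 1 1) :
    (new (g • t) : Coord G (p + 1) (q + 1)) = g • new t := by
  rcases t with t | t <;> rfl

end Coord

/-- The `T`-fold power of the circle `S¹ = ℝ ∪ {∞}`.  Collapsing the points with some coordinate
equal to `∞` gives the `T`-fold smash power of `S¹`, that is, the sphere of the permutation
representation `ℝ^T`.  So pointed maps out of `S^{ℝ^T} ∧ A` are maps out of `Torus T × A` that send
every point with a coordinate `∞` of the torus, or with second coordinate the base point, to the
base point. -/
abbrev Torus (T : Type u) : Type u := T → OnePoint ℝ

/-- The action of `G` on the torus by permutation of coordinates. -/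
def permute {G : Type u} [Group G] {T : Type u} [MulAction G T] (g : G) (z : Torus T) : Torus T :=
  fun t => z (g⁻¹ • t)

section Constructions

variable {G : Type u} [Group G]

/-- The pointed `G`-space `(G/K)₊`; the added base point is `none`. -/
def orbit (K : Subgroup G) : PtGSpace G :=
  letI : TopologicalSpace (Option (G ⧸ K)) := ⊥
  letI a : MulAction G (Option (G ⧸ K)) :=
    { smul := fun g => Option.map (g • ·)
      one_smul := fun x => by
        change Option.map ((1 : G) • ·) x = x
        cases x <;> simp
      mul_smul := fun g h x => by
        change Option.map ((g * h) • ·) x = Option.map (g • ·) (Option.map (h • ·) x)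
        cases x <;> simp [mul_smul] }
  { carrier := Option (G ⧸ K)
    top := ⊥
    act := a
    cont := ⟨fun _ => continuous_bot⟩
    pt := none
    smul_pt := fun _ => rfl }

instance (K : Subgroup G) : DiscreteTopology (orbit K) := ⟨rfl⟩

/-- The relation collapsing the wedge `X ∨ B` in `X × B`. -/
def smashRel (X B : PtGSpace G) (x y : X × B) : Prop :=
  (x.1 = X.pt ∨ x.2 = B.pt) ∧ (y.1 = X.pt ∨ y.2 = B.pt)

/-- The smash product `X ∧ B` of pointed `G`-spaces, with the diagonal action. -/
def smashSpace (X B : PtGSpace G) : PtGSpace G :=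
  have resp : ∀ (g : G) (x y : X × B), smashRel X B x y → smashRel X B (g • x) (g • y) := by
    rintro g ⟨a, b⟩ ⟨a', b'⟩ ⟨h, h'⟩
    refine ⟨h.imp ?_ ?_, h'.imp ?_ ?_⟩ <;> intro e <;> simp_all [PtGSpace.smul_pt]
  letI a : MulAction G (Quot (smashRel X B)) :=
    { smul := fun g => Quot.map (g • ·) (resp g)
      one_smul := by
        rintro ⟨x⟩
        change Quot.mk _ ((1 : G) • x) = Quot.mk _ x
        rw [one_smul]
      mul_smul := by
        rintro g h ⟨x⟩
        change Quot.mk _ ((g * h) • x) = Quot.mk _ (g • h • x)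
        rw [mul_smul] }
  { carrier := Quot (smashRel X B)
    act := a
    cont := ⟨fun g => continuous_quot_lift _
      (continuous_quot_mk.comp (continuous_const_smul g))⟩
    pt := Quot.mk _ (X.pt, B.pt)
    smul_pt := fun g => by
      change Quot.mk _ (g • X.pt, g • B.pt) = _
      rw [X.smul_pt, B.smul_pt] }

/-- The relation defining `G₊ ∧_K B`: `(g k, b) ~ (g, k b)`, and all `(g, *)` are identified. -/
inductive indRel (K : Subgroup G) (B : PtGSpace K) : (Σ _ : G, B) → (Σ _ : G, B) → Prop
  | mul (g : G) (k : K) (b : B) : indRel K B ⟨g * k, b⟩ ⟨g, k • b⟩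
  | pt (g g' : G) : indRel K B ⟨g, B.pt⟩ ⟨g', B.pt⟩

/-- The induced pointed `G`-space `G₊ ∧_K B`. -/
def induced (K : Subgroup G) (B : PtGSpace K) : PtGSpace G :=
  have resp : ∀ (g : G) (x y : Σ _ : G, B), indRel K B x y →
      indRel K B ⟨g * x.1, x.2⟩ ⟨g * y.1, y.2⟩ := by
    rintro g _ _ (⟨h, k, b⟩ | ⟨h, h'⟩)
    · change indRel K B ⟨g * (h * k), b⟩ _
      rw [← mul_assoc]
      exact indRel.mul (g * h) k b
    · exact indRel.pt _ _
  letI a : MulAction G (Quot (indRel K B)) :=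
    { smul := fun g => Quot.map (fun x => ⟨g * x.1, x.2⟩) (resp g)
      one_smul := by
        rintro ⟨x⟩
        change Quot.mk _ (⟨1 * x.1, x.2⟩ : Σ _ : G, B) = Quot.mk _ x
        rw [one_mul]
      mul_smul := by
        rintro g h ⟨x⟩
        change Quot.mk _ (⟨g * h * x.1, x.2⟩ : Σ _ : G, B) = Quot.mk _ ⟨g * (h * x.1), x.2⟩
        rw [mul_assoc] }
  { carrier := Quot (indRel K B)
    act := a
    cont := ⟨fun g => continuous_quot_lift _ (continuous_quot_mk.comp
      (continuous_sigma fun h => continuous_sigmaMk (σ := fun _ : G => B) (i := g * h)))⟩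
    pt := Quot.mk _ ⟨1, B.pt⟩
    smul_pt := fun g => Quot.sound (indRel.pt _ _) }

end Constructions

/-! ## `G`-spectra -/

/-- A (genuine) `G`-prespectrum, indexed on the exhausting sequence of representations
`V_n = (e + n) + (d + n) ρ_G`: pointed `G`-spaces `X_n` (the value at `V_n`) with structure maps
`S^{1 + ρ_G} ∧ X_n → X_{n+1}`, written in adjoint form on the torus of coordinates of `1 + ρ_G`.
An orthogonal `G`-spectrum gives a prespectrum by restriction to the representations `V_n`, and
homotopy classes of maps from suspension spectra only depend on that restriction. -/
structure GPrespectrum (G : Type u) [Group G] where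
  d : ℕ
  e : ℕ
  level : ℕ → PtGSpace G
  struct (n : ℕ) : C(level n, C(Torus (Coord G 1 1), level (n + 1)))
  struct_pt (n : ℕ) (z : Torus (Coord G 1 1)) : struct n (level n).pt z = (level (n + 1)).pt
  struct_infty (n : ℕ) (x : level n) (z : Torus (Coord G 1 1)) :
    (∃ t, z t = OnePoint.infty) → struct n x z = (level (n + 1)).pt
  struct_smul (n : ℕ) (g : G) (x : level n) (z : Torus (Coord G 1 1)) :
    struct n (g • x) (permute g z) = g • struct n x z

section Maps

variable {G : Type u} [Group G]

/-- The space of pointed `G`-maps `S^{p + q ρ_G} ∧ A → Y`, with the compact-open topology. -/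
def MapSpace (p q : ℕ) (A Y : PtGSpace G) : Type u :=
  { f : C(Torus (Coord G p q) × A, Y) //
    (∀ z a, (∃ t, z t = OnePoint.infty) → f (z, a) = Y.pt) ∧
    (∀ z, f (z, A.pt) = Y.pt) ∧
    (∀ (g : G) z a, f (permute g z, g • a) = g • f (z, a)) }

instance (p q : ℕ) (A Y : PtGSpace G) : TopologicalSpace (MapSpace p q A Y) :=
  inferInstanceAs (TopologicalSpace (Subtype _))

/-- The constant map. -/
def MapSpace.base (p q : ℕ) (A Y : PtGSpace G) : MapSpace p q A Y :=
  ⟨ContinuousMap.const _ Y.pt, fun _ _ _ => rfl, fun _ => rfl, fun g _ _ => (Y.smul_pt g).symm⟩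

/-- The stabilization map
`Map^G(S^{p + q ρ} ∧ A, X_n) → Map^G(S^{(p + 1) + (q + 1) ρ} ∧ A, X_{n+1})`: smash with the
identity of `S^{1 + ρ}` and compose with the structure map. -/
def stabilize (X : GPrespectrum G) (A : PtGSpace G) [LocallyCompactSpace A] (p q n : ℕ) :
    C(MapSpace p q A (X.level n), MapSpace (p + 1) (q + 1) A (X.level (n + 1))) where
  toFun f := ⟨⟨fun x => X.struct n (f.1 (x.1 ∘ Coord.old, x.2)) (x.1 ∘ Coord.new), by fun_prop⟩, by
    obtain ⟨f, hf1, hf2, hf3⟩ := f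
    refine ⟨?_, ?_, ?_⟩
    · rintro z a ⟨t, ht⟩
      change X.struct n (f (z ∘ Coord.old, a)) (z ∘ Coord.new) = _
      by_cases h : ∃ s : Coord G p q, Coord.old s = t
      · obtain ⟨s, rfl⟩ := h
        rw [hf1 _ _ ⟨s, ht⟩, X.struct_pt]
      · have : ∃ s : Coord G 1 1, Coord.new s = t := by
          rcases t with i | ⟨i, g⟩
          · refine Fin.lastCases (fun h => ⟨Sum.inl 0, rfl⟩)
              (fun i h => (h ⟨Sum.inl i, rfl⟩).elim) i h
          · refine Fin.lastCases (fun h => ⟨Sum.inr (0, g), rfl⟩)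
              (fun i h => (h ⟨Sum.inr (i, g), rfl⟩).elim) i h
        obtain ⟨s, rfl⟩ := this
        exact X.struct_infty _ _ _ ⟨s, ht⟩
    · intro z
      change X.struct n (f (z ∘ Coord.old, A.pt)) (z ∘ Coord.new) = _
      rw [hf2, X.struct_pt]
    · intro g z a
      change X.struct n (f (permute g z ∘ Coord.old, g • a)) (permute g z ∘ Coord.new) =
        g • X.struct n (f (z ∘ Coord.old, a)) (z ∘ Coord.new)
      have h1 : permute g z ∘ (Coord.old : Coord G p q → _) = permute g (z ∘ Coord.old) := by
        funext t; simp [permute, Coord.old_smul]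
      have h2 : permute g z ∘ (Coord.new : Coord G 1 1 → Coord G (p + 1) (q + 1)) =
          permute g (z ∘ Coord.new) := by
        funext t; simp [permute, Coord.new_smul]
      rw [h1, h2, hf3, X.struct_smul]⟩
  continuous_toFun := by
    refine Continuous.subtype_mk (ContinuousMap.continuous_of_continuous_uncurry _ ?_) _
    have h : Continuous fun y : MapSpace p q A (X.level n) ×
        (Torus (Coord G (p + 1) (q + 1)) × A) => y.1.1 (y.2.1 ∘ Coord.old, y.2.2) :=
      Continuous.eval (continuous_subtype_val.comp continuous_fst) (by fun_prop)
    exact Continuous.eval (F := C(Torus (Coord G 1 1), X.level (n + 1)))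
      ((X.struct n).continuous.comp h) (g := fun y => y.2.1 ∘ Coord.new) (by fun_prop)

theorem stabilize_base (X : GPrespectrum G) (A : PtGSpace G) [LocallyCompactSpace A]
    (p q n : ℕ) : stabilize X A p q n (MapSpace.base p q A (X.level n)) =
      MapSpace.base (p + 1) (q + 1) A (X.level (n + 1)) := by
  apply Subtype.ext
  ext x
  exact X.struct_pt _ _

/-- The sequence of groups `[S^{k + V} ∧ A, X_V]^G`, for `V` in the indexing sequence of `X`,
starting with the first `n` for which `1 - k ≤ n`.  One of the trivial coordinates of the sphere
is the loop coordinate of the fundamental group of the mapping space. -/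
def stableSeq (k : ℤ) (A : PtGSpace G) [LocallyCompactSpace A] (X : GPrespectrum G) :
    ℕ ⥤ GrpCat.{u} :=
  Functor.ofSequence
    (X := fun n => GrpCat.of (FundamentalGroup
      (MapSpace (X.e + (k - 1).toNat + n) (X.d + (1 - k).toNat + n) A
        (X.level ((1 - k).toNat + n))) (MapSpace.base _ _ _ _)))
    (fun n => GrpCat.ofHom (FundamentalGroup.mapOfEq
      (stabilize X A (X.e + (k - 1).toNat + n) (X.d + (1 - k).toNat + n) ((1 - k).toNat + n))
      (stabilize_base X A _ _ _)))

/-- The group `[S^k ∧ A, X]^G = colim_V [S^{k + V} ∧ A, X_V]^G` of maps in the stable homotopy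
category of `G`-spectra out of (the suspension spectrum of) a compact `G`-CW complex `A`. -/
def stableMaps (k : ℤ) (A : PtGSpace G) [LocallyCompactSpace A] (X : GPrespectrum G) :
    GrpCat.{u} :=
  GrpCat.FilteredColimits.colimit.{0, u} (stableSeq k A X)

/-- The map `(G/K)₊ → (G/L)₊` given by a map of `G`-sets `G/K → G/L`. -/
def orbitMap {K L : Subgroup G} (f : (G ⧸ K) →[G] (G ⧸ L)) : C(orbit K, orbit L) where
  toFun := Option.map f
  continuous_toFun := continuous_bot

theorem orbitMap_smul {K L : Subgroup G} (f : (G ⧸ K) →[G] (G ⧸ L)) (g : G) (a : orbit K) :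
    orbitMap f (g • a) = g • orbitMap f a := by
  rcases a with _ | a
  · rfl
  · exact congrArg some (map_smul f g a)

/-- Precomposition with the map `(G/K)₊ → (G/L)₊` given by a map of `G`-sets. -/
def MapSpace.precomp (p q : ℕ) {K L : Subgroup G} (f : (G ⧸ K) →[G] (G ⧸ L)) (Y : PtGSpace G) :
    C(MapSpace p q (orbit L) Y, MapSpace p q (orbit K) Y) where
  toFun h := ⟨h.1.comp (ContinuousMap.prodMap (ContinuousMap.id _) (orbitMap f)), by
    refine ⟨fun z a ht => h.2.1 _ _ ht, fun z => h.2.2.1 z, fun g z a => ?_⟩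
    change h.1 (permute g z, orbitMap f (g • a)) = g • h.1 (z, orbitMap f a)
    rw [orbitMap_smul, h.2.2.2]⟩
  continuous_toFun := continuous_induced_rng.2
    ((ContinuousMap.continuous_precomp (ContinuousMap.prodMap (ContinuousMap.id _)
      (orbitMap f))).comp continuous_subtype_val)

theorem MapSpace.precomp_base (p q : ℕ) {K L : Subgroup G} (f : (G ⧸ K) →[G] (G ⧸ L))
    (Y : PtGSpace G) : precomp p q f Y (base p q _ Y) = base p q _ Y := rfl

theorem mapOfEq_comp_mapOfEq {X Y Z : Type u} [TopologicalSpace X] [TopologicalSpace Y]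
    [TopologicalSpace Z] (f : C(X, Y)) (g : C(Y, Z)) {x : X} {y : Y} {z : Z} (hf : f x = y)
    (hg : g y = z) : (FundamentalGroup.mapOfEq g hg).comp (FundamentalGroup.mapOfEq f hf) =
      FundamentalGroup.mapOfEq (g.comp f) (by simp [hf, hg]) := by
  subst hf hg
  refine MonoidHom.ext fun p => ?_
  rw [MonoidHom.comp_apply, FundamentalGroup.mapOfEq_apply, FundamentalGroup.mapOfEq_apply,
    FundamentalGroup.mapOfEq_apply]
  induction p using Quotient.inductionOn
  rfl

/-- The restriction map `[S^k ∧ (G/L)₊, X]^G → [S^k ∧ (G/K)₊, X]^G` along a map of `G`-sets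
`G/K → G/L`. -/
def restriction (k : ℤ) {K L : Subgroup G} (f : (G ⧸ K) →[G] (G ⧸ L)) (X : GPrespectrum G) :
    stableMaps k (orbit L) X →* stableMaps k (orbit K) X :=
  GrpCat.Hom.hom ((GrpCat.FilteredColimits.colimitCoconeIsColimit.{0, u}
    (stableSeq k (orbit L) X)).map (GrpCat.FilteredColimits.colimitCocone.{0, u}
      (stableSeq k (orbit K) X))
    (NatTrans.ofSequence (fun n => GrpCat.ofHom (FundamentalGroup.mapOfEq
      (MapSpace.precomp _ _ f _) (MapSpace.precomp_base _ _ f _))) (fun n => by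
        simp only [stableSeq, Functor.ofSequence_map_homOfLE_succ]
        refine GrpCat.hom_ext ?_
        refine (mapOfEq_comp_mapOfEq _ _ (stabilize_base X _ _ _ _)
          (MapSpace.precomp_base _ _ f _)).trans (Eq.trans ?_ (mapOfEq_comp_mapOfEq _ _
            (MapSpace.precomp_base _ _ f _) (stabilize_base X _ _ _ _)).symm)
        rfl)))

/-- The equivariant homotopy group `π_k^G X = [S^k, X]^G`; here `S⁰ = (G/G)₊`. -/
def homotopyGroup (k : ℤ) (X : GPrespectrum G) : GrpCat.{u} := stableMaps k (orbit ⊤) X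

/-- `X` is an Eilenberg-Mac Lane spectrum for the constant Mackey functor `M`: the Mackey functors
`π_n X : G/K ↦ [S^n ∧ (G/K)₊, X]^G` vanish for `n ≠ 0`, and `π_0 X` is the constant functor with
value `M` and identity restriction maps.  Transfers need not be mentioned: by the double coset
formula, identity restrictions force the transfer along `G/K → G/L` to be multiplication by
the index of `K` in `L`. -/
structure IsEilenbergMacLane (X : GPrespectrum G) (M : Type) [AddCommGroup M] : Prop where
  vanish : ∀ (K : Subgroup G) (n : ℤ), n ≠ 0 → Subsingleton (stableMaps n (orbit K) X)
  coeff : ∃ φ : ∀ K : Subgroup G, stableMaps 0 (orbit K) X ≃* Multiplicative M,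
    ∀ (K L : Subgroup G) (f : (G ⧸ K) →[G] (G ⧸ L)) (x : stableMaps 0 (orbit L) X),
      φ K (restriction 0 f X x) = φ L x

/-- The (reduced) cohomology `[A, Σ^i X]^G = [S^{-i} ∧ A, X]^G` of a compact pointed `G`-CW complex
`A` in the theory represented by `X`.  If `X` is an Eilenberg-Mac Lane spectrum for the constant
Mackey functor `M`, this is `H^i_G(A; M)`. -/
def cohomology (X : GPrespectrum G) (i : ℤ) (A : PtGSpace G) [LocallyCompactSpace A] :
    GrpCat.{u} := stableMaps (-i) A X

end Maps

section Spheres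

variable {G : Type u} [Group G]

instance {V : Type u} [AddCommGroup V] [Module ℝ V] [TopologicalSpace V]
    [IsTopologicalAddGroup V] [ContinuousSMul ℝ V] [T2Space V] [FiniteDimensional ℝ V]
    (r : Representation ℝ G V) : LocallyCompactSpace (repSphere r) := by
  have e : V ≃L[ℝ] (Fin (Module.finrank ℝ V) → ℝ) := ContinuousLinearEquiv.ofFinrankEq (by simp)
  have : LocallyCompactSpace V := e.toHomeomorph.isClosedEmbedding.locallyCompactSpace
  change LocallyCompactSpace (OnePoint V)
  infer_instance

/-- The sphere `S^{n ρ_G}` of `n` copies of the regular representation. -/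
abbrev regSphere (G : Type u) [Group G] [Finite G] (n : ℕ) : PtGSpace G :=
  repSphere (permRep G (Coord G 0 n))

/-- The sphere `S^{ρ_G - 1}` of the reduced regular representation. -/
abbrev reducedRegSphere (G : Type u) [Group G] [Finite G] : PtGSpace G :=
  repSphere (reducedRegRep G)

end Spheres

/-! ## Slice cells -/

section Slices

variable {G : Type u} [Group G]

/-- A `G`-spectrum of the form `S^{-(b + a ρ_G)} ∧ B`, for a pointed `G`-space `B`. -/
structure DesuspendedSpace (G : Type u) [Group G] where
  a : ℕ
  b : ℕ
  space : PtGSpace G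

/-- The smash product `X ∧ S^{-(b + a ρ_G)} ∧ B`: its value at `V ⊕ (b + a ρ_G)` is `X_V ∧ B`. -/
def GPrespectrum.smash (X : GPrespectrum G) (E : DesuspendedSpace G) : GPrespectrum G where
  d := X.d + E.a
  e := X.e + E.b
  level n := smashSpace (X.level n) E.space
  struct n :=
    { toFun := Quot.lift
        (fun x : X.level n × E.space => ⟨fun z => (Quot.mk _ (X.struct n x.1 z, x.2) :
            smashSpace (X.level (n + 1)) E.space),
          continuous_quot_mk.comp (by fun_prop)⟩)
        (by
          rintro ⟨x, b⟩ ⟨x', b'⟩ ⟨h, h'⟩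
          ext z
          refine Quot.sound ⟨h.imp (fun h => ?_) id, h'.imp (fun h => ?_) id⟩
          · change X.struct n x z = _
            rw [show x = _ from h, X.struct_pt]
          · change X.struct n x' z = _
            rw [show x' = _ from h, X.struct_pt])
      continuous_toFun := by
        refine continuous_quot_lift _ (ContinuousMap.continuous_of_continuous_uncurry _ ?_)
        have h : Continuous fun y : (X.level n × E.space) × Torus (Coord G 1 1) =>
            (X.struct n y.1.1 y.2, y.1.2) :=
          (Continuous.eval (F := C(Torus (Coord G 1 1), X.level (n + 1)))
            (f := fun y : (X.level n × E.space) × Torus (Coord G 1 1) => X.struct n y.1.1)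
            (by fun_prop) continuous_snd).prodMk (by fun_prop)
        exact continuous_quot_mk.comp h }
  struct_pt n z := by
    change Quot.mk _ (X.struct n (X.level n).pt z, E.space.pt) = Quot.mk _ _
    rw [X.struct_pt]
  struct_infty n := by
    rintro ⟨_⟩ z hz
    exact Quot.sound ⟨Or.inl (X.struct_infty _ _ _ hz), Or.inl rfl⟩
  struct_smul n g := by
    rintro ⟨x : X.level n × E.space⟩ z
    change Quot.mk _ (X.struct n (g • x.1) (permute g z), g • x.2) =
      Quot.mk _ (g • X.struct n x.1 z, g • x.2)
    rw [X.struct_smul]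

/-- The `K`-set obtained from `j` copies of `G`, with `K` acting by left multiplication, by
removing the `j` copies of `K`.  Its permutation representation is the complement of
`j ρ_K` in the restriction of `j ρ_G` to `K`. -/
def CoCoord (K : Subgroup G) (j : ℕ) : Type u := { x : Fin j × G // x.2 ∉ K }

instance [Finite G] (K : Subgroup G) (j : ℕ) : Finite (CoCoord K j) :=
  inferInstanceAs (Finite (Subtype _))

instance (K : Subgroup G) (j : ℕ) : MulAction K (CoCoord K j) where
  smul k x := ⟨(x.1.1, k * x.1.2), fun h => x.2 ((K.mul_mem_cancel_left k.2).1 h)⟩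
  one_smul x := Subtype.ext (Prod.ext rfl (one_mul _))
  mul_smul k l x := Subtype.ext (Prod.ext rfl (mul_assoc (k : G) l x.1.2))

/-- The spectrum `G₊ ∧_K S^{m ρ_K}`.  For `m = -j < 0` it is written as
`S^{-j ρ_G} ∧ (G₊ ∧_K S^{j ρ_G - j ρ_K})`. -/
def inducedSphere [Finite G] (K : Subgroup G) : ℤ → DesuspendedSpace G
  | Int.ofNat j => ⟨0, 0, induced K (repSphere (permRep K (Coord K 0 j)))⟩
  | Int.negSucc j => ⟨j + 1, 0, induced K (repSphere (permRep K (CoCoord K (j + 1))))⟩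

/-- The slice cells: `G₊ ∧_K S^{m ρ_K}`, and its desuspension `Σ^{-1} G₊ ∧_K S^{m ρ_K}`. -/
inductive SliceCell (G : Type u) [Group G] : Type u
  | regular (m : ℤ) (K : Subgroup G) : SliceCell G
  | desuspended (m : ℤ) (K : Subgroup G) : SliceCell G

/-- The spectrum given by a slice cell. -/
def SliceCell.spectrum [Finite G] : SliceCell G → DesuspendedSpace G
  | regular m K => inducedSphere K m
  | desuspended m K => { inducedSphere K m with b := (inducedSphere K m).b + 1 }

/-- The dimension of a slice cell. -/
def SliceCell.dim : SliceCell G → ℤ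
  | regular m K => m * Nat.card K
  | desuspended m K => m * Nat.card K - 1

/-- A slice cell is free if it is induced from the trivial group, that is, if it is of the form
`G₊ ∧ S^m`. -/
def SliceCell.IsFree : SliceCell G → Prop
  | regular _ K => K = ⊥
  | desuspended _ K => K = ⊥

/-- A slice cell is isotropic if it is not free. -/
def SliceCell.IsIsotropic (S : SliceCell G) : Prop := ¬ S.IsFree

end Slices

/-- The odd integers, as a multiplicative subset of `ℤ`. -/
def oddIntegers : Submonoid ℤ where
  carrier := { n | Odd n }
  one_mem' := odd_one
  mul_mem' := Odd.mul

/-- The ring `ℤ_(2)` of integers localized at `2`. -/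
abbrev IntLocTwo : Type := Localization oddIntegers

end GStable

end

noncomputable section

namespace GStable

set_option linter.unusedSectionVars false

set_option autoImplicit true

open Set Metric Path.Homotopic FundamentalGroup

open scoped OnePoint

local notation "I" => unitInterval

local notation "J" => Icc (0 : ℝ) 1

local notation "Cyl(" T ")" => (T → ℝ) × ℝ

local notation "𝕋(" G ", " p ", " q ")" => Torus (Coord G p q)

local notation "𝕊(" Γ ", " T ")" => repSphere (permRep Γ T)

universe v w

section

/-- A sequence of pointed `Γ`-spaces and pointed `Γ`-maps. -/
structure Tower (Γ : Type w) [Group Γ] where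
  obj : ℕ → Type v
  [top : ∀ n, TopologicalSpace (obj n)]
  [act : ∀ n, MulAction Γ (obj n)]
  [cont : ∀ n, ContinuousConstSMul Γ (obj n)]
  pt : ∀ n, obj n
  smul_pt : ∀ n (g : Γ), g • pt n = pt n
  step : ∀ n, C(obj n, obj (n + 1))
  step_pt : ∀ n, step n (pt n) = pt (n + 1)
  step_smul : ∀ n (g : Γ) (x : obj n), step n (g • x) = g • step n x

attribute [instance] Tower.top Tower.act Tower.cont

namespace Tower

variable {Γ : Type w} [Group Γ] (L : Tower.{v} Γ)

/-- The composite of the maps from stage `n` to stage `n'`. -/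
def map (h : n ≤ n') : C(L.obj n, L.obj n') :=
  Nat.leRecOn (C := fun k => C(L.obj n, L.obj k)) h (fun {k} f => (L.step k).comp f)
    (ContinuousMap.id _)

lemma map_refl (h : n ≤ n) (x : L.obj n) : L.map h x = x := by
  simp [map, Nat.leRecOn_self]

lemma map_succ (h : n ≤ n') (h' : n ≤ n' + 1) (x : L.obj n) :
    L.map h' x = L.step n' (L.map h x) := by
  simp [map, Nat.leRecOn_succ h]

lemma map_one (h : n ≤ n + 1) (x : L.obj n) : L.map h x = L.step n x := by
  rw [L.map_succ le_rfl, L.map_refl]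

lemma map_map (h : n ≤ n') (h' : n' ≤ n'') (x : L.obj n) :
    L.map h' (L.map h x) = L.map (h.trans h') x := by
  induction n'', h' using Nat.le_induction with
  | base => rw [L.map_refl]
  | succ k hk ih => rw [L.map_succ hk, ih, L.map_succ (h.trans hk)]

lemma map_pt (h : n ≤ n') : L.map h (L.pt n) = L.pt n' := by
  induction n', h using Nat.le_induction with
  | base => rw [L.map_refl]
  | succ k hk ih => rw [L.map_succ hk, ih, L.step_pt]

lemma map_smul (h : n ≤ n') (g : Γ) (x : L.obj n) :
    L.map h (g • x) = g • L.map h x := by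
  induction n', h using Nat.le_induction with
  | base => simp only [L.map_refl]
  | succ k hk ih => simp only [L.map_succ hk, ih, L.step_smul]

/-- Points fixed by a subgroup. -/
def Fixed (H : Subgroup Γ) (x : L.obj n) : Prop := ∀ g ∈ H, g • x = x

variable {L}

lemma Fixed.map (h : n ≤ n') (hx : L.Fixed H x) :
    L.Fixed H (L.map h x) := fun g hg => by rw [← L.map_smul, hx g hg]

variable (L) in
lemma fixed_pt (H : Subgroup Γ) (n : ℕ) : L.Fixed H (L.pt n) := fun g _ => L.smul_pt n g

variable {E : Type*} [NormedAddCommGroup E] [NormedSpace ℝ E]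

variable (L) in
/-- The map `u`, trivial outside of the unit ball, becomes null homotopic at some later stage,
through maps that are fixed by `H` and trivial outside of the unit ball. -/
def EvNull (H : Subgroup Γ) (u : E → L.obj n) : Prop :=
  ∃ (n' : ℕ) (h : n ≤ n') (N : ℝ × E → L.obj n'), Continuous N ∧
    (∀ x, N (0, x) = L.map h (u x)) ∧ (∀ x, N (1, x) = L.pt n') ∧
    (∀ t x, 1 ≤ ‖x‖ → N (t, x) = L.pt n') ∧ ∀ t x, L.Fixed H (N (t, x))

variable (L) in
/-- The `j`-th homotopy group of the `H`-fixed points vanishes in the limit. -/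
def PiTriv (H : Subgroup Γ) (j : ℕ) : Prop :=
  ∀ (n : ℕ) (u : (Fin j → ℝ) → L.obj n), Continuous u → (∀ x, 1 ≤ ‖x‖ → u x = L.pt n) →
    (∀ x, L.Fixed H (u x)) → L.EvNull H u

variable (L) in
/-- A map given on `C × 0 ∪ B × [0, 1]` extends to `C × [0, 1]` at some later stage, trivially at
time `1`. -/
def Fillable (H : Subgroup Γ) [TopologicalSpace Y] (C B : Set Y)
    (h : Y × ℝ → L.obj n) : Prop :=
  ∃ (n' : ℕ) (hn : n ≤ n') (f : Y × ℝ → L.obj n'), ContinuousOn f (C ×ˢ J) ∧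
    (∀ x ∈ C, ∀ t ∈ J, x ∈ B ∨ t = 0 → f (x, t) = L.map hn (h (x, t))) ∧
    (∀ x ∈ C, f (x, 1) = L.pt n') ∧ ∀ x ∈ C, ∀ t ∈ J, L.Fixed H (f (x, t))

/-- The part `C × 0 ∪ B × [0, 1]` of the boundary of a cylinder. -/
def cup {Y : Type*} (C B : Set Y) : Set (Y × ℝ) :=
  {x | x.1 ∈ C ∧ x.2 ∈ J ∧ (x.1 ∈ B ∨ x.2 = 0)}

/-- The unit ball as a parametrization of the cup `ball × 0 ∪ sphere × [0, 1]`. -/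
def cupParam (x : E) : E × ℝ := ((max ‖x‖ (1 / 2))⁻¹ • x, max 0 (min 1 (2 * ‖x‖ - 1)))

lemma continuous_cupParam : Continuous (cupParam : E → E × ℝ) := by
  unfold cupParam
  have : ∀ x : E, max ‖x‖ (1 / 2) ≠ 0 := fun x => (lt_max_of_lt_right (by norm_num)).ne'
  fun_prop

lemma cupParam_of_le {x : E} (hx : ‖x‖ ≤ 1 / 2) : cupParam x = ((2 : ℝ) • x, 0) := by
  have h1 := max_eq_right hx
  have h2 : min 1 (2 * ‖x‖ - 1) ≤ 0 := (min_le_right _ _).trans (by linarith)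
  simp only [cupParam, h1, max_eq_left h2]
  norm_num

lemma norm_cupParam_of_ge {x : E} (hx : 1 / 2 ≤ ‖x‖) : ‖(cupParam x).1‖ = 1 := by
  have h0 : 0 < ‖x‖ := by linarith
  simp only [cupParam, max_eq_left hx, norm_smul, norm_inv, norm_norm, inv_mul_cancel₀ h0.ne']

lemma cupParam_mem (x : E) : cupParam x ∈ cup (closedBall (0 : E) 1) (sphere 0 1) := by
  have h2 : (cupParam x).2 ∈ J :=
    ⟨le_max_left _ _, max_le zero_le_one (min_le_left _ _)⟩
  rcases le_total ‖x‖ (1 / 2) with hx | hx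
  · refine ⟨?_, h2, .inr ?_⟩
    · rw [cupParam_of_le hx, mem_closedBall_zero_iff, norm_smul]
      norm_num; linarith
    · rw [cupParam_of_le hx]
  · have := norm_cupParam_of_ge hx
    exact ⟨by simp [this], h2, Or.inl (by simp [this])⟩

lemma fillable_ball (H : Subgroup Γ) {n : ℕ} (h : E × ℝ → L.obj n)
    (hN : L.EvNull H (fun x : E => h (cupParam x))) :
    L.Fillable H (closedBall (0 : E) 1) (sphere 0 1) h := by
  obtain ⟨n', hn, N, hNc, hN0, hN1, hNs, hNf⟩ := hN
  have hpos : ∀ x : E, 0 < max ‖x‖ (1 / 2) := fun x => lt_max_of_lt_right (by norm_num)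
  refine ⟨n', hn, fun z => N (min 1 (2 - 2 * ‖z.1‖) * z.2,
    ((1 / 2 : ℝ) * (1 + z.2 * (2 / max ‖z.1‖ (1 / 2) - 1))) • z.1), ?_, ?_, ?_, ?_⟩
  · refine (hNc.comp ?_).continuousOn
    have : ∀ x : E × ℝ, max ‖x.1‖ (1 / 2) ≠ 0 := fun x => (hpos x.1).ne'
    fun_prop (disch := exact this)
  · rintro x hx t ht (hb | rfl)
    · have hx1 : ‖x‖ = 1 := by simpa using hb
      have h1 : max ‖x‖ (1 / 2) = 1 := by rw [hx1]; norm_num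
      have h2 : min 1 (2 - 2 * ‖x‖) * t = 0 := by rw [hx1]; norm_num
      simp only [h1, h2, hN0]
      congr 2
      have hk : ((1 / 2 : ℝ) * (1 + t * (2 / 1 - 1))) = (1 + t) / 2 := by ring
      rw [hk]
      have hk0 : 0 ≤ (1 + t) / 2 := by linarith [ht.1]
      have hnorm : ‖((1 + t) / 2) • x‖ = (1 + t) / 2 := by
        rw [norm_smul, hx1, Real.norm_of_nonneg hk0, mul_one]
      have hmax : max ((1 + t) / 2) (1 / 2) = (1 + t) / 2 := max_eq_left (by linarith [ht.1])
      simp only [cupParam, hnorm, hmax, smul_smul]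
      have h3 : ((1 + t) / 2)⁻¹ * ((1 + t) / 2) = 1 := inv_mul_cancel₀ (by linarith [ht.1])
      rw [h3, one_smul]
      congr 1
      rw [show 2 * ((1 + t) / 2) - 1 = t by ring, min_eq_right ht.2, max_eq_right ht.1]
    · simp only [mul_zero, hN0, zero_mul, add_zero, mul_one]
      congr 2
      have hx1 : ‖x‖ ≤ 1 := by simpa using hx
      rw [cupParam_of_le, smul_smul]
      · norm_num
      · rw [norm_smul]; norm_num; linarith
  · intro x hx
    rcases le_total ‖x‖ (1 / 2) with h | h
    · have : min 1 (2 - 2 * ‖x‖) * 1 = 1 := by rw [mul_one, min_eq_left]; linarith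
      simp only [this, hN1]
    · refine hNs _ _ (le_of_eq ?_)
      have h0 : 0 < ‖x‖ := by linarith
      rw [max_eq_left h, norm_smul, show (1 / 2 : ℝ) * (1 + 1 * (2 / ‖x‖ - 1)) = ‖x‖⁻¹ by
        field_simp; ring, norm_inv, norm_norm, inv_mul_cancel₀ h0.ne']
  · intro x _ t _
    exact hNf _ _

lemma continuous_comp_cupParam {h : E × ℝ → L.obj n}
    (hc : ContinuousOn h (cup (closedBall (0 : E) 1) (sphere 0 1))) :
    Continuous fun x : E => h (cupParam x) :=
  hc.comp_continuous continuous_cupParam cupParam_mem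

lemma comp_cupParam_of_ge {h : E × ℝ → L.obj n}
    (h1 : ∀ x, ‖x‖ = 1 → h (x, 1) = L.pt n) {x : E} (hx : 1 ≤ ‖x‖) :
    h (cupParam x) = L.pt n := by
  have h2 : (cupParam x).2 = 1 := by
    simp only [cupParam]
    rw [min_eq_left (by linarith), max_eq_right zero_le_one]
  rw [show cupParam x = ((cupParam x).1, 1) from Prod.ext rfl h2]
  exact h1 _ (norm_cupParam_of_ge (by linarith))

lemma Fillable.transport [TopologicalSpace Y]
    [TopologicalSpace Y']
    (e : Y' → Y) (i : Y → Y') (hf : L.Fillable H C' B' (fun z => h (e z.1, z.2)))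
    (hi : ContinuousOn i C) (hiC : MapsTo i C C') (hiB : ∀ x ∈ C, x ∈ B → i x ∈ B')
    (hei : ∀ x ∈ C, e (i x) = x) : L.Fillable H C B h := by
  obtain ⟨n', hn, f, hfc, hfb, hf1, hff⟩ := hf
  refine ⟨n', hn, fun z => f (i z.1, z.2), ?_, ?_, ?_, ?_⟩
  · exact hfc.comp ((hi.comp continuousOn_fst fun z hz => hz.1).prodMk continuousOn_snd)
      fun z hz => ⟨hiC hz.1, hz.2⟩
  · intro x hx t ht hb
    have := hfb (i x) (hiC hx) t ht (hb.imp (hiB x hx) id)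
    simpa only [hei x hx] using this
  · intro x hx
    exact hf1 _ (hiC hx)
  · intro x hx t ht
    exact hff _ (hiC hx) t ht

lemma fillable_of_convex (hL : L.PiTriv H j) [FiniteDimensional ℝ E]
    (hE : Module.finrank ℝ E = j) {C : Set E} (hC : Convex ℝ C) (hC' : IsCompact C)
    (hCi : (interior C).Nonempty) {n : ℕ} {h : E × ℝ → L.obj n}
    (hc : ContinuousOn h (cup C (frontier C)))
    (hfix : ∀ z ∈ cup C (frontier C), L.Fixed H (h z))
    (h1 : ∀ x ∈ frontier C, h (x, 1) = L.pt n) : L.Fillable H C (frontier C) h := by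
  let ℓ : E ≃L[ℝ] (Fin j → ℝ) := ContinuousLinearEquiv.ofFinrankEq (by simp [hE])
  have hbd : Bornology.IsBounded (ℓ '' C) := (hC'.image ℓ.continuous).isBounded
  have hcl := (hC'.image ℓ.continuous).isClosed.closure_eq
  have hfr : frontier (ℓ '' C) = ℓ '' frontier C := (ℓ.toHomeomorph.image_frontier C).symm
  obtain ⟨e, -, he1, he2⟩ := exists_homeomorph_image_interior_closure_frontier_eq_unitBall
    (s := ℓ '' C) (hC.linear_image ℓ.toLinearMap)
    ((hCi.image _).mono (ℓ.toHomeomorph.image_interior C).subset) hbd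
  rw [hcl] at he1
  rw [hfr] at he2
  let φ : E ≃ₜ (Fin j → ℝ) := ℓ.toHomeomorph.trans e
  have hφ1 : φ '' C = closedBall 0 1 := by rw [← he1, ← Set.image_comp]; rfl
  have hφ2 : φ '' frontier C = sphere 0 1 := by rw [← he2, ← Set.image_comp]; rfl
  have hs1 : ∀ y ∈ closedBall 0 1, φ.symm y ∈ C := by
    rw [← hφ1]; rintro _ ⟨x, hx, rfl⟩; simpa using hx
  have hs2 : ∀ y ∈ sphere 0 1, φ.symm y ∈ frontier C := by
    rw [← hφ2]; rintro _ ⟨x, hx, rfl⟩; simpa using hx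
  have hcup : MapsTo (fun z : (Fin j → ℝ) × ℝ => (φ.symm z.1, z.2))
      (cup (closedBall 0 1) (sphere 0 1)) (cup C (frontier C)) :=
    fun z hz => ⟨hs1 _ hz.1, hz.2.1, hz.2.2.imp (hs2 _) id⟩
  refine Fillable.transport φ.symm φ ?_ φ.continuous.continuousOn (C' := closedBall 0 1)
    (B' := sphere 0 1) (fun x hx => hφ1 ▸ mem_image_of_mem _ hx)
    (fun x _ hx => hφ2 ▸ mem_image_of_mem _ hx) (fun x _ => φ.symm_apply_apply x)
  refine fillable_ball H _ (hL n _ ?_ ?_ ?_)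
  · refine continuous_comp_cupParam (h := fun z => h (φ.symm z.1, z.2)) (hc.comp ?_ hcup)
    exact ((φ.symm.continuous.comp continuous_fst).prodMk continuous_snd).continuousOn
  · intro x hx
    exact comp_cupParam_of_ge (h := fun z => h (φ.symm z.1, z.2))
      (fun x hx => h1 _ (hs2 _ (by simpa using hx))) hx
  · intro x
    exact hfix _ (hcup (cupParam_mem x))

end Tower

end

section Shift

variable {Γ : Type w} [Group Γ] {T : Type*} [MulAction Γ T] {α : Type*}

/-- The action of a group on functions on a set it acts on. -/
def shift (g : Γ) (x : T → α) : T → α := fun t => x (g⁻¹ • t)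

lemma shift_one (x : T → α) : shift (1 : Γ) x = x := by
  funext t; simp [shift]

lemma shift_shift (g h : Γ) (x : T → α) : shift g (shift h x) = shift (g * h) x := by
  funext t; simp [shift, mul_smul]

lemma shift_inv_shift (g : Γ) (x : T → α) : shift g⁻¹ (shift g x) = x := by
  rw [shift_shift, inv_mul_cancel, shift_one]

lemma shift_shift_inv (g : Γ) (x : T → α) : shift g (shift g⁻¹ x) = x := by
  rw [shift_shift, mul_inv_cancel, shift_one]

lemma shift_comp (g : Γ) (v : α → β) (x : T → α) :
    shift g (v ∘ x) = v ∘ shift g x := rfl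

lemma range_shift (g : Γ) (x : T → α) : range (shift g x) = range x :=
  (MulAction.surjective g⁻¹).range_comp x

lemma continuous_shift [TopologicalSpace α] (g : Γ) : Continuous (shift g : (T → α) → T → α) := by
  unfold shift; fun_prop

/-- The stabilizer of a function. -/
def cellStab (Γ : Type w) [Group Γ] [MulAction Γ T] (x : T → α) : Subgroup Γ where
  carrier := {g | shift g x = x}
  one_mem' := shift_one x
  mul_mem' {g h} hg hh := by
    change shift (g * h) x = x
    rw [← shift_shift, show shift h x = x from hh, show shift g x = x from hg]
  inv_mem' {g} hg := by
    change shift g⁻¹ x = x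
    conv_lhs => rw [← show shift g x = x from hg]
    exact shift_inv_shift g x

lemma mem_cellStab {x : T → α} {g : Γ} : g ∈ cellStab Γ x ↔ shift g x = x := Iff.rfl

end Shift

section OrderSimplex

variable {k : ℕ}

/-- The sequence `0, v₁, …, v_k, 1`. -/
def vhat (v : Fin k → ℝ) : Fin (k + 2) → ℝ :=
  Fin.cons (α := fun _ => ℝ) 0 (Fin.snoc (α := fun _ => ℝ) v 1)

@[simp] theorem vhat_zero (v : Fin k → ℝ) : vhat v 0 = 0 := rfl

@[simp] theorem vhat_last (v : Fin k → ℝ) : vhat v (Fin.last (k + 1)) = 1 := by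
  rw [vhat, ← Fin.succ_last, Fin.cons_succ, Fin.snoc_last]

@[simp] theorem vhat_mid (v : Fin k → ℝ) (i : Fin k) : vhat v i.castSucc.succ = v i := by
  rw [vhat, Fin.cons_succ, Fin.snoc_castSucc]

lemma eq_zero_or_last_or_mid (i : Fin (k + 2)) :
    i = 0 ∨ i = Fin.last (k + 1) ∨ ∃ j : Fin k, i = j.castSucc.succ := by
  refine Fin.cases (.inl rfl) (fun i => .inr ?_) i
  refine Fin.lastCases (.inl (Fin.succ_last _)) (fun j => .inr ⟨j, rfl⟩) i

lemma vhat_eq (y : Fin (k + 2) → ℝ) (h0 : y 0 = 0) (h1 : y (Fin.last (k + 1)) = 1) :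
    vhat (fun i : Fin k => y i.castSucc.succ) = y := by
  funext i
  rcases eq_zero_or_last_or_mid i with rfl | rfl | ⟨j, rfl⟩ <;> simp [*]

lemma continuous_vhat : Continuous (vhat : (Fin k → ℝ) → Fin (k + 2) → ℝ) := by
  refine continuous_pi fun i => ?_
  rcases eq_zero_or_last_or_mid i with rfl | rfl | ⟨j, rfl⟩ <;> simp only [vhat_zero, vhat_last,
    vhat_mid] <;> fun_prop

lemma vhat_comb (a b : ℝ) (hab : a + b = 1) (v u : Fin k → ℝ) (i : Fin (k + 2)) :
    vhat (a • v + b • u) i = a * vhat v i + b * vhat u i := by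
  rcases eq_zero_or_last_or_mid i with rfl | rfl | ⟨j, rfl⟩ <;> simp [hab]

variable (k) in
/-- The order simplex `0 ≤ v₁ ≤ … ≤ v_k ≤ 1`. -/
def ordSimplex : Set (Fin k → ℝ) := {v | Monotone (vhat v)}

lemma mem_ordSimplex :
    v ∈ ordSimplex k ↔ ∀ i : Fin (k + 1), vhat v i.castSucc ≤ vhat v i.succ :=
  Fin.monotone_iff_le_succ

lemma vhat_mem_Icc (hv : v ∈ ordSimplex k) (i : Fin (k + 2)) :
    vhat v i ∈ J :=
  ⟨by simpa using hv (Fin.zero_le i), by simpa using hv (Fin.le_last i)⟩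

lemma isClosed_ordSimplex : IsClosed (ordSimplex k) := by
  have : ordSimplex k = ⋂ i : Fin (k + 1), {v | vhat v i.castSucc ≤ vhat v i.succ} := by
    ext v; simp [mem_ordSimplex]
  rw [this]
  exact isClosed_iInter fun i => isClosed_le ((continuous_apply _).comp continuous_vhat)
    ((continuous_apply _).comp continuous_vhat)

lemma isCompact_ordSimplex : IsCompact (ordSimplex k) := by
  refine (isCompact_univ_pi fun _ => isCompact_Icc).of_isClosed_subset isClosed_ordSimplex
    (fun v hv i _ => ?_) (s := univ.pi fun _ => J)
  simpa using vhat_mem_Icc hv i.castSucc.succ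

lemma convex_ordSimplex : Convex ℝ (ordSimplex k) := by
  intro v hv u hu a b ha hb hab
  rw [mem_ordSimplex] at *
  intro i
  rw [vhat_comb a b hab, vhat_comb a b hab]
  exact add_le_add (mul_le_mul_of_nonneg_left (hv i) ha) (mul_le_mul_of_nonneg_left (hu i) hb)

lemma isOpen_strictMono_vhat : IsOpen {v : Fin k → ℝ | StrictMono (vhat v)} := by
  have : {v : Fin k → ℝ | StrictMono (vhat v)} =
      ⋂ i : Fin (k + 1), {v | vhat v i.castSucc < vhat v i.succ} := by
    ext v; simp [Fin.strictMono_iff_lt_succ]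
  rw [this]
  exact isOpen_iInter_of_finite fun i => isOpen_lt ((continuous_apply _).comp continuous_vhat)
    ((continuous_apply _).comp continuous_vhat)

lemma exists_strictMono_vhat : ∃ v : Fin k → ℝ, StrictMono (vhat v) := by
  let y : Fin (k + 2) → ℝ := fun i => i / (k + 1)
  refine ⟨fun i => y i.castSucc.succ, ?_⟩
  rw [vhat_eq y (by simp [y]) (by
    simp only [y, Fin.val_last]; push_cast; exact div_self (by positivity))]
  intro i j hij
  simp only [y]
  gcongr
  exact hij

lemma interior_ordSimplex : interior (ordSimplex k) = {v | StrictMono (vhat v)} := by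
  refine Subset.antisymm (fun v hv => ?_)
    (interior_maximal (fun _ hv => StrictMono.monotone hv) isOpen_strictMono_vhat)
  obtain ⟨c, hc⟩ := exists_strictMono_vhat
  have hcont : Continuous fun ε : ℝ => (1 + ε) • v + (-ε) • c := by fun_prop
  have h0 : (fun ε : ℝ => (1 + ε) • v + (-ε) • c) 0 ∈ interior (ordSimplex k) := by simpa using hv
  have hnhds := hcont.continuousAt.preimage_mem_nhds (isOpen_interior.mem_nhds h0)
  obtain ⟨δ, hδ, hsub⟩ := Metric.mem_nhds_iff.1 hnhds
  have hmem : (1 + δ / 2) • v + (-(δ / 2)) • c ∈ ordSimplex k := by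
    refine interior_subset (hsub (a := δ / 2) ?_)
    rw [Metric.mem_ball, Real.dist_eq, sub_zero, abs_of_pos (by linarith)]
    linarith
  rw [mem_ordSimplex] at hmem
  change StrictMono (vhat v)
  rw [Fin.strictMono_iff_lt_succ] at hc ⊢
  intro i
  have h1 := hmem i
  rw [vhat_comb _ _ (by ring), vhat_comb _ _ (by ring)] at h1
  have h2 := mul_lt_mul_of_pos_left (hc i) (show 0 < δ / 2 by linarith)
  have h3 : (1 + δ / 2) * vhat v i.castSucc < (1 + δ / 2) * vhat v i.succ := by linarith
  exact lt_of_mul_lt_mul_left h3 (by linarith)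

lemma nonempty_interior_ordSimplex : (interior (ordSimplex k)).Nonempty := by
  rw [interior_ordSimplex]; exact exists_strictMono_vhat

lemma mem_frontier_ordSimplex :
    v ∈ frontier (ordSimplex k) ↔ v ∈ ordSimplex k ∧ ¬ Function.Injective (vhat v) := by
  rw [isClosed_ordSimplex.frontier_eq, interior_ordSimplex]
  refine and_congr_right fun hv => not_congr ⟨fun h => StrictMono.injective h, fun h => ?_⟩
  exact Monotone.strictMono_of_injective hv h

end OrderSimplex

section Poly

variable {T : Type*}

/-- The boundary of the simplex on `T`: functions with minimum `0` and maximum `1`. -/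
def Poly (T : Type*) : Set (T → ℝ) :=
  {x | (∀ t, x t ∈ J) ∧ (∃ t, x t = 0) ∧ ∃ t, x t = 1}

/-- The function takes at least `k + 2` values. -/
def Many (k : ℕ) (x : T → ℝ) : Prop := ∃ s : Fin (k + 2) → T, Function.Injective (x ∘ s)

lemma isClosed_poly [Finite T] : IsClosed (Poly T) := by
  have : Poly T = (⋂ t, {x | x t ∈ J}) ∩ ((⋃ t, {x | x t = 0}) ∩ ⋃ t, {x | x t = 1}) := by
    ext x; simp [Poly]
  rw [this]
  refine IsClosed.inter (isClosed_iInter fun t => isClosed_Icc.preimage (continuous_apply t))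
    (IsClosed.inter ?_ ?_) <;>
  exact isClosed_iUnion_of_finite fun t => isClosed_eq (continuous_apply t) continuous_const

lemma isCompact_poly [Finite T] : IsCompact (Poly T) :=
  (isCompact_univ_pi fun _ => isCompact_Icc).of_isClosed_subset isClosed_poly
    (fun _ hx i _ => hx.1 i)

lemma isOpen_many [Finite T] (k : ℕ) : IsOpen {x : T → ℝ | Many k x} := by
  have : {x : T → ℝ | Many k x} =
      ⋃ s : Fin (k + 2) → T, ⋂ i, ⋂ j, ⋂ _ : i ≠ j, {x | x (s i) ≠ x (s j)} := by
    ext x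
    simp only [Many, mem_ofPred_eq, mem_iUnion, mem_iInter, Function.Injective, Function.comp]
    refine exists_congr fun s => ⟨fun h i j hij e => hij (h e), fun h i j e => ?_⟩
    by_contra hij
    exact h i j hij e
  rw [this]
  refine isOpen_iUnion fun s => isOpen_iInter_of_finite fun i => isOpen_iInter_of_finite fun j =>
    isOpen_iInter_of_finite fun _ => isOpen_ne_fun (continuous_apply _) (continuous_apply _)

lemma many_iff [Finite T] {x : T → ℝ} : Many k x ↔ k + 2 ≤ (range x).ncard := by
  constructor
  · rintro ⟨s, hs⟩
    rw [show k + 2 = (range (x ∘ s)).ncard by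
      rw [← image_univ, ncard_image_of_injective _ hs, ncard_univ, Nat.card_fin]]
    exact ncard_le_ncard (range_comp_subset_range s x) (finite_range x)
  · intro h
    obtain ⟨s, hsub, hs⟩ := exists_subset_card_eq h
    have hfin := (finite_range x).subset hsub
    have : Finite s := hfin
    have e := (Finite.equivFinOfCardEq (by rw [Nat.card_coe_set_eq, hs])).symm
    choose f hf using fun i => hsub (e i).2
    refine ⟨f, fun i j hij => e.injective (Subtype.ext ?_)⟩
    simpa [Function.comp, hf] using hij

lemma Many.mono (h : k ≤ k') (hx : Many k' x) : Many k x := by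
  obtain ⟨s, hs⟩ := hx
  exact ⟨s ∘ Fin.castLE (by omega), hs.comp (Fin.castLE_injective _)⟩

lemma many_vhat_comp {w : T → Fin (k + 2)}
    (hw : Function.Surjective w) : Many k (vhat v ∘ w) ↔ Function.Injective (vhat v) := by
  constructor
  · rintro ⟨s, hs⟩
    have h1 : Function.Injective (w ∘ s) := fun i j hij => hs (congrArg (vhat v) hij)
    have h2 := Finite.injective_iff_surjective.1 h1
    intro i j hij
    obtain ⟨a, rfl⟩ := h2 i
    obtain ⟨b, rfl⟩ := h2 j
    exact congrArg _ (hs hij)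
  · intro h
    choose s hs using hw
    exact ⟨s, fun i j hij => h (by simpa [Function.comp, hs] using hij)⟩

lemma vhat_comp_mem_poly (hv : v ∈ ordSimplex k)
    (hw : Function.Surjective w) : vhat v ∘ w ∈ Poly T := by
  refine ⟨fun t => vhat_mem_Icc hv _, ?_, ?_⟩
  · obtain ⟨t, ht⟩ := hw 0
    exact ⟨t, by simp [ht]⟩
  · obtain ⟨t, ht⟩ := hw (Fin.last _)
    exact ⟨t, by simp [ht]⟩

lemma exists_cell [Finite T] {x : T → ℝ} (hx : x ∈ Poly T) (h : Many k x)
    (h' : ¬ Many (k + 1) x) : ∃ w : T → Fin (k + 2), Function.Surjective w ∧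
      ∃ v ∈ ordSimplex k, x = vhat v ∘ w := by
  have hfin : (range x).Finite := finite_range x
  have hcard : hfin.toFinset.card = k + 2 := by
    rw [← ncard_eq_toFinset_card _ hfin]
    rw [many_iff] at h h'
    omega
  let e := hfin.toFinset.orderIsoOfFin hcard
  let w : T → Fin (k + 2) := fun t => e.symm ⟨x t, by simp⟩
  have hwx : ∀ t, (e (w t) : ℝ) = x t := fun t => by simp [w]
  have hw : Function.Surjective w := by
    intro i
    obtain ⟨t, ht⟩ : (e i : ℝ) ∈ range x := hfin.mem_toFinset.1 (e i).2
    refine ⟨t, e.injective (Subtype.ext ?_)⟩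
    rw [hwx, ht]
  let y : Fin (k + 2) → ℝ := fun i => e i
  have hy : StrictMono y := fun i j hij => e.strictMono hij
  have h0 : y 0 = 0 := by
    obtain ⟨t, ht⟩ := hx.2.1
    obtain ⟨s, hs⟩ := hw 0
    refine le_antisymm ?_ ?_
    · rw [← ht, ← hwx t]; exact hy.monotone (Fin.zero_le _)
    · rw [← hs]; simp only [y, hwx]; exact (hx.1 s).1
  have h1 : y (Fin.last _) = 1 := by
    obtain ⟨t, ht⟩ := hx.2.2
    obtain ⟨s, hs⟩ := hw (Fin.last _)
    refine le_antisymm ?_ ?_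
    · rw [← hs]; simp only [y, hwx]; exact (hx.1 s).2
    · rw [← ht, ← hwx t]; exact hy.monotone (Fin.le_last _)
  refine ⟨w, hw, fun i => y i.castSucc.succ, ?_, ?_⟩
  · change Monotone _
    rw [vhat_eq y h0 h1]
    exact hy.monotone
  · rw [vhat_eq y h0 h1]
    funext t
    exact (hwx t).symm

lemma cell_unique {w w' : T → Fin (k + 2)}
    (hw : Function.Surjective w) (hw' : Function.Surjective w') (hv : v ∈ ordSimplex k)
    (hv' : v' ∈ ordSimplex k) (hvi : Function.Injective (vhat v))
    (h : vhat v ∘ w = vhat v' ∘ w') : v = v' ∧ w = w' := by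
  have hvi' : Function.Injective (vhat v') := by
    rw [← many_vhat_comp hw', ← h, many_vhat_comp hw]; exact hvi
  have e : vhat v = vhat v' := by
    refine ((Monotone.strictMono_of_injective hv hvi).range_inj
      (Monotone.strictMono_of_injective hv' hvi')).1 ?_
    rw [← hw.range_comp, h, hw'.range_comp]
  refine ⟨?_, ?_⟩
  · funext i
    rw [← vhat_mid v, e, vhat_mid]
  · funext t
    exact hvi (by rw [congrFun h t |> fun q => (q : vhat v (w t) = vhat v' (w' t)), e])

lemma shift_mem_poly [Group Γ] [MulAction Γ T] (g : Γ)
    (hx : x ∈ Poly T) : shift g x ∈ Poly T := by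
  refine ⟨fun t => hx.1 _, ?_, ?_⟩
  · obtain ⟨t, ht⟩ := hx.2.1
    exact ⟨g • t, by simpa [shift] using ht⟩
  · obtain ⟨t, ht⟩ := hx.2.2
    exact ⟨g • t, by simpa [shift] using ht⟩

lemma many_shift [Group Γ] [MulAction Γ T] (g : Γ) {x : T → ℝ} :
    Many k (shift g x) ↔ Many k x := by
  constructor
  · rintro ⟨s, hs⟩
    exact ⟨fun i => g⁻¹ • s i, hs⟩
  · rintro ⟨s, hs⟩
    refine ⟨fun i => g • s i, ?_⟩
    simpa [Function.comp_def, shift] using hs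

end Poly

section

variable {Γ : Type w} [Group Γ] {T : Type*} [MulAction Γ T]

/-- The closed simplex of `Poly T` given by an ordered partition of `T`. -/
def cellSet (w : T → Fin (k + 2)) : Set (T → ℝ) := (fun v => vhat v ∘ w) '' ordSimplex k

lemma isCompact_cellSet (w : T → Fin (k + 2)) : IsCompact (cellSet w) := by
  refine isCompact_ordSimplex.image ?_
  exact continuous_pi fun t => (continuous_apply (w t)).comp continuous_vhat

variable (Γ) in
/-- An invariant subcomplex of `Poly T`. -/
structure IsSubcomplex (A : Set (T → ℝ)) : Prop where
  isClosed : IsClosed A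
  shift_mem : ∀ (g : Γ) x, x ∈ A → shift g x ∈ A
  cell : ∀ (k : ℕ) (w : T → Fin (k + 2)) (v v' : Fin k → ℝ), Function.Surjective w →
    v ∈ ordSimplex k → v' ∈ ordSimplex k → Function.Injective (vhat v) →
    vhat v ∘ w ∈ A → vhat v' ∘ w ∈ A

lemma isSubcomplex_empty : IsSubcomplex Γ (∅ : Set (T → ℝ)) :=
  ⟨isClosed_empty, fun _ _ h => h, fun _ _ _ _ _ _ _ _ h => h⟩

variable {F : Type*} [NormedAddCommGroup F] [NormedSpace ℝ F]

variable (F) in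
/-- The union of `A × B × [0, 1]`, `S × B × [0, 1]`, `Poly T × ∂B × [0, 1]` and `Poly T × B × 0`,
where `B` is the unit ball of `F` and `S` consists of the simplices of dimension less than `k`. -/
def skelDom (A : Set (T → ℝ)) (k : ℕ) : Set (((T → ℝ) × F) × ℝ) :=
  {z | z.1.1 ∈ Poly T ∧ z.1.2 ∈ closedBall 0 1 ∧ z.2 ∈ J ∧
    (z.1.1 ∈ A ∨ ¬ Many k z.1.1 ∨ ‖z.1.2‖ = 1 ∨ z.2 = 0)}

lemma isClosed_skelDom [Finite T] {A : Set (T → ℝ)} (hA : IsClosed A) (k : ℕ) :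
    IsClosed (skelDom F A k) := by
  have h1 : IsClosed {z : ((T → ℝ) × F) × ℝ | z.1.1 ∈ Poly T} :=
    isClosed_poly.preimage (continuous_fst.comp continuous_fst)
  have h2 : IsClosed {z : ((T → ℝ) × F) × ℝ | z.1.2 ∈ closedBall (0 : F) 1} :=
    isClosed_closedBall.preimage (continuous_snd.comp continuous_fst)
  have h3 : IsClosed {z : ((T → ℝ) × F) × ℝ | z.2 ∈ J} :=
    isClosed_Icc.preimage continuous_snd
  have h4 : IsClosed {z : ((T → ℝ) × F) × ℝ | z.1.1 ∈ A} :=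
    hA.preimage (continuous_fst.comp continuous_fst)
  have h5 : IsClosed {z : ((T → ℝ) × F) × ℝ | ¬ Many k z.1.1} :=
    (isOpen_many k).isClosed_compl.preimage (continuous_fst.comp continuous_fst)
  have h6 : IsClosed {z : ((T → ℝ) × F) × ℝ | ‖z.1.2‖ = 1} :=
    isClosed_eq (by fun_prop) continuous_const
  have h7 : IsClosed {z : ((T → ℝ) × F) × ℝ | z.2 = 0} := isClosed_eq (by fun_prop) continuous_const
  exact h1.inter (h2.inter (h3.inter (h4.union (h5.union (h6.union h7)))))

/-- A continuous equivariant map on `D`, trivial at time `1`. -/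
structure IsEqOn (L : Tower.{v} Γ) (D : Set (((T → ℝ) × F) × ℝ)) {n : ℕ}
    (h : ((T → ℝ) × F) × ℝ → L.obj n) : Prop where
  cont : ContinuousOn h D
  equi : ∀ (g : Γ), ∀ z ∈ D, h ((shift g z.1.1, z.1.2), z.2) = g • h z
  one : ∀ z ∈ D, z.2 = 1 → h z = L.pt n

variable {L : Tower.{v} Γ}

lemma fillable_cellSet {w : T → Fin (k + 2)}
    (hw : Function.Surjective w) {H : Subgroup Γ}
    (hf : L.Fillable H (ordSimplex k ×ˢ closedBall (0 : F) 1)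
      (frontier (ordSimplex k ×ˢ closedBall (0 : F) 1))
      (fun z => h ((vhat z.1.1 ∘ w, z.1.2), z.2))) :
    L.Fillable H (cellSet w ×ˢ closedBall (0 : F) 1) {y | ¬ Many k y.1 ∨ ‖y.2‖ = 1} h := by
  choose s hs using fun i : Fin k => hw i.castSucc.succ
  have key : ∀ v : Fin k → ℝ, (fun i => (vhat v ∘ w) (s i)) = v := fun v => by
    funext i; simp [hs]
  refine hf.transport (fun z => (vhat z.1 ∘ w, z.2)) (fun y => (fun i => y.1 (s i), y.2)) ?_ ?_ ?_ ?_
  · fun_prop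
  · rintro ⟨_, p⟩ ⟨⟨v, hv, rfl⟩, hp⟩
    refine ⟨?_, hp⟩
    change (fun i => (vhat v ∘ w) (s i)) ∈ _
    rw [key]; exact hv
  · rintro ⟨_, p⟩ ⟨⟨v, hv, rfl⟩, hp⟩ hb
    simp only [key]
    rw [frontier_prod_eq, frontier_closedBall _ one_ne_zero, isClosed_ordSimplex.closure_eq,
      isClosed_closedBall.closure_eq]
    rcases hb with hb | hb
    · right
      refine ⟨mem_frontier_ordSimplex.2 ⟨hv, ?_⟩, hp⟩
      rwa [← many_vhat_comp hw]
    · left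
      exact ⟨hv, by simpa using hb⟩
  · rintro ⟨_, p⟩ ⟨⟨v, hv, rfl⟩, hp⟩
    simp only [key]

lemma shift_eq_of_mem_cellSet {g : Γ} (hg : g ∈ cellStab Γ w)
    {x : T → ℝ} (hx : x ∈ cellSet w) : shift g x = x := by
  obtain ⟨v, -, rfl⟩ := hx
  rw [shift_comp, mem_cellStab.1 hg]

lemma shift_mem_cellSet (g : Γ) {x : T → ℝ}
    (hx : x ∈ cellSet w) : shift g x ∈ cellSet (shift g w) := by
  obtain ⟨v, hv, rfl⟩ := hx
  exact ⟨v, hv, rfl⟩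

lemma surjective_shift (g : Γ) {x : T → α} (hx : Function.Surjective x) :
    Function.Surjective (shift g x) := by
  rw [← range_eq_univ, range_shift, hx.range_eq]

lemma exists_rep : ∃ (r : (T → α) → T → α) (γ : (T → α) → Γ),
    (∀ x, shift (γ x) (r x) = x) ∧ (∀ x, shift (γ x)⁻¹ x = r x) ∧
    ∀ (g : Γ) x, r (shift g x) = r x := by
  let S : Setoid (T → α) :=
    { r := fun x y => ∃ g : Γ, shift g x = y
      iseqv := ⟨fun x => ⟨1, shift_one x⟩,
        fun {x y} ⟨g, hg⟩ => ⟨g⁻¹, by rw [← hg, shift_inv_shift]⟩,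
        fun {x y z} ⟨g, hg⟩ ⟨g', hg'⟩ => ⟨g' * g, by rw [← shift_shift, hg, hg']⟩⟩ }
  have h : ∀ x : T → α, ∃ g : Γ, shift g (Quotient.mk S x).out = x := fun x => Quotient.mk_out x
  choose γ hγ using h
  refine ⟨fun x => (Quotient.mk S x).out, γ, hγ, fun x => ?_, fun g x =>
    congrArg Quotient.out (Quotient.sound ⟨g⁻¹, shift_inv_shift g x⟩)⟩
  · have := congrArg (shift (γ x)⁻¹) (hγ x)
    rw [shift_inv_shift] at this
    exact this.symm

open Classical in
lemma exists_extend_step [Finite T] {A : Set (T → ℝ)} (hA : IsSubcomplex Γ A) {k n : ℕ}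
    {h : ((T → ℝ) × F) × ℝ → L.obj n} (hh : IsEqOn L (skelDom F A k) h)
    (hfill : ∀ w : T → Fin (k + 2), Function.Surjective w → ¬ cellSet w ⊆ A →
      L.Fillable (cellStab Γ w) (ordSimplex k ×ˢ closedBall (0 : F) 1)
        (frontier (ordSimplex k ×ˢ closedBall (0 : F) 1))
        (fun z => h ((vhat z.1.1 ∘ w, z.1.2), z.2))) :
    ∃ (n' : ℕ) (hn : n ≤ n') (h' : ((T → ℝ) × F) × ℝ → L.obj n'),
      IsEqOn L (skelDom F A (k + 1)) h' ∧ ∀ z ∈ skelDom F A k, h' z = L.map hn (h z) := by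
  let W : Set (T → Fin (k + 2)) := {w | Function.Surjective w ∧ ¬ cellSet w ⊆ A}
  have hWs : ∀ (g : Γ), ∀ w ∈ W, shift g w ∈ W := by
    rintro g w ⟨hw1, hw2⟩
    refine ⟨surjective_shift g hw1, fun hsub => hw2 fun x hx => ?_⟩
    rw [← shift_inv_shift g x]
    exact hA.shift_mem _ _ (hsub (shift_mem_cellSet g hx))
  have hf1 : ∀ w : T → Fin (k + 2), ∃ n', n ≤ n' ∧ (w ∈ W → ∃ hn : n ≤ n',
      ∃ f : ((T → ℝ) × F) × ℝ → L.obj n',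
        ContinuousOn f ((cellSet w ×ˢ closedBall (0 : F) 1) ×ˢ J) ∧
        (∀ x ∈ cellSet w ×ˢ closedBall (0 : F) 1, ∀ t ∈ J,
          x ∈ {y : (T → ℝ) × F | ¬ Many k y.1 ∨ ‖y.2‖ = 1} ∨ t = 0 →
            f (x, t) = L.map hn (h (x, t))) ∧
        (∀ x ∈ cellSet w ×ˢ closedBall (0 : F) 1, f (x, 1) = L.pt n') ∧
        ∀ x ∈ cellSet w ×ˢ closedBall (0 : F) 1, ∀ t ∈ J,
          L.Fixed (cellStab Γ w) (f (x, t))) := by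
    intro w
    by_cases hw : w ∈ W
    · obtain ⟨n', hn, f, hf⟩ := fillable_cellSet hw.1 (hfill w hw.1 hw.2)
      exact ⟨n', hn, fun _ => ⟨hn, f, hf⟩⟩
    · exact ⟨n, le_rfl, fun h => (hw h).elim⟩
  choose ν hν hf1 using hf1
  obtain ⟨N, hN⟩ : ∃ N, ∀ w, ν w ≤ N := by
    have : Fintype (T → Fin (k + 2)) := Fintype.ofFinite _
    exact ⟨Finset.univ.sup ν, fun w => Finset.le_sup (Finset.mem_univ w)⟩
  have hn := (hν fun _ => 0).trans (hN _)
  have hf2 : ∀ w : W, ∃ f : ((T → ℝ) × F) × ℝ → L.obj N,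
        ContinuousOn f ((cellSet w.1 ×ˢ closedBall 0 1) ×ˢ J) ∧
        (∀ x ∈ cellSet w.1 ×ˢ closedBall 0 1, ∀ t ∈ J,
          (¬ Many k x.1 ∨ ‖x.2‖ = 1) ∨ t = 0 → f (x, t) = L.map hn (h (x, t))) ∧
        (∀ x ∈ cellSet w.1 ×ˢ closedBall 0 1, f (x, 1) = L.pt N) ∧
        ∀ x ∈ cellSet w.1 ×ˢ closedBall 0 1, ∀ t ∈ J,
          L.Fixed (cellStab Γ w.1) (f (x, t)) := by
    rintro ⟨w, hw⟩
    obtain ⟨hn', f, hc, hb, h1, hfix⟩ := hf1 w hw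
    refine ⟨fun z => L.map (hN w) (f z), (L.map _).continuous.comp_continuousOn hc, ?_, ?_, ?_⟩
    · intro x hx t ht hxt
      simp only [hb x hx t ht hxt, L.map_map]
    · intro x hx
      simp only [h1 x hx, L.map_pt]
    · intro x hx t ht
      exact (hfix x hx t ht).map _
  choose f hfc hfb hfone hfix using hf2
  obtain ⟨r, γ, hγ, hγ', hr⟩ := exists_rep (Γ := Γ) (T := T) (α := Fin (k + 2))
  have hrW : ∀ w : W, r w.1 ∈ W := fun w => by
    have := hWs (γ w.1)⁻¹ w.1 w.2
    rwa [hγ'] at this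
  let φ : W → ((T → ℝ) × F) × ℝ → L.obj N := fun w z =>
    γ w.1 • f ⟨r w.1, hrW w⟩ ((shift (γ w.1)⁻¹ z.1.1, z.1.2), z.2)
  let P : W → Set (((T → ℝ) × F) × ℝ) := fun w =>
    (cellSet w.1 ×ˢ closedBall 0 1) ×ˢ J
  have hback : ∀ w : W, ∀ x ∈ cellSet w.1, shift (γ w.1)⁻¹ x ∈ cellSet (r w.1) := by
    intro w x hx
    have := shift_mem_cellSet (γ w.1)⁻¹ hx
    rwa [hγ'] at this
  have hφc : ∀ w, ContinuousOn (φ w) (P w) := by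
    intro w
    refine ContinuousOn.const_smul ((hfc ⟨r w.1, hrW w⟩).comp (Continuous.continuousOn ?_) ?_) _
    · have := continuous_shift (α := ℝ) (T := T) (γ w.1)⁻¹
      fun_prop
    · rintro z ⟨⟨h1, h2⟩, h3⟩
      exact ⟨⟨hback w _ h1, h2⟩, h3⟩
  have hPdom : ∀ w : W, ∀ z ∈ P w, z ∈ skelDom F A k → φ w z = L.map hn (h z) := by
    rintro w z ⟨⟨h1, h2⟩, h3⟩ hz
    have hb : (¬ Many k z.1.1 ∨ ‖z.1.2‖ = 1) ∨ z.2 = 0 := by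
      rcases hz.2.2.2 with h | h | h | h
      · refine .inl (.inl fun hm => w.2.2 ?_)
        obtain ⟨v, hv, hvx⟩ := h1
        rintro _ ⟨v', hv', rfl⟩
        rw [← hvx] at hm h
        exact hA.cell k w.1 v v' w.2.1 hv hv' ((many_vhat_comp w.2.1).1 hm) h
      · exact .inl (.inl h)
      · exact .inl (.inr h)
      · exact .inr h
    simp only [φ]
    rw [hfb ⟨r w.1, hrW w⟩ (shift (γ w.1)⁻¹ z.1.1, z.1.2) ⟨hback w _ h1, h2⟩ z.2 h3
      (by rwa [many_shift]), ← L.map_smul, hh.equi _ z hz, smul_inv_smul]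
  have hφeq : ∀ g w, ∀ z ∈ P w,
      φ ⟨shift g w.1, hWs g w.1 w.2⟩ ((shift g z.1.1, z.1.2), z.2) = g • φ w z := by
    rintro g ⟨w, hw⟩ z ⟨⟨h1, h2⟩, h3⟩
    have hy := hback ⟨w, hw⟩ _ h1
    simp only [φ] at hy ⊢
    set y := shift (γ w)⁻¹ z.1.1 with hydef
    set w' := shift g w with hw'
    let s := (γ w')⁻¹ * (g * γ w)
    have hs : s ∈ cellStab Γ (r w) := by
      rw [mem_cellStab, ← shift_shift, ← shift_shift, hγ w, ← hw', hγ' w', hw', hr]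
    have e1 : shift (γ w')⁻¹ (shift g z.1.1) = y := by
      rw [show shift g z.1.1 = shift (g * γ w) y by
        rw [hydef, ← shift_shift, shift_shift_inv], shift_shift]
      exact shift_eq_of_mem_cellSet hs hy
    have e2 : (⟨r w', hrW ⟨w', hWs g w hw⟩⟩ : W) = ⟨r w, hrW ⟨w, hw⟩⟩ :=
      Subtype.ext (hr g w)
    rw [e1, e2]
    have e3 := hfix ⟨r w, hrW ⟨w, hw⟩⟩ (y, z.1.2) ⟨hy, h2⟩ z.2 h3 s hs
    have e4 : γ w' = g * γ w * s⁻¹ := by simp only [s]; group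
    rw [e4, mul_smul, mul_smul]
    congr 2
    rw [inv_smul_eq_iff]
    exact e3.symm
  have hφ1 : ∀ w : W, ∀ z ∈ P w, z.2 = 1 → φ w z = L.pt N := by
    rintro w ⟨⟨x, p⟩, t⟩ ⟨⟨h1, h2⟩, h3⟩ rfl
    simp only [φ]
    rw [hfone ⟨r w.1, hrW w⟩ (shift (γ w.1)⁻¹ x, p) ⟨hback w _ h1, h2⟩, L.smul_pt]
  have hPuniq : ∀ w w' : W, ∀ z ∈ P w, z ∈ P w' → z ∉ skelDom F A k → w = w' := by
    rintro w w' z ⟨⟨⟨v, hv, h1⟩, h2⟩, h3⟩ ⟨⟨⟨v', hv', h1'⟩, _⟩, _⟩ hz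
    have hm : Many k z.1.1 := by
      by_contra hm
      exact hz ⟨h1 ▸ vhat_comp_mem_poly hv w.2.1, h2, h3, .inr (.inl hm)⟩
    rw [← h1, many_vhat_comp w.2.1] at hm
    exact Subtype.ext (cell_unique w.2.1 w'.2.1 hv hv' hm (h1.trans h1'.symm)).2
  let h' : ((T → ℝ) × F) × ℝ → L.obj N := fun z =>
    if z ∈ skelDom F A k then L.map hn (h z) else
      if hz : ∃ w, z ∈ P w then φ hz.choose z else L.pt N
  have h'dom : ∀ z ∈ skelDom F A k, h' z = L.map hn (h z) := fun z hz => if_pos hz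
  have h'P : ∀ w, ∀ z ∈ P w, h' z = φ w z := by
    intro w z hz
    by_cases hd : z ∈ skelDom F A k
    · rw [h'dom z hd, hPdom w z hz hd]
    · have hex : ∃ w, z ∈ P w := ⟨w, hz⟩
      simp only [h', if_neg hd, dif_pos hex]
      rw [hPuniq _ _ z hex.choose_spec hz hd]
  have hcover : ∀ z ∈ skelDom F A (k + 1), z ∈ skelDom F A k ∨ ∃ w, z ∈ P w := by
    rintro z ⟨h1, h2, h3, h4⟩
    by_cases hm : Many k z.1.1
    · rcases h4 with h4 | h4 | h4
      · exact .inl ⟨h1, h2, h3, .inl h4⟩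
      · obtain ⟨w, hw, v, hv, hx⟩ := exists_cell h1 hm h4
        by_cases hwA : cellSet w ⊆ A
        · exact .inl ⟨h1, h2, h3, .inl (hwA ⟨v, hv, hx.symm⟩)⟩
        · exact .inr ⟨⟨w, hw, hwA⟩, ⟨⟨v, hv, hx.symm⟩, h2⟩, h3⟩
      · exact .inl ⟨h1, h2, h3, .inr (.inr h4)⟩
    · exact .inl ⟨h1, h2, h3, .inr (.inl hm)⟩
  refine ⟨N, hn, h', ⟨?_, ?_, ?_⟩, h'dom⟩
  · have hc1 : ContinuousOn h' (skelDom F A k) :=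
      ((L.map hn).continuous.comp_continuousOn hh.cont).congr h'dom
    have hc2 : ContinuousOn h' (⋃ w, P w) := by
      refine (locallyFinite_of_finite _).continuousOn_iUnion (fun w => ?_)
        fun w => (hφc w).congr (h'P w)
      exact ((isCompact_cellSet w.1).isClosed.prod isClosed_closedBall).prod isClosed_Icc
    refine (hc1.union_of_isClosed hc2 (isClosed_skelDom hA.isClosed k) ?_).mono fun z hz => ?_
    · exact isClosed_iUnion_of_finite fun w =>
        ((isCompact_cellSet w.1).isClosed.prod isClosed_closedBall).prod isClosed_Icc
    · exact (hcover z hz).imp id mem_iUnion.2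
  · intro g z hz
    rcases hcover z hz with hz | ⟨w, hw⟩
    · have hgz : ((shift g z.1.1, z.1.2), z.2) ∈ skelDom F A k :=
        ⟨shift_mem_poly g hz.1, hz.2.1, hz.2.2.1, hz.2.2.2.imp (hA.shift_mem g _)
          (Or.imp (by rw [many_shift]; exact id) id)⟩
      rw [h'dom _ hgz, h'dom _ hz, hh.equi g z hz, L.map_smul]
    · rw [h'P w z hw, ← hφeq g w z hw]
      exact h'P _ _ ⟨⟨shift_mem_cellSet g hw.1.1, hw.1.2⟩, hw.2⟩
  · intro z hz h1
    rcases hcover z hz with hz | ⟨w, hw⟩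
    · rw [h'dom _ hz, hh.one z hz h1, L.map_pt]
    · rw [h'P w z hw, hφ1 w z hw h1]

lemma cup_prod_subset_skelDom {k : ℕ} {w : T → Fin (k + 2)}
    (hw : Function.Surjective w) {z : ((Fin k → ℝ) × F) × ℝ}
    (hz : z ∈ Tower.cup (ordSimplex k ×ˢ closedBall (0 : F) 1)
      (frontier (ordSimplex k ×ˢ closedBall (0 : F) 1))) :
    ((vhat z.1.1 ∘ w, z.1.2), z.2) ∈ skelDom F A k := by
  obtain ⟨⟨h1, h2⟩, h3, h4⟩ := hz
  refine ⟨vhat_comp_mem_poly h1 hw, h2, h3, ?_⟩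
  rw [frontier_prod_eq, frontier_closedBall _ one_ne_zero] at h4
  rcases h4 with (h4 | h4) | h4
  · exact .inr (.inr (.inl (by simpa using h4.2)))
  · refine .inr (.inl ?_)
    rw [many_vhat_comp hw]
    exact (mem_frontier_ordSimplex.1 h4.1).2
  · exact .inr (.inr (.inr h4))

lemma fillable_of_piTriv [FiniteDimensional ℝ F] {k n : ℕ}
    {h : ((T → ℝ) × F) × ℝ → L.obj n} (hh : IsEqOn L (skelDom F A k) h) {w : T → Fin (k + 2)}
    (hw : Function.Surjective w) (hL : L.PiTriv (cellStab Γ w) (k + Module.finrank ℝ F)) :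
    L.Fillable (cellStab Γ w) (ordSimplex k ×ˢ closedBall (0 : F) 1)
        (frontier (ordSimplex k ×ˢ closedBall (0 : F) 1))
        (fun z => h ((vhat z.1.1 ∘ w, z.1.2), z.2)) := by
  have hcw : Continuous fun v : Fin k → ℝ => vhat v ∘ w :=
    continuous_pi fun t => (continuous_apply (w t)).comp continuous_vhat
  have hconv : Convex ℝ (ordSimplex k ×ˢ closedBall (0 : F) 1) :=
    Convex.prod convex_ordSimplex (convex_closedBall (0 : F) 1)
  have : ProperSpace F := FiniteDimensional.proper ℝ F
  have hcomp : IsCompact (ordSimplex k ×ˢ closedBall (0 : F) 1) :=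
    isCompact_ordSimplex.prod (isCompact_closedBall (0 : F) 1)
  refine Tower.fillable_of_convex hL (by simp) hconv hcomp ?_ ?_ ?_ ?_
  · rw [interior_prod_eq]
    refine nonempty_interior_ordSimplex.prod ⟨0, ?_⟩
    exact ball_subset_interior_closedBall (mem_ball_self one_pos)
  · refine hh.cont.comp (Continuous.continuousOn ?_) fun z hz => cup_prod_subset_skelDom hw hz
    exact ((hcw.comp (continuous_fst.comp continuous_fst)).prodMk
      (continuous_snd.comp continuous_fst)).prodMk continuous_snd
  · intro z hz g hg
    have := hh.equi g _ (cup_prod_subset_skelDom hw hz)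
    rw [← this, shift_comp, mem_cellStab.1 hg]
  · intro x hx
    have hC : IsClosed (ordSimplex k ×ˢ closedBall (0 : F) 1) :=
      isClosed_ordSimplex.prod isClosed_closedBall
    refine hh.one _ (cup_prod_subset_skelDom hw
      ⟨hC.frontier_subset hx, ⟨zero_le_one, le_rfl⟩, .inl hx⟩) rfl

lemma exists_extend [Finite T] [FiniteDimensional ℝ F]
    (hA : IsSubcomplex Γ A) {k n : ℕ} {h : ((T → ℝ) × F) × ℝ → L.obj n}
    (hh : IsEqOn L (skelDom F A k) h)
    (hL : ∀ k' ≥ k, ∀ w : T → Fin (k' + 2), Function.Surjective w → ¬ cellSet w ⊆ A →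
      L.PiTriv (cellStab Γ w) (k' + Module.finrank ℝ F)) :
    ∃ (n' : ℕ) (hn : n ≤ n') (h' : ((T → ℝ) × F) × ℝ → L.obj n'),
      IsEqOn L (skelDom F univ 0) h' ∧ ∀ z ∈ skelDom F A k, h' z = L.map hn (h z) := by
  have key : ∀ d : ℕ, ∃ (n' : ℕ) (hn : n ≤ n') (h' : ((T → ℝ) × F) × ℝ → L.obj n'),
      IsEqOn L (skelDom F A (k + d)) h' ∧ ∀ z ∈ skelDom F A k, h' z = L.map hn (h z) := by
    intro d
    induction d with
    | zero => exact ⟨n, le_rfl, h, hh, fun z _ => (L.map_refl _ _).symm⟩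
    | succ d ih =>
      obtain ⟨n', hn, h', hh', he⟩ := ih
      obtain ⟨n'', hn', h'', hh'', he'⟩ := exists_extend_step hA hh' fun w hw hwA =>
        fillable_of_piTriv hh' hw (hL _ (by omega) w hw hwA)
      refine ⟨n'', hn.trans hn', h'', hh'', fun z hz => ?_⟩
      rw [he' z, he z hz, L.map_map]
      exact ⟨hz.1, hz.2.1, hz.2.2.1, hz.2.2.2.imp id
        (Or.imp (fun h hm => h (hm.mono (Nat.le_add_right _ _))) id)⟩
  obtain ⟨n', hn, h', hh', he⟩ := key (Nat.card T)
  have hsub : skelDom F univ 0 ⊆ skelDom F A (k + Nat.card T) := by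
    rintro z ⟨h1, h2, h3, -⟩
    refine ⟨h1, h2, h3, .inr (.inl fun hm => ?_)⟩
    rw [many_iff] at hm
    have : (range z.1.1).ncard ≤ Nat.card T := by
      rw [← image_univ, ← ncard_univ]
      exact ncard_image_le finite_univ
    omega
  exact ⟨n', hn, h', ⟨hh'.cont.mono hsub, fun g z hz => hh'.equi g z (hsub hz),
    fun z hz => hh'.one z (hsub hz)⟩, he⟩

end

/-- Multiplication by nonzero natural numbers is injective on `M`. -/
abbrev NoTorsion (M : Type*) [AddCommGroup M] : Prop :=
  ∀ (n : ℕ) (m : M), n ≠ 0 → n • m = 0 → m = 0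

section Potential

variable {Γ : Type w} [Group Γ] {T : Type*} [MulAction Γ T] {M : Type*} [AddCommGroup M]

/-- The translate of a set. -/
def shiftSet (g : Γ) (A : Set T) : Set T := {t | g⁻¹ • t ∈ A}

lemma shiftSet_mono (g : Γ) {A B : Set T} (h : A ⊆ B) : shiftSet g A ⊆ shiftSet g B :=
  fun _ ht => h ht

lemma shiftSet_nonempty (g : Γ) {A : Set T} (h : A.Nonempty) : (shiftSet g A).Nonempty := by
  obtain ⟨t, ht⟩ := h
  exact ⟨g • t, by simpa [shiftSet] using ht⟩

lemma shiftSet_ne_univ (g : Γ) {A : Set T} (h : A ≠ univ) : shiftSet g A ≠ univ := by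
  rw [ne_univ_iff_exists_notMem] at *
  obtain ⟨t, ht⟩ := h
  exact ⟨g • t, by simpa [shiftSet] using ht⟩

lemma shiftSet_mul (g h : Γ) (A : Set T) : shiftSet (g * h) A = shiftSet g (shiftSet h A) := by
  ext t; simp [shiftSet, mul_smul]

lemma shiftSet_one (A : Set T) : shiftSet (1 : Γ) A = A := by
  ext t; simp [shiftSet]

/-- `c` is the coboundary of `ψ` on the poset of proper nonempty subsets. -/
def IsPotential (c : Set T → Set T → M) (ψ : Set T → M) : Prop :=
  ∀ A B : Set T, A.Nonempty → A ⊆ B → B ≠ univ → ψ B - ψ A = c A B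

lemma eq_of_subset_invariant [Finite T] (hT : 3 ≤ Nat.card T) (D : Set T → α)
    (hD : ∀ A B : Set T, A.Nonempty → A ⊆ B → B ≠ univ → D A = D B)
    (hA : A.Nonempty) (hA' : A ≠ univ) (hB : B.Nonempty) (hB' : B ≠ univ) : D A = D B := by
  obtain ⟨s, hs⟩ := hA
  obtain ⟨t, ht⟩ := hB
  have h2 : ({s, t} : Set T) ≠ univ := fun h => by
    have h1 := ncard_univ T
    have h3 := ncard_insert_le s ({t} : Set T)
    rw [ncard_singleton] at h3
    rw [h] at h3
    omega
  rw [← hD {s} A (singleton_nonempty s) (by simpa using hs) hA',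
    ← hD {t} B (singleton_nonempty t) (by simpa using ht) hB',
    hD {s} {s, t} (singleton_nonempty s) (by simp) h2,
    hD {t} {s, t} (singleton_nonempty t) (by simp) h2]

lemma IsPotential.invariant [Finite T] [Finite Γ] (hT : 3 ≤ Nat.card T)
    (hM : NoTorsion M) {ψ : Set T → M}
    (hψ : IsPotential c ψ) (hc : ∀ (g : Γ) (A B : Set T), A.Nonempty → A ⊆ B → B ≠ univ →
      c (shiftSet g A) (shiftSet g B) = c A B) (g : Γ) {A : Set T} (hA : A.Nonempty)
    (hA' : A ≠ univ) : ψ (shiftSet g A) = ψ A := by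
  have hconst : ∀ B : Set T, B.Nonempty → B ≠ univ →
      ψ (shiftSet g B) - ψ B = ψ (shiftSet g A) - ψ A := by
    intro B hB hB'
    refine eq_of_subset_invariant hT (fun B => ψ (shiftSet g B) - ψ B) ?_ hB hB' hA hA'
    intro A B hA hAB hB
    have h1 := hψ A B hA hAB hB
    have h2 := hψ _ _ (shiftSet_nonempty g hA) (shiftSet_mono g hAB) (shiftSet_ne_univ g hB)
    rw [hc g A B hA hAB hB] at h2
    have h3 := h2.trans h1.symm
    linear_combination (norm := module) -h3
  have hpow : ∀ n : ℕ, ψ (shiftSet (g ^ n) A) - ψ A = n • (ψ (shiftSet g A) - ψ A) := by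
    intro n
    induction n with
    | zero => simp [shiftSet_one]
    | succ n ih =>
      rw [pow_succ', shiftSet_mul, succ_nsmul, ← ih,
        ← hconst _ (shiftSet_nonempty (g ^ n) hA) (shiftSet_ne_univ (g ^ n) hA')]
      abel
  have h := hpow (orderOf g)
  rw [pow_orderOf_eq_one, shiftSet_one, sub_self] at h
  exact sub_eq_zero.1 (hM _ _ (orderOf_pos g).ne' h.symm)

lemma exists_potential [Finite T] (hT : 4 ≤ Nat.card T) {c : Set T → Set T → M}
    (hc : ∀ A B C : Set T, A.Nonempty → A ⊆ B → B ⊆ C → C ≠ univ → c A B + c B C = c A C) :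
    ∃ ψ, IsPotential c ψ := by
  classical
  have : Nonempty T := (Nat.card_pos_iff.1 (by omega)).1
  obtain ⟨o⟩ := this
  have h3 : ∀ r s t : T, ({r, s, t} : Set T) ≠ univ := fun r s t h => by
    have h1 := ncard_univ T
    have h3 := ncard_insert_le r ({s, t} : Set T)
    have h4 := ncard_insert_le s ({t} : Set T)
    rw [ncard_singleton] at h4
    rw [h] at h3
    omega
  let f : T → M := fun t => c {o} {t, o} - c {t} {t, o}
  -- values on singletons and pairs
  have key : ∀ s t : T, ∀ A : Set T, s ∈ A → t ∈ A → A ≠ univ → f s + c {s} A = f t + c {t} A := by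
    intro s t A hs ht hA
    have h1 : c {s} {s, t} + c {s, t} A = c {s} A :=
      hc _ _ _ (singleton_nonempty s) (by simp) (by simp [insert_subset_iff, hs, ht]) hA
    have h2 : c {t} {s, t} + c {s, t} A = c {t} A :=
      hc _ _ _ (singleton_nonempty t) (by simp) (by simp [insert_subset_iff, hs, ht]) hA
    have e : ∀ x y : T, ∀ z : Set T, x ∈ ({s, t, o} : Set T) → y ∈ ({s, t, o} : Set T) →
        z ⊆ {s, t, o} → x ∈ z → y ∈ z →
        c {x} z - c {y} z = c {x} {s, t, o} - c {y} {s, t, o} := by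
      intro x y z _ _ hz hxz hyz
      have a := hc {x} z {s, t, o} (singleton_nonempty x) (by simpa using hxz) hz (h3 _ _ _)
      have b := hc {y} z {s, t, o} (singleton_nonempty y) (by simpa using hyz) hz (h3 _ _ _)
      rw [← a, ← b]; abel
    have e1 := e s o {s, o} (by simp) (by simp) (by simp [insert_subset_iff]) (by simp) (by simp)
    have e2 := e t o {t, o} (by simp) (by simp) (by simp) (by simp) (by simp)
    have e3 := e s t {s, t} (by simp) (by simp) (by simp [insert_subset_iff]) (by simp) (by simp)
    linear_combination (norm := module) e2 - e1 + e3 - h1 + h2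
  refine ⟨fun A => if h : A.Nonempty then f h.some + c {h.some} A else 0, ?_⟩
  intro A B hA hAB hB
  have hB' := hA.mono hAB
  simp only [dif_pos hA, dif_pos hB']
  rw [key hB'.some hA.some B hB'.some_mem (hAB hA.some_mem) hB,
    ← hc {hA.some} A B (singleton_nonempty _) (by simpa using hA.some_mem) hAB hB]
  abel

end Potential

section Paths

variable {X : Type*} [TopologicalSpace X]

/-- The homotopy class of the restriction of a map on the line to an oriented segment. -/
def qseg (u : ℝ → X) (hu : Continuous u) (a b : ℝ) (hx : u a = x) (hy : u b = y) :
    Path.Homotopic.Quotient x y :=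
  Path.Homotopic.Quotient.mk
    { toFun := fun t => u (a + t * (b - a))
      continuous_toFun := by fun_prop
      source' := by simpa using hx
      target' := by simpa using hy }

lemma image_paths_eq [AddCommGroup E] [Module ℝ E] [TopologicalSpace E]
    [IsTopologicalAddGroup E] [ContinuousSMul ℝ E]
    (hC : Convex ℝ C) (hφ : ContinuousOn φ C) {p q : ℝ → E} (hp : Continuous p)
    (hq : Continuous q) (hpC : ∀ t ∈ J, p t ∈ C) (hqC : ∀ t ∈ J, q t ∈ C)
    {x y : X} (γ δ : Path x y) (hγ : ∀ t, γ t = φ (p t)) (hδ : ∀ t, δ t = φ (q t))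
    (h0 : p 0 = q 0) (h1 : p 1 = q 1) :
    Path.Homotopic.Quotient.mk γ = Path.Homotopic.Quotient.mk δ := by
  refine Quotient.sound ⟨⟨⟨⟨fun z => φ ((1 - (z.1 : ℝ)) • p z.2 + (z.1 : ℝ) • q z.2), ?_⟩, ?_, ?_⟩, ?_⟩⟩
  · refine hφ.comp_continuous (by fun_prop) fun z => ?_
    exact hC (hpC _ z.2.2) (hqC _ z.2.2) (sub_nonneg.2 z.1.2.2) z.1.2.1 (by ring)
  · intro t; simp [hγ]
  · intro t; simp [hδ]
  · rintro s t (rfl | ht)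
    · change φ ((1 - (s : ℝ)) • p 0 + (s : ℝ) • q 0) = γ 0
      rw [← h0, ← add_smul, sub_add_cancel, one_smul, hγ]
      rfl
    · rw [mem_singleton_iff] at ht
      subst ht
      change φ ((1 - (s : ℝ)) • p 1 + (s : ℝ) • q 1) = γ 1
      rw [← h1, ← add_smul, sub_add_cancel, one_smul, hγ]
      rfl

section Convex

variable {E : Type*} [AddCommGroup E] [Module ℝ E] [TopologicalSpace E]
    [IsTopologicalAddGroup E] [ContinuousSMul ℝ E] {C : Set E}

/-- The image of the straight line between two points of a convex set. -/
def linePath (hC : Convex ℝ C) (hφ : ContinuousOn φ C) (hp : p ∈ C)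
    (hq : q ∈ C) {x y : X} (hx : φ p = x) (hy : φ q = y) : Path x y where
  toFun t := φ ((1 - (t : ℝ)) • p + (t : ℝ) • q)
  continuous_toFun := hφ.comp_continuous (by fun_prop) fun t =>
    hC hp hq (sub_nonneg.2 t.2.2) t.2.1 (by ring)
  source' := by simpa using hx
  target' := by simpa using hy

/-- The homotopy class of the image of the straight line between two points of a convex set. -/
def qline (hC : Convex ℝ C) {φ : E → X} (hφ : ContinuousOn φ C) {p q : E} (hp : p ∈ C)
    (hq : q ∈ C) (hx : φ p = x) (hy : φ q = y) : Path.Homotopic.Quotient x y :=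
  Path.Homotopic.Quotient.mk (linePath hC hφ hp hq hx hy)

lemma mk_eq_qline (hC : Convex ℝ C) (hφ : ContinuousOn φ C) (hp : p ∈ C)
    (hq : q ∈ C) {x y : X} (hx : φ p = x) (hy : φ q = y) (γ : Path x y) {r : ℝ → E}
    (hr : Continuous r) (hrC : ∀ t ∈ J, r t ∈ C) (hγ : ∀ t, γ t = φ (r t))
    (h0 : r 0 = p) (h1 : r 1 = q) :
    Path.Homotopic.Quotient.mk γ = qline hC hφ hp hq hx hy :=
  image_paths_eq hC hφ hr (by fun_prop) hrC
    (fun t ht => hC hp hq (sub_nonneg.2 ht.2) ht.1 (by ring)) γ _ hγ (fun t => rfl)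
    (by simpa using h0) (by simpa using h1)

lemma qline_trans (hC : Convex ℝ C) (hφ : ContinuousOn φ C) {p q r : E}
    (hp : p ∈ C) (hq : q ∈ C) (hr : r ∈ C) {x y z : X} (hx : φ p = x) (hy : φ q = y)
    (hz : φ r = z) :
    (qline hC hφ hp hq hx hy).trans (qline hC hφ hq hr hy hz) = qline hC hφ hp hr hx hz := by
  unfold qline
  rw [← Quotient.mk_trans]
  refine mk_eq_qline hC hφ hp hr hx hz _ (r := fun t => if t ≤ 1 / 2 then
    (1 - 2 * t) • p + (2 * t) • q else (1 - (2 * t - 1)) • q + (2 * t - 1) • r) ?_ ?_ ?_ ?_ ?_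
  · refine Continuous.if_le (by fun_prop) (by fun_prop) continuous_id continuous_const ?_
    rintro t rfl
    norm_num
  · intro t ht
    split_ifs with h
    · exact hC hp hq (by linarith) (by linarith [ht.1]) (by ring)
    · push Not at h
      exact hC hq hr (by linarith [ht.2]) (by linarith) (by ring)
  · intro t
    rw [Path.trans_apply]
    split_ifs with h <;> rfl
  · simp
  · norm_num

lemma qseg_eq_qline (hC : Convex ℝ C) (hφ : ContinuousOn φ C)
    (hp : p ∈ C) (hq : q ∈ C) (hx : φ p = x) (hy : φ q = y) {u : ℝ → X}
    (hu : Continuous u) {a b : ℝ} (hua : u a = x) (hub : u b = y) {r : ℝ → E}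
    (hr : Continuous r) (hrC : ∀ t ∈ J, r t ∈ C)
    (h : ∀ t ∈ J, u (a + t * (b - a)) = φ (r t)) (h0 : r 0 = p) (h1 : r 1 = q) :
    qseg u hu a b hua hub = qline hC hφ hp hq hx hy :=
  mk_eq_qline hC hφ hp hq hx hy _ hr hrC (fun t => h t t.2) h0 h1

end Convex

lemma qseg_trans {u : ℝ → X} (hu : Continuous u) {a b c : ℝ} {x y z : X} (hx : u a = x)
    (hy : u b = y) (hz : u c = z) :
    (qseg u hu a b hx hy).trans (qseg u hu b c hy hz) = qseg u hu a c hx hz := by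
  have key : ∀ (a b : ℝ) {x y : X} (hx : u a = x) (hy : u b = y), qseg u hu a b hx hy =
      qline convex_univ hu.continuousOn (mem_univ a) (mem_univ b) hx hy := fun a b x y hx hy =>
    qseg_eq_qline convex_univ hu.continuousOn (mem_univ a) (mem_univ b) hx hy hu hx hy
      (r := fun t => a + t * (b - a)) (by fun_prop) (fun _ _ => trivial) (fun _ _ => rfl)
      (by simp) (by ring)
  rw [key, key, key, qline_trans]

end Paths

section

variable {Γ : Type w} [Group Γ] {T : Type*} [MulAction Γ T]

namespace Tower

/-- A tower of spaces behaving in the limit like an Eilenberg-Mac Lane space of degree one, for the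
constant coefficient system `M`. -/
structure EM1 (L : Tower.{v} Γ) (M : Type*) [AddCommGroup M] where
  κ : ∀ n, Path.Homotopic.Quotient (L.pt n) (L.pt n) → M
  κ_trans : ∀ n a b, κ n (a.trans b) = κ n a + κ n b
  κ_step : ∀ n (γ : Path (L.pt n) (L.pt n)) (γ' : Path (L.pt (n + 1)) (L.pt (n + 1))),
    (∀ t, γ' t = L.step n (γ t)) →
      κ (n + 1) (Path.Homotopic.Quotient.mk γ') = κ n (Path.Homotopic.Quotient.mk γ)
  κ_smul : ∀ n (g : Γ) (γ γ' : Path (L.pt n) (L.pt n)), (∀ t, γ' t = g • γ t) →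
    κ n (Path.Homotopic.Quotient.mk γ') = κ n (Path.Homotopic.Quotient.mk γ)
  inj : ∀ (H : Subgroup Γ) (n : ℕ) (u : ℝ → L.obj n) (hu : Continuous u)
    (h : ∀ x, 1 ≤ ‖x‖ → u x = L.pt n), (∀ x, L.Fixed H (u x)) →
    κ n (qseg u hu (-1) 1 (h _ (by simp)) (h _ (by simp))) = 0 → L.EvNull H u
  surj : ∀ m : M, ∃ (n : ℕ) (u : ℝ → L.obj n) (hu : Continuous u) (h0 : u 0 = L.pt n)
    (h1 : u 1 = L.pt n), (∀ x, L.Fixed ⊤ (u x)) ∧ κ n (qseg u hu 0 1 h0 h1) = m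
  piTriv : ∀ (H : Subgroup Γ) (j : ℕ), j ≠ 1 → L.PiTriv H j

namespace EM1

variable {L : Tower.{v} Γ} {M : Type*} [AddCommGroup M] (e : L.EM1 M)

include e in
lemma κ_refl (n : ℕ) : e.κ n (Path.Homotopic.Quotient.refl _) = 0 := by
  have := e.κ_trans n (Path.Homotopic.Quotient.refl _) (Path.Homotopic.Quotient.refl _)
  rw [Quotient.refl_trans] at this
  simpa using this

lemma κ_symm (n : ℕ) (a) : e.κ n a.symm = - e.κ n a := by
  have := e.κ_trans n a.symm a
  rw [Quotient.symm_trans, e.κ_refl] at this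
  exact eq_neg_of_add_eq_zero_left this.symm

lemma κ_map (h : n ≤ n') (γ : Path (L.pt n) (L.pt n))
    (γ' : Path (L.pt n') (L.pt n')) (hγ : ∀ t, γ' t = L.map h (γ t)) :
    e.κ n' (Path.Homotopic.Quotient.mk γ') = e.κ n (Path.Homotopic.Quotient.mk γ) := by
  induction n', h using Nat.le_induction with
  | base =>
    congr 2
    ext t
    rw [hγ, L.map_refl]
  | succ k hk ih =>
    have hp := L.map_pt hk
    let δ : Path (L.pt k) (L.pt k) := (γ.map (L.map hk).continuous).cast hp.symm hp.symm
    rw [← ih δ fun t => rfl]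
    exact e.κ_step k δ γ' fun t => by rw [hγ, L.map_succ hk]; rfl

lemma κ_qseg_map (h : n ≤ n')
    (hu : Continuous u) (hu' : Continuous u') (h0 : u a = L.pt n) (h1 : u b = L.pt n)
    (h0' : u' a = L.pt n') (h1' : u' b = L.pt n') (hh : ∀ x, u' x = L.map h (u x)) :
    e.κ n' (qseg u' hu' a b h0' h1') = e.κ n (qseg u hu a b h0 h1) :=
  e.κ_map h _ _ fun _ => hh _

end EM1

end Tower

/-- The vertex of the polytope `Poly T` with coordinates `1` on `A`. -/
def ind (A : Set T) : T → ℝ := by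
  classical exact fun t => if t ∈ A then 1 else 0

lemma ind_mem (h : t ∈ A) : ind A t = 1 := by simp [ind, h]

lemma ind_notMem (h : t ∉ A) : ind A t = 0 := by simp [ind, h]

lemma ind_eq_one : ind A t = 1 ↔ t ∈ A := by
  by_cases h : t ∈ A <;> simp [ind, h]

/-- The nonempty proper subsets. -/
def Proper (A : Set T) : Prop := A.Nonempty ∧ A ≠ univ

lemma Proper.shift {A : Set T} (h : Proper A) (g : Γ) : Proper (shiftSet g A) :=
  ⟨shiftSet_nonempty g h.1, shiftSet_ne_univ g h.2⟩

lemma Proper.ind_mem_poly (h : Proper A) : ind A ∈ Poly T := by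
  obtain ⟨s, hs⟩ := h.1
  obtain ⟨t, ht⟩ := (ne_univ_iff_exists_notMem _).1 h.2
  refine ⟨fun t => ?_, ⟨t, ind_notMem ht⟩, ⟨s, ind_mem hs⟩⟩
  by_cases h : t ∈ A <;> simp [ind, h]

lemma Proper.not_many : ¬ Many 1 (ind A) := by
  rintro ⟨s, hs⟩
  have h : ∀ i, ind A (s i) = 0 ∨ ind A (s i) = 1 := fun i => by
    by_cases h : s i ∈ A <;> simp [ind, h]
  have h01 : ind A (s 0) ≠ ind A (s 1) := fun h => absurd (hs h) (by decide)
  have h02 : ind A (s 0) ≠ ind A (s 2) := fun h => absurd (hs h) (by decide)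
  have h12 : ind A (s 1) ≠ ind A (s 2) := fun h => absurd (hs h) (by decide)
  rcases h 0 with h0 | h0 <;> rcases h 1 with h1 | h1 <;> rcases h 2 with h2 | h2 <;> simp_all

lemma exists_eq_ind [Finite T] (hy : y ∈ Poly T) (h : ¬ Many 1 y) :
    Proper {t | y t = 1} ∧ y = ind {t | y t = 1} := by
  have h0 : Many 0 y := by
    obtain ⟨-, ⟨s, hs⟩, ⟨t, ht⟩⟩ := hy
    refine ⟨![s, t], ?_⟩
    intro i j hij
    fin_cases i <;> fin_cases j <;> simp_all
  refine ⟨⟨hy.2.2, fun h => ?_⟩, ?_⟩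
  · obtain ⟨s, hs⟩ := hy.2.1
    have h1 : y s = 1 := (eq_univ_iff_forall.1 h) s
    rw [hs] at h1
    exact zero_ne_one h1
  · obtain ⟨w, -, v, -, rfl⟩ := exists_cell hy h0 h
    funext t
    by_cases ht : (vhat v ∘ w) t = 1
    · rw [ind_mem (A := {t | (vhat v ∘ w) t = 1}) ht, ht]
    · rw [ind_notMem (A := {t | (vhat v ∘ w) t = 1}) ht]
      rcases eq_zero_or_last_or_mid (w t) with h | h | ⟨j, -⟩
      · simp [h]
      · exact absurd (by simp only [Function.comp_apply, h, vhat_last]) ht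
      · exact j.elim0

/-- The convex set of points of the cube that are `1` on `A` and `0` outside of `B`. -/
def edgeSet (A B : Set T) : Set (T → ℝ) :=
  {x | (∀ t, x t ∈ J) ∧ (∀ t ∈ A, x t = 1) ∧ ∀ t ∉ B, x t = 0}

lemma convex_edgeSet (A B : Set T) : Convex ℝ (edgeSet A B) := by
  rintro x ⟨hx1, hx2, hx3⟩ y ⟨hy1, hy2, hy3⟩ a b ha hb hab
  refine ⟨fun t => convex_Icc 0 1 (hx1 t) (hy1 t) ha hb hab, fun t ht => ?_, fun t ht => ?_⟩
  · simp [hx2 t ht, hy2 t ht, hab]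
  · simp [hx3 t ht, hy3 t ht]

lemma edgeSet_subset_poly (hA : A.Nonempty) (hB : B ≠ univ) :
    edgeSet A B ⊆ Poly T := by
  obtain ⟨s, hs⟩ := hA
  obtain ⟨t, ht⟩ := (ne_univ_iff_exists_notMem _).1 hB
  exact fun x hx => ⟨hx.1, ⟨t, hx.2.2 t ht⟩, ⟨s, hx.2.1 s hs⟩⟩

lemma ind_mem_edgeSet (h : A ⊆ C) (h' : C ⊆ B) : ind C ∈ edgeSet A B := by
  refine ⟨fun t => ?_, fun t ht => ind_mem (h ht), fun t ht => ind_notMem fun hC => ht (h' hC)⟩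
  by_cases h : t ∈ C <;> simp [ind, h]

/-- Paths to the base point from the values of `φ` at the vertices of `Poly T`. -/
structure VertexPaths (L : Tower.{v} Γ) {n : ℕ} (φ : (T → ℝ) → L.obj n) where
  path : Set T → ℝ → L.obj n
  cont : ∀ A, Continuous (path A)
  zero : ∀ A, Proper A → path A 0 = φ (ind A)
  one : ∀ A, path A 1 = L.pt n
  smul : ∀ (g : Γ) A, Proper A → ∀ t, path (shiftSet g A) t = g • path A t

namespace VertexPaths

variable {L : Tower.{v} Γ} {M : Type*} [AddCommGroup M] (e : L.EM1 M) {n : ℕ}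
  {φ : (T → ℝ) → L.obj n} (hφ : ContinuousOn φ (Poly T)) (V : VertexPaths L φ)

lemma mono_right (hA : A.Nonempty) (hAB : A ⊆ B) (hB : B ≠ univ) :
    Proper A ∧ Proper B :=
  ⟨⟨hA, fun h => hB (univ_subset_iff.1 (h ▸ hAB))⟩, ⟨hA.mono hAB, hB⟩⟩

/-- The image of the edge between two vertices. -/
def edge (hA : A.Nonempty) (hAB : A ⊆ B) (hB : B ≠ univ) :
    Path.Homotopic.Quotient (φ (ind A)) (φ (ind B)) :=
  qline (convex_edgeSet A B) (hφ.mono (edgeSet_subset_poly hA hB))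
    (ind_mem_edgeSet subset_rfl hAB) (ind_mem_edgeSet hAB subset_rfl) rfl rfl

/-- The class of a vertex path. -/
def cls (hA : Proper A) : Path.Homotopic.Quotient (φ (ind A)) (L.pt n) :=
  qseg (V.path A) (V.cont A) 0 1 (V.zero A hA) (V.one A)

/-- The obstruction on an edge. -/
def coc (A B : Set T) : M := by
  classical
  exact if h : A.Nonempty ∧ A ⊆ B ∧ B ≠ univ then
    e.κ n ((V.cls (mono_right h.1 h.2.1 h.2.2).1).symm.trans ((edge hφ h.1 h.2.1 h.2.2).trans
      (V.cls (mono_right h.1 h.2.1 h.2.2).2))) else 0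

lemma coc_eq (hA : A.Nonempty) (hAB : A ⊆ B) (hB : B ≠ univ) :
    V.coc e hφ A B = e.κ n ((V.cls (mono_right hA hAB hB).1).symm.trans
      ((edge hφ hA hAB hB).trans (V.cls (mono_right hA hAB hB).2))) :=
  dif_pos ⟨hA, hAB, hB⟩

lemma edge_trans (hA : A.Nonempty) (hAB : A ⊆ B) (hBC : B ⊆ C)
    (hC : C ≠ univ) (hB : B ≠ univ) (hB' : B.Nonempty) :
    (edge hφ hA hAB hB).trans (edge hφ hB' hBC hC) = edge hφ hA (hAB.trans hBC) hC := by
  have hC' := hφ.mono (edgeSet_subset_poly hA hC)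
  have h1 : edge hφ hA hAB hB = qline (convex_edgeSet A C) hC'
      (ind_mem_edgeSet subset_rfl (hAB.trans hBC)) (ind_mem_edgeSet hAB hBC) rfl rfl := rfl
  have h2 : edge hφ hB' hBC hC = qline (convex_edgeSet A C) hC'
      (ind_mem_edgeSet hAB hBC) (ind_mem_edgeSet (hAB.trans hBC) subset_rfl) rfl rfl := rfl
  rw [h1, h2, qline_trans]
  rfl

lemma coc_add (hA : A.Nonempty) (hAB : A ⊆ B) (hBC : B ⊆ C)
    (hC : C ≠ univ) : V.coc e hφ A B + V.coc e hφ B C = V.coc e hφ A C := by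
  have hB : B ≠ univ := fun h => hC (univ_subset_iff.1 (h ▸ hBC))
  have hB' := hA.mono hAB
  rw [V.coc_eq e hφ hA hAB hB, V.coc_eq e hφ hB' hBC hC, V.coc_eq e hφ hA (hAB.trans hBC) hC,
    ← e.κ_trans, ← edge_trans hφ hA hAB hBC hC hB hB']
  congr 1
  simp only [Quotient.trans_assoc]
  congr 2
  rw [← Quotient.trans_assoc, Quotient.trans_symm,
    Quotient.refl_trans]

lemma coc_self (A : Set T) (hA : Proper A) : V.coc e hφ A A = 0 := by
  have := V.coc_add e hφ hA.1 (subset_refl A) subset_rfl hA.2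
  simpa using this

include hφ in
lemma coc_shift (hφ' : ∀ (g : Γ), ∀ y ∈ Poly T, φ (shift g y) = g • φ y) (g : Γ) (A B : Set T)
    (hA : A.Nonempty) (hAB : A ⊆ B) (hB : B ≠ univ) :
    V.coc e hφ (shiftSet g A) (shiftSet g B) = V.coc e hφ A B := by
  obtain ⟨pA, pB⟩ := mono_right hA hAB hB
  rw [V.coc_eq e hφ hA hAB hB, V.coc_eq e hφ (shiftSet_nonempty g hA) (shiftSet_mono g hAB)
    (shiftSet_ne_univ g hB)]
  unfold cls edge qseg qline
  simp only [← Quotient.mk_symm, ← Quotient.mk_trans]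
  refine e.κ_smul n g _ _ fun t => ?_
  have h1 : ∀ t : I, φ (shift g ((1 - (t : ℝ)) • ind A + (t : ℝ) • ind B)) =
      g • φ ((1 - (t : ℝ)) • ind A + (t : ℝ) • ind B) := fun t =>
    hφ' g _ (edgeSet_subset_poly hA hB (convex_edgeSet A B (ind_mem_edgeSet subset_rfl hAB)
      (ind_mem_edgeSet hAB subset_rfl) (sub_nonneg.2 t.2.2) t.2.1 (by ring)))
  simp only [Path.trans_apply, Path.symm_apply]
  split_ifs with h h'
  · exact V.smul g A pA _
  · exact h1 _
  · exact V.smul g B pB _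

end VertexPaths

end

section

variable {Γ : Type w} [Group Γ] {T : Type*} [MulAction Γ T]

lemma quotient_trans_symm {X : Type*} [TopologicalSpace X] {x y z : X}
    (a : Path.Homotopic.Quotient x y) (b : Path.Homotopic.Quotient y z) :
    (a.trans b).symm = b.symm.trans a.symm := by
  induction a using Path.Homotopic.Quotient.ind
  induction b using Path.Homotopic.Quotient.ind
  simp only [← Quotient.mk_symm, ← Quotient.mk_trans, Path.trans_symm]

namespace Tower

lemma cupParam_neg (h : -1 ≤ x) (h' : x ≤ -(1 / 2)) : cupParam x = (-1, -2 * x - 1) := by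
  have h1 : max ‖x‖ (1 / 2) = -x := by
    rw [Real.norm_of_nonpos (by linarith), max_eq_left (by linarith)]
  refine Prod.ext ?_ ?_
  · simp only [cupParam, h1, smul_eq_mul]
    rw [inv_neg, neg_mul, inv_mul_cancel₀ (by linarith)]
  · simp only [cupParam]
    rw [Real.norm_of_nonpos (by linarith), min_eq_right (by linarith), max_eq_right (by linarith)]
    ring

lemma cupParam_pos (h : x ≤ 1) (h' : 1 / 2 ≤ x) : cupParam x = (1, 2 * x - 1) := by
  have h1 : max ‖x‖ (1 / 2) = x := by
    rw [Real.norm_of_nonneg (by linarith), max_eq_left (by linarith)]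
  refine Prod.ext ?_ ?_
  · simp only [cupParam, h1, smul_eq_mul]
    rw [inv_mul_cancel₀ (by linarith)]
  · simp only [cupParam]
    rw [Real.norm_of_nonneg (by linarith), min_eq_right (by linarith), max_eq_right (by linarith)]

variable {L : Tower.{v} Γ} {M : Type*} [AddCommGroup M] (e : L.EM1 M)

lemma EM1.evNull_cup {g : ℝ × ℝ → L.obj n}
    (hg : ContinuousOn g (cup (closedBall 0 1) (sphere 0 1)))
    (h1 : ∀ x, ‖x‖ = 1 → g (x, 1) = L.pt n)
    (hf : ∀ z ∈ cup (closedBall (0 : ℝ) 1) (sphere 0 1), L.Fixed H (g z))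
    {x y : L.obj n} (α : Path x (L.pt n)) (γ : Path x y) (β : Path y (L.pt n))
    (hα : ∀ t : I, g (-1, t) = α t) (hβ : ∀ t : I, g (1, t) = β t)
    (hγ : ∀ t : I, g (2 * t - 1, 0) = γ t)
    (h : e.κ n ((Path.Homotopic.Quotient.mk α).symm.trans
      ((Path.Homotopic.Quotient.mk γ).trans (Path.Homotopic.Quotient.mk β))) = 0) :
    L.EvNull H (fun s : ℝ => g (cupParam s)) := by
  have hu := continuous_comp_cupParam hg
  have hn : ∀ t : ℝ, 0 ≤ t → t ≤ 1 → cupParam (-1 + t * (-(1 / 2) - -1)) = (-1, 1 - t) := by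
    intro t h0 h1
    rw [cupParam_neg (by linarith) (by linarith)]
    ring_nf
  have hp : ∀ t : ℝ, 0 ≤ t → t ≤ 1 → cupParam (1 / 2 + t * (1 - 1 / 2)) = (1, t) := by
    intro t h0 h1
    rw [cupParam_pos (by linarith) (by linarith)]
    ring_nf
  have hm : ∀ t : ℝ, 0 ≤ t → t ≤ 1 →
      cupParam (-(1 / 2) + t * (1 / 2 - -(1 / 2))) = (2 * t - 1, 0) := by
    intro t h0 h1
    rw [cupParam_of_le (by rw [Real.norm_eq_abs, abs_le]; constructor <;> linarith)]
    simp only [smul_eq_mul]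
    ring_nf
  have e1 : cupParam (-(1 / 2) : ℝ) = (-1, 0) := by
    rw [cupParam_neg (by norm_num) le_rfl]; norm_num
  have e2 : cupParam ((1 / 2) : ℝ) = (1, 0) := by
    rw [cupParam_pos (by norm_num) le_rfl]; norm_num
  have hx : g (cupParam (-(1 / 2) : ℝ)) = x := by
    rw [e1]; simpa using hα 0
  have hy : g (cupParam (1 / 2 : ℝ)) = y := by
    rw [e2]; simpa using hβ 0
  refine e.inj H n _ hu (fun x hx => comp_cupParam_of_ge h1 hx) (fun s => hf _ (cupParam_mem s)) ?_
  rw [← qseg_trans hu _ hx _, ← qseg_trans hu hx hy _]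
  refine Eq.trans ?_ h
  congr 2
  · unfold qseg
    rw [← Quotient.mk_symm]
    congr 1
    ext t
    change g (cupParam _) = α _
    rw [hn t t.2.1 t.2.2, ← hα]
    rfl
  · congr 1
    · unfold qseg
      congr 1
      ext t
      change g (cupParam _) = γ _
      rw [hm t t.2.1 t.2.2, ← hγ]
    · unfold qseg
      congr 1
      ext t
      change g (cupParam _) = β _
      rw [hp t t.2.1 t.2.2, ← hβ]

end Tower

namespace VertexPaths

variable {L : Tower.{v} Γ} {M : Type*} [AddCommGroup M] (e : L.EM1 M) {n : ℕ}
  {φ : (T → ℝ) → L.obj n} (hφ : ContinuousOn φ (Poly T)) (V : VertexPaths L φ)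

/-- Vertex paths at a later stage. -/
def map (h : n ≤ n') (hφ' : ∀ y, φ' y = L.map h (φ y)) :
    VertexPaths L φ' where
  path A t := L.map h (V.path A t)
  cont A := (L.map h).continuous.comp (V.cont A)
  zero A hA := by rw [V.zero A hA, hφ']
  one A := by rw [V.one A, L.map_pt]
  smul g A hA t := by rw [V.smul g A hA t, L.map_smul]

lemma coc_map (h : n ≤ n') {φ' : (T → ℝ) → L.obj n'}
    (hφ' : ∀ y, φ' y = L.map h (φ y)) (hc : ContinuousOn φ' (Poly T)) {A B : Set T}
    (hA : A.Nonempty) (hAB : A ⊆ B) (hB : B ≠ univ) :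
    (V.map h hφ').coc e hc A B = V.coc e hφ A B := by
  rw [V.coc_eq e hφ hA hAB hB, coc_eq e hc _ hA hAB hB]
  unfold cls edge qseg qline
  refine e.κ_map h _ _ fun t => ?_
  simp only [Path.trans_apply, Path.symm_apply]
  split_ifs with h h'
  · rfl
  · exact hφ' _
  · rfl

/-- Change of the vertex paths by invariant loops. -/
def modify (ℓ : Set T → ℝ → L.obj n) (hℓ : ∀ A, Continuous (ℓ A)) (h0 : ∀ A, ℓ A 0 = L.pt n)
    (h1 : ∀ A, ℓ A 1 = L.pt n) (hf : ∀ A x, L.Fixed ⊤ (ℓ A x))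
    (hs : ∀ (g : Γ) A, Proper A → ℓ (shiftSet g A) = ℓ A) : VertexPaths L φ where
  path A t := if t ≤ 1 / 2 then V.path A (2 * t) else ℓ A (2 * t - 1)
  cont A := by
    refine Continuous.if_le ((V.cont A).comp (by fun_prop)) ((hℓ A).comp (by fun_prop))
      continuous_id continuous_const ?_
    rintro t rfl
    norm_num [V.one, h0]
  zero A hA := by norm_num [V.zero A hA]
  one A := by norm_num [h1]
  smul g A hA t := by
    split_ifs
    · exact V.smul g A hA _
    · rw [hs g A hA, hf A _ g (Subgroup.mem_top g)]

lemma coc_modify (ℓ : Set T → ℝ → L.obj n) (hℓ : ∀ A, Continuous (ℓ A))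
    (h0 : ∀ A, ℓ A 0 = L.pt n) (h1 : ∀ A, ℓ A 1 = L.pt n) (hf : ∀ A x, L.Fixed ⊤ (ℓ A x))
    (hs : ∀ (g : Γ) A, Proper A → ℓ (shiftSet g A) = ℓ A) {A B : Set T} (hA : A.Nonempty)
    (hAB : A ⊆ B) (hB : B ≠ univ) : (V.modify ℓ hℓ h0 h1 hf hs).coc e hφ A B = V.coc e hφ A B -
      e.κ n (qseg (ℓ A) (hℓ A) 0 1 (h0 A) (h1 A)) +
      e.κ n (qseg (ℓ B) (hℓ B) 0 1 (h0 B) (h1 B)) := by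
  have key : ∀ {A : Set T} (pA : Proper A), (V.modify ℓ hℓ h0 h1 hf hs).cls pA =
      (V.cls pA).trans (qseg (ℓ A) (hℓ A) 0 1 (h0 A) (h1 A)) := by
    intro A pA
    unfold cls qseg
    rw [← Quotient.mk_trans]
    congr 1
    ext t
    simp only [Path.trans_apply]
    simp [modify]
  rw [V.coc_eq e hφ hA hAB hB, coc_eq e hφ _ hA hAB hB, key, key, sub_eq_neg_add, ← e.κ_symm,
    ← e.κ_trans, ← e.κ_trans]
  congr 1
  rw [quotient_trans_symm]
  simp only [Quotient.trans_assoc]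

end VertexPaths

end

section

variable {Γ : Type w} [Group Γ] {T : Type*} [MulAction Γ T] [Finite T]
  {L : Tower.{v} Γ} {M : Type*} [AddCommGroup M] (e : L.EM1 M) {n : ℕ}
  {φ : (T → ℝ) → L.obj n} (hφ : ContinuousOn φ (Poly T))

lemma projIcc_of_mem' (ht : t ∈ J) :
    (projIcc (0 : ℝ) 1 zero_le_one t : ℝ) = t := by rw [projIcc_of_mem _ ht]

/-- Vertex paths from a map on the vertices times the interval. -/
def vertexPathsOf
    (hh : IsEqOn L (skelDom (Fin 0 → ℝ) ∅ 1) h)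
    (h0 : ∀ y ∈ Poly T, h ((y, 0), 0) = φ y) : VertexPaths L φ := by
  classical
  have hmem : ∀ {A : Set T}, Proper A → ∀ t : ℝ,
      ((ind A, (0 : Fin 0 → ℝ)), (projIcc (0 : ℝ) 1 zero_le_one t : ℝ)) ∈
        skelDom (Fin 0 → ℝ) ∅ 1 := fun hA t =>
    ⟨hA.ind_mem_poly, by simp, (projIcc (0 : ℝ) 1 zero_le_one t).2, Or.inr (Or.inl Proper.not_many)⟩
  exact
  { path := fun A t => if Proper A then h ((ind A, 0), projIcc (0 : ℝ) 1 zero_le_one t) else L.pt n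
    cont := fun A => by
      split_ifs with hA
      · exact hh.cont.comp_continuous (by fun_prop) (hmem hA)
      · exact continuous_const
    zero := fun A hA => by
      rw [if_pos hA, ← h0 _ hA.ind_mem_poly]
      simp
    one := fun A => by
      split_ifs with hA
      · exact hh.one _ (hmem hA 1) (by simp)
      · rfl
    smul := fun g A hA t => by
      rw [if_pos hA, if_pos (hA.shift g)]
      exact hh.equi g _ (hmem hA t) }

namespace VertexPaths

variable (V : VertexPaths L φ)

open Classical in
/-- The map on the vertices times the interval given by vertex paths. -/
def toFun (z : ((T → ℝ) × (Fin 0 → ℝ)) × ℝ) : L.obj n :=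
  if z.2 = 0 then φ z.1.1 else V.path {t | z.1.1 t = 1} z.2

lemma toFun_zero (y : T → ℝ) (p : Fin 0 → ℝ) : V.toFun ((y, p), 0) = φ y := if_pos rfl

lemma toFun_ind (hA : Proper A) (p : Fin 0 → ℝ) (t : ℝ) :
    V.toFun ((ind A, p), t) = V.path A t := by
  by_cases ht : t = 0
  · rw [ht, toFun_zero, V.zero A hA]
  · have : {t | ind A t = 1} = A := by ext t; exact ind_eq_one
    simp only [toFun, if_neg ht, this]

lemma skelDom_cases {z : ((T → ℝ) × (Fin 0 → ℝ)) × ℝ}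
    (hz : z ∈ skelDom (Fin 0 → ℝ) ∅ 1) : z.2 = 0 ∨ ∃ A, Proper A ∧ z.1.1 = ind A := by
  obtain ⟨h1, -, -, h | h | h | h⟩ := hz
  · exact h.elim
  · exact .inr ⟨_, exists_eq_ind h1 h⟩
  · rw [Subsingleton.elim z.1.2 0, norm_zero] at h
    exact absurd h zero_ne_one
  · exact .inl h

include hφ in
lemma isEqOn_toFun (hφ' : ∀ (g : Γ), ∀ y ∈ Poly T, φ (shift g y) = g • φ y) :
    IsEqOn L (skelDom (Fin 0 → ℝ) ∅ 1) V.toFun := by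
  refine ⟨?_, ?_, ?_⟩
  · have hc1 : ContinuousOn V.toFun {z | z.1.1 ∈ Poly T ∧ z.2 = 0} := by
      refine (hφ.comp (f := fun z : ((T → ℝ) × (Fin 0 → ℝ)) × ℝ => z.1.1)
        (by fun_prop) fun z hz => hz.1).congr fun z hz => ?_
      exact if_pos hz.2
    have hc2 : ContinuousOn V.toFun (⋃ A : {A : Set T // Proper A},
        {z : ((T → ℝ) × (Fin 0 → ℝ)) × ℝ | z.1.1 = ind A.1}) := by
      refine (locallyFinite_of_finite _).continuousOn_iUnion (fun A => ?_) fun A => ?_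
      · exact isClosed_eq (by fun_prop) continuous_const
      · refine ((V.cont A.1).comp continuous_snd).continuousOn.congr ?_
        rintro ⟨⟨y, p⟩, t⟩ (rfl : y = _)
        exact V.toFun_ind A.2 p t
    refine (hc1.union_of_isClosed hc2 ?_ ?_).mono fun z hz => ?_
    · exact (isClosed_poly.preimage (continuous_fst.comp continuous_fst)).inter
        (isClosed_eq (by fun_prop) continuous_const)
    · exact isClosed_iUnion_of_finite fun A => isClosed_eq (by fun_prop) continuous_const
    · exact (skelDom_cases hz).imp (fun h => ⟨hz.1, h⟩)
        (fun ⟨A, hA, h⟩ => mem_iUnion.2 ⟨⟨A, hA⟩, h⟩)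
  · rintro g ⟨⟨y, p⟩, t⟩ hz
    rcases skelDom_cases hz with rfl | ⟨A, hA, rfl⟩
    · simp only [toFun_zero, hφ' g y hz.1]
    · change V.toFun ((ind (shiftSet g A), p), t) = g • V.toFun ((ind A, p), t)
      rw [V.toFun_ind (hA.shift g), V.toFun_ind hA, V.smul g A hA]
  · rintro ⟨⟨y, p⟩, t⟩ hz rfl
    rcases skelDom_cases hz with h | ⟨A, hA, rfl⟩
    · exact absurd h one_ne_zero
    · exact (V.toFun_ind hA p 1).trans (V.one A)

include e hφ in
lemma fillable_edge (hφ' : ∀ (g : Γ), ∀ y ∈ Poly T, φ (shift g y) = g • φ y)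
    (hV : ∀ A B : Set T, A.Nonempty → A ⊆ B → B ≠ univ → V.coc e hφ A B = 0)
    (w : T → Fin 3) (hw : Function.Surjective w) :
    L.Fillable (cellStab Γ w) (ordSimplex 1 ×ˢ closedBall (0 : Fin 0 → ℝ) 1)
        (frontier (ordSimplex 1 ×ˢ closedBall (0 : Fin 0 → ℝ) 1))
        (fun z => V.toFun ((vhat z.1.1 ∘ w, z.1.2), z.2)) := by
  have hh := V.isEqOn_toFun hφ hφ'
  have hord : ∀ v : Fin 1 → ℝ, v ∈ ordSimplex 1 ↔ v 0 ∈ J := fun v => by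
    rw [mem_ordSimplex, Fin.forall_fin_two]
    rfl
  have hfr : ∀ v : Fin 1 → ℝ, v ∈ frontier (ordSimplex 1) → v 0 = 0 ∨ v 0 = 1 := fun v hv => by
    obtain ⟨hv, hi⟩ := mem_frontier_ordSimplex.1 hv
    by_contra! hcon
    have := (hord v).1 hv
    refine hi ((Fin.strictMono_iff_lt_succ.2 fun i => ?_).injective)
    fin_cases i
    · exact lt_of_le_of_ne this.1 (Ne.symm hcon.1)
    · exact lt_of_le_of_ne this.2 hcon.2
  have hfr' : ∀ v : Fin 1 → ℝ, v 0 = 0 ∨ v 0 = 1 → v ∈ frontier (ordSimplex 1) := fun v hv => by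
    refine mem_frontier_ordSimplex.2 ⟨(hord v).2 ?_, fun hi => ?_⟩
    · rcases hv with h | h <;> simp [h]
    · rcases hv with h | h
      · exact absurd (@hi 1 0 h) (by decide)
      · exact absurd (@hi 1 2 h) (by decide)
  refine Tower.Fillable.transport (C' := closedBall (0 : ℝ) 1) (B' := sphere 0 1)
    (fun s : ℝ => ((fun _ => (s + 1) / 2 : Fin 1 → ℝ), (0 : Fin 0 → ℝ)))
    (fun z => 2 * z.1 0 - 1) ?_ (Continuous.continuousOn (by fun_prop)) ?_ ?_ ?_
  rotate_left
  · rintro ⟨v, p⟩ ⟨hv, -⟩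
    have := (hord v).1 hv
    rw [mem_closedBall_zero_iff, Real.norm_eq_abs, abs_le]
    constructor <;> linarith [this.1, this.2]
  · rintro ⟨v, p⟩ ⟨hv, -⟩ hz
    rw [frontier_prod_eq, isClosed_closedBall.closure_eq, isClosed_ordSimplex.closure_eq,
      frontier_closedBall _ one_ne_zero] at hz
    rcases hz with ⟨-, hz⟩ | ⟨hz, -⟩
    · rw [Subsingleton.elim p 0, mem_sphere_zero_iff_norm, norm_zero] at hz
      exact absurd hz zero_ne_one
    · rcases hfr v hz with h | h <;> (simp [h]; try norm_num)
  · rintro ⟨v, p⟩ -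
    refine Prod.ext (funext fun i => ?_) (Subsingleton.elim _ _)
    rw [Subsingleton.elim i 0]
    simp
  have hA : Proper {t | w t = 2} := by
    obtain ⟨s, hs⟩ := hw 2
    obtain ⟨t, ht⟩ := hw 0
    exact ⟨⟨s, hs⟩, (ne_univ_iff_exists_notMem _).2 ⟨t, by simp [ht]⟩⟩
  have hB : Proper {t | w t ≠ 0} := by
    obtain ⟨s, hs⟩ := hw 2
    obtain ⟨t, ht⟩ := hw 0
    exact ⟨⟨s, by simp [hs]⟩, (ne_univ_iff_exists_notMem _).2 ⟨t, by simp [ht]⟩⟩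
  have hAB : {t | w t = 2} ⊆ {t | w t ≠ 0} := fun t (ht : w t = 2) => by simp [ht]
  have hvec : ∀ s : ℝ, vhat (fun _ : Fin 1 => s) ∘ w =
      (1 - s) • ind {t | w t = 2} + s • ind {t | w t ≠ 0} := fun s => by
    funext t
    have h3 : ∀ i : Fin 3, i = 0 ∨ i = 1 ∨ i = 2 := by decide
    have e1 : vhat (fun _ : Fin 1 => s) (1 : Fin 3) = s := rfl
    have e2 : vhat (fun _ : Fin 1 => s) (2 : Fin 3) = 1 := rfl
    rcases h3 (w t) with h | h | h
    · simp [h, ind]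
    · simp [h, ind, e1]
    · simp [h, ind, e2]
  have hv0 : vhat (fun _ => 0) ∘ w = ind {t | w t = 2} := by simp [hvec]
  have hv1 : vhat (fun _ => 1) ∘ w = ind {t | w t ≠ 0} := by simp [hvec]
  have hcup : ∀ z ∈ Tower.cup (closedBall 0 1) (sphere 0 1),
      ((vhat (fun _ => (z.1 + 1) / 2) ∘ w, 0), z.2) ∈
        skelDom (Fin 0 → ℝ) ∅ 1 := by
    rintro ⟨s, t⟩ ⟨h1, h2, h3⟩
    refine cup_prod_subset_skelDom hw
      (z := ((fun _ => (s + 1) / 2, (0 : Fin 0 → ℝ)), t)) ⟨⟨?_, by simp⟩, h2, ?_⟩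
    · rw [hord]
      rw [mem_closedBall_zero_iff, Real.norm_eq_abs, abs_le] at h1
      constructor <;> linarith [h1.1, h1.2]
    · refine h3.imp (fun h => ?_) id
      rw [frontier_prod_eq]
      refine .inr ⟨hfr' _ ?_, subset_closure (by simp)⟩
      rw [mem_sphere_zero_iff_norm, Real.norm_eq_abs] at h
      rcases eq_or_eq_neg_of_abs_eq h with h | h
      · right
        rw [show s = 1 from h]; norm_num
      · left
        rw [show s = -1 from h]; norm_num
  refine Tower.fillable_ball _ _ (e.evNull_cup (g := fun z =>
    V.toFun ((vhat (fun _ : Fin 1 => (z.1 + 1) / 2) ∘ w, (0 : Fin 0 → ℝ)), z.2)) ?_ ?_ ?_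
    (x := φ (ind {t | w t = 2})) (y := φ (ind {t | w t ≠ 0}))
    ⟨⟨fun t => V.path {t | w t = 2} t, (V.cont _).comp continuous_subtype_val⟩, ?_, ?_⟩
    (linePath (convex_edgeSet _ _) (hφ.mono (edgeSet_subset_poly hA.1 hB.2))
      (ind_mem_edgeSet subset_rfl hAB) (ind_mem_edgeSet hAB subset_rfl) rfl rfl)
    ⟨⟨fun t => V.path {t | w t ≠ 0} t, (V.cont _).comp continuous_subtype_val⟩, ?_, ?_⟩
    ?_ ?_ ?_ ?_)
  · refine hh.cont.comp (Continuous.continuousOn ?_) hcup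
    have : Continuous fun z : ℝ × ℝ => vhat (fun _ : Fin 1 => (z.1 + 1) / 2) :=
      continuous_vhat.comp (by fun_prop)
    exact ((continuous_pi fun t => (continuous_apply (w t)).comp this).prodMk
      continuous_const).prodMk continuous_snd
  · intro x hx
    exact hh.one _ (hcup (x, 1) ⟨by simp [hx], by simp, .inl (by simp [hx])⟩) rfl
  · intro z hz g hg
    have := hh.equi g _ (hcup z hz)
    rw [← this, shift_comp, mem_cellStab.1 hg]
  · simpa using V.zero _ hA
  · simpa using V.one _
  · simpa using V.zero _ hB
  · simpa using V.one _
  · intro t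
    rw [show ((-1 : ℝ) + 1) / 2 = 0 by norm_num, hv0, V.toFun_ind hA]
    rfl
  · intro t
    rw [show ((1 : ℝ) + 1) / 2 = 1 by norm_num, hv1, V.toFun_ind hB]
    rfl
  · intro t
    change V.toFun ((vhat (fun _ => ((2 * t - 1) + 1) / 2) ∘ w,
      0), 0) = _
    rw [show ((2 * (t : ℝ) - 1) + 1) / 2 = t by ring, hvec, V.toFun_zero]
    rfl
  · have := hV _ _ hA.1 hAB hB.2
    rw [V.coc_eq e hφ hA.1 hAB hB.2] at this
    unfold cls edge qseg qline at this
    refine Eq.trans ?_ this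
    congr 3
    · congr 1
      ext t
      simp
    · congr 1
      ext t
      simp

end VertexPaths

include hφ in
lemma eqNull_of_potential (hφ' : ∀ (g : Γ), ∀ y ∈ Poly T, φ (shift g y) = g • φ y)
    (hψ : ∀ (n' : ℕ) (h : n ≤ n') (hc : ContinuousOn (fun y => L.map h (φ y)) (Poly T))
      (V : VertexPaths L (fun y => L.map h (φ y))), ∃ ψ : Set T → M,
        IsPotential (V.coc e hc) ψ ∧ ∀ (g : Γ) A, Proper A → ψ (shiftSet g A) = ψ A) :
    ∃ (n' : ℕ) (h : n ≤ n') (H : Cyl(T) → L.obj n'), ContinuousOn H (Poly T ×ˢ J) ∧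
      (∀ (g : Γ), ∀ y ∈ Poly T, ∀ t ∈ J, H (shift g y, t) = g • H (y, t)) ∧
      (∀ y ∈ Poly T, H (y, 0) = L.map h (φ y)) ∧ ∀ y ∈ Poly T, H (y, 1) = L.pt n' := by
  have hmem0 : ∀ {k : ℕ} {y : T → ℝ}, y ∈ Poly T →
      ((y, (0 : Fin 0 → ℝ)), (0 : ℝ)) ∈ skelDom (Fin 0 → ℝ) (∅ : Set (T → ℝ)) k :=
    fun hy => ⟨hy, by simp, by simp, Or.inr (Or.inr (Or.inr rfl))⟩
  have hz0 : ∀ z ∈ skelDom (Fin 0 → ℝ) (∅ : Set (T → ℝ)) 0, z.2 = 0 := by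
    rintro z ⟨h1, -, -, h | h | h | h⟩
    · exact h.elim
    · refine absurd ?_ h
      obtain ⟨-, ⟨s, hs⟩, ⟨t, ht⟩⟩ := h1
      refine ⟨![s, t], fun i j hij => ?_⟩
      fin_cases i <;> fin_cases j <;> simp_all
    · rw [Subsingleton.elim z.1.2 0, norm_zero] at h
      exact absurd h zero_ne_one
    · exact h
  have hh0 : IsEqOn L (skelDom (Fin 0 → ℝ) ∅ 0) fun z => φ z.1.1 := by
    refine ⟨hφ.comp (by fun_prop) fun z hz => hz.1, fun g z hz => hφ' g _ hz.1, fun z hz h => ?_⟩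
    rw [hz0 z hz] at h
    exact absurd h zero_ne_one
  obtain ⟨n₁, hn₁, h₁, hh₁, hext₁⟩ := exists_extend_step isSubcomplex_empty hh0 fun w hw _ =>
    fillable_of_piTriv hh0 hw (e.piTriv _ _ (by simp))
  have hφ₁ := (L.map hn₁).continuous.comp_continuousOn hφ
  let V₁ : VertexPaths L (fun y => L.map hn₁ (φ y)) := vertexPathsOf hh₁ fun y hy =>
    hext₁ _ (hmem0 hy)
  obtain ⟨ψ, hψ, hψg⟩ := hψ n₁ hn₁ hφ₁ V₁
  choose N u hu hu0 hu1 huf huκ using e.surj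
  obtain ⟨n₂, hn₂⟩ : ∃ n₂, ∀ A : Set T, N (-(ψ A)) ≤ n₂ := by
    obtain ⟨n₂, h⟩ := (Set.finite_range fun A : Set T => N (-(ψ A))).bddAbove
    exact ⟨n₂, fun A => h ⟨A, rfl⟩⟩
  have h12 : n₁ ≤ max n₁ n₂ := le_max_left _ _
  have hN2 : ∀ A : Set T, N (-(ψ A)) ≤ max n₁ n₂ := fun A => (hn₂ A).trans (le_max_right _ _)
  set φ₂ : (T → ℝ) → L.obj (max n₁ n₂) := fun y => L.map (hn₁.trans h12) (φ y) with hφ₂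
  have hφ₂c : ContinuousOn φ₂ (Poly T) := (L.map _).continuous.comp_continuousOn hφ
  have hφ₂' : ∀ (g : Γ), ∀ y ∈ Poly T, φ₂ (shift g y) = g • φ₂ y := fun g y hy => by
    simp only [hφ₂, hφ' g y hy, L.map_smul]
  have hcongr : ∀ (m m' : M) (h : N m ≤ max n₁ n₂) (h' : N m' ≤ max n₁ n₂), m = m' → ∀ x,
      L.map h (u m x) = L.map h' (u m' x) := by
    rintro m _ h h' rfl x
    rfl
  let V₂ : VertexPaths L φ₂ := (V₁.map h12 fun y => (L.map_map _ _ _).symm).modify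
    (fun A x => L.map (hN2 A) (u (-(ψ A)) x)) (fun A => (L.map _).continuous.comp (hu _))
    (fun A => by rw [hu0, L.map_pt]) (fun A => by rw [hu1, L.map_pt])
    (fun A x => (huf _ x).map _) (fun g A hA => funext fun x => hcongr _ _ _ _ (by rw [hψg g A hA]) x)
  have hV₂ : ∀ A B : Set T, A.Nonempty → A ⊆ B → B ≠ univ → V₂.coc e hφ₂c A B = 0 := by
    intro A B hA hAB hB
    rw [VertexPaths.coc_modify e hφ₂c _ _ _ _ _ _ _ hA hAB hB,
      VertexPaths.coc_map e hφ₁ V₁ h12 _ hφ₂c hA hAB hB, ← hψ A B hA hAB hB]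
    have key : ∀ A, e.κ _ (qseg (fun x => L.map (hN2 A) (u (-(ψ A)) x))
        ((L.map _).continuous.comp (hu _)) 0 1 (by rw [hu0, L.map_pt]) (by rw [hu1, L.map_pt])) =
          -(ψ A) := fun A => by
      exact (e.κ_qseg_map (hN2 A) (hu _) _ _ _ _ _ fun x => rfl).trans (huκ _)
    rw [key, key]
    abel
  have hh₂ := V₂.isEqOn_toFun hφ₂c hφ₂'
  obtain ⟨n₃, hn₃, h₃, hh₃, hext₃⟩ := exists_extend_step isSubcomplex_empty hh₂ fun w hw _ =>
    V₂.fillable_edge e hφ₂c hφ₂' hV₂ w hw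
  obtain ⟨n₄, hn₄, h₄, hh₄, hext₄⟩ := exists_extend isSubcomplex_empty hh₃ fun k hk w hw _ =>
    e.piTriv _ _ (by rw [Module.finrank_zero_of_subsingleton]; omega)
  have hm : ∀ y ∈ Poly T, ∀ t ∈ J,
      ((y, (0 : Fin 0 → ℝ)), t) ∈ skelDom (Fin 0 → ℝ) univ 0 :=
    fun y hy t ht => ⟨hy, by simp, ht, Or.inl trivial⟩
  refine ⟨n₄, (hn₁.trans h12).trans (hn₃.trans hn₄), fun z => h₄ ((z.1, 0), z.2), ?_, ?_, ?_, ?_⟩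
  · exact hh₄.cont.comp (by fun_prop) fun z hz => hm _ hz.1 _ hz.2
  · exact fun g y hy t ht => hh₄.equi g _ (hm y hy t ht)
  · intro y hy
    simp only [hext₄ _ (hmem0 hy), hext₃ _ (hmem0 hy), V₂.toFun_zero, L.map_map, hφ₂]
  · exact fun y hy => hh₄.one _ (hm y hy 1 (by simp)) rfl

end

section

variable {Γ : Type w} [Group Γ] {T : Type*} [MulAction Γ T] [Finite T]
  {L : Tower.{v} Γ} {M : Type*} [AddCommGroup M] (e : L.EM1 M) {n : ℕ}
  {φ : (T → ℝ) → L.obj n} (hφ : ContinuousOn φ (Poly T))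

lemma VertexPaths.exists_potential_of_null (V : VertexPaths L φ)
    (hH : ContinuousOn H (Poly T ×ˢ J)) (h0 : ∀ y ∈ Poly T, H (y, 0) = φ y)
    (h1 : ∀ y ∈ Poly T, H (y, 1) = L.pt n) : ∃ ψ : Set T → M, IsPotential (V.coc e hφ) ψ := by
  classical
  have hp : ∀ {A : Set T}, Proper A → ∀ t : I, (ind A, (t : ℝ)) ∈ Poly T ×ˢ J :=
    fun hA t => ⟨hA.ind_mem_poly, t.2⟩
  let P : ∀ {A : Set T}, Proper A → Path (φ (ind A)) (L.pt n) := fun {A} hA =>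
    { toFun := fun t => H (ind A, t)
      continuous_toFun := hH.comp_continuous (by fun_prop) (hp hA)
      source' := by simpa using h0 _ hA.ind_mem_poly
      target' := by simpa using h1 _ hA.ind_mem_poly }
  let Q : ∀ {A : Set T}, Proper A → Path.Homotopic.Quotient (φ (ind A)) (L.pt n) :=
    fun hA => .mk (P hA)
  refine ⟨fun A => if hA : Proper A then -e.κ n ((V.cls hA).symm.trans (Q hA)) else 0, ?_⟩
  intro A B hA hAB hB
  obtain ⟨pA, pB⟩ := mono_right hA hAB hB
  have hconv : Convex ℝ (edgeSet A B ×ˢ J) := (convex_edgeSet A B).prod (convex_Icc 0 1)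
  have hHc : ContinuousOn H (edgeSet A B ×ˢ J) :=
    hH.mono (prod_mono (edgeSet_subset_poly hA hB) subset_rfl)
  have mA : ∀ t ∈ J, (ind A, t) ∈ edgeSet A B ×ˢ J := fun t ht =>
    ⟨ind_mem_edgeSet subset_rfl hAB, ht⟩
  have mB : ∀ t ∈ J, (ind B, t) ∈ edgeSet A B ×ˢ J := fun t ht =>
    ⟨ind_mem_edgeSet hAB subset_rfl, ht⟩
  have mAB : ∀ t ∈ J, (1 - t) • ind A + t • ind B ∈ edgeSet A B := fun t ht =>
    convex_edgeSet A B (ind_mem_edgeSet subset_rfl hAB)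
      (ind_mem_edgeSet hAB subset_rfl) (sub_nonneg.2 ht.2) ht.1 (by ring)
  have l0 : (0 : ℝ) ∈ J := by simp
  have l1 : (1 : ℝ) ∈ J := by simp
  have k1 : (edge hφ hA hAB hB).trans (Q pB) = Q pA := by
    have e1 : edge hφ hA hAB hB = qline hconv hHc (mA 0 l0) (mB 0 l0) (h0 _ pA.ind_mem_poly)
        (h0 _ pB.ind_mem_poly) := by
      refine mk_eq_qline hconv hHc _ _ _ _ _ (r := fun t => ((1 - t) • ind A + t • ind B, 0))
        (by fun_prop) (fun t ht => ⟨mAB t ht, l0⟩) (fun t => ?_) (by simp) (by simp)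
      exact (h0 _ (edgeSet_subset_poly hA hB (mAB t t.2))).symm
    have e2 : Q pB = qline hconv hHc (mB 0 l0) (mB 1 l1) (h0 _ pB.ind_mem_poly)
        (h1 _ pB.ind_mem_poly) :=
      mk_eq_qline hconv hHc _ _ _ _ _ (r := fun t => (ind B, t))
        (by fun_prop) mB (fun t => rfl) rfl rfl
    have e3 : Q pA = qline hconv hHc (mA 0 l0) (mA 1 l1) (h0 _ pA.ind_mem_poly)
        (h1 _ pA.ind_mem_poly) :=
      mk_eq_qline hconv hHc _ _ _ _ _ (r := fun t => (ind A, t))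
        (by fun_prop) mA (fun t => rfl) rfl rfl
    have e4 : Path.Homotopic.Quotient.refl (L.pt n) = qline hconv hHc (mA 1 l1) (mB 1 l1)
        (h1 _ pA.ind_mem_poly) (h1 _ pB.ind_mem_poly) := by
      refine mk_eq_qline hconv hHc _ _ _ _ (Path.refl _)
        (r := fun t => ((1 - t) • ind A + t • ind B, 1))
        (by fun_prop) (fun t ht => ⟨mAB t ht, l1⟩) (fun t => ?_) (by simp) (by simp)
      exact (h1 _ (edgeSet_subset_poly hA hB (mAB t t.2))).symm
    rw [← Quotient.trans_refl (Q pA), e1, e2, e3, e4, qline_trans, qline_trans]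
  have k2 : e.κ n ((V.cls pA).symm.trans (Q pA)) =
      V.coc e hφ A B + e.κ n ((V.cls pB).symm.trans (Q pB)) := by
    rw [V.coc_eq e hφ hA hAB hB, ← e.κ_trans, ← k1]
    congr 1
    simp only [Quotient.trans_assoc]
    congr 2
    rw [← Quotient.trans_assoc, Quotient.trans_symm,
      Quotient.refl_trans]
  simp only [dif_pos pA, dif_pos pB, k2]
  abel

lemma Proper.eq_of_subset (hT : Nat.card T ≤ 2) {A B : Set T} (hA : Proper A) (hB : Proper B)
    (h : A ⊆ B) : A = B := by
  refine Set.eq_of_subset_of_ncard_le h ?_ (toFinite _)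
  have h1 := (Set.ncard_pos (toFinite A)).2 hA.1
  have h2 := Set.ncard_lt_card hB.2
  omega

include e in
lemma exists_eqNull [Finite Γ] (hM : NoTorsion M)
    (hφ : ContinuousOn φ (Poly T))
    (hφ' : ∀ (g : Γ), ∀ y ∈ Poly T, φ (shift g y) = g • φ y)
    (hT : Nat.card T = 2 ∨ 4 ≤ Nat.card T ∨ (3 ≤ Nat.card T ∧
      ∃ (n' : ℕ) (h : n ≤ n') (H : Cyl(T) → L.obj n'), ContinuousOn H (Poly T ×ˢ J) ∧
        (∀ y ∈ Poly T, H (y, 0) = L.map h (φ y)) ∧ ∀ y ∈ Poly T, H (y, 1) = L.pt n')) :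
    ∃ (n' : ℕ) (h : n ≤ n') (H : Cyl(T) → L.obj n'), ContinuousOn H (Poly T ×ˢ J) ∧
      (∀ (g : Γ), ∀ y ∈ Poly T, ∀ t ∈ J, H (shift g y, t) = g • H (y, t)) ∧
      (∀ y ∈ Poly T, H (y, 0) = L.map h (φ y)) ∧ ∀ y ∈ Poly T, H (y, 1) = L.pt n' := by
  refine eqNull_of_potential e hφ hφ' fun n₁ hn₁ hc V => ?_
  have hinv : 3 ≤ Nat.card T → ∀ ψ : Set T → M, IsPotential (V.coc e hc) ψ → ∃ ψ : Set T → M,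
        IsPotential (V.coc e hc) ψ ∧ ∀ (g : Γ) A, Proper A → ψ (shiftSet g A) = ψ A := by
    intro h3 ψ hψ
    refine ⟨ψ, hψ, fun g A hA => hψ.invariant h3 hM (fun g A B hA hAB hB => ?_) g hA.1 hA.2⟩
    exact V.coc_shift e hc (fun g y hy => by rw [hφ' g y hy, L.map_smul]) g A B hA hAB hB
  rcases hT with hT | hT | ⟨hT, n₂, hn₂, H, hH, hH0, hH1⟩
  · refine ⟨fun _ => 0, fun A B hA hAB hB => ?_, fun _ _ _ => rfl⟩
    obtain ⟨pA, pB⟩ := VertexPaths.mono_right hA hAB hB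
    obtain rfl := pA.eq_of_subset hT.le pB hAB
    rw [V.coc_self e hc A pA, sub_zero]
  · obtain ⟨ψ, hψ⟩ := exists_potential hT (c := V.coc e hc) fun A B C hA hAB hBC hC =>
      V.coc_add e hc hA hAB hBC hC
    exact hinv (by omega) ψ hψ
  · have h1 := le_max_left n₁ n₂
    have h2 := le_max_right n₁ n₂
    have hmm : ∀ y, L.map (hn₁.trans h1) (φ y) = L.map h1 (L.map hn₁ (φ y)) := fun y =>
      (L.map_map _ _ _).symm
    have hc2 : ContinuousOn (fun y => L.map (hn₁.trans h1) (φ y)) (Poly T) :=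
      (L.map _).continuous.comp_continuousOn hφ
    obtain ⟨ψ, hψ⟩ := (V.map h1 hmm).exists_potential_of_null e hc2 (H := fun z => L.map h2 (H z))
      ((L.map _).continuous.comp_continuousOn hH)
      (fun y hy => by rw [hH0 y hy, L.map_map]) (fun y hy => by rw [hH1 y hy, L.map_pt])
    refine hinv hT ψ fun A B hA hAB hB => ?_
    rw [hψ A B hA hAB hB, V.coc_map e hc h1 hmm hc2 hA hAB hB]

end

section

variable {Γ : Type w} [Group Γ] {T : Type*} [MulAction Γ T]
  {L : Tower.{v} Γ} {M : Type*} [AddCommGroup M]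

variable (L) in
/-- An equivariant map on `Poly T × [0, 1]`, trivial at one end and constant at the other: a
pointed map on the unreduced suspension of `Poly T`. -/
structure IsPolar {n : ℕ} (f : Cyl(T) → L.obj n) : Prop where
  cont : ContinuousOn f (Poly T ×ˢ J)
  equi : ∀ (g : Γ), ∀ y ∈ Poly T, ∀ b ∈ J, f (shift g y, b) = g • f (y, b)
  one : ∀ y ∈ Poly T, f (y, 1) = L.pt n
  zero : ∀ y ∈ Poly T, ∀ y' ∈ Poly T, f (y, 0) = f (y', 0)

variable (L) in
/-- A homotopy through maps as in `IsPolar`, equivariant for a subgroup. -/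
structure IsPolarHtpy (K : Subgroup Γ) {n : ℕ} (H : Cyl(T) × ℝ → L.obj n) (f f' : Cyl(T) → L.obj n) :
    Prop where
  cont : ContinuousOn H ((Poly T ×ˢ J) ×ˢ J)
  equi : ∀ g ∈ K, ∀ y ∈ Poly T, ∀ b ∈ J, ∀ t ∈ J,
    H ((shift g y, b), t) = g • H ((y, b), t)
  left : ∀ y ∈ Poly T, ∀ b ∈ J, H ((y, b), 0) = f (y, b)
  right : ∀ y ∈ Poly T, ∀ b ∈ J, H ((y, b), 1) = f' (y, b)
  one : ∀ y ∈ Poly T, ∀ t ∈ J, H ((y, 1), t) = L.pt n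
  zero : ∀ y ∈ Poly T, ∀ y' ∈ Poly T, ∀ t ∈ J, H ((y, 0), t) = H ((y', 0), t)

lemma IsPolarHtpy.trans
    {f f' f'' : Cyl(T) → L.obj n} (h : IsPolarHtpy L K H f f') (h' : IsPolarHtpy L K H' f' f'') :
    IsPolarHtpy L K (fun z => if z.2 ≤ 1 / 2 then H (z.1, 2 * z.2) else H' (z.1, 2 * z.2 - 1))
      f f'' := by
  have h1 : ∀ t ∈ J, t ≤ 1 / 2 → 2 * t ∈ J := fun t ht h =>
    ⟨by linarith [ht.1], by linarith⟩
  have h2 : ∀ t ∈ J, 1 / 2 ≤ t → 2 * t - 1 ∈ J := fun t ht h =>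
    ⟨by linarith, by linarith [ht.2]⟩
  refine ⟨?_, ?_, ?_, ?_, ?_, ?_⟩
  · refine ContinuousOn.if ?_ ?_ ?_
    · rintro ⟨⟨y, b⟩, t⟩ ⟨hz, ht⟩
      have : t = 1 / 2 :=
        frontier_le_subset_eq (f := fun z : Cyl(T) × ℝ => z.2) continuous_snd
          continuous_const ht
      subst this
      norm_num
      rw [h.right _ hz.1.1 _ hz.1.2, h'.left _ hz.1.1 _ hz.1.2]
    · refine h.cont.comp (by fun_prop) ?_
      rintro z ⟨hz, ht⟩
      have ht : z.2 ≤ 1 / 2 := closure_le_eq continuous_snd continuous_const |>.subset ht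
      exact ⟨hz.1, h1 _ hz.2 ht⟩
    · refine h'.cont.comp (by fun_prop) ?_
      rintro z ⟨hz, ht⟩
      have ht : 1 / 2 ≤ z.2 := by
        have : closure {a : Cyl(T) × ℝ | ¬ a.2 ≤ 1 / 2} ⊆ {a | 1 / 2 ≤ a.2} :=
          closure_minimal (fun a ha => (not_le.1 ha).le) (isClosed_le continuous_const continuous_snd)
        exact this ht
      exact ⟨hz.1, h2 _ hz.2 ht⟩
  · intro g hg y hy b hb t ht
    split_ifs with hc
    · exact h.equi g hg y hy b hb _ (h1 t ht hc)
    · exact h'.equi g hg y hy b hb _ (h2 t ht (not_le.1 hc).le)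
  · intro y hy b hb
    norm_num
    exact h.left y hy b hb
  · intro y hy b hb
    norm_num
    exact h'.right y hy b hb
  · intro y hy t ht
    split_ifs with hc
    · exact h.one y hy _ (h1 t ht hc)
    · exact h'.one y hy _ (h2 t ht (not_le.1 hc).le)
  · intro y hy y' hy' t ht
    split_ifs with hc
    · exact h.zero y hy y' hy' _ (h1 t ht hc)
    · exact h'.zero y hy y' hy' _ (h2 t ht (not_le.1 hc).le)

lemma IsPolarHtpy.map (hn : n ≤ n')
    {f f' : Cyl(T) → L.obj n} (h : IsPolarHtpy L K H f f') :
    IsPolarHtpy L K (fun z => L.map hn (H z)) (fun z => L.map hn (f z)) (fun z => L.map hn (f' z)) where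
  cont := (L.map hn).continuous.comp_continuousOn h.cont
  equi g hg y hy b hb t ht := by rw [h.equi g hg y hy b hb t ht, L.map_smul]
  left y hy b hb := by rw [h.left y hy b hb]
  right y hy b hb := by rw [h.right y hy b hb]
  one y hy t ht := by rw [h.one y hy t ht, L.map_pt]
  zero y hy y' hy' t ht := by rw [h.zero y hy y' hy' t ht]

lemma IsPolarHtpy.symm
    {f f' : Cyl(T) → L.obj n} (h : IsPolarHtpy L K H f f') :
    IsPolarHtpy L K (fun z => H (z.1, 1 - z.2)) f' f := by
  have hm : ∀ t ∈ J, 1 - t ∈ J := fun t ht =>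
    ⟨by linarith [ht.2], by linarith [ht.1]⟩
  refine ⟨h.cont.comp (by fun_prop) fun z hz => ⟨hz.1, hm _ hz.2⟩, ?_, ?_, ?_, ?_, ?_⟩
  · exact fun g hg y hy b hb t ht => h.equi g hg y hy b hb _ (hm t ht)
  · exact fun y hy b hb => by simpa using h.right y hy b hb
  · exact fun y hy b hb => by simpa using h.left y hy b hb
  · exact fun y hy t ht => h.one y hy _ (hm t ht)
  · exact fun y hy y' hy' t ht => h.zero y hy y' hy' _ (hm t ht)

lemma IsPolarHtpy.mono (hK : K' ≤ K) {f f' : Cyl(T) → L.obj n}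
    (h : IsPolarHtpy L K H f f') : IsPolarHtpy L K' H f f' :=
  { h with equi := fun g hg => h.equi g (hK hg) }

lemma IsPolar.map (hn : n ≤ n') {f : Cyl(T) → L.obj n} (h : IsPolar L f) :
    IsPolar L (fun z => L.map hn (f z)) where
  cont := (L.map hn).continuous.comp_continuousOn h.cont
  equi g y hy b hb := by rw [h.equi g y hy b hb, L.map_smul]
  one y hy := by rw [h.one y hy, L.map_pt]
  zero y hy y' hy' := by rw [h.zero y hy y' hy']

variable (L) in
/-- The map becomes null homotopic at some later stage. -/
def PolarNull (K : Subgroup Γ) (f : Cyl(T) → L.obj n) : Prop :=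
  ∃ (n' : ℕ) (h : n ≤ n') (H : Cyl(T) × ℝ → L.obj n'),
    IsPolarHtpy L K H (fun z => L.map h (f z)) fun _ => L.pt n'

lemma PolarNull.of_htpy (h : n ≤ n')
    {f' : Cyl(T) → L.obj n'} {H : Cyl(T) × ℝ → L.obj n'}
    (hH : IsPolarHtpy L K H (fun z => L.map h (f z)) f') (hf' : PolarNull L K f') :
    PolarNull L K f := by
  obtain ⟨n'', h', H', hH'⟩ := hf'
  have := (hH.map h').trans hH'
  simp only [L.map_map] at this
  exact ⟨n'', h.trans h', _, this⟩

variable (L) in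
/-- Invariant points that can be connected to the base point, can be connected to it through
invariant points at a later stage. -/
def FixedConn : Prop := ∀ (n : ℕ) (c : ℝ → L.obj n), Continuous c → L.Fixed ⊤ (c 0) →
  c 1 = L.pt n → ∃ (n' : ℕ) (h : n ≤ n') (c' : ℝ → L.obj n'), Continuous c' ∧
    c' 0 = L.map h (c 0) ∧ c' 1 = L.pt n' ∧ ∀ t, L.Fixed ⊤ (c' t)

lemma Tower.PiTriv.fixedConn (h : L.PiTriv ⊤ 0) : FixedConn L := by
  intro n c hc h0 h1
  obtain ⟨n', hn, N, hN, hN0, hN1, -, hNf⟩ := h n (fun _ => c 0) continuous_const (fun x hx => by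
      rw [Subsingleton.elim x 0, norm_zero] at hx
      exact absurd hx (by norm_num)) (fun _ => h0)
  exact ⟨n', hn, fun t => N (t, 0), by fun_prop, hN0 0, hN1 0, fun t => hNf t 0⟩

lemma IsPolar.exists_loop {f : Cyl(T) → L.obj n} (hf : IsPolar L f)
    (hL : FixedConn L) (hT : (Poly T).Nonempty) :
    ∃ (n' : ℕ) (h : n ≤ n') (H : Cyl(T) × ℝ → L.obj n') (f' : Cyl(T) → L.obj n'),
      IsPolarHtpy L ⊤ H (fun z => L.map h (f z)) f' ∧ IsPolar L f' ∧
      ∀ y ∈ Poly T, f' (y, 0) = L.pt n' := by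
  obtain ⟨y₀, hy₀⟩ := hT
  obtain ⟨n', h, c, hc, hc0, hc1, hcf⟩ := hL n (fun t => f (y₀, projIcc (0 : ℝ) 1 zero_le_one t))
    (hf.cont.comp_continuous (by fun_prop) fun t => ⟨hy₀, (projIcc (0 : ℝ) 1 zero_le_one t).2⟩)
    (fun g _ => by
      simp only [projIcc_left]
      rw [← hf.equi g y₀ hy₀ 0 (by simp), hf.zero _ (shift_mem_poly g hy₀) _ hy₀])
    (by simpa using hf.one y₀ hy₀)
  simp only [projIcc_left] at hc0
  let k : Cyl(T) → L.obj n' := fun z => if z.2 ≤ 0 then c (-z.2) else L.map h (f z)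
  have hk0 : ∀ y, ∀ b ≤ 0, k (y, b) = c (-b) := fun y b hb => if_pos hb
  have hk1 : ∀ y ∈ Poly T, ∀ b ≥ 0, k (y, b) = L.map h (f (y, b)) := fun y hy b hb => by
    rcases hb.lt_or_eq with hb | rfl
    · exact if_neg (not_le.2 hb)
    · rw [hk0 _ _ le_rfl, neg_zero, hc0, hf.zero y hy y₀ hy₀]
  have hkc : ContinuousOn k (Poly T ×ˢ Icc (-1) 1) := by
    refine ContinuousOn.if ?_ ?_ ?_
    · rintro ⟨y, b⟩ ⟨hz, ht⟩
      have : b = 0 := frontier_le_subset_eq (f := fun z : Cyl(T) => z.2) continuous_snd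
          continuous_const ht
      subst this
      simp only [neg_zero]
      rw [hc0, hf.zero y hz.1 y₀ hy₀]
    · exact (hc.comp (by fun_prop)).continuousOn
    · refine (L.map h).continuous.comp_continuousOn (hf.cont.mono ?_)
      rintro z ⟨hz, ht⟩
      have : closure {a : Cyl(T) | ¬ a.2 ≤ 0} ⊆ {a | 0 ≤ a.2} :=
          closure_minimal (fun a ha => (not_le.1 ha).le) (isClosed_le continuous_const continuous_snd)
      exact ⟨hz.1, this ht, hz.2.2⟩
  have hke : ∀ (g : Γ), ∀ y ∈ Poly T, ∀ b ∈ Icc (-1 : ℝ) 1, k (shift g y, b) = g • k (y, b) := by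
    intro g y hy b hb
    rcases le_total b 0 with h0 | h0
    · rw [hk0 _ _ h0, hk0 _ _ h0, hcf _ g (Subgroup.mem_top g)]
    · rw [hk1 _ (shift_mem_poly g hy) _ h0, hk1 _ hy _ h0, hf.equi g y hy b ⟨h0, hb.2⟩, L.map_smul]
  have hm : ∀ b ∈ J, ∀ s ∈ J, b * (1 + s) - s ∈ Icc (-1 : ℝ) 1 := by
    intro b hb s hs
    constructor
    · nlinarith [hb.1, hs.1, hs.2]
    · nlinarith [hb.2, hs.1]
  refine ⟨n', h, fun z => k (z.1.1, z.1.2 * (1 + z.2) - z.2), fun z => k (z.1, z.2 * (1 + 1) - 1),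
    ⟨?_, ?_, ?_, ?_, ?_, ?_⟩, ⟨?_, ?_, ?_, ?_⟩, ?_⟩
  · exact hkc.comp (by fun_prop) fun z hz => ⟨hz.1.1, hm _ hz.1.2 _ hz.2⟩
  · exact fun g _ y hy b hb t ht => hke g y hy _ (hm b hb t ht)
  · intro y hy b hb
    simpa using hk1 y hy b hb.1
  · intro y hy b hb
    rfl
  · intro y hy t ht
    simp only [one_mul, add_sub_cancel_right]
    rw [hk1 y hy 1 zero_le_one, hf.one y hy, L.map_pt]
  · intro y hy y' hy' t ht
    rw [hk0 _ _ (by linarith [ht.1]), hk0 _ _ (by linarith [ht.1])]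
  · exact hkc.comp (by fun_prop) fun z hz => ⟨hz.1, hm _ hz.2 1 (by simp)⟩
  · exact fun g y hy b hb => hke g y hy _ (hm b hb 1 (by simp))
  · intro y hy
    simp only [one_mul, add_sub_cancel_right]
    rw [hk1 y hy 1 zero_le_one, hf.one y hy, L.map_pt]
  · intro y hy y' hy'
    rw [hk0 _ _ (by norm_num), hk0 _ _ (by norm_num)]
  · intro y hy
    simp only [zero_mul, zero_sub]
    rw [hk0 _ _ (by norm_num), neg_neg, hc1]

lemma polarNull_const {ℓ : ℝ → L.obj n} (hℓ : Continuous ℓ) (h1 : ℓ 1 = L.pt n)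
    (hf : ∀ t, L.Fixed ⊤ (ℓ t)) : PolarNull L ⊤ (fun z : Cyl(T) => ℓ z.2) := by
  refine ⟨n, le_rfl, fun z => ℓ (max z.1.2 z.2), ⟨?_, ?_, ?_, ?_, ?_, ?_⟩⟩
  · fun_prop
  · exact fun g _ y _ b _ t _ => (hf _ g (Subgroup.mem_top g)).symm
  · exact fun y _ b hb => by simp only [max_eq_left hb.1, L.map_refl]
  · exact fun y _ b hb => by simp only [max_eq_right hb.2, h1]
  · exact fun y _ t ht => by simp only [max_eq_left ht.2, h1]
  · exact fun y _ y' _ t _ => rfl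

/-- The boundary values of a homotopy from a family of loops to a constant family. -/
def loopHtpyFun (f : Cyl(T) → L.obj n) (ℓ : ℝ → L.obj n)
    (z : Cyl(T) × ℝ) : L.obj n :=
  if z.1.2 ≤ 0 then f (z.1.1, -z.1.2 * z.2) else ℓ (z.1.2 * z.2)

section LoopHtpy

variable [Finite T] {n : ℕ} {f : Cyl(T) → L.obj n} (hf : IsPolar L f)
  (hf0 : ∀ y ∈ Poly T, f (y, 0) = L.pt n) {ℓ : ℝ → L.obj n} (hℓ : Continuous ℓ)
  (h0 : ℓ 0 = L.pt n) (h1 : ℓ 1 = L.pt n) (hℓf : ∀ t, L.Fixed ⊤ (ℓ t))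

include hf hf0 hℓ h0 h1 hℓf

lemma isEqOn_loopHtpyFun : IsEqOn L (skelDom ℝ ∅ 0) (loopHtpyFun f ℓ) := by
  have hmem : ∀ p ∈ closedBall 0 1, p ≤ 0 → ∀ t ∈ J, -p * t ∈ J := by
    intro p hp hp0 t ht
    rw [mem_closedBall_zero_iff, Real.norm_eq_abs, abs_le] at hp
    exact ⟨mul_nonneg (by linarith) ht.1, mul_le_one₀ (by linarith [hp.1]) ht.1 ht.2⟩
  have hbd : ∀ z ∈ skelDom (T := T) ℝ ∅ 0, ‖z.1.2‖ = 1 ∨ z.2 = 0 := by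
    rintro z ⟨⟨-, ⟨s, hs⟩, ⟨t, ht⟩⟩, -, -, h | h | h⟩
    · exact h.elim
    · refine absurd ⟨![s, t], fun i j hij => ?_⟩ h
      fin_cases i <;> fin_cases j <;> simp_all
    · exact h
  refine ⟨?_, ?_, ?_⟩
  · refine ContinuousOn.if ?_ ?_ ?_
    · rintro ⟨⟨y, p⟩, t⟩ ⟨hz, ht⟩
      have : p = 0 := frontier_le_subset_eq (f := fun z : Cyl(T) × ℝ => z.1.2)
        (by fun_prop) continuous_const ht
      subst this
      simp only [neg_zero, zero_mul, h0, hf0 y hz.1]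
    · refine hf.cont.comp (by fun_prop) ?_
      rintro z ⟨hz, ht⟩
      have ht : z.1.2 ≤ 0 := closure_le_eq (f := fun z : Cyl(T) × ℝ => z.1.2) (by fun_prop)
        continuous_const |>.subset ht
      exact ⟨hz.1, hmem _ hz.2.1 ht _ hz.2.2.1⟩
    · exact (hℓ.comp (by fun_prop)).continuousOn
  · intro g z hz
    simp only [loopHtpyFun]
    split_ifs with h
    · exact hf.equi g _ hz.1 _ (hmem _ hz.2.1 h _ hz.2.2.1)
    · exact (hℓf _ g (Subgroup.mem_top g)).symm
  · intro z hz ht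
    have := (hbd z hz).resolve_right (by rw [ht]; exact one_ne_zero)
    rw [Real.norm_eq_abs] at this
    simp only [loopHtpyFun, ht, mul_one]
    rcases eq_or_eq_neg_of_abs_eq this with h | h <;> rw [h]
    · norm_num [h1]
    · norm_num [hf.one _ hz.1]

lemma exists_polarHtpy_loop (hL : ∀ (H : Subgroup Γ) (j : ℕ), 2 ≤ j → L.PiTriv H j)
    (hfill : ∀ w : T → Fin 2, Function.Surjective w →
      L.Fillable (cellStab Γ w) (ordSimplex 0 ×ˢ closedBall (0 : ℝ) 1)
        (frontier (ordSimplex 0 ×ˢ closedBall (0 : ℝ) 1))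
        (fun z => loopHtpyFun f ℓ ((vhat z.1.1 ∘ w, z.1.2), z.2))) :
    ∃ (n' : ℕ) (h : n ≤ n') (H : Cyl(T) × ℝ → L.obj n'),
      IsPolarHtpy L ⊤ H (fun z => L.map h (f z)) (fun z => L.map h (ℓ z.2)) := by
  have hh := isEqOn_loopHtpyFun hf hf0 hℓ h0 h1 hℓf
  obtain ⟨n₁, hn₁, g₁, hg₁, hext₁⟩ := exists_extend_step isSubcomplex_empty hh
    fun w hw _ => hfill w hw
  obtain ⟨n₂, hn₂, g₂, hg₂, hext₂⟩ := exists_extend isSubcomplex_empty hg₁ fun k hk w hw _ =>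
    hL _ _ (by rw [Module.finrank_self]; omega)
  have hm : ∀ y ∈ Poly T, ∀ b ∈ J, ∀ t ∈ J,
      ((y, 2 * t - 1), b) ∈ skelDom (T := T) ℝ univ 0 := fun y hy b hb t ht =>
    ⟨hy, by rw [mem_closedBall_zero_iff, Real.norm_eq_abs, abs_le]; constructor <;> linarith [ht.1, ht.2],
      hb, Or.inl trivial⟩
  have hbdy : ∀ {k : ℕ}, ∀ y ∈ Poly T, ∀ b ∈ J, ∀ p ∈ Icc (-1 : ℝ) 1,
      ‖p‖ = 1 ∨ b = 0 → ((y, p), b) ∈ skelDom (T := T) ℝ ∅ k := fun y hy b hb p hp h =>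
    ⟨hy, by rw [mem_closedBall_zero_iff, Real.norm_eq_abs, abs_le]; exact hp, hb,
      Or.inr (.inr h)⟩
  have hval : ∀ y ∈ Poly T, ∀ b ∈ J, ∀ p ∈ Icc (-1 : ℝ) 1,
      ‖p‖ = 1 ∨ b = 0 → g₂ ((y, p), b) = L.map (hn₁.trans hn₂) (loopHtpyFun f ℓ ((y, p), b)) := by
    intro y hy b hb p hp h
    rw [hext₂ _ (hbdy y hy b hb p hp h), hext₁ _ (hbdy y hy b hb p hp h), L.map_map]
  refine ⟨n₂, hn₁.trans hn₂, fun z => g₂ ((z.1.1, 2 * z.2 - 1), z.1.2), ⟨?_, ?_, ?_, ?_, ?_, ?_⟩⟩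
  · exact hg₂.cont.comp (by fun_prop) fun z hz => hm _ hz.1.1 _ hz.1.2 _ hz.2
  · exact fun g _ y hy b hb t ht => hg₂.equi g _ (hm y hy b hb t ht)
  · intro y hy b hb
    rw [hval y hy b hb _ (by norm_num) (by norm_num)]
    simp [loopHtpyFun]
  · intro y hy b hb
    rw [hval y hy b hb _ (by norm_num) (by norm_num)]
    simp only [loopHtpyFun]
    norm_num
  · intro y hy t ht
    exact hg₂.one _ (hm y hy 1 (by simp) t ht) rfl
  · have : ∀ y ∈ Poly T, ∀ t ∈ J, g₂ ((y, 2 * t - 1), 0) = L.pt n₂ := by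
      intro y hy t ht
      rw [hval y hy 0 (by simp) _ ⟨by linarith [ht.1], by linarith [ht.2]⟩ (.inr rfl)]
      simp only [loopHtpyFun, mul_zero]
      split_ifs
      · rw [hf0 y hy, L.map_pt]
      · rw [h0, L.map_pt]
    intro y hy y' hy' t ht
    simp only [this y hy t ht, this y' hy' t ht]

end LoopHtpy

lemma IsPolar.null_zero [Finite T] {f : Cyl(T) → L.obj n} (hf : IsPolar L f)
    (hT : (Poly T).Nonempty) (hL : FixedConn L)
    (hpi : ∀ (H : Subgroup Γ) (j : ℕ), 1 ≤ j → L.PiTriv H j) : PolarNull L ⊤ f := by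
  obtain ⟨n₁, hn₁, H₁, f₁, hH₁, hf₁, hf₁0⟩ := hf.exists_loop hL hT
  refine PolarNull.of_htpy hn₁ hH₁ ?_
  obtain ⟨n₂, hn₂, H₂, hH₂⟩ := exists_polarHtpy_loop hf₁ hf₁0
    continuous_const rfl rfl (fun _ => L.fixed_pt _ _) (fun H j hj => hpi H j (by omega))
    fun w hw => fillable_of_piTriv (isEqOn_loopHtpyFun hf₁ hf₁0 continuous_const rfl rfl
      fun _ => L.fixed_pt _ _) hw (hpi _ _ (by rw [Module.finrank_self]))
  refine PolarNull.of_htpy hn₂ hH₂ (polarNull_const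
    continuous_const (L.map_pt _) fun _ => (L.fixed_pt _ _).map _)

end

section

variable {Γ : Type w} [Group Γ] {T : Type*} [MulAction Γ T] [Finite T]
  {L : Tower.{v} Γ} {M : Type*} [AddCommGroup M] (e : L.EM1 M)

/-- The loops at the vertices given by a family of loops. -/
def vertexLoop {f : Cyl(T) → L.obj n} (hf : IsPolar L f)
    (hf0 : ∀ y ∈ Poly T, f (y, 0) = L.pt n) {A : Set T} (hA : Proper A) :
    Path (L.pt n) (L.pt n) where
  toFun t := f (ind A, t)
  continuous_toFun := hf.cont.comp_continuous (by fun_prop) fun t => ⟨hA.ind_mem_poly, t.2⟩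
  source' := hf0 _ hA.ind_mem_poly
  target' := hf.one _ hA.ind_mem_poly

lemma vertexLoop_eq_of_subset {f : Cyl(T) → L.obj n} (hf : IsPolar L f)
    (hf0 : ∀ y ∈ Poly T, f (y, 0) = L.pt n) {A B : Set T} (hA : Proper A) (hB : Proper B)
    (hAB : A ⊆ B) : Path.Homotopic.Quotient.mk (vertexLoop hf hf0 hA) =
      Path.Homotopic.Quotient.mk (vertexLoop hf hf0 hB) := by
  have hconv : Convex ℝ (edgeSet A B ×ˢ J) := (convex_edgeSet A B).prod (convex_Icc 0 1)
  have hsub := edgeSet_subset_poly hA.1 hB.2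
  have hHc : ContinuousOn f (edgeSet A B ×ˢ J) := hf.cont.mono (prod_mono hsub subset_rfl)
  have mA : ∀ t ∈ J, (ind A, t) ∈ edgeSet A B ×ˢ J := fun t ht =>
    ⟨ind_mem_edgeSet subset_rfl hAB, ht⟩
  have mB : ∀ t ∈ J, (ind B, t) ∈ edgeSet A B ×ˢ J := fun t ht =>
    ⟨ind_mem_edgeSet hAB subset_rfl, ht⟩
  have mAB : ∀ t ∈ J, (1 - t) • ind A + t • ind B ∈ edgeSet A B := fun t ht =>
    convex_edgeSet A B (ind_mem_edgeSet subset_rfl hAB)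
      (ind_mem_edgeSet hAB subset_rfl) (sub_nonneg.2 ht.2) ht.1 (by ring)
  have l0 : (0 : ℝ) ∈ J := by simp
  have l1 : (1 : ℝ) ∈ J := by simp
  have e1 : Path.Homotopic.Quotient.refl (L.pt n) = qline hconv hHc (mA 0 l0) (mB 0 l0)
      (hf0 _ hA.ind_mem_poly) (hf0 _ hB.ind_mem_poly) :=
    mk_eq_qline hconv hHc _ _ _ _ (Path.refl _) (r := fun t => ((1 - t) • ind A + t • ind B, 0))
      (by fun_prop) (fun t ht => ⟨mAB t ht, l0⟩) (fun t => (hf0 _ (hsub (mAB t t.2))).symm)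
      (by simp) (by simp)
  have e2 : Path.Homotopic.Quotient.mk (vertexLoop hf hf0 hB) = qline hconv hHc (mB 0 l0)
      (mB 1 l1) (hf0 _ hB.ind_mem_poly) (hf.one _ hB.ind_mem_poly) :=
    mk_eq_qline hconv hHc _ _ _ _ _ (r := fun t => (ind B, t)) (by fun_prop) mB (fun t => rfl) rfl rfl
  have e3 : Path.Homotopic.Quotient.mk (vertexLoop hf hf0 hA) = qline hconv hHc (mA 0 l0)
      (mA 1 l1) (hf0 _ hA.ind_mem_poly) (hf.one _ hA.ind_mem_poly) :=
    mk_eq_qline hconv hHc _ _ _ _ _ (r := fun t => (ind A, t)) (by fun_prop) mA (fun t => rfl) rfl rfl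
  have e4 : Path.Homotopic.Quotient.refl (L.pt n) = qline hconv hHc (mA 1 l1) (mB 1 l1)
      (hf.one _ hA.ind_mem_poly) (hf.one _ hB.ind_mem_poly) :=
    mk_eq_qline hconv hHc _ _ _ _ (Path.refl _) (r := fun t => ((1 - t) • ind A + t • ind B, 1))
      (by fun_prop) (fun t ht => ⟨mAB t ht, l1⟩) (fun t => (hf.one _ (hsub (mAB t t.2))).symm)
      (by simp) (by simp)
  have h1 : (Path.Homotopic.Quotient.refl (L.pt n)).trans
      (Path.Homotopic.Quotient.mk (vertexLoop hf hf0 hB)) =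
      (Path.Homotopic.Quotient.mk (vertexLoop hf hf0 hA)).trans
        (Path.Homotopic.Quotient.refl (L.pt n)) := by
    nth_rewrite 1 [e1]
    rw [e4, e2, e3, qline_trans, qline_trans]
  rwa [Quotient.refl_trans, Quotient.trans_refl, eq_comm] at h1

include e in
lemma fillable_loopHtpyFun {f : Cyl(T) → L.obj n} (hf : IsPolar L f)
    (hf0 : ∀ y ∈ Poly T, f (y, 0) = L.pt n) {ℓ : ℝ → L.obj n} (hℓ : Continuous ℓ)
    (h0 : ℓ 0 = L.pt n) (h1 : ℓ 1 = L.pt n) (hℓf : ∀ t, L.Fixed ⊤ (ℓ t)) {m : M}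
    (hm : e.κ n (qseg ℓ hℓ 0 1 h0 h1) = m)
    (hfm : ∀ A (hA : Proper A), e.κ n (.mk (vertexLoop hf hf0 hA)) = m)
    (w : T → Fin 2) (hw : Function.Surjective w) :
    L.Fillable (cellStab Γ w) (ordSimplex 0 ×ˢ closedBall (0 : ℝ) 1)
        (frontier (ordSimplex 0 ×ˢ closedBall (0 : ℝ) 1))
        (fun z => loopHtpyFun f ℓ ((vhat z.1.1 ∘ w, z.1.2), z.2)) := by
  have hh := isEqOn_loopHtpyFun hf hf0 hℓ h0 h1 hℓf
  have hA : Proper {t | w t = 1} := by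
    obtain ⟨s, hs⟩ := hw 1
    obtain ⟨t, ht⟩ := hw 0
    exact ⟨⟨s, hs⟩, (ne_univ_iff_exists_notMem _).2 ⟨t, by simp [ht]⟩⟩
  have hv : ∀ v : Fin 0 → ℝ, vhat v ∘ w = ind {t | w t = 1} := fun v => by
    funext t
    have h3 : ∀ i : Fin 2, i = 0 ∨ i = 1 := by decide
    have e1 : vhat v (1 : Fin 2) = 1 := rfl
    rcases h3 (w t) with h | h
    · simp [h, ind]
    · simp [h, ind, e1]
  have hcup : ∀ z ∈ Tower.cup (closedBall 0 1) (sphere 0 1),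
      ((ind {t | w t = 1}, z.1), z.2) ∈ skelDom ℝ ∅ 0 := by
    rintro ⟨s, t⟩ ⟨h1, h2, h3⟩
    exact ⟨hA.ind_mem_poly, h1, h2, .inr (.inr (h3.imp (fun h => by simpa using h) id))⟩
  refine Tower.Fillable.transport (C' := closedBall 0 1) (B' := sphere 0 1)
    (fun s => (0, s)) (fun z => z.2) ?_ (Continuous.continuousOn (by fun_prop))
    (fun z hz => hz.2) ?_ (fun z _ => Prod.ext (Subsingleton.elim _ _) rfl)
  rotate_left
  · rintro ⟨v, p⟩ - hz
    rw [frontier_prod_eq, isClosed_closedBall.closure_eq, isClosed_ordSimplex.closure_eq,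
      frontier_closedBall _ one_ne_zero] at hz
    rcases hz with ⟨-, hz⟩ | ⟨hz, -⟩
    · exact hz
    · obtain ⟨-, hi⟩ := mem_frontier_ordSimplex.1 hz
      refine absurd (fun i j hij => ?_) hi
      fin_cases i <;> fin_cases j <;> simp_all
  simp only [hv]
  refine Tower.fillable_ball _ _ (e.evNull_cup (g := fun z =>
    loopHtpyFun f ℓ ((ind {t | w t = 1}, z.1), z.2)) ?_ ?_ ?_
    (vertexLoop hf hf0 hA) (Path.refl _) ⟨⟨fun t => ℓ t, by fun_prop⟩, by simpa using h0,
      by simpa using h1⟩ ?_ ?_ ?_ ?_)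
  · exact hh.cont.comp (by fun_prop) hcup
  · intro x hx
    exact hh.one _ (hcup (x, 1) ⟨by simp [hx], by simp, .inl (by simp [hx])⟩) rfl
  · intro z hz g hg
    have := hh.equi g _ (hcup z hz)
    rw [← this]
    rw [← hv 0, shift_comp, mem_cellStab.1 hg]
  · intro t
    norm_num [loopHtpyFun]
    rfl
  · intro t
    norm_num [loopHtpyFun]
  · intro t
    simp only [loopHtpyFun, mul_zero, Path.refl_apply]
    split_ifs
    · exact hf0 _ hA.ind_mem_poly
    · exact h0
  · rw [e.κ_trans, e.κ_symm, e.κ_trans, hfm, Quotient.mk_refl, e.κ_refl, zero_add]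
    rw [neg_add_eq_zero, ← hm]
    unfold qseg
    congr 2
    ext t
    simp

include e in
lemma IsPolar.null_one {f : Cyl(T) → L.obj n} (hf : IsPolar L f)
    (hT : 3 ≤ Nat.card T ∨ (Nat.card T = 2 ∧ MulAction.IsPretransitive Γ T)) : PolarNull L ⊤ f := by
  classical
  have : Nontrivial T := Finite.one_lt_card_iff_nontrivial.1 (by omega)
  obtain ⟨a, b, hab⟩ := exists_pair_ne T
  have ha : Proper ({a} : Set T) := ⟨⟨a, rfl⟩, (ne_univ_iff_exists_notMem _).2 ⟨b, by simpa using hab.symm⟩⟩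
  obtain ⟨n₁, hn₁, H₁, f₁, hH₁, hf₁, hf₁0⟩ := hf.exists_loop (e.piTriv _ _ zero_ne_one).fixedConn
    ⟨_, ha.ind_mem_poly⟩
  refine PolarNull.of_htpy hn₁ hH₁ ?_
  obtain ⟨n₂, u, hu, hu0, hu1, huf, huκ⟩ := e.surj (e.κ n₁ (.mk (vertexLoop hf₁ hf₁0 ha)))
  have h1 := le_max_left n₁ n₂
  have h2 := le_max_right n₁ n₂
  have hf₂ := hf₁.map h1
  have hf₂0 : ∀ y ∈ Poly T, L.map h1 (f₁ (y, 0)) = L.pt (max n₁ n₂) := fun y hy => by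
    rw [hf₁0 y hy, L.map_pt]
  have hconst : ∀ A (hA : Proper A), e.κ n₁ (.mk (vertexLoop hf₁ hf₁0 hA)) =
      e.κ n₁ (.mk (vertexLoop hf₁ hf₁0 ha)) := by
    intro A hA
    rcases hT with hT | ⟨hT, htr⟩
    · have := eq_of_subset_invariant hT
        (fun A => if hA : Proper A then e.κ n₁ (.mk (vertexLoop hf₁ hf₁0 hA)) else 0)
        (fun A B hA hAB hB => by
          obtain ⟨pA, pB⟩ := VertexPaths.mono_right hA hAB hB
          simp only [dif_pos pA, dif_pos pB, vertexLoop_eq_of_subset hf₁ hf₁0 pA pB hAB])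
        hA.1 hA.2 ha.1 ha.2
      simpa only [dif_pos hA, dif_pos ha] using this
    · obtain ⟨x, hx⟩ := hA.1
      obtain ⟨g, hg⟩ := MulAction.exists_smul_eq Γ a x
      have hxA : shiftSet g {a} = A := by
        refine (ha.shift g).eq_of_subset hT.le hA fun t ht => ?_
        have : t = x := by
          rw [← hg]
          simp only [shiftSet] at ht
          rw [← show g⁻¹ • t = a from ht, smul_inv_smul]
        rwa [this]
      subst hxA
      exact e.κ_smul _ g _ _ fun t => hf₁.equi g _ ha.ind_mem_poly t t.2
  have hκ₂ : ∀ A (hA : Proper A), e.κ _ (.mk (vertexLoop hf₂ hf₂0 hA)) =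
      e.κ n₁ (.mk (vertexLoop hf₁ hf₁0 ha)) := fun A hA =>
    (e.κ_map h1 _ _ fun t => rfl).trans (hconst A hA)
  have hℓ : Continuous fun t => L.map h2 (u t) := (L.map h2).continuous.comp hu
  have hℓ0 : L.map h2 (u 0) = L.pt _ := by rw [hu0, L.map_pt]
  have hℓ1 : L.map h2 (u 1) = L.pt _ := by rw [hu1, L.map_pt]
  have hℓf : ∀ t, L.Fixed ⊤ (L.map h2 (u t)) := fun t => (huf t).map _
  obtain ⟨n₃, hn₃, H₃, hH₃⟩ := exists_polarHtpy_loop hf₂ hf₂0 hℓ hℓ0 hℓ1 hℓf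
    (fun H j hj => e.piTriv H j (by omega)) fun w hw =>
      fillable_loopHtpyFun e hf₂ hf₂0 hℓ hℓ0 hℓ1 hℓf
        ((e.κ_qseg_map h2 hu hℓ hu0 hu1 hℓ0 hℓ1 fun x => rfl).trans huκ) hκ₂ w hw
  simp only [L.map_map] at hH₃
  refine PolarNull.of_htpy (h1.trans hn₃) hH₃ (polarNull_const ((L.map _).continuous.comp hu)
    (by rw [Function.comp_apply, hu1, L.map_pt]) fun t => (huf t).map _)

end

section

variable {Γ : Type w} [Group Γ]

/-- The loops at the base point in a stage of a tower. -/
def Tower.Loop (L : Tower.{v} Γ) (n : ℕ) : Type v :=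
  {γ : C(I, L.obj n) // γ 0 = L.pt n ∧ γ 1 = L.pt n}

namespace Tower.Loop

variable {L : Tower.{v} Γ} {n : ℕ}

instance : TopologicalSpace (L.Loop n) := inferInstanceAs (TopologicalSpace (Subtype _))

instance : FunLike (L.Loop n) I (L.obj n) where
  coe γ := γ.1
  coe_injective _ _ h := Subtype.ext (DFunLike.coe_injective h)

instance : ContinuousEval (L.Loop n) I (L.obj n) where
  continuous_eval := (continuous_eval (F := C(I, L.obj n))).comp
    (continuous_subtype_val.prodMap continuous_id)

lemma zero (γ : L.Loop n) : γ 0 = L.pt n := γ.2.1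

lemma one (γ : L.Loop n) : γ 1 = L.pt n := γ.2.2

instance : MulAction Γ (L.Loop n) where
  smul g γ := ⟨⟨fun t => g • γ t, (continuous_const_smul g).comp γ.1.continuous⟩,
    by change g • γ 0 = _; rw [γ.zero, L.smul_pt], by change g • γ 1 = _; rw [γ.one, L.smul_pt]⟩
  one_smul γ := DFunLike.ext _ _ fun t => one_smul Γ (γ t)
  mul_smul g h γ := DFunLike.ext _ _ fun t => mul_smul g h (γ t)

lemma smul_apply (g : Γ) (γ : L.Loop n) (t : I) : (g • γ) t = g • γ t := rfl

lemma continuous_of_uncurry {X : Type*} [TopologicalSpace X] {f : X → L.Loop n}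
    (hf : Continuous fun z : X × I => f z.1 z.2) : Continuous f :=
  Continuous.subtype_mk
    (ContinuousMap.continuous_of_continuous_uncurry _ hf) _

instance : ContinuousConstSMul Γ (L.Loop n) where
  continuous_const_smul g := continuous_of_uncurry
    ((continuous_const_smul g).comp (continuous_eval (F := L.Loop n)))

end Tower.Loop

/-- The tower of loop spaces. -/
abbrev Tower.loops (L : Tower.{v} Γ) : Tower.{v} Γ where
  obj n := L.Loop n
  pt n := ⟨ContinuousMap.const _ (L.pt n), rfl, rfl⟩
  smul_pt n g := Subtype.ext (ContinuousMap.ext fun _ => L.smul_pt n g)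
  step n := ⟨fun γ => ⟨(L.step n).comp γ.1, by simp [γ.2.1, L.step_pt], by simp [γ.2.2, L.step_pt]⟩,
    Loop.continuous_of_uncurry ((L.step n).continuous.comp (continuous_eval (F := L.Loop n)))⟩
  step_pt n := Subtype.ext (ContinuousMap.ext fun _ => L.step_pt n)
  step_smul n g γ := Subtype.ext (ContinuousMap.ext fun t => L.step_smul n g (γ.1 t))

variable {L : Tower.{v} Γ}

lemma loops_map_apply (h : n ≤ n') (γ : L.loops.obj n) (t : I) :
    DFunLike.coe (F := L.Loop n') (L.loops.map h γ) t =
      L.map h (DFunLike.coe (F := L.Loop n) γ t) := by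
  induction n', h using Nat.le_induction with
  | base => rw [L.map_refl, L.loops.map_refl]
  | succ k hk ih => rw [L.map_succ hk, ← ih, L.loops.map_succ hk]; rfl

variable {T : Type*} [MulAction Γ T] {M : Type*} [AddCommGroup M]

lemma exists_loopFamily [TopologicalSpace X]
    {G : X × ℝ → L.obj n} (hG : ContinuousOn G (S ×ˢ J)) (h0 : ∀ x ∈ S, G (x, 0) = L.pt n)
    (h1 : ∀ x ∈ S, G (x, 1) = L.pt n) : ∃ F : X → L.Loop n, ContinuousOn F S ∧
      ∀ x ∈ S, ∀ t : I, F x t = G (x, t) := by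
  classical
  let P : ∀ x ∈ S, L.Loop n := fun x hx =>
    ⟨⟨fun t => G (x, t), hG.comp_continuous (by fun_prop) fun t => ⟨hx, t.2⟩⟩, h0 x hx, h1 x hx⟩
  have hF : ∀ (x) (hx : x ∈ S) (t : I),
      (if hx : x ∈ S then P x hx else L.loops.pt n) t = G (x, t) := fun x hx t => by
    rw [dif_pos hx]; rfl
  refine ⟨fun x => if hx : x ∈ S then P x hx else L.loops.pt n, ?_, hF⟩
  rw [continuousOn_iff_continuous_domRestrict]
  refine Tower.Loop.continuous_of_uncurry ?_
  have : Continuous fun z : S × I => G (z.1, z.2) :=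
    hG.comp_continuous (by fun_prop) fun z => ⟨z.1.2, z.2.2⟩
  exact this.congr fun z => (hF z.1 z.1.2 z.2).symm

variable [Finite T]

lemma exists_null_family (h1 : L.PiTriv ⊥ 1) {f : Cyl(T) → L.obj n}
    (hT : (Poly T).Nonempty) (hf0 : ∀ y ∈ Poly T, f (y, 0) = L.pt n) (hf : PolarNull L ⊥ f) :
    ∃ (n' : ℕ) (h : n ≤ n') (G : Cyl(T) × ℝ → L.obj n'),
      ContinuousOn G ((Poly T ×ˢ J) ×ˢ J) ∧
      (∀ y ∈ Poly T, ∀ b ∈ J, G ((y, 0), b) = L.map h (f (y, b))) ∧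
      (∀ y ∈ Poly T, ∀ b ∈ J, G ((y, 1), b) = L.pt n') ∧
      (∀ y ∈ Poly T, ∀ s ∈ J, G ((y, s), 0) = L.pt n') ∧
      ∀ y ∈ Poly T, ∀ s ∈ J, G ((y, s), 1) = L.pt n' := by
  obtain ⟨y₀, hy₀⟩ := hT
  obtain ⟨n₁, hn₁, H, hH⟩ := hf
  have hI : ∀ t : ℝ, (projIcc (0 : ℝ) 1 zero_le_one t : ℝ) ∈ J := fun t =>
    (projIcc (0 : ℝ) 1 zero_le_one t).2
  let ω : ℝ → L.obj n₁ := fun t => H ((y₀, 0), projIcc (0 : ℝ) 1 zero_le_one t)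
  have hω : Continuous ω := hH.cont.comp_continuous (by fun_prop) fun t =>
    ⟨⟨hy₀, by simp⟩, hI t⟩
  have hω0 : ∀ t ≤ 0, ω t = L.pt n₁ := fun t ht => by
    simp only [ω, projIcc_of_le_left _ ht]
    rw [hH.left _ hy₀ _ (by simp), hf0 _ hy₀, L.map_pt]
  have hω1 : ∀ t ≥ 1, ω t = L.pt n₁ := fun t ht => by
    simp only [ω, projIcc_of_right_le _ ht]
    exact hH.right _ hy₀ _ (by simp)
  obtain ⟨n₂, hn₂, N, hN, hN0, hN1, hNb, -⟩ := h1 n₁ (fun x => ω ((x 0 + 1) / 2))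
    (by fun_prop) (fun x hx => by
      have : 1 ≤ |x 0| := hx.trans ((pi_norm_le_iff_of_nonneg (abs_nonneg _)).2 fun i => by
        rw [Subsingleton.elim i 0, Real.norm_eq_abs])
      rcases le_abs.1 this with h | h
      · exact hω1 _ (by linarith)
      · exact hω0 _ (by linarith)) (fun x g hg => by rw [Subgroup.mem_bot.1 hg, one_smul])
  have hNb' : ∀ s x, 1 ≤ |x| → N (s, fun _ => x) = L.pt n₂ := fun s x hx =>
    hNb s _ (hx.trans (norm_le_pi_norm (fun _ : Fin 1 => x) 0))
  have m1 : ∀ s ∈ J, s ≤ 1 / 2 → ∀ b ∈ J,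
      (1 - 2 * s) * b + 2 * s * max 0 (2 * b - 1) ∈ J := by
    intro s hs hs' b hb
    have h1 : max 0 (2 * b - 1) ∈ J := ⟨le_max_left _ _, max_le zero_le_one (by linarith [hb.2])⟩
    exact convex_Icc 0 1 hb h1 (b := 2 * s) (by linarith)
      (by linarith [hs.1]) (by ring)
  have m2 : ∀ s ∈ J, s ≤ 1 / 2 → ∀ b ∈ J,
      2 * s * min (2 * b) 1 ∈ J := by
    intro s hs hs' b hb
    exact ⟨mul_nonneg (by linarith [hs.1]) (le_min (by linarith [hb.1]) zero_le_one),
      mul_le_one₀ (by linarith) (le_min (by linarith [hb.1]) zero_le_one) (min_le_right _ _)⟩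
  refine ⟨n₂, hn₁.trans hn₂, fun z => if z.1.2 ≤ 1 / 2 then
    L.map hn₂ (H ((z.1.1, (1 - 2 * z.1.2) * z.2 + 2 * z.1.2 * max 0 (2 * z.2 - 1)),
      2 * z.1.2 * min (2 * z.2) 1)) else
    N (2 * z.1.2 - 1, fun _ => 2 * min (2 * z.2) 1 - 1), ?_, ?_, ?_, ?_, ?_⟩
  · refine ContinuousOn.if ?_ ?_ ?_
    · rintro ⟨⟨y, s⟩, b⟩ ⟨hz, ht⟩
      have : s = 1 / 2 := frontier_le_subset_eq (f := fun z : Cyl(T) × ℝ => z.1.2)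
        (by fun_prop) continuous_const ht
      subst this
      have hy : y ∈ Poly T := hz.1.1
      have hb : b ∈ J := hz.2
      norm_num
      rw [hN0]
      congr 1
      rcases le_total b (1 / 2) with h | h
      · have h2 : 2 * b ∈ J := ⟨by linarith [hb.1], by linarith⟩
        rw [max_eq_left (by linarith), min_eq_left h2.2, hH.zero _ hy _ hy₀ _ h2]
        simp only [ω]
        rw [show (2 * (2 * b) - 1 + 1) / 2 = 2 * b by ring, projIcc_of_mem' h2]
      · rw [max_eq_right (by linarith), min_eq_right (by linarith),
          hH.right _ hy _ ⟨by linarith, by linarith [hb.2]⟩]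
        exact (hω1 _ (by norm_num)).symm
    · refine (L.map hn₂).continuous.comp_continuousOn (hH.cont.comp (by fun_prop) ?_)
      rintro z ⟨hz, ht⟩
      have ht : z.1.2 ≤ 1 / 2 := closure_le_eq (f := fun z : Cyl(T) × ℝ => z.1.2)
        (by fun_prop) continuous_const |>.subset ht
      exact ⟨⟨hz.1.1, m1 _ hz.1.2 ht _ hz.2⟩, m2 _ hz.1.2 ht _ hz.2⟩
    · exact (hN.comp (by fun_prop)).continuousOn
  · intro y hy b hb
    norm_num
    rw [hH.left y hy b hb, L.map_map]
  · intro y hy b hb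
    norm_num
    exact hN1 _
  · intro y hy s hs
    dsimp only
    split_ifs with h
    · norm_num
      rw [hH.left _ hy _ (by simp), hf0 _ hy, L.map_pt, L.map_pt]
    · norm_num
      exact hNb' _ _ (by norm_num)
  · intro y hy s hs
    dsimp only
    split_ifs with h
    · have := m2 s hs h 1 (by simp)
      norm_num at this ⊢
      rw [hH.one _ hy (2 * s) ⟨by linarith [this.1], this.2⟩, L.map_pt]
    · norm_num
      exact hNb' _ _ (by norm_num)

lemma exists_null_loops (h1 : L.PiTriv ⊥ 1) {f : Cyl(T) → L.obj n}
    (hT : (Poly T).Nonempty) (hf0 : ∀ y ∈ Poly T, f (y, 0) = L.pt n) (hf : PolarNull L ⊥ f)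
    {F : (T → ℝ) → L.Loop n} (hF : ∀ y ∈ Poly T, ∀ t : I, F y t = f (y, t)) :
    ∃ (n' : ℕ) (h : n ≤ n') (H : Cyl(T) → L.loops.obj n'),
      ContinuousOn H (Poly T ×ˢ J) ∧ (∀ y ∈ Poly T, H (y, 0) = L.loops.map h (F y)) ∧
      ∀ y ∈ Poly T, H (y, 1) = L.loops.pt n' := by
  obtain ⟨n', hn, G, hG, hG0, hG1, hGl, hGr⟩ := exists_null_family h1 hT hf0 hf
  obtain ⟨H, hH, hHG⟩ := exists_loopFamily hG (fun z hz => hGl z.1 hz.1 z.2 hz.2)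
    (fun z hz => hGr z.1 hz.1 z.2 hz.2)
  refine ⟨n', hn, H, hH, fun y hy => ?_, fun y hy => ?_⟩
  · refine DFunLike.ext _ _ fun t => ?_
    rw [hHG _ ⟨hy, by simp⟩, hG0 y hy t t.2, loops_map_apply, hF y hy]
  · refine DFunLike.ext _ _ fun t => ?_
    rw [hHG _ ⟨hy, by simp⟩, hG1 y hy t t.2]
    rfl

lemma IsPolar.null_two [Finite Γ] (e : L.loops.EM1 M)
    (hM : NoTorsion M) (h0 : L.PiTriv ⊤ 0) (h1 : L.PiTriv ⊥ 1) {f : Cyl(T) → L.obj n} (hf : IsPolar L f)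
    (hT : Nat.card T = 2 ∨ 4 ≤ Nat.card T ∨ (3 ≤ Nat.card T ∧ PolarNull L ⊥ f)) :
    PolarNull L ⊤ f := by
  classical
  have : Nontrivial T := Finite.one_lt_card_iff_nontrivial.1 (by omega)
  obtain ⟨a, b, hab⟩ := exists_pair_ne T
  have ha : Proper ({a} : Set T) := ⟨⟨a, rfl⟩, (ne_univ_iff_exists_notMem _).2 ⟨b, by simpa using hab.symm⟩⟩
  obtain ⟨n₁, hn₁, H₁, f₁, hH₁, hf₁, hf₁0⟩ := hf.exists_loop h0.fixedConn ⟨_, ha.ind_mem_poly⟩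
  refine PolarNull.of_htpy hn₁ hH₁ ?_
  obtain ⟨F, hF, hFf⟩ := exists_loopFamily hf₁.cont hf₁0 hf₁.one
  have hcase : PolarNull L ⊥ f → ∃ n' h H,
      ContinuousOn H (Poly T ×ˢ J) ∧ (∀ y ∈ Poly T, H (y, 0) = L.loops.map h (F y)) ∧
      ∀ y ∈ Poly T, H (y, 1) = L.loops.pt n' := by
    rintro ⟨n₂, hn₂, H₂, hH₂⟩
    have hnull : PolarNull L ⊥ f₁ := by
      have e1 := ((hH₁.mono bot_le).symm.map (le_max_left n₁ n₂))
      have e2 := hH₂.map (le_max_right n₁ n₂)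
      simp only [L.map_map, L.map_pt] at e1 e2
      exact ⟨_, _, _, e1.trans e2⟩
    exact exists_null_loops h1 ⟨_, ha.ind_mem_poly⟩ hf₁0 hnull hFf
  obtain ⟨n₂, hn₂, H₂, hH₂c, hH₂e, hH₂0, hH₂1⟩ := exists_eqNull e hM hF
    (fun g y hy => by
      refine DFunLike.ext _ _ fun t => ?_
      rw [hFf _ (shift_mem_poly g hy), hf₁.equi g y hy t t.2, ← hFf y hy]
      rfl) (hT.imp_right (Or.imp_right (And.imp_right hcase)))
  refine ⟨n₂, hn₂, fun z => DFunLike.coe (H₂ (z.1.1, z.2))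
    (projIcc 0 1 zero_le_one z.1.2), ⟨?_, ?_, ?_, ?_, ?_, ?_⟩⟩
  · refine (continuous_eval (F := L.Loop n₂)).comp_continuousOn
      ((hH₂c.comp (by fun_prop) fun z hz => ⟨hz.1.1, hz.2⟩).prodMk
        (Continuous.continuousOn (by fun_prop)))
  · intro g _ y hy b hb t ht
    simp only [hH₂e g y hy t ht]
    rfl
  · intro y hy b hb
    simp only [hH₂0 y hy]
    rw [loops_map_apply, hFf y hy, projIcc_of_mem _ hb]
  · intro y hy b hb
    simp only [hH₂1 y hy]
    rfl
  · intro y hy t ht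
    simp only [projIcc_right]
    exact Tower.Loop.one _
  · intro y hy y' hy' t ht
    simp only [projIcc_left]
    exact (Tower.Loop.zero _).trans (Tower.Loop.zero _).symm

end

section

variable {G : Type u} [Group G] (X : GPrespectrum G)

lemma permute_permute {T : Type u} [MulAction G T] (g h : G) (z : Torus T) :
    permute g (permute h z) = permute (g * h) z := shift_shift g h z

lemma continuous_permute {T : Type u} [MulAction G T] (g : G) :
    Continuous (permute g : Torus T → Torus T) := continuous_shift g

/-- The space of pointed maps `S^{p + q ρ} → X_l`, not necessarily equivariant. -/
def Rep (p q l : ℕ) : Type u :=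
  {f : C(𝕋(G, p, q), X.level l) // ∀ z, (∃ t, z t = ∞) → f z = (X.level l).pt}

namespace Rep

variable {X} {p q l : ℕ}

instance : TopologicalSpace (Rep X p q l) := inferInstanceAs (TopologicalSpace (Subtype _))

instance : FunLike (Rep X p q l) 𝕋(G, p, q) (X.level l) where
  coe f := f.1
  coe_injective _ _ h := Subtype.ext (DFunLike.coe_injective h)

instance : ContinuousEval (Rep X p q l) 𝕋(G, p, q) (X.level l) where
  continuous_eval := (continuous_eval (F := C(𝕋(G, p, q), X.level l))).comp
    (continuous_subtype_val.prodMap continuous_id)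

instance : ContinuousMapClass (Rep X p q l) 𝕋(G, p, q) (X.level l) where
  map_continuous f := f.1.continuous

@[ext] theorem ext {f f' : Rep X p q l} (h : ∀ z, f z = f' z) : f = f' := DFunLike.ext _ _ h

lemma infty (f : Rep X p q l) {z : 𝕋(G, p, q)} (h : ∃ t, z t = ∞) :
    f z = (X.level l).pt := f.2 z h

lemma continuous_of_uncurry {W : Type*} [TopologicalSpace W] {f : W → Rep X p q l}
    (hf : Continuous fun z : W × 𝕋(G, p, q) => f z.1 z.2) : Continuous f :=
  Continuous.subtype_mk
    (ContinuousMap.continuous_of_continuous_uncurry _ hf) _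

variable (X p q l) in
/-- The constant map. -/
def base : Rep X p q l := ⟨ContinuousMap.const _ (X.level l).pt, fun _ _ => rfl⟩

lemma base_apply (z) : base X p q l z = (X.level l).pt := rfl

instance : MulAction G (Rep X p q l) where
  smul g f := ⟨⟨fun z => g • f (permute g⁻¹ z),
    (continuous_const_smul g).comp ((map_continuous f).comp (continuous_permute g⁻¹))⟩, by
      rintro z ⟨t, ht⟩
      change g • f (permute g⁻¹ z) = _
      rw [f.infty ⟨g⁻¹ • t, by simpa [permute] using ht⟩, (X.level l).smul_pt]⟩
  one_smul f := ext fun z => by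
    change (1 : G) • f (permute 1⁻¹ z) = f z
    rw [one_smul, inv_one]
    congr 1
    exact shift_one z
  mul_smul g h f := ext fun z => by
    change (g * h) • f (permute (g * h)⁻¹ z) = g • h • f (permute h⁻¹ (permute g⁻¹ z))
    rw [permute_permute, mul_smul, mul_inv_rev]

lemma smul_apply (g : G) (f : Rep X p q l) (z) : (g • f) z = g • f (permute g⁻¹ z) := rfl

lemma smul_permute (g : G) (f : Rep X p q l) (z) : (g • f) (permute g z) = g • f z := by
  rw [smul_apply, permute_permute, inv_mul_cancel]
  congr 2
  exact shift_one z

instance : ContinuousConstSMul G (Rep X p q l) where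
  continuous_const_smul g := continuous_of_uncurry (by
    change Continuous fun z : Rep X p q l × 𝕋(G, p, q) => g • z.1 (permute g⁻¹ z.2)
    exact (continuous_const_smul g).comp (continuous_fst.eval
      ((continuous_permute g⁻¹).comp continuous_snd)))

lemma smul_base (g : G) : g • base X p q l = base X p q l :=
  ext fun _ => (X.level l).smul_pt g

lemma exists_old_or_new (t : Coord G (p + 1) (q + 1)) :
    (∃ s : Coord G p q, Coord.old s = t) ∨ ∃ s : Coord G 1 1, Coord.new s = t := by
  rcases t with i | ⟨i, g⟩
  · refine Fin.lastCases (.inr ⟨.inl 0, rfl⟩) (fun i => .inl ⟨.inl i, rfl⟩) i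
  · refine Fin.lastCases (.inr ⟨.inr (0, g), rfl⟩) (fun i => .inl ⟨.inr (i, g), rfl⟩) i

/-- Smash with the identity of `S^{1 + ρ}` and compose with the structure map. -/
def stab : C(Rep X p q l, Rep X (p + 1) (q + 1) (l + 1)) where
  toFun f := ⟨⟨fun z => X.struct l (f (z ∘ Coord.old)) (z ∘ Coord.new), by fun_prop⟩, by
    rintro z ⟨t, ht⟩
    change X.struct l (f (z ∘ Coord.old)) (z ∘ Coord.new) = _
    rcases exists_old_or_new t with ⟨s, rfl⟩ | ⟨s, rfl⟩
    · rw [f.infty ⟨s, ht⟩, X.struct_pt]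
    · exact X.struct_infty _ _ _ ⟨s, ht⟩⟩
  continuous_toFun := by
    refine continuous_of_uncurry ?_
    have h : Continuous fun y : Rep X p q l × Torus (Coord G (p + 1) (q + 1)) =>
        y.1 (y.2 ∘ Coord.old) := continuous_fst.eval (by fun_prop)
    exact Continuous.eval (F := C(𝕋(G, 1, 1), X.level (l + 1)))
      ((X.struct l).continuous.comp h) (g := fun y => y.2 ∘ Coord.new) (by fun_prop)

lemma stab_apply (f : Rep X p q l) (z) :
    stab f z = X.struct l (f (z ∘ Coord.old)) (z ∘ Coord.new) := rfl

lemma stab_base : stab (base X p q l) = base X (p + 1) (q + 1) (l + 1) :=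
  ext fun _ => X.struct_pt _ _

lemma permute_comp {S T : Type u} [MulAction G S] [MulAction G T] {φ : S → T}
    (hφ : ∀ (g : G) s, φ (g • s) = g • φ s) (g : G) (z : Torus T) :
    permute g z ∘ φ = permute g (z ∘ φ) := by
  funext t; simp [permute, hφ]

lemma stab_smul (g : G) (f : Rep X p q l) : stab (g • f) = g • stab f := by
  ext z
  rw [smul_apply, stab_apply, stab_apply, smul_apply, permute_comp Coord.old_smul,
    permute_comp Coord.new_smul, ← X.struct_smul, permute_permute, mul_inv_cancel]
  congr 1
  exact (shift_one _).symm

end Rep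

/-- The tower of spaces of pointed maps `S^{(p + n) + (q + n) ρ} → X_{l + n}`. -/
abbrev towerOf [Group Γ] (ι : Γ →* G) (p q l : ℕ) : Tower.{u} Γ where
  obj n := Rep X (p + n) (q + n) (l + n)
  act _ := MulAction.compHom _ ι
  cont n :=
    letI : MulAction Γ (Rep X (p + n) (q + n) (l + n)) := MulAction.compHom _ ι
    ⟨fun g => continuous_const_smul (ι g)⟩
  pt _ := Rep.base X _ _ _
  smul_pt _ g := Rep.smul_base (ι g)
  step _ := Rep.stab
  step_pt _ := Rep.stab_base
  step_smul _ g f := Rep.stab_smul (ι g) f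

variable {X}

section After

variable {W : Type*} (N : ∀ p q l : ℕ, (W → Rep X p q l) → Prop)

/-- The property `N` holds after `m` stabilizations. -/
def After : ℕ → ∀ {p q l : ℕ}, (W → Rep X p q l) → Prop
  | 0, _, _, _, f => N _ _ _ f
  | m + 1, _, _, _, f => After m fun x => Rep.stab (f x)

variable {N}

variable {Γ : Type w} [Group Γ] (ι : Γ →* G)

lemma exists_after (h : n ≤ n') (f : W → Rep X (p + n) (q + n) (l + n))
    (hf : N _ _ _ fun x => (towerOf X ι p q l).map h (f x)) : ∃ m, After N m f := by
  obtain ⟨d, rfl⟩ := Nat.exists_eq_add_of_le h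
  induction d generalizing n with
  | zero => exact ⟨0, Eq.mp (congrArg (N _ _ _) (funext fun x => (towerOf X ι p q l).map_refl h (f x))) hf⟩
  | succ d ih =>
    have e : n + (d + 1) = (n + 1) + d := by omega
    have hf' : ∀ k (hk : k = n + 1 + d) (h' : n + 1 ≤ k) (h : n ≤ k),
        N _ _ _ (fun x => (towerOf X ι p q l).map h (f x)) →
        N _ _ _ fun x => (towerOf X ι p q l).map (Nat.le_add_right (n + 1) d) (Rep.stab (f x)) := by
      rintro k rfl h' h hN
      refine Eq.mp ?_ hN
      congr 1
      funext x
      rw [← (towerOf X ι p q l).map_map (Nat.le_succ n) h', (towerOf X ι p q l).map_one]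
    obtain ⟨m, hm⟩ := ih (n := n + 1) (fun x => Rep.stab (f x))
      (Nat.le_add_right _ _) (hf' _ e (by omega) h hf)
    exact ⟨m + 1, hm⟩

lemma After.exists_map {f : W → Rep X (p + n) (q + n) (l + n)}
    (hf : After N m f) : ∃ (n' : ℕ) (h : n ≤ n'),
      N _ _ _ fun x => (towerOf X ι p q l).map h (f x) := by
  induction m generalizing n with
  | zero => exact ⟨n, le_rfl,
      Eq.mpr (congrArg (N _ _ _) (funext fun x => (towerOf X ι p q l).map_refl le_rfl (f x))) hf⟩
  | succ m ih =>
    obtain ⟨n', h, hN⟩ := ih (n := n + 1) (f := fun x => Rep.stab (f x)) hf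
    refine ⟨n', (Nat.le_succ n).trans h, ?_⟩
    refine Eq.mp ?_ hN
    congr 1
    funext x
    rw [← (towerOf X ι p q l).map_map (Nat.le_succ n) h, (towerOf X ι p q l).map_one]

lemma After.transport {Y : GPrespectrum G} {W' : Type*}
    {N' : ∀ p q l : ℕ, (W' → Rep Y p q l) → Prop}
    (R : ∀ p q l p' q' : ℕ, (W → Rep X p q l) → (W' → Rep Y p' q' l) → Prop)
    (hR : ∀ {p q l p' q' : ℕ} (f : W → Rep X p q l) (f' : W' → Rep Y p' q' l), R _ _ _ _ _ f f' →
      R _ _ _ _ _ (fun x => Rep.stab (f x)) fun x => Rep.stab (f' x))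
    (hN : ∀ {p q l p' q' : ℕ} (f : W → Rep X p q l) (f' : W' → Rep Y p' q' l), R _ _ _ _ _ f f' →
      N _ _ _ f → N' _ _ _ f') {p q l p' q' m : ℕ} {f : W → Rep X p q l} {f' : W' → Rep Y p' q' l}
    (h : R _ _ _ _ _ f f') (hf : After N m f) : After N' m f' := by
  induction m generalizing p q l p' q' with
  | zero => exact hN f f' h hf
  | succ m ih => exact ih (hR f f' h) hf

end After

end

open _root_.GStable.Rep

section

section Topology

open OnePoint Filter Topology

lemma exists_descend [TopologicalSpace Y] [TopologicalSpace Z]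
    [TopologicalSpace V] [TopologicalSpace W] [CompactSpace Y] [T2Space Z]
    (hq : Continuous q) (hs : Function.Surjective q) {g : W × Y → V} (hg : Continuous g)
    (h : ∀ w y y', q y = q y' → g (w, y) = g (w, y')) :
    ∃ f : W × Z → V, Continuous f ∧ ∀ w y, f (w, q y) = g (w, y) := by
  choose s hs' using hs
  have hQ : IsQuotientMap (Prod.map (id : W → W) q) :=
    (isProperMap_id.prodMap hq.isProperMap).isClosedMap.isQuotientMap
      (continuous_id.prodMap hq) (fun z => ⟨(z.1, s z.2), Prod.ext rfl (hs' _)⟩)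
  have key : ∀ w y, g (w, s (q y)) = g (w, y) := fun w y => h w _ _ (hs' _)
  refine ⟨fun z => g (z.1, s z.2), ?_, key⟩
  rw [hQ.continuous_iff]
  exact hg.congr fun z => (key z.1 z.2).symm

open Classical in
lemma continuous_blowup {Y E : Type*} [TopologicalSpace Y] [TopologicalSpace E] {ρ : Y → ℝ}
    (hρ : Continuous ρ) {g : Y → E} (hg : ContinuousOn g {y | 0 < ρ y}) {N : E → ℝ}
    (hN : Continuous N) (h : ∀ y, 0 < ρ y → (1 / ρ y - 1) / 2 ≤ N (g y)) :
    Continuous fun y => if 0 < ρ y then (g y : OnePoint E) else ∞ := by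
  rw [continuous_iff_continuousAt]
  intro y₀
  by_cases h0 : 0 < ρ y₀
  · have hnhds : {y | 0 < ρ y} ∈ 𝓝 y₀ := (isOpen_lt continuous_const hρ).mem_nhds h0
    refine ContinuousAt.congr (f := fun y => (g y : OnePoint E))
      (OnePoint.continuous_coe.continuousAt.comp (hg.continuousAt hnhds)) ?_
    filter_upwards [hnhds] with y hy
    exact (if_pos hy).symm
  · rw [ContinuousAt, if_neg h0]
    intro S hS
    rw [OnePoint.nhds_infty_eq, mem_sup, mem_map, Filter.mem_coclosedCompact_iff, mem_pure] at hS
    obtain ⟨hK, hS⟩ := hS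
    obtain ⟨B, hB⟩ : ∃ B, ∀ x ∈ closure ((↑) ⁻¹' S : Set E)ᶜ, N x ≤ B := by
      obtain ⟨B, hB⟩ := (hK.image hN).bddAbove
      exact ⟨B, fun x hx => hB ⟨x, hx, rfl⟩⟩
    have hpos : 0 < 1 / (2 * |B| + 2) := by positivity
    have hlt : {y | ρ y < 1 / (2 * |B| + 2)} ∈ 𝓝 y₀ :=
      (isOpen_lt hρ continuous_const).mem_nhds ((not_lt.1 h0).trans_lt hpos)
    rw [mem_map]
    filter_upwards [hlt] with y hy
    by_cases hy0 : 0 < ρ y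
    · rw [mem_preimage, if_pos hy0]
      by_contra hyS
      have h1 := hB _ (subset_closure hyS)
      have h2 := h y hy0
      have h3 : 2 * |B| + 2 < 1 / ρ y := by
        rw [lt_div_iff₀ hy0]
        rw [lt_div_iff₀ (by positivity)] at hy
        linarith
      have := le_abs_self B
      linarith
    · rw [mem_preimage, if_neg hy0]
      exact hS

/-- The homeomorphism from an open interval to the line. -/
def stretch (s : ℝ) : ℝ := s / (1 - |s|)

lemma abs_stretch {s : ℝ} (hs : |s| < 1) : |stretch s| = 1 / (1 - |s|) - 1 := by
  have h : 0 < 1 - |s| := by linarith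
  rw [stretch, abs_div, abs_of_pos h]
  field_simp
  ring

lemma stretch_shrink (y : ℝ) : |y / (1 + |y|)| < 1 ∧ stretch (y / (1 + |y|)) = y := by
  have h : 0 < 1 + |y| := by positivity
  have h1 : |y / (1 + |y|)| = |y| / (1 + |y|) := by rw [abs_div, abs_of_pos h]
  have h2 : 1 - |y| / (1 + |y|) = 1 / (1 + |y|) := by field_simp; ring
  refine ⟨?_, ?_⟩
  · rw [h1, div_lt_one h]; linarith
  · rw [stretch, h1, h2]; field_simp

lemma stretch_injOn (hs : |s| < 1) (ht : |t| < 1) (h : stretch s = stretch t) :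
    s = t := by
  have h1 : 1 / (1 - |s|) = 1 / (1 - |t|) := by
    have := congrArg abs h
    rw [abs_stretch hs, abs_stretch ht] at this
    linarith
  have h2 : 1 - |s| = 1 - |t| := by simpa using h1
  have h3 : 0 < 1 - |t| := by linarith
  rw [stretch, stretch, h2] at h
  exact (div_left_inj' h3.ne').1 h

lemma continuousOn_stretch : ContinuousOn stretch {s | 0 < 1 - |s|} :=
  continuousOn_id.div (by fun_prop) fun _ hs => (ne_of_gt hs)

open Classical in
/-- The line, collapsed to the circle by identifying the points outside of `(-1, 1)`. -/
def collapse (s : ℝ) : OnePoint ℝ := if 0 < 1 - |s| then (stretch s : OnePoint ℝ) else ∞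

lemma collapse_of_lt (h : |s| < 1) : collapse s = (stretch s : OnePoint ℝ) :=
  if_pos (by linarith)

lemma collapse_of_ge (h : 1 ≤ |s|) : collapse s = ∞ := if_neg (by linarith)

lemma collapse_eq_infty : collapse s = ∞ ↔ 1 ≤ |s| := by
  rcases lt_or_ge |s| 1 with h | h
  · rw [collapse_of_lt h]
    exact ⟨fun h' => absurd h' (OnePoint.coe_ne_infty _), fun h' => absurd h (not_lt.2 h')⟩
  · simp [collapse_of_ge h, h]

lemma continuous_collapse : Continuous collapse := by
  refine continuous_blowup (by fun_prop) continuousOn_stretch continuous_abs fun s hs => ?_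
  rw [abs_stretch (by linarith)]
  have : 1 ≤ 1 / (1 - |s|) := by
    rw [le_div_iff₀ hs]; linarith [abs_nonneg s]
  linarith

lemma collapse_injOn (hs : |s| < 1) (h : collapse s = collapse t) : s = t := by
  rw [collapse_of_lt hs] at h
  have ht : |t| < 1 := by
    by_contra ht
    rw [collapse_of_ge (not_lt.1 ht)] at h
    exact OnePoint.coe_ne_infty _ h
  rw [collapse_of_lt ht] at h
  exact stretch_injOn hs ht (OnePoint.coe_injective h)

lemma exists_collapse (y : OnePoint ℝ) : ∃ s ∈ Icc (-1 : ℝ) 1, collapse s = y := by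
  induction y using OnePoint.rec with
  | infty => exact ⟨1, by simp, collapse_of_ge (by simp)⟩
  | coe y =>
    obtain ⟨h1, h2⟩ := stretch_shrink y
    exact ⟨_, abs_le.1 h1.le, by rw [collapse_of_lt h1, h2]⟩

lemma exists_descend_collapse [Finite T] [TopologicalSpace V]
    [TopologicalSpace W] {u : W × (T → ℝ) → V} (hu : Continuous u) {v₀ : V}
    (h : ∀ w x, (∃ i, 1 ≤ |x i|) → u (w, x) = v₀) :
    ∃ f : W × (T → OnePoint ℝ) → V, Continuous f ∧ (∀ w x, f (w, collapse ∘ x) = u (w, x)) ∧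
      ∀ w ζ, (∃ i, ζ i = ∞) → f (w, ζ) = v₀ := by
  obtain ⟨f, hf, hfu⟩ := exists_descend (W := W) (Y := T → Icc (-1 : ℝ) 1)
    (q := fun y i => collapse (y i)) (g := fun z => u (z.1, fun i => z.2 i))
    (continuous_pi fun i => continuous_collapse.comp (by fun_prop))
    (fun ζ => by
      choose s hs hs' using fun i => exists_collapse (ζ i)
      exact ⟨fun i => ⟨s i, hs i⟩, funext hs'⟩)
    (by fun_prop) (fun w y y' hy => by
      by_cases hyi : ∃ i, 1 ≤ |(y i : ℝ)|
      · have hyi' : ∃ i, 1 ≤ |(y' i : ℝ)| := by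
          obtain ⟨i, hi⟩ := hyi
          refine ⟨i, collapse_eq_infty.1 ?_⟩
          rw [← congrFun hy i]
          exact collapse_of_ge hi
        rw [h _ _ hyi, h _ _ hyi']
      · push Not at hyi
        have : y = y' := funext fun i => Subtype.ext (collapse_injOn (hyi i) (congrFun hy i))
        rw [this])
  have key : ∀ w x, f (w, collapse ∘ x) = u (w, x) := fun w x => by
    by_cases hx : ∃ i, 1 ≤ |x i|
    · have h1 : collapse ∘ x =
          fun i => collapse ((⟨max (-1) (min 1 (x i)), by simp, by simp⟩ : Icc (-1 : ℝ) 1) : ℝ) := by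
        funext i
        simp only [Function.comp_apply]
        rcases le_or_gt 1 |x i| with hi | hi
        · rw [collapse_of_ge hi, collapse_of_ge]
          rcases le_abs'.1 hi with hi | hi
          · rw [min_eq_right (by linarith), max_eq_left hi]; simp
          · rw [min_eq_left hi, max_eq_right (by norm_num)]; simp
        · rw [abs_lt] at hi
          rw [min_eq_right hi.2.le, max_eq_right hi.1.le]
      obtain ⟨i, hi⟩ := hx
      rw [h1, hfu w (fun i => ⟨max (-1) (min 1 (x i)), by simp, by simp⟩), h w x ⟨i, hi⟩, h]
      refine ⟨i, ?_⟩
      change 1 ≤ |max (-1) (min 1 (x i))|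
      rcases le_abs'.1 hi with hi | hi
      · rw [min_eq_right (by linarith), max_eq_left hi]; simp
      · rw [min_eq_left hi, max_eq_right (by norm_num)]; simp
    · push Not at hx
      exact hfu w fun i => ⟨x i, abs_le.1 (hx i).le⟩
  refine ⟨f, hf, key, fun w ζ ⟨i, hi⟩ => ?_⟩
  choose s hs hs' using fun i => exists_collapse (ζ i)
  have : ζ = collapse ∘ s := funext fun i => (hs' i).symm
  rw [this, key]
  exact h _ _ ⟨i, collapse_eq_infty.1 ((hs' i).trans hi)⟩

end Topology

namespace Coord

variable {G : Type u} {p q j m P Q : ℕ} (hP : P = p + j) (hQ : Q = q + m)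

include hP hQ

/-- The first coordinates of `(j + m ρ) ⊕ (p + q ρ)`. -/
def fr : Coord G j m → Coord G P Q :=
  Sum.map (fun i => ⟨i, by omega⟩) (Prod.map (fun i => ⟨i, by omega⟩) id)

/-- The last coordinates of `(j + m ρ) ⊕ (p + q ρ)`. -/
def sh : Coord G p q → Coord G P Q :=
  Sum.map (fun i => ⟨i + j, by omega⟩) (Prod.map (fun i => ⟨i + m, by omega⟩) id)

/-- The point of the torus with given first and last coordinates. -/
def merge (ζ : 𝕋(G, j, m)) (z : 𝕋(G, p, q)) : 𝕋(G, P, Q)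
  | Sum.inl i => if h : (i : ℕ) < j then ζ (Sum.inl ⟨i, h⟩) else z (Sum.inl ⟨i - j, by omega⟩)
  | Sum.inr (i, g) =>
    if h : (i : ℕ) < m then ζ (Sum.inr (⟨i, h⟩, g)) else z (Sum.inr (⟨i - m, by omega⟩, g))

lemma merge_fr (ζ : 𝕋(G, j, m)) (z : 𝕋(G, p, q)) :
    merge hP hQ ζ z ∘ fr hP hQ = ζ := by
  funext t
  rcases t with i | ⟨i, g⟩ <;> exact dif_pos i.2

lemma merge_sh (ζ : 𝕋(G, j, m)) (z : 𝕋(G, p, q)) :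
    merge hP hQ ζ z ∘ sh hP hQ = z := by
  ext (i | ⟨i, g⟩)
  · refine (dif_neg (by simp)).trans ?_
    exact congrArg (fun i => z (.inl i)) (Fin.ext (Nat.add_sub_cancel _ _))
  · refine (dif_neg (by simp)).trans ?_
    exact congrArg (fun i => z (.inr (i, g))) (Fin.ext (Nat.add_sub_cancel _ _))

lemma merge_self (z : 𝕋(G, P, Q)) : merge hP hQ (z ∘ fr hP hQ) (z ∘ sh hP hQ) = z := by
  ext (i | ⟨i, g⟩)
  · by_cases h : i < j
    · exact dif_pos h
    · exact (dif_neg h).trans (congrArg (fun i => z (.inl i))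
        (Fin.ext (Nat.sub_add_cancel (not_lt.1 h))))
  · by_cases h : i < m
    · exact dif_pos h
    · exact (dif_neg h).trans (congrArg (fun i => z (.inr (i, g)))
        (Fin.ext (Nat.sub_add_cancel (not_lt.1 h))))

lemma continuous_merge : Continuous fun x : 𝕋(G, j, m) × 𝕋(G, p, q) =>
    merge hP hQ x.1 x.2 := by
  refine continuous_pi fun t => ?_
  rcases t with i | ⟨i, g⟩
  · by_cases h : i < j
    · simp only [merge, dif_pos h]; fun_prop
    · simp only [merge, dif_neg h]; fun_prop
  · by_cases h : i < m
    · simp only [merge, dif_pos h]; fun_prop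
    · simp only [merge, dif_neg h]; fun_prop

lemma merge_infty {z : 𝕋(G, p, q)} :
    (∃ t, merge hP hQ ζ z t = ∞) ↔ (∃ t, ζ t = ∞) ∨ ∃ t, z t = ∞ := by
  constructor
  · rintro ⟨i | ⟨i, g⟩, h⟩ <;> simp only [merge] at h <;> split_ifs at h
    exacts [.inl ⟨_, h⟩, .inr ⟨_, h⟩, .inl ⟨_, h⟩, .inr ⟨_, h⟩]
  · rintro (⟨t, h⟩ | ⟨t, h⟩)
    · exact ⟨fr hP hQ t, by rw [← h]; exact congrFun (merge_fr hP hQ ζ z) t⟩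
    · exact ⟨sh hP hQ t, by rw [← h]; exact congrFun (merge_sh hP hQ ζ z) t⟩

variable [Group G]

lemma fr_smul (g : G) (t : Coord G j m) : fr hP hQ (g • t) = g • fr hP hQ t := by
  rcases t with t | t <;> rfl

lemma sh_smul (g : G) (t : Coord G p q) : sh hP hQ (g • t) = g • sh hP hQ t := by
  rcases t with t | t <;> rfl

lemma permute_merge (g : G) (ζ : 𝕋(G, j, m)) (z : 𝕋(G, p, q)) :
    permute g (merge hP hQ ζ z) = merge hP hQ (permute g ζ) (permute g z) := by
  rw [← merge_self hP hQ (permute g (merge hP hQ ζ z)), permute_comp (fr_smul hP hQ),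
    permute_comp (sh_smul hP hQ), merge_fr, merge_sh]

lemma stab_merge_old (ζ : 𝕋(G, j, m)) (z : Torus (Coord G (p + 1) (q + 1)))
    (hP' : P + 1 = p + 1 + j) (hQ' : Q + 1 = q + 1 + m) :
    merge hP' hQ' ζ z ∘ old = merge hP hQ ζ (z ∘ old) := by
  ext (i | ⟨i, g⟩)
  · by_cases h : i < j
    · exact (dif_pos h).trans (Eq.symm (by exact dif_pos h))
    · exact (dif_neg h).trans (Eq.symm (by exact dif_neg h))
  · by_cases h : i < m
    · exact (dif_pos h).trans (Eq.symm (by exact dif_pos h))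
    · exact (dif_neg h).trans (Eq.symm (by exact dif_neg h))

lemma stab_merge_new (ζ : 𝕋(G, j, m)) (z : Torus (Coord G (p + 1) (q + 1)))
    (hP' : P + 1 = p + 1 + j) (hQ' : Q + 1 = q + 1 + m) :
    merge hP' hQ' ζ z ∘ new = z ∘ new := by
  subst hP hQ
  ext (i | ⟨i, g⟩)
  · have h : ¬ (p + j + i < j) := by omega
    exact (dif_neg h).trans
      (congrArg (fun i => z (.inl i)) (Fin.ext (by simp only [Fin.val_natAdd]; omega)))
  · have h : ¬ (q + m + i < m) := by omega
    exact (dif_neg h).trans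
      (congrArg (fun i => z (.inr (i, g))) (Fin.ext (by simp only [Fin.val_natAdd]; omega)))

end Coord

end

section

variable {G : Type u} [Group G] {X : GPrespectrum G}

namespace Rep

section Absorb

variable {p q l j m P Q : ℕ} (hP : P = p + j) (hQ : Q = q + m)

/-- Restriction of a map on `S^{P + Q ρ}` along a point of the sphere of the first coordinates. -/
def unabs (F : Rep X P Q l) (ζ : 𝕋(G, j, m)) : Rep X p q l :=
  ⟨⟨fun z => F (Coord.merge hP hQ ζ z), (map_continuous F).comp
    ((Coord.continuous_merge hP hQ).comp (continuous_const.prodMk continuous_id))⟩,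
    fun _ h => F.infty ((Coord.merge_infty hP hQ).2 (Or.inr h))⟩

lemma unabs_apply (F : Rep X P Q l) (ζ : 𝕋(G, j, m)) (z) :
    unabs hP hQ F ζ z = F (Coord.merge hP hQ ζ z) := rfl

lemma continuous_unabs :
    Continuous fun x : Rep X P Q l × 𝕋(G, j, m) => unabs hP hQ x.1 x.2 := by
  refine continuous_of_uncurry ?_
  exact (continuous_fst.comp continuous_fst).eval ((Coord.continuous_merge hP hQ).comp
    ((continuous_snd.comp continuous_fst).prodMk continuous_snd))

lemma unabs_infty (F : Rep X P Q l)
    (h : ∃ t, ζ t = ∞) : unabs hP hQ F ζ = base X p q l :=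
  ext fun _ => F.infty ((Coord.merge_infty hP hQ).2 (.inl h))

lemma unabs_base (ζ : 𝕋(G, j, m)) : unabs hP hQ (base X P Q l) ζ = base X p q l := rfl

lemma unabs_smul (g : G) (F : Rep X P Q l) (ζ : 𝕋(G, j, m)) :
    unabs hP hQ (g • F) (permute g ζ) = g • unabs hP hQ F ζ := by
  ext z
  rw [unabs_apply, smul_apply, smul_apply, unabs_apply, Coord.permute_merge, permute_permute,
    inv_mul_cancel]
  congr 3
  exact shift_one _

lemma unabs_stab (hP' : P + 1 = p + 1 + j) (hQ' : Q + 1 = q + 1 + m) (F : Rep X P Q l)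
    (ζ : 𝕋(G, j, m)) : unabs hP' hQ' (stab F) ζ = stab (unabs hP hQ F ζ) := by
  ext z
  rw [unabs_apply, stab_apply, stab_apply, Coord.stab_merge_old hP hQ,
    Coord.stab_merge_new hP hQ, unabs_apply]

lemma unabs_ext {F F' : Rep X P Q l} (h : ∀ ζ, unabs hP hQ F ζ = unabs hP hQ F' ζ) : F = F' :=
  ext fun z => by
    have := DFunLike.congr_fun (h (z ∘ Coord.fr hP hQ)) (z ∘ Coord.sh hP hQ)
    rwa [unabs_apply, unabs_apply, Coord.merge_self] at this

lemma exists_absorb [TopologicalSpace W]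
    (hf : Continuous f) (h : ∀ w ζ, (∃ t, ζ t = ∞) → f (w, ζ) = base X p q l) :
    ∃ F : W → Rep X P Q l, Continuous F ∧ ∀ w ζ, unabs hP hQ (F w) ζ = f (w, ζ) := by
  have hc : Continuous fun x : W × 𝕋(G, P, Q) =>
      f (x.1, x.2 ∘ Coord.fr hP hQ) (x.2 ∘ Coord.sh hP hQ) :=
    (hf.comp (by fun_prop)).eval (by fun_prop)
  let F : W → Rep X P Q l := fun w =>
    ⟨⟨fun z => f (w, z ∘ Coord.fr hP hQ) (z ∘ Coord.sh hP hQ),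
      hc.comp (continuous_const.prodMk continuous_id)⟩, fun z hz => by
      change f (w, z ∘ Coord.fr hP hQ) (z ∘ Coord.sh hP hQ) = _
      rw [← Coord.merge_self hP hQ z, Coord.merge_infty] at hz
      rcases hz with hz | hz
      · rw [h _ _ hz]; rfl
      · exact infty _ hz⟩
  refine ⟨F, continuous_of_uncurry hc, fun w ζ => ext fun z => ?_⟩
  change f (w, Coord.merge hP hQ ζ z ∘ Coord.fr hP hQ) (Coord.merge hP hQ ζ z ∘ Coord.sh hP hQ) = _
  rw [Coord.merge_fr, Coord.merge_sh]

end Absorb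

end Rep

section Loops

variable {Γ : Type w} [Group Γ] (ι : Γ →* G) {A : Type*} [TopologicalSpace A] [MulAction Γ A]
  (a₀ : A) {p q l : ℕ}

/-- A loop of pointed equivariant maps `S^{p + q ρ} ∧ A → X_l`. -/
structure IsLoopMap (f : I × A → Rep X p q l) : Prop where
  cont : Continuous f
  zero : ∀ a, f (0, a) = Rep.base X p q l
  one : ∀ a, f (1, a) = Rep.base X p q l
  pt : ∀ s, f (s, a₀) = Rep.base X p q l
  equi : ∀ (g : Γ) s a, f (s, g • a) = ι g • f (s, a)

/-- Null homotopic loops of pointed equivariant maps. -/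
def LoopNull (p q l : ℕ) (f : I × A → Rep X p q l) : Prop :=
  ∃ H : I × (I × A) → Rep X p q l, Continuous H ∧
    (∀ t, IsLoopMap ι a₀ fun w => H (t, w)) ∧ (∀ w, H (0, w) = f w) ∧
    ∀ w, H (1, w) = Rep.base X p q l

variable {ι a₀}

lemma IsLoopMap.stab (hf : IsLoopMap ι a₀ f) :
    IsLoopMap ι a₀ fun w => stab (f w) where
  cont := Rep.stab.continuous.comp hf.cont
  zero a := by rw [hf.zero, stab_base]
  one a := by rw [hf.one, stab_base]
  pt s := by rw [hf.pt, stab_base]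
  equi g s a := by rw [hf.equi, stab_smul]

end Loops

namespace MapSpace

variable {A : PtGSpace G} {p q l : ℕ}

/-- The maps `S^{p + q ρ} → X_l` given by the points of `A`. -/
def rep (f : MapSpace p q A (X.level l)) (a : A) : Rep X p q l :=
  ⟨⟨fun z => f.1 (z, a), by fun_prop⟩, fun _ h => f.2.1 _ _ h⟩

lemma rep_apply (f : MapSpace p q A (X.level l)) (a : A) (z) : rep f a z = f.1 (z, a) := rfl

lemma rep_pt (f : MapSpace p q A (X.level l)) : rep f A.pt = Rep.base X p q l :=
  Rep.ext fun _ => f.2.2.1 _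

lemma rep_base (a : A) : rep (base p q A (X.level l)) a = Rep.base X p q l := rfl

lemma rep_smul (f : MapSpace p q A (X.level l)) (g : G) (a : A) :
    rep f (g • a) = g • rep f a := by
  ext z
  rw [Rep.smul_apply, rep_apply, rep_apply, ← f.2.2.2, permute_permute, mul_inv_cancel]
  congr 2
  exact (shift_one z).symm

lemma rep_ext {f f' : MapSpace p q A (X.level l)} (h : ∀ a, rep f a = rep f' a) : f = f' :=
  Subtype.ext (ContinuousMap.ext fun x => DFunLike.congr_fun (h x.2) x.1)

lemma continuous_rep [LocallyCompactSpace A] :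
    Continuous fun x : MapSpace p q A (X.level l) × A => rep x.1 x.2 :=
  continuous_of_uncurry (Continuous.eval
    (f := fun x : (MapSpace p q A (X.level l) × A) × 𝕋(G, p, q) => x.1.1.1)
    (continuous_subtype_val.comp (by fun_prop))
    (g := fun x : (MapSpace p q A (X.level l) × A) × 𝕋(G, p, q) => (x.2, x.1.2))
    (by fun_prop))

lemma exists_rep_eq {W : Type*} [TopologicalSpace W] {f : W × A → Rep X p q l}
    (hf : Continuous f) (hpt : ∀ w, f (w, A.pt) = Rep.base X p q l)
    (he : ∀ (g : G) w a, f (w, g • a) = g • f (w, a)) :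
    ∃ F : W → MapSpace p q A (X.level l), Continuous F ∧ ∀ w a, rep (F w) a = f (w, a) := by
  have hc : Continuous fun x : W × (𝕋(G, p, q) × A) => f (x.1, x.2.2) x.2.1 :=
    (hf.comp (by fun_prop)).eval (by fun_prop)
  let F : W → MapSpace p q A (X.level l) := fun w =>
    ⟨⟨fun x => f (w, x.2) x.1, hc.comp (continuous_const.prodMk continuous_id)⟩,
      fun z a h => (f (w, a)).infty h, fun z => by
        change f (w, A.pt) z = _
        rw [hpt]; rfl, fun g z a => by
        change f (w, g • a) (permute g z) = g • f (w, a) z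
        rw [he, smul_permute]⟩
  exact ⟨F, Continuous.subtype_mk
    (ContinuousMap.continuous_of_continuous_uncurry _ hc) _, fun _ _ => rfl⟩

lemma rep_stabilize [LocallyCompactSpace A] (f : MapSpace p q A (X.level l)) (a : A) :
    rep (stabilize X A p q l f) a = stab (rep f a) := rfl

/-- A loop in a mapping space, as a loop of maps. -/
def loopRep (γ : Path (base p q A (X.level l)) (base p q A (X.level l)))
    (w : I × A) : Rep X p q l := rep (γ w.1) w.2

lemma isLoopMap_loopRep [LocallyCompactSpace A]
    (γ : Path (base p q A (X.level l)) (base p q A (X.level l))) :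
    IsLoopMap (MonoidHom.id G) A.pt (loopRep γ) where
  cont := by
    exact continuous_rep.comp (f := fun w : I × A => (γ w.1, w.2)) (by fun_prop)
  zero a := by rw [loopRep, γ.source, rep_base]
  one a := by rw [loopRep, γ.target, rep_base]
  pt s := rep_pt _
  equi g s a := rep_smul _ _ _

lemma exists_loopRep_eq {f : I × A → Rep X p q l} (hf : IsLoopMap (MonoidHom.id G) A.pt f) :
    ∃ γ : Path (base p q A (X.level l)) (base p q A (X.level l)), loopRep γ = f := by
  obtain ⟨F, hF, hFf⟩ := exists_rep_eq hf.cont hf.pt fun g s a => hf.equi g s a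
  refine ⟨⟨⟨F, hF⟩, rep_ext fun a => ?_, rep_ext fun a => ?_⟩, funext fun w => hFf _ _⟩
  · exact (hFf _ _).trans (hf.zero a)
  · exact (hFf _ _).trans (hf.one a)

lemma homotopic_refl_iff [LocallyCompactSpace A]
    (γ : Path (base p q A (X.level l)) (base p q A (X.level l))) :
    γ.Homotopic (Path.refl _) ↔ LoopNull (MonoidHom.id G) A.pt p q l (loopRep γ) := by
  constructor
  · rintro ⟨F⟩
    refine ⟨fun x => rep (F (x.1, x.2.1)) x.2.2,
      continuous_rep.comp ((F.continuous.comp (by fun_prop)).prodMk (by fun_prop)),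
      fun t => isLoopMap_loopRep (F.eval t), fun w => ?_, fun w => ?_⟩
    · change rep (F (0, w.1)) w.2 = rep (γ w.1) w.2
      rw [F.apply_zero]; rfl
    · change rep (F (1, w.1)) w.2 = _
      rw [F.apply_one]; rfl
  · rintro ⟨H, hH, hl, h0, h1⟩
    obtain ⟨F, hF, hFH⟩ := exists_rep_eq (W := I × I)
      (f := fun x => H (x.1.1, (x.1.2, x.2))) (hH.comp (by fun_prop))
      (fun w => (hl w.1).pt w.2) (fun g w a => (hl w.1).equi g w.2 a)
    have hF0 : ∀ s, F (0, s) = γ s := fun s => rep_ext fun a => (hFH _ _).trans (h0 (s, a))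
    have hF1 : ∀ s, F (1, s) = base p q A (X.level l) :=
      fun s => rep_ext fun a => (hFH _ _).trans (h1 (s, a))
    have hFl : ∀ t, F (t, 0) = base p q A (X.level l) :=
      fun t => rep_ext fun a => (hFH _ _).trans ((hl t).zero a)
    have hFr : ∀ t, F (t, 1) = base p q A (X.level l) :=
      fun t => rep_ext fun a => (hFH _ _).trans ((hl t).one a)
    refine ⟨⟨⟨⟨F, hF⟩, hF0, hF1⟩, ?_⟩⟩
    rintro t s (rfl | hs)
    · exact (hFl t).trans γ.source.symm
    · obtain rfl : s = 1 := hs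
      exact (hFr t).trans γ.target.symm

end MapSpace

section Cls

variable (X) (k : ℤ) (A : PtGSpace G) [LocallyCompactSpace A]

/-- The space of maps at a stage of `stableSeq`. -/
abbrev StageMap (N : ℕ) : Type u :=
  MapSpace (X.e + (k - 1).toNat + N) (X.d + (1 - k).toNat + N) A (X.level ((1 - k).toNat + N))

/-- The constant map at a stage of `stableSeq`. -/
abbrev stageBase (N : ℕ) : StageMap X k A N := MapSpace.base _ _ _ _

/-- The stable class of a loop of maps. -/
def cls (N : ℕ) : FundamentalGroup (StageMap X k A N) (stageBase X k A N) →* stableMaps k A X :=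
  GrpCat.Hom.hom ((GrpCat.FilteredColimits.colimitCocone.{0, u} (stableSeq k A X)).ι.app N)

lemma exists_cls (x : stableMaps k A X) :
    ∃ (N : ℕ) (γ : Path (stageBase X k A N) (stageBase X k A N)),
      cls X k A N (fromPath (.mk γ)) = x := by
  obtain ⟨N, y, hy⟩ := (stableSeq k A X ⋙ forget GrpCat).ιColimitType_jointly_surjective x
  obtain ⟨γ, rfl⟩ := Quotient.mk_surjective y
  exact ⟨N, γ, hy⟩

variable {X k A}

lemma stableSeq_map_succ (N : ℕ) (a : FundamentalGroup (StageMap X k A N) (stageBase X k A N)) :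
    ((stableSeq k A X).map (homOfLE N.le_succ)).hom a =
      FundamentalGroup.mapOfEq (stabilize X A _ _ _) (stabilize_base X A _ _ _) a := by
  have := Functor.ofSequence_map_homOfLE_succ (X := fun n => GrpCat.of (FundamentalGroup
      (StageMap X k A n) (stageBase X k A n))) (fun n => GrpCat.ofHom (FundamentalGroup.mapOfEq
      (stabilize X A _ _ _) (stabilize_base X A _ _ _))) N
  exact DFunLike.congr_fun (congrArg GrpCat.Hom.hom this) a

lemma cls_succ (N : ℕ) (γ : Path (stageBase X k A N) (stageBase X k A N))
    (γ' : Path (stageBase X k A (N + 1)) (stageBase X k A (N + 1)))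
    (h : ∀ s, γ' s = stabilize X A _ _ _ (γ s)) :
    cls X k A (N + 1) (fromPath (.mk γ')) =
      cls X k A N (fromPath (.mk γ)) := by
  have h1 := DFunLike.congr_fun (congrArg GrpCat.Hom.hom ((GrpCat.FilteredColimits.colimitCocone.{0, u}
    (stableSeq k A X)).w (homOfLE N.le_succ))) (fromPath (.mk γ))
  refine Eq.trans ?_ h1
  have h2 := stableSeq_map_succ N (fromPath (.mk γ))
  rw [FundamentalGroup.mapOfEq_apply] at h2
  obtain rfl : γ' = (γ.map (stabilize X A _ _ _).continuous).cast (stabilize_base X A _ _ _).symm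
    (stabilize_base X A _ _ _).symm := Path.ext (funext h)
  exact congrArg (cls X k A (N + 1)) h2.symm

lemma cls_eq_one_iff (γ : Path (stageBase X k A N) (stageBase X k A N)) :
    cls X k A N (fromPath (.mk γ)) = 1 ↔
      ∃ m, After (LoopNull (MonoidHom.id G) A.pt) m (MapSpace.loopRep γ) := by
  constructor
  · intro h
    have h' : cls X k A N (fromPath (.mk γ)) =
      cls X k A N 1 := h.trans (map_one _).symm
    have h2 := ((stableSeq k A X ⋙ forget GrpCat).ιColimitType_eq_iff _ _).1 h'
    rw [← Types.FilteredColimit.rel_eq_eqvGen_colimitTypeRel] at h2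
    obtain ⟨N', f, g, (hfg : ((stableSeq k A X).map f).hom _ = ((stableSeq k A X).map g).hom 1)⟩ := h2
    obtain rfl : f = g := Subsingleton.elim _ _
    obtain ⟨d, rfl⟩ := Nat.exists_eq_add_of_le (leOfHom f)
    rw [map_one] at hfg
    clear h h'
    induction d generalizing N with
    | zero =>
      obtain rfl : f = 𝟙 N := Subsingleton.elim _ _
      rw [CategoryTheory.Functor.map_id] at hfg
      exact ⟨0, (MapSpace.homotopic_refl_iff γ).1 (Quotient.exact hfg)⟩
    | succ d ih =>
      have key : ∀ (k' : ℕ) (hk' : k' = N + 1 + d) (f : N ⟶ k'),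
          ((stableSeq k A X).map f).hom (fromPath (.mk γ)) = 1 →
          ∃ m, After (LoopNull (MonoidHom.id G) A.pt) m (MapSpace.loopRep γ) := by
        rintro _ rfl f hf
        obtain rfl : f = homOfLE N.le_succ ≫ homOfLE (Nat.le_add_right (N + 1) d) :=
          Subsingleton.elim _ _
        rw [CategoryTheory.Functor.map_comp] at hf
        have h2 := stableSeq_map_succ N (fromPath (.mk γ))
        rw [FundamentalGroup.mapOfEq_apply] at h2
        obtain ⟨m, hm⟩ := ih (N := N + 1) ((γ.map (stabilize X A _ _ _).continuous).cast
          (stabilize_base X A _ _ _).symm (stabilize_base X A _ _ _).symm) _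
          ((congrArg (GrpCat.Hom.hom ((stableSeq k A X).map _)) h2.symm).trans hf)
        exact ⟨m + 1, hm⟩
      exact key _ (by change N + (d + 1) = _; omega) f hfg
  · rintro ⟨m, hm⟩
    induction m generalizing N with
    | zero =>
      have := (MapSpace.homotopic_refl_iff γ).2 hm
      rw [Path.Homotopic.Quotient.eq.2 this]
      exact map_one _
    | succ m ih =>
      let γ' : Path (stageBase X k A (N + 1)) (stageBase X k A (N + 1)) :=
        (γ.map (stabilize X A _ _ _).continuous).cast
          (stabilize_base X A _ _ _).symm (stabilize_base X A _ _ _).symm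
      rw [← cls_succ N γ γ' fun _ => rfl]
      exact ih (N := N + 1) γ' hm

end Cls

end

section

variable {G : Type u} [Group G] {X : GPrespectrum G}

section Cube

/-- The cube as a parametrization of the torus of trivial coordinates. -/
def cube (G : Type u) (x : Fin j → ℝ) : 𝕋(G, j, 0)
  | Sum.inl i => collapse (x i)
  | Sum.inr (i, _) => i.elim0

variable {j : ℕ}

lemma continuous_cube : Continuous (cube G : (Fin j → ℝ) → 𝕋(G, j, 0)) := by
  refine continuous_pi fun t => ?_
  rcases t with i | ⟨i, g⟩
  · exact continuous_collapse.comp (continuous_apply i)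
  · exact i.elim0

lemma cube_surjective (ζ : 𝕋(G, j, 0)) : ∃ x : Fin j → ℝ, cube G x = ζ := by
  choose s hs hs' using fun i => exists_collapse (ζ (.inl i))
  refine ⟨s, funext fun t => ?_⟩
  rcases t with i | ⟨i, g⟩
  · exact hs' i
  · exact i.elim0

lemma permute_cube (g : G) (x : Fin j → ℝ) : permute g (cube G x) = cube G x := by
  ext (i | ⟨i, g⟩)
  · rfl
  · exact i.elim0

lemma exists_cube_eq_infty : (∃ t, cube G x t = ∞) ↔ ∃ i, 1 ≤ |x i| := by
  constructor
  · rintro ⟨i | ⟨i, g⟩, h⟩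
    · exact ⟨i, collapse_eq_infty.1 h⟩
    · exact i.elim0
  · rintro ⟨i, h⟩
    exact ⟨.inl i, collapse_eq_infty.2 h⟩

lemma one_le_norm_iff {x : Fin j → ℝ} : 1 ≤ ‖x‖ ↔ ∃ i, 1 ≤ |x i| := by
  rw [← not_lt, pi_norm_lt_iff one_pos]
  push Not
  rfl

namespace Rep

variable {p q l P Q : ℕ} (hP : P = p + j) (hQ : Q = q + 0)

lemma unabs_cube_ext
    (h : ∀ x, unabs hP hQ F (cube G x) = unabs hP hQ F' (cube G x)) : F = F' :=
  unabs_ext hP hQ fun ζ => by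
    obtain ⟨x, rfl⟩ := cube_surjective ζ
    exact h x

lemma unabs_cube_smul (g : G) (F : Rep X P Q l) (x : Fin j → ℝ) :
    unabs hP hQ (g • F) (cube G x) = g • unabs hP hQ F (cube G x) := by
  conv_lhs => rw [← permute_cube g x]
  exact unabs_smul hP hQ g F _

lemma continuous_unabs_cube :
    Continuous fun x : Rep X P Q l × (Fin j → ℝ) => unabs hP hQ x.1 (cube G x.2) :=
  (continuous_unabs hP hQ).comp (continuous_fst.prodMk (continuous_cube.comp continuous_snd))

lemma unabs_cube_of_ge (F : Rep X P Q l) (h : ∃ i, 1 ≤ |x i|) :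
    unabs hP hQ F (cube G x) = base X p q l :=
  unabs_infty hP hQ F (exists_cube_eq_infty.2 h)

lemma exists_absorb_cube [TopologicalSpace W]
    (hf : Continuous f) (h : ∀ w x, (∃ i, 1 ≤ |x i|) → f (w, x) = base X p q l) :
    ∃ F : W → Rep X P Q l, Continuous F ∧ ∀ w x, unabs hP hQ (F w) (cube G x) = f (w, x) := by
  obtain ⟨f', hf', hff', hinf⟩ := exists_descend_collapse hf h
  obtain ⟨F, hF, hFf⟩ := exists_absorb hP hQ
    (f := fun z : W × 𝕋(G, j, 0) => f' (z.1, fun i => z.2 (Sum.inl i)))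
    (hf'.comp (by fun_prop)) (by
      rintro w ζ ⟨i | ⟨i, g⟩, ht⟩
      · exact hinf w _ ⟨i, ht⟩
      · exact i.elim0)
  refine ⟨F, hF, fun w x => ?_⟩
  rw [hFf, ← hff']
  rfl

end Rep

/-- The interval as a parametrization of the circle. -/
def circ (G : Type u) (s : I) : 𝕋(G, 1, 0) := cube G fun _ => 2 * (s : ℝ) - 1

lemma circ_zero : ∃ t, circ G 0 t = ∞ :=
  exists_cube_eq_infty.2 ⟨0, by simp⟩

lemma circ_one : ∃ t, circ G 1 t = ∞ :=
  exists_cube_eq_infty.2 ⟨0, by norm_num⟩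

lemma continuous_circ : Continuous (circ G) := continuous_cube.comp (by fun_prop)

lemma circ_surjective (ζ : 𝕋(G, 1, 0)) : ∃ s, circ G s = ζ := by
  obtain ⟨s, hs, hs'⟩ := exists_collapse (ζ (.inl 0))
  refine ⟨⟨(s + 1) / 2, by linarith [hs.1], by linarith [hs.2]⟩, funext fun t => ?_⟩
  rcases t with i | ⟨i, g⟩
  · rw [Subsingleton.elim i 0, ← hs']
    change collapse (2 * ((s + 1) / 2) - 1) = _
    congr 1
    ring
  · exact i.elim0

namespace Rep

variable {p q l P Q : ℕ} (hP : P = p + 1) (hQ : Q = q + 0)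

lemma unabs_circ_ext
    (h : ∀ s, unabs hP hQ F (circ G s) = unabs hP hQ F' (circ G s)) : F = F' :=
  unabs_ext hP hQ fun ζ => by
    obtain ⟨x, rfl⟩ := circ_surjective ζ
    exact h x

lemma unabs_circ_zero (F : Rep X P Q l) : unabs hP hQ F (circ G 0) = base X p q l :=
  unabs_infty hP hQ F circ_zero

lemma unabs_circ_one (F : Rep X P Q l) : unabs hP hQ F (circ G 1) = base X p q l :=
  unabs_infty hP hQ F circ_one

lemma continuous_unabs_circ :
    Continuous fun x : Rep X P Q l × I => unabs hP hQ x.1 (circ G x.2) :=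
  (continuous_unabs hP hQ).comp (continuous_fst.prodMk (continuous_circ.comp continuous_snd))

lemma unabs_circ_smul (g : G) (F : Rep X P Q l) (s : I) :
    unabs hP hQ (g • F) (circ G s) = g • unabs hP hQ F (circ G s) := unabs_cube_smul hP hQ g F _

lemma exists_absorb_circ [TopologicalSpace W]
    (hf : Continuous f) (h0 : ∀ w, f (w, 0) = base X p q l) (h1 : ∀ w, f (w, 1) = base X p q l) :
    ∃ F : W → Rep X P Q l, Continuous F ∧ ∀ w s, unabs hP hQ (F w) (circ G s) = f (w, s) := by
  obtain ⟨F, hF, hFf⟩ := exists_absorb_cube hP hQ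
    (f := fun z : W × (Fin 1 → ℝ) => f (z.1, projIcc 0 1 zero_le_one ((z.2 0 + 1) / 2)))
    (hf.comp (by fun_prop)) (by
      rintro w x ⟨i, hi⟩
      rw [Subsingleton.elim i 0] at hi
      rcases le_abs'.1 hi with hi | hi
      · rw [projIcc_of_le_left _ (by linarith)]
        exact h0 w
      · rw [projIcc_of_right_le _ (by linarith)]
        exact h1 w)
  refine ⟨F, hF, fun w s => (hFf _ _).trans ?_⟩
  have : ((2 * (s : ℝ) - 1) + 1) / 2 = s := by ring
  rw [this, projIcc_val]

end Rep

end Cube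

section Orbit

variable {p q l : ℕ} {W : Type*} (K : Subgroup G)

/-- The extension of a map of `K`-invariant maps to the orbit `G/K`. -/
def orbitExt (u : W → Rep X p q l) : W × orbit K → Rep X p q l
  | (w, some a) => Quotient.out (a : G ⧸ K) • u w
  | (_, none) => Rep.base X p q l

/-- The base coset. -/
def coset : orbit K := some ((1 : G) : G ⧸ K)

variable {K}

lemma orbitExt_mk (hu : ∀ w, ∀ g ∈ K, g • u w = u w) (w : W) (g : G) :
    orbitExt K u (w, some (g : G ⧸ K)) = g • u w := by
  change Quotient.out (g : G ⧸ K) • u w = g • u w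
  have h :=
    QuotientGroup.eq.1 (QuotientGroup.out_eq' (g : G ⧸ K)).symm
  conv_lhs => rw [← mul_inv_cancel_left g (Quotient.out (g : G ⧸ K)), mul_smul, hu w _ h]

lemma orbitExt_coset (hu : ∀ w, ∀ g ∈ K, g • u w = u w) (w : W) :
    orbitExt K u (w, coset K) = u w := (orbitExt_mk hu w 1).trans (one_smul _ _)

lemma orbitExt_smul (hu : ∀ w, ∀ g ∈ K, g • u w = u w) (g : G) (w : W)
    (a : orbit K) : orbitExt K u (w, g • a) = g • orbitExt K u (w, a) := by
  rcases a with _ | a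
  · exact (smul_base g).symm
  · induction a using QuotientGroup.induction_on with | H h =>
    refine Eq.trans ?_ ((orbitExt_mk hu w (g * h)).trans ?_)
    · rfl
    · rw [mul_smul, ← orbitExt_mk hu w h]

lemma continuous_orbitExt [TopologicalSpace W] {u : W → Rep X p q l} (hu : Continuous u) :
    Continuous (orbitExt K u) := by
  rw [continuous_prod_of_discrete_right]
  rintro (_ | a)
  · exact continuous_const
  · exact (continuous_const_smul _).comp hu

lemma smul_coset (hg : g ∈ K) : g • coset K = coset K := by
  refine congrArg some ?_
  change ((g * 1 : G) : G ⧸ K) = _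
  rw [mul_one]
  exact QuotientGroup.eq.2 (by simpa using hg)

lemma exists_smul_coset (a : orbit K) : a = (orbit K).pt ∨ ∃ g : G, a = g • coset K := by
  rcases a with _ | a
  · exact .inl rfl
  · induction a using QuotientGroup.induction_on with | H h =>
    refine .inr ⟨h, congrArg some ?_⟩
    change _ = ((h * 1 : G) : G ⧸ K)
    rw [mul_one]

lemma isLoopMap_orbitExt {u : I → Rep X p q l} (hu : ∀ w, ∀ g ∈ K, g • u w = u w)
    (hc : Continuous u) (h0 : u 0 = Rep.base X p q l) (h1 : u 1 = Rep.base X p q l) :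
    IsLoopMap (MonoidHom.id G) (orbit K).pt (orbitExt K u) where
  cont := continuous_orbitExt hc
  zero a := by
    rcases a with _ | a
    · rfl
    · change _ • u 0 = _
      rw [h0, smul_base]
  one a := by
    rcases a with _ | a
    · rfl
    · change _ • u 1 = _
      rw [h1, smul_base]
  pt _ := rfl
  equi g s a := orbitExt_smul hu g s a

end Orbit

section Vanishing

/-- The homotopy groups in nonzero degrees vanish. -/
def Concentrated (X : GPrespectrum G) : Prop :=
  ∀ (K : Subgroup G) (n : ℤ), n ≠ 0 → Subsingleton (stableMaps n (orbit K) X)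

/-- The point can be connected to the base point through `K`-invariant points. -/
def ConnBase (K : Subgroup G) (p q l : ℕ) (f : Unit → Rep X p q l) : Prop :=
  ∃ c : I → Rep X p q l, Continuous c ∧ c 0 = f () ∧ c 1 = Rep.base X p q l ∧
    ∀ t, ∀ g ∈ K, g • c t = c t

lemma exists_after_connBase_of_lt (hX : Concentrated X) (K : Subgroup G)
    {x : Rep X p q l} (hx : ∀ g ∈ K, g • x = x) (hq : q = X.d + l) (hp : p ≠ X.e + l)
    (hpe : X.e < p) : ∃ m, After (ConnBase K) m fun _ => x := by
  obtain ⟨n, N, hn, hp, hq, hl⟩ : ∃ (n : ℤ) (N : ℕ), n ≠ 0 ∧ p = X.e + (n - 1).toNat + N + 1 ∧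
      q = X.d + (1 - n).toNat + N ∧ l = (1 - n).toNat + N :=
    ⟨(p : ℤ) - X.e - l, min l (p - 1 - X.e), by omega, by omega, by omega, by omega⟩
  subst hp hq hl
  have hQ : X.d + (1 - n).toNat + N = X.d + (1 - n).toNat + N + 0 := rfl
  have hu : ∀ s, ∀ g ∈ K, g • unabs rfl hQ x (circ G s) = unabs rfl hQ x (circ G s) :=
    fun s g hg => by rw [← unabs_circ_smul, hx g hg]
  obtain ⟨γ, hγ⟩ := MapSpace.exists_loopRep_eq
    (isLoopMap_orbitExt hu ((continuous_unabs_circ rfl hQ).comp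
      (continuous_const.prodMk continuous_id)) (unabs_circ_zero rfl hQ x)
      (unabs_circ_one rfl hQ x))
  have := hX K n hn
  obtain ⟨m, hm⟩ := (cls_eq_one_iff γ).1 (Subsingleton.elim _ _)
  refine ⟨m, hm.transport (N' := ConnBase K) (fun p q l p' q' f f' =>
    ∃ hP hQ, ∀ s, unabs hP hQ (f' ()) (circ G s) =
      f (s, coset K)) ?_ ?_ ⟨rfl, rfl, fun s => ?_⟩⟩
  · rintro p q l p' q' f f' ⟨hP, hQ, h⟩
    refine ⟨by omega, by omega, fun s => ?_⟩
    rw [unabs_stab hP hQ, h]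
  · rintro p q l p' q' f f' ⟨hP, hQ, h⟩ ⟨H, hH, hl, h0, h1⟩
    obtain ⟨F, hF, hFf⟩ := exists_absorb_circ hP hQ
      (f := fun z : I × I => H (z.1, (z.2, coset K)))
      (hH.comp (by fun_prop)) (fun t => (hl t).zero _) fun t => (hl t).one _
    refine ⟨F, hF, unabs_circ_ext hP hQ fun s => ?_, unabs_circ_ext hP hQ fun s => ?_,
      fun t g hg => unabs_circ_ext hP hQ fun s => ?_⟩
    · rw [hFf, h0, h]
    · rw [hFf, h1, unabs_base]
    · rw [unabs_circ_smul, hFf]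
      exact ((hl t).equi g s (coset K)).symm.trans (by rw [smul_coset hg])
  · rw [hγ, orbitExt_coset hu]

lemma exists_after_connBase (hX : Concentrated X) (K : Subgroup G)
    {x : Rep X p q l} (hx : ∀ g ∈ K, g • x = x) (hq : q = X.d + l) (hp : p ≠ X.e + l) :
    ∃ m, After (ConnBase K) m fun _ => x := by
  obtain ⟨c, hc⟩ : ∃ c, X.e < p + c := ⟨X.e + 1, by omega⟩
  induction c generalizing p q l with
  | zero => exact exists_after_connBase_of_lt hX K hx hq hp hc
  | succ c ih =>
    obtain ⟨m, hm⟩ := ih (fun g hg => by rw [← stab_smul, hx g hg])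
      (by omega) (by omega) (by omega)
    exact ⟨m + 1, hm⟩

variable {Γ : Type w} [Group Γ] (ι : Γ →* G)

/-- Maps on a normed space that are trivial outside of the unit ball, and null homotopic through
invariant such maps. -/
def MapNull (H : Subgroup Γ) [NormedAddCommGroup E] (p q l : ℕ)
    (f : E → Rep X p q l) : Prop :=
  ∃ N : I × E → Rep X p q l, Continuous N ∧ (∀ x, N (0, x) = f x) ∧
    (∀ x, N (1, x) = Rep.base X p q l) ∧ (∀ t x, 1 ≤ ‖x‖ → N (t, x) = Rep.base X p q l) ∧
    ∀ t x, ∀ g ∈ H, ι g • N (t, x) = N (t, x)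

lemma evNull_of_after [NormedAddCommGroup E] [NormedSpace ℝ E] {u : E → Rep X (p + n) (q + n) (l + n)} (h : After (MapNull ι H) m u) :
    (towerOf X ι p q l).EvNull H (n := n) u := by
  obtain ⟨n', hn, N, hN, hN0, hN1, hNb, hNf⟩ := h.exists_map ι
  refine ⟨n', hn, fun z => N (projIcc 0 1 zero_le_one z.1, z.2), hN.comp (by fun_prop),
    fun x => ?_, fun x => ?_, fun t x hx => hNb _ x hx, fun t x => hNf _ x⟩
  · simp only [projIcc_left]
    exact hN0 x
  · simp only [projIcc_right]
    exact hN1 x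

lemma piTriv_towerOf (hX : Concentrated X) (hq : q = X.d + l) (H : Subgroup Γ)
    {j : ℕ} (hj : p + j ≠ X.e + l) : (towerOf X ι p q l).PiTriv H j := by
  intro n u hu hu1 huf
  obtain ⟨F, hF, hFf⟩ := exists_absorb_cube rfl rfl
    (f := fun z : Unit × (Fin j → ℝ) => u z.2) (hu.comp continuous_snd)
    fun _ x hx => hu1 x (one_le_norm_iff.2 hx)
  obtain ⟨m, hm⟩ := exists_after_connBase hX (H.map ι) (x := F ()) (by
    rintro _ ⟨g, hg, rfl⟩
    refine unabs_cube_ext rfl rfl fun x => ?_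
    rw [unabs_cube_smul, hFf]
    exact huf x g hg) (by omega) (by omega)
  refine evNull_of_after ι (hm.transport (N' := MapNull ι H) (fun p q l p' q' f f' =>
    ∃ hP hQ, ∀ x, unabs hP hQ (f ()) (cube G x) = f' x)
    (f' := u) ?_ ?_ ⟨rfl, rfl, fun x => hFf () x⟩)
  · rintro p q l p' q' f f' ⟨hP, hQ, h⟩
    refine ⟨by omega, by omega, fun s => ?_⟩
    rw [unabs_stab hP hQ, h]
  · rintro p q l p' q' f f' ⟨hP, hQ, h⟩ ⟨c, hc, hc0, hc1, hcf⟩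
    refine ⟨fun z => unabs hP hQ (c z.1) (cube G z.2), (continuous_unabs_cube hP hQ).comp
        ((hc.comp continuous_fst).prodMk continuous_snd), fun x => ?_, fun x => ?_,
      fun t x hx => unabs_cube_of_ge hP hQ _ (one_le_norm_iff.1 hx), fun t x g hg => ?_⟩
    · simp only [hc0, h]
    · simp only [hc1, unabs_base]
    · rw [← unabs_cube_smul, hcf t _ (Subgroup.mem_map_of_mem ι hg)]

end Vanishing

end

section

variable {G : Type u} [Group G] {X : GPrespectrum G}

section Restriction

variable {K L : Subgroup G} (f : (G ⧸ K) →[G] (G ⧸ L))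

lemma restriction_cls (k : ℤ) (N : ℕ) (γ : Path (stageBase X k (orbit L) N) (stageBase X k (orbit L) N))
    (γ' : Path (stageBase X k (orbit K) N) (stageBase X k (orbit K) N))
    (h : ∀ s, γ' s = MapSpace.precomp _ _ f _ (γ s)) :
    restriction k f X (cls X k (orbit L) N (fromPath (.mk γ))) =
      cls X k (orbit K) N (fromPath (.mk γ')) := by
  obtain rfl : γ' = γ.map (MapSpace.precomp _ _ f _).continuous := Path.ext (funext h)
  have h1 := DFunLike.congr_fun (congrArg GrpCat.Hom.hom
    (IsColimit.ι_map (GrpCat.FilteredColimits.colimitCoconeIsColimit.{0, u}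
      (stableSeq k (orbit L) X)) (GrpCat.FilteredColimits.colimitCocone.{0, u}
      (stableSeq k (orbit K) X)) (NatTrans.ofSequence (fun n => GrpCat.ofHom (FundamentalGroup.mapOfEq
      (MapSpace.precomp _ _ f _) (MapSpace.precomp_base _ _ f _))) (fun n => by
        simp only [stableSeq, Functor.ofSequence_map_homOfLE_succ]
        refine GrpCat.hom_ext ?_
        refine (mapOfEq_comp_mapOfEq _ _ (stabilize_base X _ _ _ _)
          (MapSpace.precomp_base _ _ f _)).trans (Eq.trans ?_ (mapOfEq_comp_mapOfEq _ _
            (MapSpace.precomp_base _ _ f _) (stabilize_base X _ _ _ _)).symm)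
        rfl)) N)) (fromPath (.mk γ))
  refine h1.trans ?_
  have h2 := FundamentalGroup.mapOfEq_apply
    (MapSpace.precomp (X.e + (k - 1).toNat + N) (X.d + (1 - k).toNat + N) f
      (X.level ((1 - k).toNat + N))) (MapSpace.precomp_base _ _ f _) (fromPath (.mk γ))
  exact congrArg (cls X k (orbit K) N) h2

end Restriction

namespace Rep

variable {p q l p' q' l' : ℕ}

/-- Transport along equalities of the indices. -/
def castRep (hp : p = p') (hq : q = q') (hl : l = l') : C(Rep X p q l, Rep X p' q' l') := by
  subst hp hq hl
  exact ContinuousMap.id _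

variable (hp : p = p') (hq : q = q') (hl : l = l')

lemma castRep_base : castRep hp hq hl (base X p q l) = base X p' q' l' := by
  subst hp hq hl; rfl

lemma castRep_smul (g : G) (f : Rep X p q l) :
    castRep hp hq hl (g • f) = g • castRep hp hq hl f := by
  subst hp hq hl; rfl

lemma castRep_stab (hp' : p + 1 = p' + 1) (hq' : q + 1 = q' + 1) (hl' : l + 1 = l' + 1)
    (f : Rep X p q l) : castRep hp' hq' hl' (stab f) = stab (castRep hp hq hl f) := by
  subst hp hq hl; rfl

lemma castRep_rfl (f : Rep X p q l) : castRep rfl rfl rfl f = f := rfl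

lemma castRep_castRep (hp' : p' = p'') (hq' : q' = q'') (hl' : l' = l'')
    (f : Rep X p q l) : castRep hp' hq' hl' (castRep hp hq hl f) =
      castRep (hp.trans hp') (hq.trans hq') (hl.trans hl') f := by
  subst hp hq hl; rfl

lemma after_castRep {m : ℕ}
    {f : W → Rep X p q l} : After N m (fun w => castRep hp hq hl (f w)) ↔ After N m f := by
  subst hp hq hl; rfl

lemma stab_castRep (f : Rep X p q l) : stab (castRep hp hq hl f) =
    castRep (congrArg (· + 1) hp) (congrArg (· + 1) hq) (congrArg (· + 1) hl) (stab f) := by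
  subst hp hq hl; rfl

end Rep

section Value

variable (X) in
/-- The space of maps at a stage of the sequence computing the zeroth homotopy group. -/
abbrev ZeroRep (N : ℕ) : Type u :=
  Rep X (X.e + ((0 : ℤ) - 1).toNat + N) (X.d + (1 - (0 : ℤ)).toNat + N) ((1 - (0 : ℤ)).toNat + N)

lemma exists_freeExt (N : ℕ) : ∃ ev : C(ZeroRep X N, StageMap X 0 (orbit (⊥ : Subgroup G)) N),
    ∀ x, MapSpace.rep (ev x) (coset ⊥) = x := by
  have hu : ∀ (w : ZeroRep X N), ∀ g ∈ (⊥ : Subgroup G), g • id w = id w := fun w g hg => by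
    rw [Subgroup.mem_bot.1 hg, one_smul]
  obtain ⟨F, hF, h⟩ := MapSpace.exists_rep_eq
    (continuous_orbitExt continuous_id) (fun _ => rfl) fun g w a => orbitExt_smul hu g w a
  exact ⟨⟨F, hF⟩, fun x => (h _ _).trans (orbitExt_coset hu x)⟩

/-- The extension of maps to free orbits. -/
def freeExt (N : ℕ) : C(ZeroRep X N, StageMap X 0 (orbit (⊥ : Subgroup G)) N) :=
  (exists_freeExt N).choose

lemma rep_freeExt {N : ℕ} (x : ZeroRep X N) : MapSpace.rep (freeExt N x) (coset ⊥) = x :=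
  (exists_freeExt N).choose_spec x

lemma rep_ext_coset {p q l : ℕ} {K : Subgroup G} {f f' : MapSpace p q (orbit K) (X.level l)}
    (h : MapSpace.rep f (coset K) = MapSpace.rep f' (coset K)) : f = f' :=
  MapSpace.rep_ext fun a => by
    rcases exists_smul_coset a with rfl | ⟨g, rfl⟩
    · rw [MapSpace.rep_pt, MapSpace.rep_pt]
    · rw [MapSpace.rep_smul, MapSpace.rep_smul, h]

lemma freeExt_base (N : ℕ) : freeExt N (Rep.base X _ _ _) = stageBase X 0 (orbit ⊥) N :=
  rep_ext_coset ((rep_freeExt _).trans (MapSpace.rep_base _).symm)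

/-- A loop of maps gives a loop of maps on free orbits. -/
def freePath (γ : Path (Rep.base X (X.e + ((0 : ℤ) - 1).toNat + N)
    (X.d + (1 - (0 : ℤ)).toNat + N) ((1 - (0 : ℤ)).toNat + N)) (Rep.base X _ _ _)) :
    Path (stageBase X 0 (orbit ⊥) N) (stageBase X 0 (orbit ⊥) N) :=
  (γ.map (freeExt N).continuous).cast (freeExt_base N).symm (freeExt_base N).symm

variable {M : Type*} [AddCommGroup M]

/-- Compatible identifications of the zeroth homotopy groups with `M`. -/
structure ZeroCoeff (X : GPrespectrum G) (M : Type*) [AddCommGroup M] where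
  φ : ∀ K : Subgroup G, stableMaps 0 (orbit K) X ≃* Multiplicative M
  compat : ∀ (K L : Subgroup G) (f : (G ⧸ K) →[G] (G ⧸ L)) (x : stableMaps 0 (orbit L) X),
      φ K (restriction 0 f X x) = φ L x

variable (c : ZeroCoeff X M)

namespace ZeroCoeff

/-- The element of `M` given by a loop of maps. -/
def val (N : ℕ) (a : Path.Homotopic.Quotient (Rep.base X (X.e + ((0 : ℤ) - 1).toNat + N)
    (X.d + (1 - (0 : ℤ)).toNat + N) ((1 - (0 : ℤ)).toNat + N)) (Rep.base X _ _ _)) : M :=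
  Multiplicative.toAdd (c.φ ⊥ (cls X 0 (orbit ⊥) N (fromPath
    ((a.map (freeExt N)).cast (freeExt_base N).symm (freeExt_base N).symm))))

lemma val_mk (γ) : c.val N (.mk γ) = Multiplicative.toAdd (c.φ ⊥
    (cls X 0 (orbit ⊥) N (fromPath (.mk (freePath γ))))) := rfl

lemma val_trans (N : ℕ) (a b) : c.val N (a.trans b) = c.val N a + c.val N b := by
  have h : ∀ a b : Path.Homotopic.Quotient (stageBase X 0 (orbit (⊥ : Subgroup G)) N)
      (stageBase X 0 (orbit (⊥ : Subgroup G)) N),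
      cls X 0 (orbit ⊥) N (fromPath (a.trans b)) =
      cls X 0 (orbit ⊥) N (fromPath b) *
      cls X 0 (orbit ⊥) N (fromPath a) := fun a b => by
    rw [← map_mul]; rfl
  induction a using Path.Homotopic.Quotient.ind with | mk a =>
  induction b using Path.Homotopic.Quotient.ind with | mk b =>
  refine Eq.trans ?_ (add_comm _ _)
  rw [← Quotient.mk_trans, val_mk, val_mk, val_mk, ← toAdd_mul, ← map_mul,
    ← h, ← Quotient.mk_trans]
  congr 5
  ext s
  simp only [freePath, Path.cast_coe, Path.map_coe, Function.comp_apply, Path.trans_apply]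
  split_ifs <;> rfl

lemma val_eq {N : ℕ} (δ : Path (stageBase X 0 (orbit K) N) (stageBase X 0 (orbit K) N)) (γ)
    (h : ∀ s, γ s = MapSpace.rep (δ s) (coset K)) :
    c.val N (.mk γ) = Multiplicative.toAdd
      (c.φ K (cls X 0 (orbit K) N (fromPath (.mk δ)))) := by
  let f : (G ⧸ (⊥ : Subgroup G)) →[G] (G ⧸ K) :=
    ⟨Subgroup.quotientMapOfLE bot_le, fun g a => by
      induction a using QuotientGroup.induction_on with | H a => rfl⟩
  rw [val_mk, ← c.compat ⊥ K f, restriction_cls f 0 N δ (freePath γ)]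
  intro s
  refine rep_ext_coset ((rep_freeExt _).trans ?_)
  exact h s

lemma val_smul {N : ℕ} (g : G) (γ γ') (h : ∀ s, γ' s = g • γ s) :
    c.val N (.mk γ') = c.val N (.mk γ) := by
  let f : (G ⧸ (⊥ : Subgroup G)) →[G] (G ⧸ (⊥ : Subgroup G)) :=
    ⟨Quotient.map' (· * g) (fun a b hab => by
      rw [QuotientGroup.leftRel_apply, Subgroup.mem_bot] at hab ⊢
      rw [mul_inv_rev, mul_assoc, ← mul_assoc a⁻¹, hab]; simp), fun h a => by
      induction a using QuotientGroup.induction_on with | H a =>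
      exact congrArg _ (mul_assoc h a g)⟩
  rw [val_mk, val_mk, ← c.compat ⊥ ⊥ f (cls X 0 (orbit ⊥) N
    (fromPath (.mk (freePath γ)))), restriction_cls f 0 N (freePath γ) (freePath γ')]
  intro s
  refine rep_ext_coset ((rep_freeExt _).trans ?_)
  have h1 : orbitMap f (coset ⊥) = g • coset ⊥ := by
    refine congrArg some ?_
    change (((1 : G) * g : G) : G ⧸ (⊥ : Subgroup G)) = ((g * 1 : G) : G ⧸ (⊥ : Subgroup G))
    rw [one_mul, mul_one]
  rw [h s]
  change _ = MapSpace.rep (freeExt N (γ s)) (orbitMap f (coset ⊥))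
  rw [h1, MapSpace.rep_smul, rep_freeExt]

lemma val_succ {N : ℕ} (γ) (γ' : Path (Rep.base X (X.e + ((0 : ℤ) - 1).toNat + (N + 1))
    (X.d + (1 - (0 : ℤ)).toNat + (N + 1)) ((1 - (0 : ℤ)).toNat + (N + 1))) (Rep.base X _ _ _))
    (h : ∀ s, γ' s = stab (γ s)) :
    c.val (N + 1) (.mk γ') = c.val N (.mk γ) := by
  rw [val_mk, val_mk, cls_succ N (freePath γ) (freePath γ')]
  intro s
  refine rep_ext_coset ((rep_freeExt _).trans ?_)
  rw [h s, MapSpace.rep_stabilize]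
  exact congrArg stab (rep_freeExt _).symm

end ZeroCoeff

end Value

end

section

namespace Tower

variable {Γ : Type w} [Group Γ]

/-- An equivariant isomorphism of towers. -/
structure Iso (L L' : Tower.{v} Γ) where
  fw : ∀ n, C(L.obj n, L'.obj n)
  inv : ∀ n, C(L'.obj n, L.obj n)
  inv_fw : ∀ n x, inv n (fw n x) = x
  fw_inv : ∀ n x, fw n (inv n x) = x
  fw_pt : ∀ n, fw n (L.pt n) = L'.pt n
  fw_smul : ∀ n (g : Γ) x, fw n (g • x) = g • fw n x
  fw_step : ∀ n x, fw (n + 1) (L.step n x) = L'.step n (fw n x)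

namespace Iso

variable {L L' : Tower.{v} Γ} (i : L.Iso L')

lemma fw_map (h : n ≤ n') (x : L.obj n) : i.fw n' (L.map h x) = L'.map h (i.fw n x) := by
  induction n', h using Nat.le_induction with
  | base => rw [L.map_refl, L'.map_refl]
  | succ k hk ih => rw [L.map_succ hk, L'.map_succ hk, i.fw_step, ih]

lemma inv_pt (n : ℕ) : i.inv n (L'.pt n) = L.pt n := by rw [← i.fw_pt, i.inv_fw]

lemma inv_smul (n : ℕ) (g : Γ) (x) : i.inv n (g • x) = g • i.inv n x := by
  rw [← i.fw_inv n x, ← i.fw_smul, i.inv_fw, i.inv_fw]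

lemma inv_map (h : n ≤ n') (x : L'.obj n) :
    i.inv n' (L'.map h x) = L.map h (i.inv n x) := by
  rw [← i.fw_inv n x, ← i.fw_map, i.inv_fw, i.inv_fw]

lemma fixed_fw {x : L.obj n} (h : L.Fixed H x) :
    L'.Fixed H (i.fw n x) := fun g hg => by rw [← i.fw_smul, h g hg]

lemma fixed_inv {x : L'.obj n} (h : L'.Fixed H x) :
    L.Fixed H (i.inv n x) := fun g hg => by rw [← i.inv_smul, h g hg]

lemma evNull [NormedAddCommGroup E] [NormedSpace ℝ E]
    {u : E → L.obj n} (h : L'.EvNull H fun x => i.fw n (u x)) : L.EvNull H u := by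
  obtain ⟨n', hn, N, hN, h0, h1, hb, hf⟩ := h
  refine ⟨n', hn, fun z => i.inv n' (N z), (i.inv n').continuous.comp hN, fun x => ?_, fun x => ?_,
    fun t x hx => ?_, fun t x => i.fixed_inv (hf t x)⟩
  · simp only [h0, i.inv_map, i.inv_fw]
  · simp only [h1, i.inv_pt]
  · simp only [hb t x hx, i.inv_pt]

lemma fw_base (n : ℕ) : L'.pt n = i.fw n (L.pt n) := (i.fw_pt n).symm

/-- Transport of the structure of an Eilenberg-Mac Lane tower along an isomorphism. -/
def em1 {M : Type*} [AddCommGroup M] (e : L'.EM1 M) : L.EM1 M where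
  κ n a := e.κ n ((a.map (i.fw n)).cast (i.fw_base n) (i.fw_base n))
  κ_trans n a b := by
    rw [← e.κ_trans]
    induction a using Path.Homotopic.Quotient.ind with | mk a =>
    induction b using Path.Homotopic.Quotient.ind with | mk b =>
    rw [← Quotient.mk_trans, ← Quotient.mk_map,
      ← Quotient.mk_map, ← Quotient.mk_map,
      ← Quotient.mk_cast, ← Quotient.mk_cast,
      ← Quotient.mk_cast, ← Quotient.mk_trans]
    congr 2
    ext s
    simp only [Path.cast_coe, Path.map_coe, Function.comp_apply, Path.trans_apply]
    split_ifs <;> rfl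
  κ_step n γ γ' h := by
    refine e.κ_step n ((γ.map (i.fw n).continuous).cast (i.fw_base n) (i.fw_base n))
      ((γ'.map (i.fw _).continuous).cast (i.fw_base _) (i.fw_base _)) fun t => ?_
    simp only [Path.cast_coe, Path.map_coe, Function.comp_apply, h, i.fw_step]
  κ_smul n g γ γ' h := by
    refine e.κ_smul n g ((γ.map (i.fw n).continuous).cast (i.fw_base n) (i.fw_base n))
      ((γ'.map (i.fw _).continuous).cast (i.fw_base _) (i.fw_base _)) fun t => ?_
    simp only [Path.cast_coe, Path.map_coe, Function.comp_apply, h, i.fw_smul]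
  inj H n u hu h hf hκ := i.evNull (e.inj H n (fun x => i.fw n (u x)) ((i.fw n).continuous.comp hu)
    (fun x hx => by rw [h x hx, i.fw_pt]) (fun x => i.fixed_fw (hf x)) hκ)
  surj m := by
    obtain ⟨n, u, hu, h0, h1, hf, hκ⟩ := e.surj m
    refine ⟨n, fun x => i.inv n (u x), (i.inv n).continuous.comp hu, by simp only [h0, i.inv_pt],
      by simp only [h1, i.inv_pt], fun x => i.fixed_inv (hf x), ?_⟩
    rw [← hκ]
    refine congrArg (e.κ n) (congrArg Path.Homotopic.Quotient.mk (Path.ext (funext fun s => ?_)))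
    exact i.fw_inv n _
  piTriv H j hj n u hu h hf := i.evNull (e.piTriv H j hj n (fun x => i.fw n (u x))
    ((i.fw n).continuous.comp hu) (fun x hx => by rw [h x hx, i.fw_pt])
    (fun x => i.fixed_fw (hf x)))

end Iso

end Tower

variable {G : Type u} [Group G] {X : GPrespectrum G}

section LoopsIso

variable {Γ : Type w} [Group Γ] (ι : Γ →* G) (p q l : ℕ)

/-- The loops in a tower of maps are a tower of maps with one more trivial coordinate. -/
def loopsIso : (towerOf X ι p q l).loops.Iso (towerOf X ι (p + 1) q l) := by
  have hP : ∀ n, p + 1 + n = p + n + 1 := fun n => by omega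
  have key : ∀ n, ∃ F : (towerOf X ι p q l).Loop n → Rep X (p + 1 + n) (q + n) (l + n),
      Continuous F ∧ ∀ γ s, unabs (hP n) (m := 0) rfl (F γ) (circ G s) = γ s := fun n =>
    exists_absorb_circ (hP n) rfl (f := fun z : (towerOf X ι p q l).Loop n × I =>
      z.1 z.2) (continuous_eval (F := (towerOf X ι p q l).Loop n)) (fun γ => γ.zero) fun γ => γ.one
  choose F hF hFs using key
  have hu : ∀ n, Continuous fun x : Rep X (p + 1 + n) (q + n) (l + n) × I =>
    unabs (hP n) (m := 0) rfl x.1 (circ G x.2) := fun n => continuous_unabs_circ (hP n) rfl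
  exact
  { fw := fun n => ⟨F n, hF n⟩
    inv := fun n => ⟨fun x => ⟨⟨fun s => unabs (hP n) (m := 0) rfl x (circ G s),
      (hu n).comp (continuous_const.prodMk continuous_id)⟩, unabs_circ_zero _ _ _,
      unabs_circ_one _ _ _⟩, Tower.Loop.continuous_of_uncurry (hu n)⟩
    inv_fw := fun n γ => DFunLike.ext (F := (towerOf X ι p q l).Loop n) _ _ fun s => hFs n γ s
    fw_inv := fun n x => unabs_circ_ext (hP n) rfl fun s => hFs n _ s
    fw_pt := fun n => unabs_circ_ext (hP n) rfl fun s => hFs n _ s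
    fw_smul := fun n g γ => unabs_circ_ext (hP n) rfl fun s => (hFs n _ s).trans
      ((congrArg (ι g • ·) (hFs n γ s).symm).trans
        (unabs_circ_smul (hP n) rfl (ι g) (F n γ) s).symm)
    fw_step := fun n γ => unabs_circ_ext (hP (n + 1)) rfl fun s => (hFs (n + 1) _ s).trans
      ((congrArg stab (hFs n γ s).symm).trans
        (unabs_stab (q := q + n) (m := 0) (hP n) rfl (hP (n + 1)) rfl (F n γ) (circ G s)).symm) }

end LoopsIso

namespace ZeroCoeff

variable {M : Type*} [AddCommGroup M] (c : ZeroCoeff X M) {p q l : ℕ}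

/-- Maps of the degree of the zeroth homotopy group, as points of the sequence computing it. -/
def toZero (hp : p + 1 = X.e + l) (hq : q = X.d + l) : C(Rep X p q l, ZeroRep X l) :=
  (castRep (by omega) (by omega) (by omega)).comp stab

variable (hp : p + 1 = X.e + l) (hq : q = X.d + l)

lemma toZero_base : toZero hp hq (Rep.base X p q l) = Rep.base X _ _ _ := by
  rw [toZero, ContinuousMap.comp_apply, stab_base, castRep_base]

lemma toZero_smul (g : G) (x : Rep X p q l) : toZero hp hq (g • x) = g • toZero hp hq x := by
  simp only [toZero, ContinuousMap.comp_apply, stab_smul, castRep_smul]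

lemma toZero_stab (hp' : p + 1 + 1 = X.e + (l + 1)) (hq' : q + 1 = X.d + (l + 1))
    (x : Rep X p q l) : toZero hp' hq' (stab x) = stab (toZero hp hq x) := by
  exact castRep_stab _ _ _ _ _ _ _

lemma exists_cls_ge (k : ℤ) (A : PtGSpace G) [LocallyCompactSpace A] (N₀ : ℕ)
    (x : stableMaps k A X) : ∃ (N : ℕ) (γ : Path (stageBase X k A (N₀ + N)) (stageBase X k A (N₀ + N))),
      cls X k A (N₀ + N) (fromPath (.mk γ)) = x := by
  induction N₀ with
  | zero =>
    obtain ⟨N, γ, h⟩ := exists_cls X k A x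
    obtain ⟨N', rfl⟩ : ∃ N', N = 0 + N' := ⟨N, (zero_add N).symm⟩
    exact ⟨N', γ, h⟩
  | succ N₀ ih =>
    obtain ⟨N, γ, h⟩ := ih
    have : ∀ N', N' = N₀ + N + 1 → ∃ γ : Path (stageBase X k A N') (stageBase X k A N'),
        cls X k A N' (fromPath (.mk γ)) = x := by
      rintro _ rfl
      exact ⟨(γ.map (stabilize X A _ _ _).continuous).cast
        (stabilize_base X A _ _ _).symm (stabilize_base X A _ _ _).symm,
        (cls_succ _ γ _ fun _ => rfl).trans h⟩
    exact ⟨N, this _ (by omega)⟩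

include c in
lemma exists_after_mapNull {Γ : Type w} [Group Γ] (ι : Γ →* G) (H : Subgroup Γ)
    {u : ℝ → Rep X p q l} (hu : Continuous u) (hb : ∀ x, 1 ≤ ‖x‖ → u x = Rep.base X p q l)
    (hf : ∀ x, ∀ g ∈ H, ι g • u x = u x) {γ}
    (hγ : ∀ s : I, γ s = toZero hp hq (u (2 * s - 1)))
    (hc : c.val l (.mk γ) = 0) : ∃ m, After (MapNull ι H) m u := by
  let v : I → ZeroRep X l := fun s => toZero hp hq (u (2 * s - 1))
  have hv : ∀ s, ∀ g ∈ H.map ι, g • v s = v s := by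
    rintro s _ ⟨g, hg, rfl⟩
    rw [← toZero_smul, hf _ g hg]
  obtain ⟨δ, hδ⟩ := MapSpace.exists_loopRep_eq (isLoopMap_orbitExt hv
    ((toZero hp hq).continuous.comp (hu.comp (by fun_prop)))
    (by simp only [v]; rw [hb _ (by simp), toZero_base])
    (by simp only [v]; rw [hb _ (by norm_num), toZero_base]))
  have hδv := fun s =>
    (congrFun hδ (s, coset _)).trans (orbitExt_coset hv s)
  rw [c.val_eq δ γ fun s => (hγ s).trans (hδv s).symm, toAdd_eq_zero, map_eq_one_iff _
    (c.φ _).injective] at hc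
  obtain ⟨m, hm⟩ := (cls_eq_one_iff δ).1 hc
  refine ⟨m + 1, (after_castRep (N := MapNull ι H) (f := fun x => stab (u x))
    (by omega) (by omega) (by omega)).1 (hm.transport
    (f' := fun x => toZero hp hq (u x)) (N' := MapNull ι H) (fun p q l p' q' f f' =>
      ∃ (hp : p = p') (hq : q = q'), (∀ x, 1 ≤ ‖x‖ → f' x = Rep.base X _ _ _) ∧
        ∀ x : ℝ, |x| ≤ 1 → castRep hp hq rfl
        (f (projIcc 0 1 zero_le_one ((x + 1) / 2), coset (H.map ι))) = f' x) ?_ ?_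
    ⟨rfl, rfl, fun x hx => ?_, fun x hx => ?_⟩)⟩
  · rintro p q l p' q' f f' ⟨rfl, rfl, h, h'⟩
    refine ⟨rfl, rfl, fun x hx => ?_, fun x hx => ?_⟩
    · simp only [h x hx, stab_base]
    · simp only [← h' x hx]; rfl
  · rintro p q l p' q' f f' ⟨rfl, rfl, h, h'⟩ ⟨N, hN, hl, h0, h1⟩
    refine ⟨fun z => N (z.1, (projIcc 0 1 zero_le_one ((z.2 + 1) / 2), coset _)),
      hN.comp (by fun_prop), fun x => ?_, fun x => h1 _, fun t x hx => ?_, fun t x g hg => ?_⟩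
    · rcases le_total |x| 1 with hx | hx
      · rw [← h' x hx]
        exact h0 _
      · rw [h x hx]
        rcases le_abs'.1 hx with hx | hx
        · dsimp only
          rw [projIcc_of_le_left _ (by linarith)]
          exact (hl 0).zero _
        · dsimp only
          rw [projIcc_of_right_le _ (by linarith)]
          exact (hl 0).one _
    · rcases le_abs'.1 (show 1 ≤ |x| from hx) with hx | hx
      · dsimp only
        rw [projIcc_of_le_left _ (by linarith)]
        exact (hl t).zero _
      · dsimp only
        rw [projIcc_of_right_le _ (by linarith)]
        exact (hl t).one _
    · have := (hl t).equi (ι g) (projIcc 0 1 zero_le_one ((x + 1) / 2)) (coset (H.map ι))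
      rw [smul_coset (Subgroup.mem_map_of_mem ι hg)] at this
      exact this.symm
  · rw [hb x hx, toZero_base]
  · refine (hδv _).trans ?_
    simp only [v]
    rw [abs_le] at hx
    rw [projIcc_of_mem zero_le_one ⟨by linarith [hx.1], by linarith [hx.2]⟩]
    congr 2
    simp only
    ring

variable {Γ : Type w} [Group Γ] (ι : Γ →* G)

/-- The tower of maps in degree one. -/
def em1 (hX : Concentrated X) : (towerOf X ι p q l).EM1 M := by
  have hp' : ∀ n, p + n + 1 = X.e + (l + n) := fun n => by omega
  have hq' : ∀ n, q + n = X.d + (l + n) := fun n => by omega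
  have hb : ∀ n, Rep.base X _ _ _ = toZero (hp' n) (hq' n) (Rep.base X _ _ _) := fun n =>
    (toZero_base (hp' n) (hq' n)).symm
  exact
  { κ := fun n a => c.val (l + n) ((a.map (toZero (hp' n) (hq' n))).cast (hb n) (hb n))
    κ_trans := fun n a b => by
      rw [← c.val_trans]
      induction a using Path.Homotopic.Quotient.ind with | mk a =>
      induction b using Path.Homotopic.Quotient.ind with | mk b =>
      rw [← Quotient.mk_trans, ← Quotient.mk_map,
        ← Quotient.mk_map, ← Quotient.mk_map,
        ← Quotient.mk_cast, ← Quotient.mk_cast,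
        ← Quotient.mk_cast, ← Quotient.mk_trans]
      congr 2
      ext s : 2
      simp only [Path.cast_coe, Path.map_coe, Function.comp_apply, Path.trans_apply]
      split_ifs <;> rfl
    κ_step := fun n γ γ' h => c.val_succ
      ((γ.map (toZero (hp' n) (hq' n)).continuous).cast (hb n) (hb n))
      ((γ'.map (toZero (hp' (n + 1)) (hq' (n + 1))).continuous).cast (hb (n + 1)) (hb (n + 1))) fun s =>
        (congrArg (toZero (hp' (n + 1)) (hq' (n + 1))) (h s)).trans
          (toZero_stab (hp' n) (hq' n) (hp' (n + 1)) (hq' (n + 1)) (γ s))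
    κ_smul := fun n g γ γ' h => c.val_smul (ι g)
      ((γ.map (toZero (hp' n) (hq' n)).continuous).cast (hb n) (hb n))
      ((γ'.map (toZero (hp' n) (hq' n)).continuous).cast (hb n) (hb n)) fun s =>
        (congrArg (toZero (hp' n) (hq' n)) (h s)).trans (toZero_smul (hp' n) (hq' n) (ι g) (γ s))
    inj := fun H n u hu h hf hκ => by
      obtain ⟨m, hm⟩ := c.exists_after_mapNull (hp' n) (hq' n) ι H hu h hf (fun s => by
        refine congrArg (toZero (hp' n) (hq' n)) (congrArg u ?_)
        ring) hκ
      exact evNull_of_after ι hm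
    surj := fun m => by
      obtain ⟨k, δ, hδ⟩ := exists_cls_ge 0 (orbit ⊤) l ((c.φ ⊤).symm (Multiplicative.ofAdd m))
      have hr : Continuous fun s => MapSpace.rep (δ s) (coset ⊤) :=
        MapSpace.continuous_rep.comp (f := fun s => (δ s, coset ⊤)) (by fun_prop)
      let γ : Path (Rep.base X (X.e + ((0 : ℤ) - 1).toNat + (l + k))
          (X.d + (1 - (0 : ℤ)).toNat + (l + k)) ((1 - (0 : ℤ)).toNat + (l + k))) (Rep.base X _ _ _) :=
        ⟨⟨fun s => MapSpace.rep (δ s) (coset ⊤), hr⟩, by simp only [δ.source]; rfl,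
          by simp only [δ.target]; rfl⟩
      have e1 : X.e + ((0 : ℤ) - 1).toNat + (l + k) = p + (k + 1) := by omega
      have e2 : X.d + (1 - (0 : ℤ)).toNat + (l + k) = q + (k + 1) := by omega
      have e3 : (1 - (0 : ℤ)).toNat + (l + k) = l + (k + 1) := by omega
      have hcast : ∀ x : ZeroRep X (l + k), toZero (hp' (k + 1)) (hq' (k + 1))
          (castRep e1 e2 e3 x) = stab x := fun x => by
        rw [toZero, ContinuousMap.comp_apply, stab_castRep, castRep_castRep]
        rfl
      refine ⟨k + 1, fun t => castRep e1 e2 e3 (γ (projIcc 0 1 zero_le_one t)),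
        (castRep e1 e2 e3).continuous.comp (by fun_prop), ?_, ?_, fun t g _ => ?_, ?_⟩
      · dsimp only
        rw [projIcc_left]
        exact (congrArg _ γ.source).trans (castRep_base e1 e2 e3)
      · dsimp only
        rw [projIcc_right]
        exact (congrArg _ γ.target).trans (castRep_base e1 e2 e3)
      · change ι g • castRep e1 e2 e3 _ = _
        rw [← castRep_smul]
        refine congrArg _ ((MapSpace.rep_smul _ _ _).symm.trans ?_)
        rw [smul_coset (Subgroup.mem_top _)]
        rfl
      · refine (c.val_succ γ _ fun s => ?_).trans
          ((c.val_eq δ γ fun s => rfl).trans (by rw [hδ, MulEquiv.apply_symm_apply]; rfl))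
        refine (hcast _).trans (congrArg stab (congrArg γ ?_))
        rw [sub_zero, mul_one, zero_add, projIcc_val]
    piTriv := fun H j hj => piTriv_towerOf ι hX hq H (by omega) }

end ZeroCoeff

end

lemma poly_nonempty {T : Type*} [Nontrivial T] : (Poly T).Nonempty := by
  classical
  obtain ⟨s, t, hst⟩ := exists_pair_ne T
  exact ⟨Pi.single t 1, fun i => by by_cases h : i = t <;> simp [h], ⟨s, by simp [hst]⟩, t, by simp⟩

section Polar

variable {T : Type*}

open Classical in
/-- Polar coordinates on the sphere `S^T`: the direction `y`, the radius `b` and the position `a` on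
the diagonal. -/
def polarMap (z : Poly T × J × Icc (-1 : ℝ) 1) : OnePoint (T → ℝ) :=
  if 0 < min (1 - |(z.2.2 : ℝ)|) (1 - |(z.2.1 : ℝ)|) then
    ((fun t => stretch z.2.2 + stretch z.2.1 * z.1.1 t : T → ℝ) : OnePoint (T → ℝ))
  else ∞

lemma polarMap_of_lt {y : Poly T} {b : J} {a : Icc (-1 : ℝ) 1} (hb : (b : ℝ) < 1)
    (ha : |(a : ℝ)| < 1) : polarMap (y, b, a) =
      ((fun t => stretch a + stretch b * y.1 t : T → ℝ) : OnePoint (T → ℝ)) :=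
  if_pos (lt_min (by linarith) (by dsimp only; rw [abs_of_nonneg b.2.1]; linarith))

lemma polarMap_of_ge {y : Poly T} {b : J} {a : Icc (-1 : ℝ) 1}
    (h : (b : ℝ) = 1 ∨ |(a : ℝ)| = 1) : polarMap (y, b, a) = ∞ := by
  refine if_neg (not_lt.2 ?_)
  rcases h with h | h
  · exact (min_le_right _ _).trans (by simp [h])
  · exact (min_le_left _ _).trans (by simp [h])

lemma polar_cases (b : J) (a : Icc (-1 : ℝ) 1) :
    ((b : ℝ) = 1 ∨ |(a : ℝ)| = 1) ∨ ((b : ℝ) < 1 ∧ |(a : ℝ)| < 1) := by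
  rcases b.2.2.lt_or_eq with hb | hb
  · rcases (abs_le.2 a.2).lt_or_eq with ha | ha
    · exact .inr ⟨hb, ha⟩
    · exact .inl (.inr ha)
  · exact .inl (.inl hb)

lemma continuous_polarMap [Finite T] : Continuous (polarMap (T := T)) := by
  have := Fintype.ofFinite T
  refine continuous_blowup (by fun_prop) ?_ continuous_norm ?_
  · refine continuousOn_pi.2 fun t => ContinuousOn.add ?_ (ContinuousOn.mul ?_
      ((continuous_apply t).comp (continuous_subtype_val.comp continuous_fst)).continuousOn)
    · refine continuousOn_stretch.comp (by fun_prop) fun z hz => ?_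
      have hz : 0 < min (1 - |(z.2.2 : ℝ)|) (1 - |(z.2.1 : ℝ)|) := hz
      exact (lt_min_iff.1 hz).1
    · refine continuousOn_stretch.comp (by fun_prop) fun z hz => ?_
      have hz : 0 < min (1 - |(z.2.2 : ℝ)|) (1 - |(z.2.1 : ℝ)|) := hz
      exact (lt_min_iff.1 hz).2
  · rintro ⟨y, b, a⟩ hz
    obtain ⟨ha, hb⟩ := lt_min_iff.1 hz
    obtain ⟨t₀, h0⟩ := y.2.2.1
    obtain ⟨t₁, h1⟩ := y.2.2.2
    set x : T → ℝ := fun t => stretch a + stretch b * y.1 t with hx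
    have n0 := norm_le_pi_norm x t₀
    have n1 := norm_le_pi_norm x t₁
    simp only [hx, h0, h1, mul_zero, add_zero, mul_one, Real.norm_eq_abs] at n0 n1
    have ea := abs_stretch (show |(a : ℝ)| < 1 by linarith)
    have eb := abs_stretch (show |(b : ℝ)| < 1 by linarith)
    have h3 : |stretch b| ≤ |stretch (a : ℝ) + stretch b| + |stretch (a : ℝ)| := by
      have := abs_sub (stretch (a : ℝ) + stretch b) (stretch (a : ℝ))
      rwa [add_sub_cancel_left] at this
    dsimp only
    rcases min_choice (1 - |(a : ℝ)|) (1 - |(b : ℝ)|) with h | h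
    · rw [h, ← ea]
      linarith [abs_nonneg (stretch (a : ℝ))]
    · rw [h, ← eb]
      linarith

lemma polarMap_surjective [Finite T] [Nontrivial T] :
    Function.Surjective (polarMap (T := T)) := by
  have := poly_nonempty (T := T).to_subtype
  intro x
  rcases x with _ | x
  · exact ⟨(Classical.arbitrary _, ⟨1, by simp⟩, ⟨0, by simp⟩), polarMap_of_ge (Or.inl rfl)⟩
  ·
    obtain ⟨s, hs⟩ := Finite.exists_min x
    obtain ⟨t, ht⟩ := Finite.exists_max x
    obtain ⟨a1, a2⟩ := stretch_shrink (x s)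
    obtain ⟨b1, b2⟩ := stretch_shrink (x t - x s)
    have hst : 0 ≤ x t - x s := by linarith [hs t]
    have hb0 : 0 ≤ (x t - x s) / (1 + |x t - x s|) := by positivity
    rcases hst.eq_or_lt with h | h
    · refine ⟨(Classical.arbitrary _, ⟨0, by simp⟩, ⟨x s / (1 + |x s|), abs_le.1 a1.le⟩), ?_⟩
      rw [polarMap_of_lt (by simp) a1]
      congr 1
      funext r
      rw [show stretch 0 = 0 by simp [stretch], zero_mul, add_zero]
      linarith [hs r, ht r]
    · refine ⟨(⟨fun r => (x r - x s) / (x t - x s), fun r => ⟨?_, ?_⟩, ⟨s, by simp⟩,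
        t, div_self h.ne'⟩, ⟨_, hb0, (abs_lt.1 b1).2.le⟩, ⟨x s / (1 + |x s|), abs_le.1 a1.le⟩), ?_⟩
      · exact div_nonneg (by linarith [hs r]) h.le
      · rw [div_le_one h]; linarith [ht r]
      · rw [polarMap_of_lt (abs_lt.1 b1).2 a1]
        congr 1
        funext r
        simp only [a2, b2]
        rw [mul_div_cancel₀ _ h.ne']
        ring

lemma polarMap_eq {y y' : Poly T} {b b' : J} {a a' : Icc (-1 : ℝ) 1}
    (h : polarMap (y, b, a) = polarMap (y', b', a')) :
    (((b : ℝ) = 1 ∨ |(a : ℝ)| = 1) ∧ ((b' : ℝ) = 1 ∨ |(a' : ℝ)| = 1)) ∨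
      (a = a' ∧ b = b' ∧ (y = y' ∨ (b : ℝ) = 0)) := by
  rcases polar_cases b a with h1 | ⟨hb, ha⟩ <;> rcases polar_cases b' a' with h1' | ⟨hb', ha'⟩
  · exact .inl ⟨h1, h1'⟩
  · rw [polarMap_of_ge h1, polarMap_of_lt hb' ha'] at h
    exact absurd h.symm (OnePoint.coe_ne_infty _)
  · rw [polarMap_of_ge h1', polarMap_of_lt hb ha] at h
    exact absurd h (OnePoint.coe_ne_infty _)
  · right
    rw [polarMap_of_lt hb ha, polarMap_of_lt hb' ha'] at h
    have h := congrFun (OnePoint.coe_injective h)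
    have sb : ∀ b : J, (b : ℝ) < 1 → 0 ≤ stretch b := fun b hb => by
      rw [stretch, abs_of_nonneg b.2.1]
      exact div_nonneg b.2.1 (by linarith)
    have key : ∀ (y y' : Poly T) (b b' : J) (a a' : Icc (-1 : ℝ) 1), (b : ℝ) < 1 →
        b' < 1 → (∀ t, stretch a + stretch b * y.1 t = stretch a' + stretch b' * y'.1 t) →
        stretch a' ≤ stretch a ∧ stretch a + stretch b ≤ stretch a' + stretch b' := by
      intro y y' b b' a a' hb hb' h
      obtain ⟨t₀, h0⟩ := y.2.2.1
      obtain ⟨t₁, h1⟩ := y.2.2.2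
      have e0 := h t₀
      have e1 := h t₁
      rw [h0] at e0
      rw [h1] at e1
      have m0 := mul_nonneg (sb b' hb') (y'.2.1 t₀).1
      have m1 := mul_le_mul_of_nonneg_left (y'.2.1 t₁).2 (sb b' hb')
      constructor <;> linarith
    have k1 := key y y' b b' a a' hb hb' h
    have k2 := key y' y b' b a' a hb' hb fun t => (h t).symm
    have hsa := le_antisymm k2.1 k1.1
    have hsb : stretch b = stretch b' := by linarith [k1.2, k2.2]
    have abs_b : ∀ b : J, (b : ℝ) < 1 → |(b : ℝ)| < 1 := fun b hb => by
      rwa [abs_of_nonneg b.2.1]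
    have haa := Subtype.ext (stretch_injOn ha ha' hsa)
    have hbb := Subtype.ext (stretch_injOn (abs_b b hb) (abs_b b' hb') hsb)
    refine ⟨haa, hbb, ?_⟩
    by_cases hb0 : (b : ℝ) = 0
    · exact Or.inr hb0
    · left
      refine Subtype.ext (funext fun t => ?_)
      have hne : stretch b ≠ 0 := by
        rw [stretch]
        exact div_ne_zero hb0 (by have := abs_b b hb; linarith)
      have := h t
      rw [hsa, ← hsb] at this
      exact mul_left_cancel₀ hne (by linarith)

end Polar

section Sphere

variable {Γ : Type u} [Group Γ] {T : Type u} [MulAction Γ T] [Finite T]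

lemma smul_polarMap (g : Γ) (y : Poly T) (b a) :
    (polarMap (⟨shift g y.1, shift_mem_poly g y.2⟩, b, a) : 𝕊(Γ, T)) =
      g • (show 𝕊(Γ, T) from polarMap (y, b, a)) := by
  rcases polar_cases b a with h | ⟨hb, ha⟩
  · rw [polarMap_of_ge h, polarMap_of_ge h]
    exact (𝕊(Γ, T).smul_pt g).symm
  · rw [polarMap_of_lt hb ha, polarMap_of_lt hb ha]
    rfl

variable {G : Type u} [Group G] {X : GPrespectrum G} (ι : Γ →* G) {p q l : ℕ}

/-- A loop of maps on a sphere, in polar coordinates. -/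
def PolarRel (p q l p' q' : ℕ) (F : Cyl(T) → Rep X p q l)
    (f : I × 𝕊(Γ, T) → Rep X p' q' l) : Prop :=
  ∃ (hP : p = p' + 2) (hQ : q = q' + 0), ∀ (y : Poly T) (b : J) (a : Icc (-1 : ℝ) 1)
    (s : I), unabs hP hQ (F (y.1, b)) (cube G ![2 * (s : ℝ) - 1, a]) = f (s, polarMap (y, b, a))

variable {ι}

lemma Rep.unabs_square_ext (hP : p = p' + 2) (hQ : q = q' + 0)
    (h : ∀ (s : I) (a : Icc (-1 : ℝ) 1), unabs hP hQ x (cube G ![2 * (s : ℝ) - 1, a]) =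
      unabs hP hQ x' (cube G ![2 * (s : ℝ) - 1, a])) : x = x' := by
  refine unabs_cube_ext hP hQ fun r => ?_
  by_cases hr : ∃ i, 1 ≤ |r i|
  · rw [unabs_cube_of_ge _ _ _ hr, unabs_cube_of_ge _ _ _ hr]
  · push Not at hr
    have h0 := abs_lt.1 (hr 0)
    have h1 := abs_lt.1 (hr 1)
    have := h ⟨(r 0 + 1) / 2, by linarith, by linarith⟩ ⟨r 1, h1.1.le, h1.2.le⟩
    have e : ![2 * ((r 0 + 1) / 2) - 1, r 1] = r := by
      funext i
      fin_cases i
      · simp; ring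
      · rfl
    simpa only [e] using this

lemma PolarRel.unique {p' q' : ℕ}
    {f : I × 𝕊(Γ, T) → Rep X p' q' l} (h : PolarRel p q l p' q' F f)
    (h' : PolarRel p q l p' q' F' f) {y : T → ℝ} (hy : y ∈ Poly T) {b : ℝ}
    (hb : b ∈ J) : F (y, b) = F' (y, b) := by
  obtain ⟨hP, hQ, h⟩ := h
  obtain ⟨_, _, h'⟩ := h'
  exact unabs_square_ext hP hQ fun s a =>
    (h ⟨y, hy⟩ ⟨b, hb⟩ a s).trans (h' ⟨y, hy⟩ ⟨b, hb⟩ a s).symm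

lemma PolarRel.stab {p' q' : ℕ}
    {f : I × 𝕊(Γ, T) → Rep X p' q' l} (h : PolarRel p q l p' q' F f) :
    PolarRel (p + 1) (q + 1) (l + 1) (p' + 1) (q' + 1) (fun z => stab (F z))
      fun w => stab (f w) := by
  obtain ⟨hP, hQ, h⟩ := h
  refine ⟨by omega, by omega, fun y b a s => ?_⟩
  rw [unabs_stab hP hQ, h]

open Classical in
lemma exists_polarHtpy (hP : P = p + 2) (hQ : Q = q + 0) (K : Subgroup Γ)
    (hh : Continuous h) (hf : ∀ t, IsLoopMap (ι.comp K.subtype) 𝕊(Γ, T).pt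
      fun w => h (t, w)) : ∃ H : Cyl(T) × ℝ → Rep X P Q l,
    IsPolarHtpy (towerOf X ι P Q l) K (n := 0) H (fun z => H (z, 0)) (fun z => H (z, 1)) ∧
      ∀ t : I, PolarRel P Q l p q (fun z => H (z, t)) fun w => h (t, w) := by
  have hc : Continuous (fun z : ((Poly T × J) × I) × (Fin 2 → ℝ) =>
      h (z.1.2, projIcc 0 1 zero_le_one ((z.2 0 + 1) / 2),
        polarMap (z.1.1.1, z.1.1.2, projIcc (-1) 1 (by norm_num) (z.2 1)))) := by
    refine hh.comp (Continuous.prodMk (by fun_prop)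
      (Continuous.prodMk (by fun_prop) (continuous_polarMap.comp (by fun_prop))))
  have hpt : ∀ t s, h (t, s, ∞) = Rep.base X p q l := fun t => (hf t).pt
  obtain ⟨F, hF, hFf⟩ := exists_absorb_cube hP hQ hc (by
    rintro w x ⟨i, hi⟩
    fin_cases i
    · have hi : 1 ≤ |x 0| := hi
      rcases le_abs'.1 hi with hi | hi
      · rw [projIcc_of_le_left _ (by linarith)]
        exact (hf _).zero _
      · rw [projIcc_of_right_le _ (by linarith)]
        exact (hf _).one _
    · rw [polarMap_of_ge, hpt]
      right
      have hi : 1 ≤ |x 1| := hi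
      rcases le_abs'.1 hi with hi | hi
      · rw [projIcc_of_le_left _ hi]; simp
      · rw [projIcc_of_right_le _ hi]; simp)
  let H : Cyl(T) × ℝ → Rep X P Q l := fun z =>
    if h : (z.1.1 ∈ Poly T ∧ z.1.2 ∈ J) ∧ z.2 ∈ J then
      F ⟨⟨⟨z.1.1, h.1.1⟩, ⟨z.1.2, h.1.2⟩⟩, ⟨z.2, h.2⟩⟩ else Rep.base X P Q l
  have hH : ∀ (y : Poly T) (b : J) (t : I),
      H ((y.1, b), t) = F ((y, b), t) := fun y b t => dif_pos ⟨⟨y.2, b.2⟩, t.2⟩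
  have key : ∀ (t s : I) y (b : J) (a : Icc (-1 : ℝ) 1),
      unabs hP hQ (H ((y.1, b), t)) (cube G ![2 * (s : ℝ) - 1, a]) =
        h (t, s, polarMap (y, b, a)) := by
    intro t s y b a
    have e1 : (2 * (s : ℝ) - 1 + 1) / 2 = s := by ring
    rw [hH, hFf]
    simp only [Matrix.cons_val_zero, Matrix.cons_val_one, e1, projIcc_val]
  refine ⟨H, ⟨?_, ?_, fun _ _ _ _ => rfl, fun _ _ _ _ => rfl, ?_, ?_⟩,
    fun t => ⟨hP, hQ, fun y b a s => key t s y b a⟩⟩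
  · rw [continuousOn_iff_continuous_domRestrict]
    exact (hF.comp (f := fun z : ((Poly T ×ˢ J) ×ˢ J : Set _) =>
      (((⟨z.1.1.1, z.2.1.1⟩, ⟨z.1.1.2, z.2.1.2⟩), ⟨z.1.2, z.2.2⟩) :
        (Poly T × J) × I)) (by fun_prop)).congr fun z =>
      (hH ⟨z.1.1.1, z.2.1.1⟩ ⟨z.1.1.2, z.2.1.2⟩ ⟨z.1.2, z.2.2⟩).symm
  · intro g hg y hy b hb t ht
    change _ = ι g • H _
    refine unabs_square_ext hP hQ fun s a => ?_
    rw [unabs_cube_smul]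
    exact (key ⟨t, ht⟩ s ⟨shift g y, shift_mem_poly g hy⟩ ⟨b, hb⟩ a).trans
      ((congrArg (fun x => h (⟨t, ht⟩, s, x)) (smul_polarMap g ⟨y, hy⟩ ⟨b, hb⟩ a)).trans
        (((hf ⟨t, ht⟩).equi ⟨g, hg⟩ s _).trans
          (congrArg (ι g • ·) (key ⟨t, ht⟩ s ⟨y, hy⟩ ⟨b, hb⟩ a).symm)))
  · intro y hy t ht
    refine unabs_square_ext hP hQ fun s a => (key ⟨t, ht⟩ s ⟨y, hy⟩ ⟨1, by simp⟩ a).trans ?_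
    rw [polarMap_of_ge (Or.inl rfl), hpt]
    exact (unabs_base hP hQ _).symm
  · intro y hy y' hy' t ht
    refine unabs_square_ext hP hQ fun s a => (key ⟨t, ht⟩ s ⟨y, hy⟩ ⟨0, by simp⟩ a).trans
      (Eq.trans ?_ (key ⟨t, ht⟩ s ⟨y', hy'⟩ ⟨0, by simp⟩ a).symm)
    congr 3
    rcases polar_cases ⟨0, by simp⟩ a with h | ⟨hb, ha⟩
    · rw [polarMap_of_ge h, polarMap_of_ge h]
    · rw [polarMap_of_lt hb ha, polarMap_of_lt hb ha]
      simp only [show stretch 0 = 0 by simp [stretch], zero_mul]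
      rfl

lemma IsLoopMap.exists_polar
    (hf : IsLoopMap ι 𝕊(Γ, T).pt f) :
    ∃ F : Cyl(T) → Rep X (p + 2) q l, IsPolar (towerOf X ι (p + 2) q l) (n := 0) F ∧
      PolarRel (p + 2) q l p q F f := by
  obtain ⟨H, hH, hHf⟩ := exists_polarHtpy rfl rfl ⊤ (hf.cont.comp continuous_snd) fun _ =>
      { hf with equi := fun g => hf.equi g }
  have h0 : 0 ∈ J := by simp
  exact ⟨fun z => H (z, 0), ⟨hH.cont.comp (by fun_prop) fun z hz => ⟨hz, h0⟩,
    fun g y hy b hb => hH.equi g trivial y hy b hb 0 h0, fun y hy => hH.one y hy 0 h0,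
    fun y hy y' hy' => hH.zero y hy y' hy' 0 h0⟩, hHf 0⟩

lemma PolarRel.polarNull
    {f : I × 𝕊(Γ, T) → Rep X p q (l + n)}
    (h : PolarRel (P + n) (Q + n) (l + n) p q F f) (K : Subgroup Γ)
    (hf : After (LoopNull (ι.comp K.subtype) 𝕊(Γ, T).pt) m f) :
    PolarNull (towerOf X ι P Q l) K (n := n) F := by
  obtain ⟨n', hn, H, hH⟩ := (hf.transport (W' := Cyl(T)) (N' := fun p q l F => ∃ H,
    IsPolarHtpy (towerOf X ι p q l) K (n := 0) H F fun _ => Rep.base X p q l)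
    (fun p q l P Q f F => PolarRel P Q l p q F f) (fun f F h => h.stab) (by
      rintro p q l P Q f F h ⟨E, hE, hEl, hE0, hE1⟩
      obtain ⟨hP, hQ, -⟩ := id h
      obtain ⟨H, hH, hHE⟩ := exists_polarHtpy hP hQ K hE hEl
      refine ⟨H, hH.cont, hH.equi, fun y hy b hb => ?_, fun y hy b hb => ?_, hH.one, hH.zero⟩
      · refine (hHE 0).unique (F' := F) ?_ hy hb
        simp only [hE0]
        exact h
      · refine (hHE 1).unique (F' := fun _ => Rep.base X P Q l) ?_ hy hb
        simp only [hE1]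
        exact ⟨hP, hQ, fun y b a s => unabs_base hP hQ _⟩) h).exists_map (ι := ι)
  exact ⟨n', hn, H, hH.cont, hH.equi, hH.left, hH.right, hH.one, hH.zero⟩

lemma IsPolarHtpy.exists_loopHtpy [Nontrivial T] (hP : p = p' + 2) (hQ : q = q' + 0) {F F' : Cyl(T) → Rep X p q l}
    (hH : IsPolarHtpy (towerOf X ι p q l) ⊤ (n := 0) H F F') :
    ∃ h : I × (I × 𝕊(Γ, T)) → Rep X p' q' l, Continuous h ∧
      (∀ t, IsLoopMap ι 𝕊(Γ, T).pt fun w => h (t, w)) ∧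
      ∀ t : I, PolarRel p q l p' q' (fun z => H (z, t)) fun w => h (t, w) := by
  have hHc : Continuous fun z : Poly T × J × I =>
      H ((z.1.1, z.2.1), z.2.2) :=
    hH.cont.comp_continuous (by fun_prop) fun z => ⟨⟨z.1.2, z.2.1.2⟩, z.2.2.2⟩
  let u : (I × I) × (Poly T × J × Icc (-1 : ℝ) 1) →
      Rep X p' q' l := fun z => unabs hP hQ (H ((z.2.1.1, z.2.2.1), z.1.1))
        (cube G ![2 * (z.1.2 : ℝ) - 1, z.2.2.2])
  have hu : Continuous u := by
    refine (continuous_unabs_cube hP hQ).comp (Continuous.prodMk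
      (hHc.comp (f := fun z : (I × I) ×
        (Poly T × J × Icc (-1 : ℝ) 1) => (z.2.1, z.2.2.1, z.1.1)) (by fun_prop))
      (continuous_pi fun i => ?_))
    fin_cases i
    · change Continuous fun z : (I × I) ×
        (Poly T × J × Icc (-1 : ℝ) 1) => 2 * (z.1.2 : ℝ) - 1
      fun_prop
    · change Continuous fun z : (I × I) × (Poly T × J × Icc (-1 : ℝ) 1) => (z.2.2.2 : ℝ)
      fun_prop
  have hua : ∀ (t s : I) (y : Poly T) (b : J) (a : Icc (-1 : ℝ) 1), ((b : ℝ) = 1 ∨ |(a : ℝ)| = 1) →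
      u ((t, s), (y, b, a)) = Rep.base X p' q' l := by
    rintro t s y b a (hb | ha)
    · change unabs hP hQ (H ((y.1, (b : ℝ)), t)) _ = _
      rw [hb, hH.one y.1 y.2 t t.2]
      exact unabs_base hP hQ _
    · exact unabs_cube_of_ge hP hQ _ ⟨1, ha.ge⟩
  have hus : ∀ t s y b a, s = 0 ∨ s = 1 → u ((t, s), (y, b, a)) = Rep.base X p' q' l := by
    rintro t s y b a (rfl | rfl)
    · exact unabs_cube_of_ge hP hQ _ ⟨0, by simp⟩
    · exact unabs_cube_of_ge hP hQ _ ⟨0, by norm_num⟩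
  have := isCompact_iff_compactSpace.1 (isCompact_poly (T := T))
  obtain ⟨g, hg, hgu⟩ := exists_descend
    (continuous_polarMap) polarMap_surjective hu (by
      rintro ⟨t, s⟩ ⟨y, b, a⟩ ⟨y', b', a'⟩ hz
      rcases polarMap_eq hz with ⟨h1, h2⟩ | ⟨rfl, rfl, rfl | hb⟩
      · rw [hua _ _ _ _ _ h1, hua _ _ _ _ _ h2]
      · rfl
      · change unabs hP hQ (H ((y.1, b), t)) _ =
          unabs hP hQ (H ((y'.1, b), t)) _
        rw [hb, hH.zero y.1 y.2 y'.1 y'.2 t t.2])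
  refine ⟨fun z => g ((z.1, z.2.1), z.2.2), hg.comp (by fun_prop), fun t =>
    ⟨hg.comp (by fun_prop), ?_, ?_, ?_, ?_⟩, fun t => ⟨hP, hQ, fun y b a s => (hgu (t, s) (y, b, a)).symm⟩⟩
  · intro x
    obtain ⟨⟨y, b, a⟩, rfl⟩ := polarMap_surjective x
    exact (hgu _ _).trans (hus _ _ _ _ _ (.inl rfl))
  · intro x
    obtain ⟨⟨y, b, a⟩, rfl⟩ := polarMap_surjective x
    exact (hgu _ _).trans (hus _ _ _ _ _ (.inr rfl))
  · intro s
    obtain ⟨⟨y, b, a⟩, hx⟩ := polarMap_surjective (∞ : OnePoint (T → ℝ))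
    refine (congrArg (fun x => g ((t, s), x)) hx.symm).trans ((hgu _ _).trans (hua _ _ _ _ _ ?_))
    by_contra h1
    rw [polarMap_of_lt (lt_of_le_of_ne b.2.2 fun h => h1 (.inl h))
      (lt_of_le_of_ne (abs_le.2 a.2) fun h => h1 (.inr h))] at hx
    exact OnePoint.coe_ne_infty _ hx
  · intro γ s x
    obtain ⟨⟨y, b, a⟩, rfl⟩ := polarMap_surjective x
    refine (congrArg (fun x => g ((t, s), x)) (smul_polarMap γ y b a).symm).trans
      ((hgu _ _).trans (Eq.trans ?_ (congrArg (ι γ • ·) (hgu _ _)).symm))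
    change unabs hP hQ (H ((shift γ y.1, b), t)) _ =
      ι γ • unabs hP hQ (H ((y.1, b), t)) _
    rw [hH.equi γ (Subgroup.mem_top _) y.1 y.2 b b.2 t t.2]
    exact unabs_cube_smul hP hQ (ι γ) _ _

lemma PolarRel.exists_after [Nontrivial T] {p' q' : ℕ}
    {f : I × 𝕊(Γ, T) → Rep X p' q' l} (h : PolarRel p q l p' q' F f)
    (hF : PolarNull (towerOf X ι p q l) ⊤ (n := 0) F) :
    ∃ m, After (LoopNull ι 𝕊(Γ, T).pt) m f := by
  obtain ⟨n', hn, H, hH⟩ := hF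
  obtain ⟨m, hm⟩ := GStable.exists_after (X := X) (N := fun p q l F => ∃ H,
    IsPolarHtpy (towerOf X ι p q l) ⊤ (n := 0) H F fun _ => Rep.base X p q l) ι hn F
    ⟨H, hH.cont, hH.equi, hH.left, hH.right, hH.one, hH.zero⟩
  refine ⟨m, hm.transport PolarRel (fun F f h => h.stab) ?_ h⟩
  rintro p q l p' q' F f ⟨hP, hQ, h⟩ ⟨H, hH⟩
  obtain ⟨g, hg, hgl, hgH⟩ := hH.exists_loopHtpy hP hQ
  refine ⟨g, hg, hgl, ?_, ?_⟩
  · rintro ⟨s, x⟩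
    obtain ⟨⟨y, b, a⟩, rfl⟩ := polarMap_surjective x
    rw [← h y b a s]
    refine ((hgH 0).2.2 y b a s).symm.trans ?_
    rw [← hH.left y.1 y.2 b b.2]
    rfl
  · rintro ⟨s, x⟩
    obtain ⟨⟨y, b, a⟩, rfl⟩ := polarMap_surjective x
    refine ((hgH 1).2.2 y b a s).symm.trans (Eq.trans ?_ (unabs_base hP hQ (cube G ![2 * s - 1, a])))
    exact congrArg (fun x => unabs hP hQ x (cube G ![2 * s - 1, a]))
      (hH.right y.1 y.2 b b.2)

end Sphere

section FixedConn

variable {Γ : Type w} [Group Γ]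

lemma Tower.EM1.fixedConn_loops {L : Tower.{v} Γ} [AddCommGroup M] (e : L.EM1 M) :
    FixedConn L.loops := by
  intro n c hc h0 h1
  let c' : ℝ → L.Loop n := c
  have hc' : Continuous c' := hc
  let u : ℝ → L.obj n := fun x => c' 0 (projIcc 0 1 zero_le_one ((x + 1) / 2))
  have hu : Continuous u := (map_continuous (c' 0).1).comp (by fun_prop)
  have hb : ∀ x, 1 ≤ ‖x‖ → u x = L.pt n := fun x hx => by
    rcases le_abs'.1 (show 1 ≤ |x| from hx) with hx | hx
    · simp only [u]
      rw [projIcc_of_le_left _ (by linarith)]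
      exact (c' 0).zero
    · simp only [u]
      rw [projIcc_of_right_le _ (by linarith)]
      exact (c' 0).one
  have hev :=
    (hc'.comp continuous_fst).eval continuous_snd
  obtain ⟨n', hn, N, hN, hN0, hN1, hNb, hNf⟩ := e.inj ⊤ n u hu hb
    (fun x g hg => (DFunLike.congr_fun (h0 g hg) _)) (by
      rw [← e.κ_refl n]
      refine congrArg (e.κ n) (Quotient.sound ⟨⟨⟨⟨fun z => c' z.1 z.2,
        hev.comp (f := fun z : I × I => ((z.1 : ℝ), z.2)) (by fun_prop)⟩,
        fun s => ?_, fun s => ?_⟩, ?_⟩⟩)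
      · change c' 0 s = c' 0 (projIcc 0 1 zero_le_one ((-1 + s * (1 - -1) + 1) / 2))
        congr 1
        rw [show (-1 + (s : ℝ) * (1 - -1) + 1) / 2 = s by ring, projIcc_val]
      · change c' 1 s = L.pt n
        rw [show c' 1 = L.loops.pt n from h1]
        rfl
      · rintro t s (rfl | hs)
        · exact ((c' t).zero).trans (hb (-1 + 0 * (1 - -1)) (by norm_num)).symm
        · obtain rfl : s = 1 := hs
          exact ((c' t).one).trans (hb (-1 + 1 * (1 - -1)) (by norm_num)).symm)
  refine ⟨n', hn, fun t => (⟨⟨fun s => N (t, 2 * s - 1), hN.comp (by fun_prop)⟩,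
    hNb _ _ (by simp), hNb _ _ (by norm_num)⟩ : L.Loop n'),
    Tower.Loop.continuous_of_uncurry (hN.comp (by fun_prop)), ?_, ?_, ?_⟩
  · refine DFunLike.ext _ _ fun s => ?_
    rw [loops_map_apply]
    refine (hN0 _).trans (congrArg (L.map hn) ?_)
    change c' 0 (projIcc 0 1 zero_le_one ((2 * (s : ℝ) - 1 + 1) / 2)) = c' 0 s
    rw [show (2 * (s : ℝ) - 1 + 1) / 2 = s by ring, projIcc_val]
  · exact DFunLike.ext _ _ fun s => hN1 _
  · exact fun t g hg => DFunLike.ext _ _ fun s => hNf t _ g hg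

lemma Tower.Iso.fixedConn {L L' : Tower.{v} Γ} (i : L.Iso L') (h : FixedConn L) :
    FixedConn L' := by
  intro n c hc h0 h1
  obtain ⟨n', hn, c', hc', h0', h1', hf⟩ := h n (fun t => i.inv n (c t))
    ((i.inv n).continuous.comp hc) (i.fixed_inv h0) (by rw [h1, i.inv_pt])
  exact ⟨n', hn, fun t => i.fw n' (c' t), (i.fw n').continuous.comp hc',
    by dsimp only; rw [h0', ← i.inv_map, i.fw_inv], by dsimp only; rw [h1', i.fw_pt], fun t => i.fixed_fw (hf t)⟩

end FixedConn

lemma card_coord (G : Type*) [Finite G] (p q : ℕ) :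
    Nat.card (Coord G p q) = p + q * Nat.card G := by
  change Nat.card (Fin p ⊕ (Fin q × G)) = _
  rw [Nat.card_sum, Nat.card_prod, Nat.card_fin, Nat.card_fin]

section Vanishing

variable {Γ : Type u} [Group Γ] {T : Type u} [MulAction Γ T] [Finite T]
  {G : Type u} [Group G] {X : GPrespectrum G} {ι : Γ →* G} {p q l : ℕ}
  {M : Type*} [AddCommGroup M] (c : ZeroCoeff X M) (hX : Concentrated X) (hq : q = X.d + l)
  {f : I × 𝕊(Γ, T) → Rep X p q l}
  (hf : IsLoopMap ι 𝕊(Γ, T).pt f)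

include c hX hq hf

lemma IsLoopMap.null_one [Nontrivial T] (hp : p + 1 + 1 = X.e + l) :
    ∃ m, After (LoopNull ι 𝕊(Γ, T).pt) m f := by
  obtain ⟨F, hF, hFf⟩ := hf.exists_polar
  refine hFf.exists_after (hF.null_zero poly_nonempty ?_ fun H j hj =>
    piTriv_towerOf ι hX hq H (by omega))
  exact (loopsIso ι (p + 1) q l).fixedConn (c.em1 hp hq ι hX).fixedConn_loops

lemma IsLoopMap.null_two (hp : p + 1 + 2 = X.e + l)
    (hT : 3 ≤ Nat.card T ∨ (Nat.card T = 2 ∧ MulAction.IsPretransitive Γ T)) :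
    ∃ m, After (LoopNull ι 𝕊(Γ, T).pt) m f := by
  have : Nontrivial T := Finite.one_lt_card_iff_nontrivial.1 (by omega)
  obtain ⟨F, hF, hFf⟩ := hf.exists_polar
  exact hFf.exists_after (hF.null_one (c.em1 hp hq ι hX) hT)

lemma IsLoopMap.null_three [Finite Γ] (hp : p + 1 + 3 = X.e + l)
    (hM : NoTorsion M)
    (hT : Nat.card T = 2 ∨ 4 ≤ Nat.card T ∨ (3 ≤ Nat.card T ∧ ∀ F,
      IsPolar (towerOf X ι (p + 2) q l) (n := 0) F → PolarRel (p + 2) q l p q F f →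
      PolarNull (towerOf X ι (p + 2) q l) ⊥ (n := 0) F)) :
    ∃ m, After (LoopNull ι 𝕊(Γ, T).pt) m f := by
  have : Nontrivial T := Finite.one_lt_card_iff_nontrivial.1 (by omega)
  obtain ⟨F, hF, hFf⟩ := hf.exists_polar
  refine hFf.exists_after (hF.null_two ((loopsIso ι (p + 2) q l).em1 (c.em1 (by omega) hq ι hX)) hM
    (piTriv_towerOf ι hX hq ⊤ (by omega)) (piTriv_towerOf ι hX hq ⊥ (by omega))
    (hT.imp id (Or.imp id (And.imp id fun h => h F hF hFf))))

end Vanishing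

lemma IsLoopMap.null {Γ : Type u} [Group Γ] [Finite Γ] [Nontrivial Γ] {n : ℕ}
    {G : Type u} [Group G] {X : GPrespectrum G} {ι : Γ →* G} {p q l : ℕ}
    {M : Type*} [AddCommGroup M] (c : ZeroCoeff X M) (hX : Concentrated X) (hq : q = X.d + l)
    (hM : NoTorsion M) (hn : 0 < n) {f : I × regSphere Γ n → Rep X p q l} (hf : IsLoopMap ι (regSphere Γ n).pt f)
    {i : ℕ} (hi : 0 < i) (hi' : i < 4) (hp : p + 1 + i = X.e + l)
    (h3 : ¬ (Nat.card Γ = 3 ∧ n = 1 ∧ i = 3)) :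
    ∃ m, After (LoopNull ι (regSphere Γ n).pt) m f := by
  have hcard := card_coord Γ 0 n
  rw [zero_add] at hcard
  have h2 : 2 ≤ Nat.card Γ := Finite.one_lt_card_iff_nontrivial.2 inferInstance
  have hle : Nat.card Γ ≤ n * Nat.card Γ := Nat.le_mul_of_pos_left _ hn
  have : Nontrivial (Coord Γ 0 n) := Finite.one_lt_card_iff_nontrivial.1 (by omega)
  obtain rfl | rfl | rfl : i = 1 ∨ i = 2 ∨ i = 3 := by omega
  · exact hf.null_one c hX hq hp
  · refine hf.null_two c hX hq hp ?_
    rw [hcard]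
    by_cases h : 3 ≤ n * Nat.card Γ
    · exact .inl h
    · have hn1 : n = 1 := by
        by_contra hn1
        have : 2 * 2 ≤ n * Nat.card Γ := Nat.mul_le_mul (by omega) h2
        omega
      subst hn1
      refine .inr ⟨by omega, ⟨fun x y => ?_⟩⟩
      rcases x with x | ⟨x, a⟩
      · exact x.elim0
      rcases y with y | ⟨y, b⟩
      · exact y.elim0
      refine ⟨b * a⁻¹, ?_⟩
      change (Sum.inr (x, b * a⁻¹ * a) : Fin 0 ⊕ (Fin 1 × Γ)) = Sum.inr (y, b)
      rw [inv_mul_cancel_right, Subsingleton.elim x y]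
  · refine hf.null_three c hX hq hp hM ?_
    rw [hcard]
    by_cases hn1 : n = 1
    · subst hn1
      have : Nat.card Γ ≠ 3 := fun h => h3 ⟨h, rfl, rfl⟩
      omega
    · have : 2 * 2 ≤ n * Nat.card Γ := Nat.mul_le_mul (by omega) h2
      omega

section SphereMap

variable {T : Type*}

open Classical in
/-- The cube as a parametrization of the sphere `S^T`; the complement of the open cube is sent to
infinity. -/
def sphereMap (c : T → ℝ) : OnePoint (T → ℝ) :=
  if ∀ t, |c t| < 1 then ((fun t => stretch (c t) : T → ℝ) : OnePoint (T → ℝ)) else ∞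

lemma sphereMap_of_lt (h : ∀ t, |c t| < 1) :
    sphereMap c = ((fun t => stretch (c t) : T → ℝ) : OnePoint (T → ℝ)) := if_pos h

lemma sphereMap_eq_infty : sphereMap c = ∞ ↔ ∃ t, 1 ≤ |c t| := by
  by_cases h : ∀ t, |c t| < 1
  · rw [sphereMap_of_lt h]
    exact ⟨fun h' => absurd h' (OnePoint.coe_ne_infty _), fun ⟨t, ht⟩ => absurd (h t) (not_lt.2 ht)⟩
  · rw [sphereMap, if_neg h]
    push Not at h
    exact ⟨fun _ => h, fun _ => rfl⟩

lemma sphereMap_inj (h : sphereMap c = sphereMap c')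
    (hc : sphereMap c ≠ ∞) : c = c' := by
  have hc' := h ▸ hc
  rw [Ne, sphereMap_eq_infty] at hc hc'
  push Not at hc hc'
  rw [sphereMap_of_lt hc, sphereMap_of_lt hc'] at h
  exact funext fun t => stretch_injOn (hc t) (hc' t) (congrFun (OnePoint.coe_injective h) t)

lemma exists_sphereMap_eq (x : T → ℝ) : ∃ c : T → ℝ, (∀ t, |c t| < 1) ∧ sphereMap c = x := by
  refine ⟨fun t => x t / (1 + |x t|), fun t => (stretch_shrink _).1, ?_⟩
  rw [sphereMap_of_lt fun t => (stretch_shrink _).1]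
  exact congrArg _ (funext fun t => (stretch_shrink _).2)

lemma continuous_sphereMap [Finite T] : Continuous (sphereMap (T := T)) := by
  have := Fintype.ofFinite T
  have h := continuous_blowup (ρ := fun c : T → ℝ => 1 - ‖c‖) (by fun_prop)
    (g := fun c t => stretch (c t)) (continuousOn_pi.2 fun t => continuousOn_stretch.comp
      (continuous_apply t).continuousOn fun c hc => by
        have h1 : 0 < 1 - ‖c‖ := hc
        have h2 := norm_le_pi_norm c t
        rw [Real.norm_eq_abs] at h2
        change 0 < 1 - |c t|
        linarith) (N := norm) continuous_norm fun c hc => by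
      have h1 : 0 ≤ (1 - ‖c‖)⁻¹ - 1 := by
        rw [sub_nonneg, one_le_inv₀ hc]
        linarith [norm_nonneg c]
      rw [one_div]
      rcases isEmpty_or_nonempty T with hT | hT
      · have : ‖c‖ = 0 := by rw [Subsingleton.elim c 0, norm_zero]
        rw [this]
        have := norm_nonneg (fun t => stretch (c t))
        norm_num
      · obtain ⟨t, ht⟩ := Finite.exists_max fun t => |c t|
        have ht := le_antisymm (norm_le_pi_norm c t)
          ((pi_norm_le_iff_of_nonneg (norm_nonneg _)).2 ht)
        have h2 := norm_le_pi_norm (fun t => stretch (c t)) t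
        rw [Real.norm_eq_abs] at ht
        rw [Real.norm_eq_abs, abs_stretch (by linarith), ht, one_div] at h2
        linarith
  refine h.congr fun c => ?_
  have : 0 < 1 - ‖c‖ ↔ ∀ t, |c t| < 1 := by
    rw [sub_pos, pi_norm_lt_iff one_pos]
    rfl
  rw [sphereMap]
  by_cases h : 0 < 1 - ‖c‖
  · rw [if_pos h, if_pos (this.1 h)]
  · rw [if_neg h, if_neg fun h' => h (this.2 h')]

lemma exists_torus_sphere [Finite T] : ∃ f : (T → OnePoint ℝ) → OnePoint (T → ℝ), Continuous f ∧
    (∀ c, f (collapse ∘ c) = sphereMap c) ∧ ∀ ζ, (∃ i, ζ i = ∞) → f ζ = ∞ := by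
  obtain ⟨f, hf, h1, h2⟩ := exists_descend_collapse
    (u := fun z : Unit × (T → ℝ) => sphereMap z.2) (continuous_sphereMap.comp continuous_snd)
    (v₀ := ∞) fun _ x hx => sphereMap_eq_infty.2 hx
  exact ⟨fun ζ => f ((), ζ), hf.comp (by fun_prop), h1 (), h2 ()⟩

lemma smul_sphereMap [Group K] [MulAction K T] [Finite T] (k : K)
    (c : T → ℝ) : (sphereMap (shift k c) : repSphere (permRep K T)) =
      k • (show repSphere (permRep K T) from sphereMap c) := by
  by_cases h : ∀ t, |c t| < 1
  · have h' : ∀ t, |shift k c t| < 1 := fun t => h _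
    rw [sphereMap_of_lt h, sphereMap_of_lt h']
    rfl
  · have h' : ¬ ∀ t, |shift k c t| < 1 := fun h' => h fun t => by simpa [shift] using h' (k • t)
    rw [sphereMap, sphereMap, if_neg h, if_neg h']
    exact ((repSphere (permRep K T)).smul_pt k).symm

end SphereMap

section Induced

variable {G : Type u} [Group G] {K : Subgroup G}

section Proj

variable {B : PtGSpace K}

open Classical in
/-- The projection of `G₊ ∧_K B` to the copy of `B` indexed by `g`. -/
def indProj (g : G) : induced K B → B :=
  Quot.lift (fun x : Σ _ : G, B => if h : g⁻¹ * x.1 ∈ K then (⟨g⁻¹ * x.1, h⟩ : K) • x.2 else B.pt) (by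
    rintro _ _ (⟨h, k, b⟩ | ⟨h, h'⟩)
    · have h1 : g⁻¹ * (h * k) ∈ K ↔ g⁻¹ * h ∈ K := by
        rw [← mul_assoc]
        exact K.mul_mem_cancel_right k.2
      by_cases h2 : g⁻¹ * h ∈ K
      · rw [dif_pos h2, dif_pos (h1.2 h2), ← mul_smul]
        congr 1
        exact Subtype.ext (mul_assoc _ _ _).symm
      · rw [dif_neg h2, dif_neg fun h => h2 (h1.1 h)]
    · simp only [B.smul_pt]
      split_ifs <;> rfl)

lemma indProj_mk (g g' : G) (b : B) (h : g⁻¹ * g' ∈ K) :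
    indProj g (Quot.mk _ ⟨g', b⟩ : induced K B) = (⟨g⁻¹ * g', h⟩ : K) • b := dif_pos h

lemma indProj_mk_of_notMem (b : B) (h : g⁻¹ * g' ∉ K) :
    indProj g (Quot.mk _ ⟨g', b⟩ : induced K B) = B.pt := dif_neg h

lemma indProj_self (g : G) (b : B) : indProj g (Quot.mk _ ⟨g, b⟩ : induced K B) = b := by
  rw [indProj_mk g g b (by rw [inv_mul_cancel]; exact K.one_mem)]
  simp only [inv_mul_cancel]
  exact one_smul K b

lemma continuous_indProj (g : G) : Continuous (indProj g : induced K B → B) := by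
  refine continuous_quot_lift _ (continuous_sigma fun g' => ?_)
  by_cases h : g⁻¹ * g' ∈ K
  · simp only [dif_pos h]
    exact continuous_const_smul _
  · simp only [dif_neg h]
    exact continuous_const

lemma induced_mk_pt (g : G) : (Quot.mk _ ⟨g, B.pt⟩ : induced K B) = (induced K B).pt :=
  Quot.sound (indRel.pt _ _)

lemma induced_mk_mul (g : G) (k : K) (b : B) :
    (Quot.mk _ ⟨g * k, b⟩ : induced K B) = Quot.mk _ ⟨g, k • b⟩ := Quot.sound (indRel.mul _ _ _)

lemma induced_ext {x y : induced K B} (h : ∀ g, indProj g x = indProj g y) : x = y := by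
  obtain ⟨⟨g, b⟩, rfl⟩ := Quot.exists_rep x
  obtain ⟨⟨g', b'⟩, rfl⟩ := Quot.exists_rep y
  have h1 := h g
  have h2 := h g'
  rw [indProj_self] at h1 h2
  by_cases hg : g⁻¹ * g' ∈ K
  · rw [indProj_mk g g' b' hg] at h1
    rw [h1, ← induced_mk_mul, mul_inv_cancel_left]
  · have hg' : g'⁻¹ * g ∉ K := fun h => hg (by simpa using K.inv_mem h)
    rw [indProj_mk_of_notMem b' hg] at h1
    rw [indProj_mk_of_notMem b hg'] at h2
    rw [h1, ← h2, induced_mk_pt, induced_mk_pt]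

instance [T2Space B] : T2Space (induced K B) :=
  T2Space.of_injective_continuous (f := fun (x : induced K B) (g : G) => indProj g x)
    (fun _ _ h => induced_ext fun g => congrFun h g) (continuous_pi fun g => continuous_indProj g)

end Proj

variable {W : Type u} [MulAction K W] [Finite W]

instance {V : Type u} [AddCommGroup V] [Module ℝ V] [TopologicalSpace V]
    [IsTopologicalAddGroup V] [ContinuousSMul ℝ V] [T2Space V] [FiniteDimensional ℝ V]
    (r : Representation ℝ G V) : T2Space (repSphere r) := by
  have e : V ≃L[ℝ] (Fin (Module.finrank ℝ V) → ℝ) := ContinuousLinearEquiv.ofFinrankEq (by simp)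
  have : LocallyCompactSpace V := e.toHomeomorph.isClosedEmbedding.locallyCompactSpace
  change T2Space (OnePoint V)
  infer_instance

variable (K W) in
/-- The target of maps to a smash product with `G₊ ∧_K S^W`. -/
abbrev IndSmash (Y : PtGSpace G) : PtGSpace G := smashSpace Y (induced K 𝕊(K, W))

/-- The point of `Y ∧ (G₊ ∧_K S^W)` given by a point of `Y`, an element of `G` and a point of the
cube. -/
def smk {Y : PtGSpace G} (y : Y) (g : G) (c : W → ℝ) : IndSmash K W Y :=
  Quot.mk _ (y, Quot.mk _ ⟨g, sphereMap c⟩)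

variable {Y : PtGSpace G}

lemma smk_pt (g : G) (c : W → ℝ) : smk (K := K) Y.pt g c = (IndSmash K W Y).pt :=
  Quot.sound ⟨.inl rfl, .inl rfl⟩

lemma smk_of_ge (y : Y) (g : G) (h : ∃ t, 1 ≤ |c t|) :
    smk (K := K) y g c = (IndSmash K W Y).pt := by
  rw [smk, sphereMap_eq_infty.2 h]
  exact Quot.sound ⟨.inr (induced_mk_pt g), .inl rfl⟩

lemma smul_smk (g g' : G) (y : Y) (c : W → ℝ) :
    g • smk (K := K) y g' c = smk (g • y) (g * g') c := rfl

lemma smk_mul (y : Y) (g : G) (k : K) (c : W → ℝ) :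
    smk (K := K) y (g * k) c = smk y g (shift k c) := by
  refine congrArg (fun b => (Quot.mk _ (y, b) : IndSmash K W Y)) ?_
  exact (induced_mk_mul _ _ _).trans
    (congrArg (fun b => (Quot.mk _ ⟨g, b⟩ : induced K _))
      (smul_sphereMap k c).symm)

lemma continuous_smk (g : G) :
    Continuous fun z : Y × (W → ℝ) => (smk z.1 g z.2 : IndSmash K W Y) := by
  refine continuous_quot_mk.comp (continuous_fst.prodMk (continuous_quot_mk.comp ?_))
  exact (continuous_sigmaMk).comp
    (continuous_sphereMap.comp continuous_snd)

lemma exists_smk_eq (x : IndSmash K W Y) : x = (IndSmash K W Y).pt ∨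
    ∃ (y : Y) (g : G) (c : W → ℝ), (∀ t, |c t| < 1) ∧ x = smk y g c := by
  obtain ⟨⟨y, b⟩, rfl⟩ := Quot.exists_rep x
  obtain ⟨⟨g, s⟩, rfl⟩ := Quot.exists_rep b
  rcases s with _ | s
  · exact Or.inl (Quot.sound ⟨Or.inr (induced_mk_pt g), Or.inl rfl⟩)
  ·
    obtain ⟨c, hc, hcs⟩ := exists_sphereMap_eq s
    exact .inr ⟨y, g, c, hc,
      congrArg (fun s => (Quot.mk _ (y, Quot.mk _ ⟨g, s⟩) : IndSmash K W Y)) hcs.symm⟩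

lemma exists_smash_lift [Finite G] [TopologicalSpace P] [LocallyCompactSpace P]
    [TopologicalSpace V] {h : G → (P × Y) × (W → ℝ) → V} (hc : ∀ g, Continuous (h g))
    (hk : ∀ g (k : K) w c, h (g * k) (w, c) = h g (w, shift k c))
    (hb : ∀ g w c, (∃ t, 1 ≤ |c t|) → h g (w, c) = v₀)
    (hx : ∀ g p c, h g ((p, Y.pt), c) = v₀) :
    ∃ H : P × IndSmash K W Y → V, Continuous H ∧
      (∀ p y g c, H (p, smk y g c) = h g ((p, y), c)) ∧ ∀ p, H (p, (IndSmash K W Y).pt) = v₀ := by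
  let _ : TopologicalSpace (Option G) := ⊥
  have : DiscreteTopology (Option G) := ⟨rfl⟩
  let B := 𝕊(K, W)
  let q : Option G × (W → Icc (-1 : ℝ) 1) → induced K B := fun z =>
    match z.1 with
    | none => (induced K B).pt
    | some g => Quot.mk _ ⟨g, sphereMap fun t => z.2 t⟩
  let h' : (P × Y) × (Option G × (W → Icc (-1 : ℝ) 1)) → V := fun z =>
    match z.2.1 with
    | none => v₀
    | some g => h g (z.1, fun t => z.2.2 t)
  have hq : Continuous q := by
    rw [continuous_prod_of_discrete_left]
    rintro (_ | g)
    · exact continuous_const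
    · exact continuous_quot_mk.comp ((continuous_sigmaMk (σ := fun _ : G => B) (i := g)).comp
        (continuous_sphereMap.comp (by fun_prop)))
  have hqs : Function.Surjective q := by
    intro b
    obtain ⟨⟨g, s⟩, rfl⟩ := Quot.exists_rep b
    induction s using OnePoint.rec with
    | infty => exact ⟨(none, fun _ => ⟨0, by simp⟩), (induced_mk_pt g).symm⟩
    | coe s =>
      obtain ⟨c, hc, hcs⟩ := exists_sphereMap_eq s
      exact ⟨(some g, fun t => ⟨c t, abs_le.1 (hc t).le⟩),
        congrArg (fun s => (Quot.mk _ ⟨g, s⟩ : induced K B)) hcs⟩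
  have hh : Continuous h' := by
    have : Continuous fun z : Option G × ((P × Y) × (W → Icc (-1 : ℝ) 1)) =>
        h' (z.2.1, (z.1, z.2.2)) := by
      rw [continuous_prod_of_discrete_left]
      rintro (_ | g)
      · exact continuous_const
      · exact (hc g).comp (by fun_prop)
    exact this.comp (f := fun z : (P × Y) × (Option G × (W → Icc (-1 : ℝ) 1)) =>
      (z.2.1, (z.1, z.2.2))) (by fun_prop)
  have hpt : ∀ g w c, (Quot.mk _ ⟨g, sphereMap c⟩ : induced K B) = (induced K B).pt →
      h g (w, c) = v₀ := by
    intro g w c hgc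
    refine hb g w c (sphereMap_eq_infty.1 ?_)
    have := congrArg (indProj g) (hgc.trans (induced_mk_pt g).symm)
    exact (indProj_self (B := B) g (sphereMap c)).symm.trans
      (this.trans (indProj_self (B := B) g B.pt))
  obtain ⟨F, hF, hFq⟩ := exists_descend hq hqs hh (by
    rintro w ⟨_ | g, c⟩ ⟨_ | g', c'⟩ hcc
    · rfl
    · exact (hpt g' w _ hcc.symm).symm
    · exact hpt g w _ hcc
    · change h g (w, fun t => c t) = h g' (w, fun t => c' t)
      have hcc := hcc
      by_cases hi : (Quot.mk _ ⟨g, sphereMap fun t => (c t : ℝ)⟩ : induced K B) = (induced K B).pt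
      · rw [hpt g w _ hi, hpt g' w _ (hcc.symm.trans hi)]
      · have hne : sphereMap (fun t => (c t : ℝ)) ≠ ∞ := fun h0 => hi (by
          rw [h0]; exact induced_mk_pt g)
        have h1 := (indProj_self (B := B) g (sphereMap fun t => (c t : ℝ))).symm.trans
          (congrArg (indProj g) hcc)
        by_cases hg : g⁻¹ * g' ∈ K
        · have h2 := (h1.trans (indProj_mk g g' _ hg)).trans (smul_sphereMap (⟨g⁻¹ * g', hg⟩ : K) fun t => (c' t : ℝ)).symm
          have h3 := sphereMap_inj h2 hne
          have h4 := hk g ⟨g⁻¹ * g', hg⟩ w fun t => (c' t : ℝ)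
          rw [← h3] at h4
          rw [← h4]
          simp
        · exact absurd (h1.trans (indProj_mk_of_notMem _ hg)) hne)
  have hFb := fun w => hFq w (none, fun _ => ⟨0, by simp⟩)
  have hFx : ∀ p b, F ((p, Y.pt), b) = v₀ := by
    intro p b
    obtain ⟨⟨_ | g, c⟩, rfl⟩ := hqs b
    · exact hFb _
    · exact (hFq (p, Y.pt) (some g, c)).trans (hx g p _)
  have hFm : ∀ w g c, F (w, Quot.mk _ ⟨g, sphereMap c⟩) = h g (w, c) := by
    intro w g c
    by_cases h1 : ∃ t, 1 ≤ |c t|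
    · rw [hb g w c h1, sphereMap_eq_infty.2 h1]
      exact (congrArg (fun b => F (w, b)) (induced_mk_pt g)).trans (hFb w)
    · push Not at h1
      exact hFq w (some g, fun t => ⟨c t, abs_le.1 (h1 t).le⟩)
  let Φ : IndSmash K W Y → C(P, V) := Quot.lift
    (fun x => ⟨fun p => F ((p, x.1), x.2), hF.comp (by fun_prop)⟩) (by
      have : ∀ x : Y × induced K B, (x.1 = Y.pt ∨ x.2 = (induced K B).pt) → ∀ p,
          F ((p, x.1), x.2) = v₀ := by
        rintro ⟨y, b⟩ (rfl | rfl) p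
        exacts [hFx p b, hFb _]
      rintro x y ⟨h1, h2⟩
      ext p
      exact (this x h1 p).trans (this y h2 p).symm)
  have hΦ : Continuous Φ := continuous_quot_lift _
    (ContinuousMap.continuous_of_continuous_uncurry _ (hF.comp (by fun_prop)))
  refine ⟨fun z => Φ z.2 z.1, (hΦ.comp continuous_snd).eval continuous_fst,
    fun p y g c => hFm _ _ _, fun p => hFb _⟩

end Induced

section

variable {G : Type u} [Group G] {X Y : GPrespectrum G} {p q l : ℕ}

/-- A path between points, fixed by a subgroup. -/
def FixedPath (K : Subgroup G) (x x' : Rep X p q l) : Prop :=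
  ∃ c : I → Rep X p q l, Continuous c ∧ c 0 = x ∧ c 1 = x' ∧ ∀ t, ∀ g ∈ K, g • c t = c t

lemma FixedPath.stab {x x' : Rep X p q l} (h : FixedPath K x x') :
    FixedPath K (stab x) (stab x') := by
  obtain ⟨c, hc, h0, h1, hf⟩ := h
  exact ⟨fun t => Rep.stab (c t), Rep.stab.continuous.comp hc, congrArg Rep.stab h0, congrArg Rep.stab h1,
    fun t g hg => by rw [← stab_smul, hf t g hg]⟩

lemma FixedPath.after {x x' : Rep X p q l} (h : FixedPath K x x') {m : ℕ}
    (hx' : After (ConnBase K) m fun _ => x') : After (ConnBase K) m fun _ => x := by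
  refine hx'.transport (fun p q l p' q' f f' =>
    ∃ hp hq, FixedPath K (f' ()) (castRep hp hq rfl (f ()))) ?_ ?_
    (f := fun _ => x') (f' := fun _ => x) ⟨rfl, rfl, h⟩
  · rintro p q l p' q' f f' ⟨rfl, rfl, h⟩
    exact ⟨rfl, rfl, h.stab⟩
  · rintro p q l p' q' f f' ⟨rfl, rfl, c, hc, h0, h1, hf⟩ ⟨c', hc', h0', h1', hf'⟩
    have h01 : c 1 = c' 0 := by rw [h1, h0']; rfl
    let γ : Path (c 0) (c 1) := ⟨⟨c, hc⟩, rfl, rfl⟩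
    let γ' : Path (c 1) (c' 1) := ⟨⟨c', hc'⟩, h01.symm, rfl⟩
    refine ⟨γ.trans γ', (γ.trans γ').continuous, (γ.trans γ').source.trans h0,
      (γ.trans γ').target.trans h1', fun t g hg => ?_⟩
    rw [Path.trans_apply]
    split_ifs
    · exact hf _ g hg
    · exact hf' _ g hg

lemma subsingleton_homotopyGroup (i : ℕ) (h : ∀ (p q l : ℕ) (x : Rep X p q l),
    (∀ g : G, g • x = x) → q = X.d + l → p + i = X.e + l →
    ∃ m, After (ConnBase ⊤) m fun _ => x) : Subsingleton (homotopyGroup (-i) X) := by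
  change Subsingleton (stableMaps (-i) (orbit ⊤) X)
  refine subsingleton_of_forall_eq 1 fun x => ?_
  obtain ⟨N, γ, rfl⟩ := exists_cls X (-i) (orbit ⊤) x
  rw [cls_eq_one_iff]
  have hl := MapSpace.isLoopMap_loopRep γ
  obtain ⟨F, hF, hFf⟩ := exists_absorb_circ rfl rfl
    (W := Unit) (f := fun z => MapSpace.loopRep γ (z.2, coset ⊤)) (hl.cont.comp (by fun_prop))
    (fun _ => hl.zero _) fun _ => hl.one _
  obtain ⟨m, hm⟩ := h _ _ _ (F ()) (fun g => unabs_circ_ext rfl rfl fun s => by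
    rw [unabs_circ_smul, hFf]
    exact (hl.equi g s (coset ⊤)).symm.trans (by rw [smul_coset (Subgroup.mem_top g)]))
    (by omega) (by omega)
  refine ⟨m, hm.transport (fun p q l p' q' F f => ∃ hP hQ,
    IsLoopMap (MonoidHom.id G) (orbit (⊤ : Subgroup G)).pt f ∧
      ∀ s, unabs hP hQ (F ()) (circ G s) = f (s, coset ⊤)) ?_ ?_ ⟨rfl, rfl, hl, hFf ()⟩⟩
  · rintro p q l p' q' F f ⟨hP, hQ, hf, h⟩
    refine ⟨by omega, by omega, hf.stab, fun s => ?_⟩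
    rw [unabs_stab hP hQ, h]
  · rintro p q l p' q' F f ⟨hP, hQ, hf, h⟩ ⟨c, hc, h0, h1, hcf⟩
    have hu : ∀ w : I × I, ∀ g ∈ (⊤ : Subgroup G),
        g • unabs hP hQ (c w.1) (circ G w.2) = unabs hP hQ (c w.1) (circ G w.2) :=
      fun w g hg => by rw [← unabs_circ_smul, hcf _ g hg]
    have huc : Continuous fun w : I × I =>
        unabs hP hQ (c w.1) (circ G w.2) :=
      (continuous_unabs_circ hP hQ).comp (f := fun w : I × I =>
        (c w.1, w.2)) (by fun_prop)
    refine ⟨fun z => orbitExt ⊤ (fun w : I × I =>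
      unabs hP hQ (c w.1) (circ G w.2)) ((z.1, z.2.1), z.2.2),
      (continuous_orbitExt huc).comp (by fun_prop), fun t => ?_, ?_, ?_⟩
    · have h := isLoopMap_orbitExt (u := fun s => unabs hP hQ (c t) (circ G s))
        (fun s => hu (t, s)) (huc.comp (f := fun s => (t, s)) (by fun_prop))
        (unabs_circ_zero hP hQ _) (unabs_circ_one hP hQ _)
      refine Eq.mp (congrArg _ (funext ?_)) h
      rintro ⟨s, _ | a⟩ <;> rfl
    · rintro ⟨s, a⟩
      rcases exists_smul_coset a with rfl | ⟨g, rfl⟩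
      · exact (hf.pt s).symm
      · dsimp only
        rw [orbitExt_smul hu, orbitExt_coset hu, h0, h, hf.equi]
        rfl
    · rintro ⟨s, a⟩
      rcases exists_smul_coset a with rfl | ⟨g, rfl⟩
      · rfl
      · dsimp only
        rw [orbitExt_smul hu, orbitExt_coset hu, h1, unabs_base, smul_base]

/-- The iterated structure map. -/
def iterStruct (X : GPrespectrum G) (l : ℕ) : ∀ a : ℕ, C(X.level l, Rep X a a (l + a))
  | 0 => ⟨fun x => ⟨ContinuousMap.const _ x, by rintro z ⟨t | ⟨t, g⟩, -⟩ <;> exact t.elim0⟩,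
      continuous_of_uncurry (W := X.level l) continuous_fst⟩
  | a + 1 => Rep.stab.comp (iterStruct X l a)

lemma iterStruct_pt (a : ℕ) : iterStruct X l a (X.level l).pt = Rep.base X a a (l + a) := by
  induction a with
  | zero => rfl
  | succ a ih => exact (congrArg stab ih).trans stab_base

lemma iterStruct_smul (a : ℕ) (g : G) (x : X.level l) :
    iterStruct X l a (g • x) = g • iterStruct X l a x := by
  induction a with
  | zero => rfl
  | succ a ih => exact (congrArg stab ih).trans (stab_smul g _)

namespace Coord

/-- The inclusion of the first coordinates in `(p + q ρ) ⊕ (a + b ρ)`. -/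
def inFst (a b : ℕ) : Coord G p q → Coord G (p + a) (q + b) :=
  Sum.map (Fin.castAdd a) (Prod.map (Fin.castAdd b) id)

/-- The inclusion of the last coordinates in `(p + q ρ) ⊕ (a + b ρ)`. -/
def inSnd (p q : ℕ) : Coord G a b → Coord G (p + a) (q + b) :=
  Sum.map (Fin.natAdd p) (Prod.map (Fin.natAdd q) id)

lemma exists_inFst_or_inSnd (t : Coord G (p + a) (q + b)) :
    (∃ s : Coord G p q, inFst a b s = t) ∨ ∃ s : Coord G a b, inSnd p q s = t := by
  rcases t with i | ⟨i, g⟩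
  · exact Fin.addCases (fun i => .inl ⟨.inl i, rfl⟩) (fun i => .inr ⟨.inl i, rfl⟩) i
  · exact Fin.addCases (fun i => .inl ⟨.inr (i, g), rfl⟩)
      (fun i => .inr ⟨.inr (i, g), rfl⟩) i

lemma inFst_smul (g : G) (t : Coord G p q) : inFst a b (g • t) = g • inFst a b t := by
  rcases t with t | t <;> rfl

lemma inSnd_smul (g : G) (t : Coord G a b) : inSnd p q (g • t) = g • inSnd p q t := by
  rcases t with t | t <;> rfl

end Coord

namespace Rep

/-- The iterated stabilization. -/
def stabN : ∀ a : ℕ, C(Rep X p q l, Rep X (p + a) (q + a) (l + a))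
  | 0 => ContinuousMap.id _
  | a + 1 => stab.comp (stabN a)

lemma stabN_apply (a : ℕ) (f : Rep X p q l) (z : Torus (Coord G (p + a) (q + a))) :
    stabN a f z = iterStruct X l a (f (z ∘ Coord.inFst a a)) (z ∘ Coord.inSnd p q) := by
  induction a with
  | zero =>
    refine congrArg f (funext fun t => ?_)
    rcases t with t | ⟨t, g⟩ <;> rfl
  | succ a ih =>
    have e1 : (z ∘ Coord.old) ∘ Coord.inFst a a = z ∘ Coord.inFst (a + 1) (a + 1) := by
      funext t
      rcases t with t | ⟨t, g⟩ <;> rfl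
    have e2 : (z ∘ Coord.old) ∘ Coord.inSnd p q = (z ∘ Coord.inSnd p q) ∘ Coord.old := by
      funext t
      rcases t with t | ⟨t, g⟩ <;> rfl
    have e3 : z ∘ Coord.new =
        (z ∘ Coord.inSnd p q) ∘ Coord.new := by
      ext (t | ⟨t, g⟩)
      · refine congrArg (fun i => z (.inl i)) (Fin.ext ?_)
        change p + a + (t : ℕ) = p + (a + t)
        omega
      · refine congrArg (fun i => z (Sum.inr (i, g))) (Fin.ext ?_)
        change q + a + (t : ℕ) = q + (a + t)
        omega
    change X.struct (l + a) (stabN a f (z ∘ Coord.old)) (z ∘ Coord.new) =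
      X.struct (l + a) (iterStruct X l a (f (z ∘ Coord.inFst (a + 1) (a + 1)))
        ((z ∘ Coord.inSnd p q) ∘ Coord.old)) ((z ∘ Coord.inSnd p q) ∘ Coord.new)
    rw [ih, e1, e2, e3]

lemma exists_after_of_stabN (a : ℕ)
    {f : W → Rep X p q l} (h : ∃ m, After N m fun x => stabN a (f x)) : ∃ m, After N m f := by
  induction a with
  | zero => exact h
  | succ a ih =>
    obtain ⟨m, hm⟩ := h
    exact ih ⟨m + 1, hm⟩

end Rep

lemma iterStruct_smash (E : DesuspendedSpace G) (a : ℕ) (x : X.level l) (b : E.space) (ζ) :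
    iterStruct (X.smash E) l a (Quot.mk _ (x, b)) ζ =
      Quot.mk (smashRel (X.level (l + a)) E.space) (iterStruct X l a x ζ, b) := by
  induction a with
  | zero => rfl
  | succ a ih =>
    refine (stab_apply _ _).trans
      ((congrArg (fun y => (X.smash E).struct (l + a) y _) (ih _)).trans ?_)
    rfl

end

section Glue

open Topology

lemma exists_glue [Group G] [Finite G] {K : Subgroup G} {Y : PtGSpace G} {P : Type*}
    [TopologicalSpace P] {σ : G → P → P} (hσ : ∀ g, Continuous (σ g)) (h1 : ∀ p, σ 1 p = p)
    (hm : ∀ g h p, σ (g * h) p = σ g (σ h p)) {O : Set P} (hO : IsOpen O)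
    (hOd : ∀ p g, p ∈ O → σ g p ∈ O → g ∈ K) {A : P → Y} (hA : Continuous A)
    (hA0 : ∀ p, p ∉ O → A p = Y.pt) (hAK : ∀ k ∈ K, ∀ p, A (σ k p) = k • A p) :
    ∃ B : P → Y, Continuous B ∧ (∀ g p, B (σ g p) = g • B p) ∧ (∀ p ∈ O, B p = A p) ∧
      ∀ p, (∀ g, σ g p ∉ O) → B p = Y.pt := by
  classical
  let B : P → Y := fun p => if h : ∃ g, σ g p ∈ O then h.choose⁻¹ • A (σ h.choose p) else Y.pt
  have hinv : ∀ g p, σ g⁻¹ (σ g p) = p := fun g p => by rw [← hm, inv_mul_cancel, h1]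
  have hB : ∀ g p, σ g p ∈ O → B p = g⁻¹ • A (σ g p) := by
    intro g p hg
    have h : ∃ g, σ g p ∈ O := ⟨g, hg⟩
    have hk : h.choose * g⁻¹ ∈ K := hOd _ _ hg (by rw [hm, hinv]; exact h.choose_spec)
    have h2 := hAK _ hk (σ g p)
    rw [hm, hinv] at h2
    change dite _ _ _ = _
    rw [dif_pos h, h2, smul_smul, inv_mul_cancel_left]
  have hB0 : ∀ p, (∀ g, σ g p ∉ O) → B p = Y.pt := fun p hp => dif_neg (by simpa using hp)
  refine ⟨B, ?_, fun g p => ?_, fun p hp => ?_, hB0⟩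
  · rw [continuous_iff_continuousAt]
    intro p
    have hc : ∀ g, Continuous fun p => g⁻¹ • A (σ g p) := fun g =>
      (continuous_const_smul _).comp (hA.comp (hσ g))
    by_cases hp : ∃ g, σ g p ∈ O
    · obtain ⟨g, hg⟩ := hp
      refine (hc g).continuousAt.congr ?_
      filter_upwards [(hO.preimage (hσ g)).mem_nhds hg] with p' hp'
      exact (hB g p' hp').symm
    · push Not at hp
      intro V hV
      rw [hB0 p hp] at hV
      have : ∀ g, ∀ᶠ p' in 𝓝 p, g⁻¹ • A (σ g p') ∈ V := fun g => by
        refine (hc g).continuousAt ?_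
        rwa [hA0 _ (hp g), Y.smul_pt]
      have hV' := Filter.eventually_all.2 this
      change ∀ᶠ p' in 𝓝 p, B p' ∈ V
      filter_upwards [hV'] with p' hp'
      by_cases h : ∃ g, σ g p' ∈ O
      · obtain ⟨g, hg⟩ := h
        rw [hB g p' hg]
        exact hp' g
      · push Not at h
        rw [hB0 p' h]
        exact mem_of_mem_nhds hV
  · by_cases h : ∃ g, σ g p ∈ O
    · obtain ⟨h, hh⟩ := h
      have e : σ (h * g⁻¹) (σ g p) = σ h p := by rw [hm, hinv]
      rw [hB (h * g⁻¹) (σ g p) (by rwa [e]), hB h p hh, e, smul_smul]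
      simp
    · push Not at h
      rw [hB0 p h, hB0 _ fun k => by rw [← hm]; exact h _, Y.smul_pt]
  · have := hB 1 p (by rwa [h1])
    rwa [h1, inv_one, one_smul] at this

end Glue

section TorusMap

variable {Γ : Type w} [Group Γ] {U : Type u} [MulAction Γ U] {G : Type u} [Group G]
  {X : GPrespectrum G} (ι : Γ →* G) {p q l : ℕ}

/-- A pointed equivariant map on the sphere `S^U`. -/
structure IsTorusMap (f : Torus U → Rep X p q l) : Prop where
  cont : Continuous f
  infty : ∀ z, (∃ t, z t = ∞) → f z = Rep.base X p q l
  equi : ∀ (γ : Γ) z, f (shift γ z) = ι γ • f z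

/-- Null homotopic pointed equivariant maps on the sphere `S^U`. -/
def TorusNull (p q l : ℕ) (f : Torus U → Rep X p q l) : Prop :=
  ∃ H : I × Torus U → Rep X p q l, Continuous H ∧
    (∀ t, IsTorusMap ι fun z => H (t, z)) ∧ (∀ z, H (0, z) = f z) ∧
    ∀ z, H (1, z) = Rep.base X p q l

variable {ι}

lemma IsTorusMap.stab {f : Torus U → Rep X p q l} (hf : IsTorusMap ι f) :
    IsTorusMap ι fun z => stab (f z) where
  cont := Rep.stab.continuous.comp hf.cont
  infty z hz := by rw [hf.infty z hz, stab_base]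
  equi γ z := by rw [hf.equi, stab_smul]

end TorusMap

lemma collapse_comp_surjective (ζ : Torus T) : ∃ r : T → ℝ, collapse ∘ r = ζ := by
  choose r _ hr using fun i => exists_collapse (ζ i)
  exact ⟨r, funext hr⟩

section Pinch

variable {G : Type u} [Group G] (K : Subgroup G) {p q l p' q' : ℕ} (q₀ : ℕ)

open Classical in
/-- The sign of an element with respect to a subgroup. -/
def subgroupSign (g : G) : ℝ := if g ∈ K then 1 else -1

lemma abs_subgroupSign (g : G) : |subgroupSign K g| = 1 := by
  unfold subgroupSign
  split_ifs <;> simp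

lemma subgroupSign_mul (hk : k ∈ K) (g : G) :
    subgroupSign K (k * g) = subgroupSign K g := by
  by_cases h : g ∈ K
  · rw [subgroupSign, subgroupSign, if_pos h, if_pos (K.mul_mem hk h)]
  · rw [subgroupSign, subgroupSign, if_neg h, if_neg fun h' => h ((K.mul_mem_cancel_left hk).1 h')]

/-- The homotopy from the identity to the map stretching the orthant of vectors in the `q₀`-th copy of
the regular representation that are positive on `K` and negative elsewhere. -/
def pinch (τ : ℝ) (r : Coord G p q → ℝ) : Coord G p q → ℝ
  | Sum.inl i => r (Sum.inl i)
  | Sum.inr (i, g) => if (i : ℕ) = q₀ then (1 + τ) * r (Sum.inr (i, g)) - τ * subgroupSign K g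
      else r (Sum.inr (i, g))

/-- The orthant of vectors that are positive on `K` and negative elsewhere. -/
def InOrthant (r : Coord G p q → ℝ) : Prop :=
  ∀ (i : Fin q) (g : G), (i : ℕ) = q₀ → 0 < subgroupSign K g * r (Sum.inr (i, g))

variable {K q₀}

lemma continuous_pinch : Continuous fun z : ℝ × (Coord G p q → ℝ) => pinch K q₀ z.1 z.2 := by
  refine continuous_pi fun t => ?_
  rcases t with i | ⟨i, g⟩
  · exact (continuous_apply _).comp continuous_snd
  · by_cases h : i = q₀
    · simp only [pinch, if_pos h]
      fun_prop
    · simp only [pinch, if_neg h]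
      fun_prop

lemma pinch_zero (r : Coord G p q → ℝ) : pinch K q₀ 0 r = r := by
  ext (i | ⟨i, g⟩)
  · rfl
  · simp [pinch]

lemma pinch_shift (hk : k ∈ K) (τ : ℝ) (r : Coord G p q → ℝ) :
    pinch K q₀ τ (shift k r) = shift k (pinch K q₀ τ r) := by
  ext (i | ⟨i, g⟩)
  · rfl
  · change ite _ (_ - τ * subgroupSign K g) _ = ite _ (_ - τ * subgroupSign K (k⁻¹ * g)) _
    rw [subgroupSign_mul K (K.inv_mem hk)]
    rfl

lemma le_abs_pinch (hτ : 0 ≤ τ) (h : 1 ≤ |r t|) :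
    1 ≤ |pinch K q₀ τ r t| := by
  rcases t with i | ⟨i, g⟩
  · exact h
  · simp only [pinch]
    split_ifs
    · have h1 := abs_sub_abs_le_abs_sub ((1 + τ) * r (.inr (i, g))) (τ * subgroupSign K g)
      rw [abs_mul, abs_mul, abs_subgroupSign, abs_of_nonneg hτ, abs_of_nonneg (by linarith)] at h1
      nlinarith
    · exact h

lemma exists_le_abs_pinch (h : ¬ InOrthant K q₀ r) :
    ∃ t, 1 ≤ |pinch K q₀ 1 r t| := by
  simp only [InOrthant, not_forall, not_lt] at h
  obtain ⟨i, g, hi, h⟩ := h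
  refine ⟨.inr (i, g), ?_⟩
  simp only [pinch, if_pos hi]
  have h1 := abs_subgroupSign K g
  have h2 : |subgroupSign K g * ((1 + 1) * r (Sum.inr (i, g)) - 1 * subgroupSign K g)| =
      |(1 + 1) * r (Sum.inr (i, g)) - 1 * subgroupSign K g| := by rw [abs_mul, h1, one_mul]
  have h3 : subgroupSign K g * subgroupSign K g = 1 := by rw [← abs_mul_abs_self, h1, one_mul]
  rw [← h2]
  refine le_abs.2 (.inr ?_)
  linarith

lemma isOpen_inOrthant [Finite G] : IsOpen {r : Coord G p q → ℝ | InOrthant K q₀ r} := by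
  simp only [InOrthant, ofPred_forall]
  refine isOpen_iInter_of_finite fun i => isOpen_iInter_of_finite fun g =>
    isOpen_iInter_of_finite fun _ => isOpen_lt continuous_const ?_
  exact continuous_const.mul (continuous_apply _)

lemma InOrthant.mem_of_shift (hq : q₀ < q) {r : Coord G p q → ℝ} (h : InOrthant K q₀ r) {g : G}
    (hg : InOrthant K q₀ (shift g r)) : g ∈ K := by
  have h1 := h ⟨q₀, hq⟩ 1 rfl
  have h2 := hg ⟨q₀, hq⟩ g rfl
  by_contra hn
  rw [subgroupSign, if_pos K.one_mem, one_mul] at h1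
  change 0 < subgroupSign K g * r (Sum.inr (⟨q₀, hq⟩, g⁻¹ * g)) at h2
  rw [subgroupSign, if_neg hn, inv_mul_cancel] at h2
  linarith

/-- The coordinates of `p + (q + j) ρ` in a block of `j` copies of the regular representation. -/
def Coord.block (q₀ : ℕ) (hq : q' = q + j) (h : q₀ ≤ q) (x : Fin j × G) : Coord G p' q' :=
  Sum.inr (⟨q₀ + x.1, by omega⟩, x.2)

variable {j : ℕ} (q₀) (hp : p' = p) (hq : q' = q + j)

/-- The coordinates of `p + (q + j) ρ` outside of a block of `j` copies of the regular
representation. -/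
def Coord.skip : Coord G p q → Coord G p' q' :=
  Sum.map (fun i => ⟨i, by omega⟩)
    (Prod.map (fun i => ⟨if (i : ℕ) < q₀ then i else i + j, by split_ifs <;> omega⟩) id)

lemma Coord.skip_smul (g : G) (t : Coord G p q) :
    Coord.skip q₀ hp hq (g • t) = g • Coord.skip q₀ hp hq t := by
  rcases t with t | t <;> rfl

lemma Coord.exists_skip_or_block (h : q₀ ≤ q) (t : Coord G p' q') :
    (∃ s, Coord.skip q₀ hp hq s = t) ∨ ∃ x, Coord.block (p' := p') q₀ hq h x = t := by
  rcases t with i | ⟨i, g⟩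
  · exact .inl ⟨.inl ⟨i, by omega⟩, rfl⟩
  · by_cases h1 : i < q₀
    · exact .inl ⟨.inr (⟨i, by omega⟩, g), congrArg (fun i => Sum.inr (i, g))
        (Fin.ext (if_pos h1))⟩
    · by_cases h2 : i < q₀ + j
      · exact .inr ⟨(⟨i - q₀, by omega⟩, g), congrArg (fun i => Sum.inr (i, g))
          (Fin.ext (by simp only; omega))⟩
      · refine .inl ⟨.inr (⟨i - j, by omega⟩, g), congrArg (fun i => Sum.inr (i, g))
          (Fin.ext ?_)⟩
        have : ¬ ((i : ℕ) - j < q₀) := by omega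
        simp only [this, if_false]
        omega

end Pinch

/-- A decomposition of `j` copies of `G`, as a `K`-set. -/
structure Splitting {G : Type u} [Group G] (K : Subgroup G) (W U : Type u) [MulAction K W]
    [MulAction K U] (j : ℕ) where
  e : W ⊕ U ≃ Fin j × G
  smul_inl : ∀ (k : K) w, e (Sum.inl (k • w)) = ((e (Sum.inl w)).1, (k : G) * (e (Sum.inl w)).2)
  smul_inr : ∀ (k : K) u, e (Sum.inr (k • u)) = ((e (Sum.inr u)).1, (k : G) * (e (Sum.inr u)).2)

section Spread

variable {G : Type u} [Group G] {K : Subgroup G} {W U : Type u} [MulAction K W] [MulAction K U]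
  [Finite W] [Finite U] {j : ℕ} (s : Splitting K W U j) {X : GPrespectrum G} {p q l p' q' : ℕ}
  (q₀ : ℕ) (hp : p' = p) (hq : q' = q + j) (h₀ : q₀ < q)

/-- The `K`-equivariant map `S^{p + (q + j) ρ} → X_l ∧ (G₊ ∧_K S^W)` given by a map
`S^{p + q ρ} ∧ S^U → X_l`. -/
def spread (f : Torus U → Rep X p q l) (r : Coord G p' q' → ℝ) : IndSmash K W (X.level l) :=
  smk (f (fun u => collapse (r (Coord.block q₀ hq h₀.le (s.e (Sum.inr u)))))
    (collapse ∘ pinch K q₀ 1 (r ∘ Coord.skip q₀ hp hq))) 1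
    fun w => r (Coord.block q₀ hq h₀.le (s.e (Sum.inl w)))

lemma continuous_spread [TopologicalSpace P]
    (hf : Continuous f) : Continuous fun z : P × (Coord G p' q' → ℝ) =>
      spread s q₀ hp hq h₀ (fun ζ => f (z.1, ζ)) z.2 := by
  refine (continuous_smk 1).comp (Continuous.prodMk ?_ ?_)
  · refine Continuous.eval (hf.comp (continuous_fst.prodMk (continuous_pi fun u =>
      continuous_collapse.comp ((continuous_apply _).comp continuous_snd)))) ?_
    have hc := continuous_pinch (K := K) (q₀ := q₀).comp
      (f := fun z : P × (Coord G p' q' → ℝ) => ((1 : ℝ), z.2 ∘ Coord.skip q₀ hp hq)) (by fun_prop)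
    exact continuous_pi fun t => continuous_collapse.comp (continuous_pi_iff.1 hc t)
  · fun_prop

variable {f : Torus U → Rep X p q l} (hf : IsTorusMap K.subtype f)

lemma spread_of_notMem (r : Coord G p' q' → ℝ) (hr : ¬ InOrthant K q₀ (r ∘ Coord.skip q₀ hp hq)) :
    spread s q₀ hp hq h₀ f r = (IndSmash K W (X.level l)).pt := by
  obtain ⟨t, ht⟩ := exists_le_abs_pinch hr
  rw [spread, Rep.infty _ ⟨t, collapse_of_ge ht⟩, smk_pt]

include hf in
lemma spread_of_ge (r : Coord G p' q' → ℝ) (hr : ∃ t, 1 ≤ |r t|) :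
    spread s q₀ hp hq h₀ f r = (IndSmash K W (X.level l)).pt := by
  obtain ⟨t, ht⟩ := hr
  rcases Coord.exists_skip_or_block q₀ hp hq h₀.le t with ⟨t, rfl⟩ | ⟨x, rfl⟩
  · rw [spread, Rep.infty _ ⟨t, collapse_of_ge
      (le_abs_pinch zero_le_one (r := r ∘ Coord.skip q₀ hp hq) ht)⟩, smk_pt]
  · obtain ⟨w | u, rfl⟩ := s.e.surjective x
    · exact smk_of_ge _ _ ⟨w, ht⟩
    · rw [spread, hf.infty _ ⟨u, collapse_of_ge ht⟩, base_apply, smk_pt]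

include hf in
lemma spread_shift (hk : k ∈ K) (r : Coord G p' q' → ℝ) :
    spread s q₀ hp hq h₀ f (shift k r) = k • spread s q₀ hp hq h₀ f r := by
  have e1 : (fun u => collapse (shift k r (Coord.block q₀ hq h₀.le (s.e (Sum.inr u))))) =
      shift (⟨k, hk⟩ : K) fun u => collapse (r (Coord.block q₀ hq h₀.le (s.e (Sum.inr u)))) := by
    funext u
    simp only [shift, s.smul_inr]
    rfl
  have e2 : (fun w => shift k r (Coord.block q₀ hq h₀.le (s.e (Sum.inl w)))) =
      shift (⟨k, hk⟩ : K) fun w => r (Coord.block q₀ hq h₀.le (s.e (Sum.inl w))) := by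
    funext w
    simp only [shift, s.smul_inl]
    rfl
  have e3 : collapse ∘ pinch K q₀ 1 (shift k r ∘ Coord.skip q₀ hp hq) =
      permute k (collapse ∘ pinch K q₀ 1 (r ∘ Coord.skip q₀ hp hq)) := by
    have : shift k r ∘ Coord.skip q₀ hp hq = shift k (r ∘ Coord.skip q₀ hp hq) := by
      funext t
      simp [shift, Coord.skip_smul]
    rw [this, pinch_shift hk]
    rfl
  rw [spread, e1, e2, e3, hf.equi, ← smk_mul]
  change smk ((k • f _) (permute k _)) _ _ = _
  rw [smul_permute, spread, smul_smk, one_mul, mul_one]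

/-- The `G`-invariant map `φ` is the sum of the translates of the `K`-equivariant map given by `f`. -/
def SpreadRel (a b : ℕ) (p q l p' q' : ℕ) (f : Torus U → Rep X p q l)
    (φ : Unit → Rep (X.smash ⟨a, b, induced K 𝕊(K, W)⟩) p' q' l) : Prop :=
  ∃ (hp : p' = p) (hq : q' = q + j) (h₀ : q₀ < q), (∀ g : G, g • φ () = φ ()) ∧
    (∀ r : Coord G p' q' → ℝ, InOrthant K q₀ (r ∘ Coord.skip q₀ hp hq) →
      φ () (collapse ∘ r) = spread s q₀ hp hq h₀ f r) ∧
    ∀ r : Coord G p' q' → ℝ, (∀ g : G, ¬ InOrthant K q₀ (shift g r ∘ Coord.skip q₀ hp hq)) →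
      φ () (collapse ∘ r) = (IndSmash K W (X.level l)).pt

end Spread

section Pinch

variable {G : Type u} [Group G] {K : Subgroup G} {p q p' q' j q₀ : ℕ} (hp : p' = p)
  (hq : q' = q + j) (hp' : p' + 1 = p + 1) (hq' : q' + 1 = q + 1 + j)

lemma Coord.skip_old (t : Coord G p q) :
    Coord.skip q₀ hp' hq' t.old = (Coord.skip q₀ hp hq t).old := by
  rcases t with t | ⟨t, g⟩ <;> rfl

lemma Coord.skip_new (h₀ : q₀ ≤ q) (t : Coord G 1 1) :
    Coord.skip q₀ hp' hq' (t.new : Coord G (p + 1) (q + 1)) = t.new := by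
  rcases t with t | ⟨t, g⟩
  · exact congrArg Sum.inl (Fin.ext (by change p + (t : ℕ) = p' + t; omega))
  · refine congrArg (fun i => Sum.inr (i, g)) (Fin.ext ?_)
    change (if q + (t : ℕ) < q₀ then q + (t : ℕ) else q + t + j) = q' + t
    rw [if_neg (by omega)]
    omega

lemma pinch_old (τ : ℝ) (r : Coord G (p + 1) (q + 1) → ℝ) :
    pinch K q₀ τ r ∘ Coord.old = pinch K q₀ τ (r ∘ Coord.old) := by
  funext t
  rcases t with t | ⟨t, g⟩ <;> rfl

lemma pinch_new (h₀ : q₀ < q) (τ : ℝ) (r : Coord G (p + 1) (q + 1) → ℝ) :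
    pinch K q₀ τ r ∘ Coord.new = r ∘ Coord.new := by
  ext (t | ⟨t, g⟩)
  · rfl
  · exact if_neg (by change ¬ (q + t = q₀); omega)

lemma inOrthant_old (h₀ : q₀ < q) (r : Coord G (p + 1) (q + 1) → ℝ) :
    InOrthant K q₀ (r ∘ Coord.old) ↔ InOrthant K q₀ r := by
  constructor
  · intro h i g hi
    exact h ⟨i, by omega⟩ g hi
  · exact fun h i g hi => h i.castSucc g hi

end Pinch

section Spread

variable {G : Type u} [Group G] {K : Subgroup G} {W U : Type u} [MulAction K W] [MulAction K U]
  [Finite W] [Finite U] {j : ℕ} {s : Splitting K W U j} {X : GPrespectrum G} {p q l p' q' : ℕ}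
  {q₀ a b : ℕ} {f : Torus U → Rep X p q l}
  {φ : Unit → Rep (X.smash ⟨a, b, induced K 𝕊(K, W)⟩) p' q' l}

lemma SpreadRel.stab (h : SpreadRel s q₀ a b p q l p' q' f φ) :
    SpreadRel s q₀ a b _ _ _ _ _ (fun z => stab (f z)) fun x => stab (φ x) := by
  obtain ⟨hp, hq, h₀, hφ, h1, h2⟩ := h
  have hp' : p' + 1 = p + 1 := by omega
  have hq' : q' + 1 = q + 1 + j := by omega
  have e1 : ∀ r : Coord G (p' + 1) (q' + 1) → ℝ,
      (r ∘ Coord.skip q₀ hp' hq') ∘ Coord.old = (r ∘ Coord.old) ∘ Coord.skip q₀ hp hq := fun r =>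
    funext fun t => congrArg r (Coord.skip_old hp hq hp' hq' t)
  have e2 : ∀ r : Coord G (p' + 1) (q' + 1) → ℝ,
      (r ∘ Coord.skip q₀ hp' hq') ∘ Coord.new = r ∘ Coord.new := fun r =>
    funext fun t => congrArg r (Coord.skip_new hp' hq' h₀.le t)
  have e3 : ∀ r : Coord G (p' + 1) (q' + 1) → ℝ, InOrthant K q₀ (r ∘ Coord.skip q₀ hp' hq') ↔
        InOrthant K q₀ ((r ∘ Coord.old) ∘ Coord.skip q₀ hp hq) := fun r => by
    rw [← inOrthant_old h₀, e1]
  refine ⟨hp', hq', by omega, fun g => ?_, fun r hr => ?_, fun r hr => ?_⟩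
  · exact (stab_smul g _).symm.trans (congrArg Rep.stab (hφ g))
  · refine (stab_apply _ _).trans ((congrArg (fun x => (X.smash _).struct l x _)
      (h1 (r ∘ Coord.old) ((e3 r).1 hr))).trans ?_)
    have h3 : ∀ u, Rep.stab (f u) (collapse ∘ pinch K q₀ 1 (r ∘ Coord.skip q₀ hp' hq')) =
        X.struct l (f u (collapse ∘ pinch K q₀ 1 ((r ∘ Coord.old) ∘ Coord.skip q₀ hp hq)))
          ((collapse ∘ r) ∘ Coord.new) := by
      intro u
      rw [stab_apply, Function.comp_assoc, Function.comp_assoc, pinch_old, e1, pinch_new h₀, e2]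
      rfl
    exact (congrArg (fun y => (smk y 1 fun w =>
      r (Coord.block q₀ hq' (by omega) (s.e (.inl w))) : IndSmash K W _)) (h3 _)).symm
  · refine (stab_apply _ _).trans ((congrArg (fun x => (X.smash _).struct l x _)
      (h2 (r ∘ Coord.old) fun g hg => hr g ((e3 _).2 hg))).trans ?_)
    exact (X.smash _).struct_pt l _

lemma SpreadRel.connBase [Finite G] (h : SpreadRel s q₀ a b p q l p' q' f φ)
    (hf : TorusNull K.subtype p q l f) : ConnBase ⊤ p' q' l φ := by
  obtain ⟨hp, hq, h₀, hφ, h1, h2⟩ := h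
  obtain ⟨H, hH, hHm, hH0, hH1⟩ := hf
  let σ : G → I × (Coord G p' q' → ℝ) → I × (Coord G p' q' → ℝ) :=
    fun g z => (z.1, shift g z.2)
  let O : Set (I × (Coord G p' q' → ℝ)) :=
    {z | InOrthant K q₀ (z.2 ∘ Coord.skip q₀ hp hq)}
  have hskip : ∀ (g : G) (r : Coord G p' q' → ℝ),
      shift g r ∘ Coord.skip q₀ hp hq = shift g (r ∘ Coord.skip q₀ hp hq) := fun g r => by
    funext t
    simp [shift, Coord.skip_smul]
  have hO : IsOpen O := isOpen_inOrthant.preimage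
    (f := fun z : I × (Coord G p' q' → ℝ) => z.2 ∘ Coord.skip q₀ hp hq) (by fun_prop)
  obtain ⟨B, hB, hBσ, hBO, hB0⟩ := exists_glue (K := K) (Y := IndSmash K W (X.level l)) (σ := σ)
    (fun g => continuous_fst.prodMk ((continuous_shift g).comp continuous_snd))
    (fun z => Prod.ext rfl (shift_one z.2)) (fun g h z => Prod.ext rfl (shift_shift g h z.2).symm)
    hO (fun z g hz hg => InOrthant.mem_of_shift h₀ hz (by rw [← hskip]; exact hg))
    (continuous_spread s q₀ hp hq h₀ hH) (fun z hz => spread_of_notMem s q₀ hp hq h₀ z.2 hz)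
    fun k hk z => spread_shift s q₀ hp hq h₀ (hHm z.1) hk z.2
  have hcase : ∀ z, (∃ g, σ g z ∈ O) ∨ B z = (IndSmash K W (X.level l)).pt := fun z => by
    by_cases h : ∃ g, σ g z ∈ O
    · exact Or.inl h
    · push Not at h
      exact Or.inr (hB0 z h)
  have hinv : ∀ g z, B z = g⁻¹ • B (σ g z) := fun g z => by rw [hBσ, inv_smul_smul]
  have hBb : ∀ t r, (∃ i, 1 ≤ |r i|) →
      B (t, r) = (IndSmash K W (X.level l)).pt := by
    rintro t r ⟨i, hi⟩
    rcases hcase (t, r) with ⟨g, hg⟩ | h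
    · rw [hinv g, hBO _ hg]
      refine (congrArg (g⁻¹ • ·) (spread_of_ge s q₀ hp hq h₀ (hHm t) (shift g r)
        ⟨g • i, by simpa [shift] using hi⟩)).trans ?_
      exact (IndSmash K W (X.level l)).smul_pt _
    · exact h
  obtain ⟨F, hF, hFB, hFb⟩ := exists_descend_collapse hB hBb
  let c : I → Rep (X.smash ⟨a, b, induced K 𝕊(K, W)⟩) p' q' l :=
    fun t => ⟨⟨fun ζ => F (t, ζ), hF.comp (by fun_prop)⟩, fun ζ hζ => hFb t ζ hζ⟩
  refine ⟨c, continuous_of_uncurry hF, Rep.ext fun ζ => ?_, Rep.ext fun ζ => ?_,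
    fun t g _ => Rep.ext fun ζ => ?_⟩
  · obtain ⟨r, rfl⟩ := collapse_comp_surjective ζ
    refine (hFB 0 r).trans ?_
    by_cases h : ∃ g, σ g (0, r) ∈ O
    · obtain ⟨g, hg⟩ := h
      rw [hinv g, hBO _ hg]
      have h3 : spread s q₀ hp hq h₀ (fun ζ => H (0, ζ)) (shift g r) = φ () (collapse ∘ shift g r) := by
        rw [show (fun ζ => H (0, ζ)) = f from funext hH0]
        exact (h1 _ hg).symm
      refine (congrArg (g⁻¹ • ·) h3).trans ?_
      have h4 : (g⁻¹ • φ ()) (collapse ∘ r) = φ () (collapse ∘ r) := by rw [hφ]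
      rw [← h4, Rep.smul_apply, inv_inv]
      rfl
    · push Not at h
      rw [hB0 _ h]
      exact (h2 r h).symm
  · obtain ⟨r, rfl⟩ := collapse_comp_surjective ζ
    refine (hFB 1 r).trans ?_
    rcases hcase (1, r) with ⟨g, hg⟩ | h
    · rw [hinv g, hBO _ hg]
      refine (congrArg (g⁻¹ • ·) (show spread s q₀ hp hq h₀ (fun ζ => H (1, ζ)) (shift g r) = 
        (IndSmash K W (X.level l)).pt from ?_)).trans ((IndSmash K W (X.level l)).smul_pt _)
      rw [spread, hH1, base_apply, smk_pt]
    · exact h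
  · obtain ⟨r, rfl⟩ := collapse_comp_surjective ζ
    refine (Rep.smul_apply g (c t) _).trans ?_
    change g • F (t, permute g⁻¹ (collapse ∘ r)) = F (t, collapse ∘ r)
    rw [show permute g⁻¹ (collapse ∘ r) = collapse ∘ shift g⁻¹ r from rfl, hFB, hFB]
    exact (hBσ g (t, shift g⁻¹ r)).symm.trans (congrArg (fun r => B (t, r)) (shift_shift_inv g r))

lemma SpreadRel.exists_after [Finite G] (h : SpreadRel s q₀ a b p q l p' q' f φ)
    (hf : ∃ m, After (TorusNull K.subtype) m f) : ∃ m, After (ConnBase ⊤) m φ := by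
  obtain ⟨m, hm⟩ := hf
  exact ⟨m, hm.transport (SpreadRel s q₀ a b) (fun _ _ h => h.stab)
    (fun _ _ h hf => h.connBase hf) h⟩

end Spread

section

section Rot

/-- The first component of a rotation of the plane, up to a positive factor. -/
def rotFst (τ s s' : ℝ) : ℝ := ((1 - τ) * s + τ * s') / ((1 - τ) ^ 2 + τ ^ 2)

/-- The second component of a rotation of the plane, up to a positive factor. -/
def rotSnd (τ s s' : ℝ) : ℝ := ((1 - τ) * s' - τ * s) / ((1 - τ) ^ 2 + τ ^ 2)

lemma rot_denom_pos (τ : ℝ) : 0 < (1 - τ) ^ 2 + τ ^ 2 := by nlinarith [sq_nonneg (1 - 2 * τ)]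

lemma le_abs_rot (h0 : 0 ≤ τ) (h1 : τ ≤ 1) (h : 1 ≤ |s| ∨ 1 ≤ |s'|) :
    1 ≤ |rotFst τ s s'| ∨ 1 ≤ |rotSnd τ s s'| := by
  by_contra! hn
  have hd := rot_denom_pos τ
  have e1 : s = (1 - τ) * rotFst τ s s' - τ * rotSnd τ s s' := by
    unfold rotFst rotSnd
    field_simp
    ring
  have e2 : s' = τ * rotFst τ s s' + (1 - τ) * rotSnd τ s s' := by
    unfold rotFst rotSnd
    field_simp
    ring
  rw [abs_lt, abs_lt] at hn
  obtain ⟨⟨h2, h3⟩, h4, h5⟩ := hn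
  have hs : |s| < 1 := by
    rw [abs_lt]
    constructor <;> rcases h0.eq_or_lt with rfl | h0 <;> nlinarith
  have hs' : |s'| < 1 := by
    rw [abs_lt]
    constructor <;> rcases h0.eq_or_lt with rfl | h0 <;> nlinarith
  rcases h with h | h <;> linarith

lemma continuous_rotFst : Continuous fun z : ℝ × ℝ × ℝ => rotFst z.1 z.2.1 z.2.2 :=
  Continuous.div (by fun_prop) (by fun_prop) fun z => (rot_denom_pos z.1).ne'

lemma continuous_rotSnd : Continuous fun z : ℝ × ℝ × ℝ => rotSnd z.1 z.2.1 z.2.2 :=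
  Continuous.div (by fun_prop) (by fun_prop) fun z => (rot_denom_pos z.1).ne'

end Rot

variable {G : Type u} [Group G] {K : Subgroup G} {W U : Type u} [MulAction K W] [MulAction K U]
  [Finite W] [Finite U] {j : ℕ} (s : Splitting K W U j) {α β : Type*}

namespace Splitting

/-- The coordinates of `(j + 1) + (j + 1) ρ`, in terms of a decomposition of `j` copies of `G`. -/
def mix (A : Coord G (j + 1) 1 → α) (B : W → α) (C : U → α) : Coord G (j + 1) (j + 1) → α
  | Sum.inl i => A (Sum.inl i)
  | Sum.inr (i, g) => if h : (i : ℕ) < j then Sum.elim B C (s.e.symm (⟨i, h⟩, g))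
      else A (Sum.inr (0, g))

/-- The last copies of `G`. -/
abbrev tail : Coord G (j + 1) 1 → Coord G (j + 1) (j + 1) :=
  Coord.skip (q := 1) (j := j) 0 rfl (by omega)

/-- The first `j` copies of `G`. -/
abbrev head (x : W ⊕ U) : Coord G (j + 1) (j + 1) :=
  Coord.block (q := 1) 0 (by omega) (by omega) (s.e x)

variable (A : Coord G (j + 1) 1 → α) (B : W → α) (C : U → α)

lemma mix_tail (t) : s.mix A B C (tail t) = A t := by
  rcases t with i | ⟨i, g⟩
  · rfl
  · obtain rfl := Subsingleton.elim i 0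
    exact dif_neg (by simp)

lemma mix_head (x) : s.mix A B C (s.head x) = Sum.elim B C x := by
  have : (0 + ((s.e x).1 : ℕ)) < j := by omega
  refine (dif_pos this).trans (congrArg _ ?_)
  rw [Equiv.symm_apply_eq]
  exact Prod.ext (Fin.ext (Nat.zero_add _)) rfl

lemma exists_tail_or_head (t : Coord G (j + 1) (j + 1)) :
    (∃ r, tail r = t) ∨ ∃ x, s.head x = t := by
  rcases Coord.exists_skip_or_block (p' := j + 1) 0 rfl (show j + 1 = 1 + j by omega) (by omega) t
    with h | ⟨x, rfl⟩
  · exact .inl h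
  · exact .inr ⟨s.e.symm x, by rw [head, Equiv.apply_symm_apply]⟩

lemma mix_eq (hA : ∀ t, z (tail t) = A t)
    (hB : ∀ w, z (s.head (Sum.inl w)) = B w) (hC : ∀ u, z (s.head (Sum.inr u)) = C u) :
    s.mix A B C = z := by
  funext t
  rcases s.exists_tail_or_head t with ⟨t, rfl⟩ | ⟨w | u, rfl⟩
  · rw [mix_tail, hA]
  · rw [mix_head, hB]
    rfl
  · rw [mix_head, hC]
    rfl

lemma comp_mix (φ : α → β) : φ ∘ s.mix A B C = s.mix (φ ∘ A) (φ ∘ B) (φ ∘ C) :=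
  (s.mix_eq _ _ _ (fun t => congrArg φ (s.mix_tail A B C t))
    (fun w => congrArg φ (s.mix_head A B C (.inl w)))
    fun u => congrArg φ (s.mix_head A B C (.inr u))).symm

lemma head_smul (k : K) (x : W ⊕ U) : (k : G) • s.head x = s.head (x.map (k • ·) (k • ·)) := by
  rcases x with w | u
  · exact congrArg Sum.inr (Prod.ext (congrArg (fun i : Fin j => (⟨0 + i, by omega⟩ : Fin (j + 1)))
      (congrArg Prod.fst (s.smul_inl k w)).symm) (congrArg Prod.snd (s.smul_inl k w)).symm)
  · exact congrArg Sum.inr (Prod.ext (congrArg (fun i : Fin j => (⟨0 + i, by omega⟩ : Fin (j + 1)))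
      (congrArg Prod.fst (s.smul_inr k u)).symm) (congrArg Prod.snd (s.smul_inr k u)).symm)

lemma mix_shift (k : K) : s.mix (fun t => A ((k : G)⁻¹ • t)) (fun w => B (k⁻¹ • w))
    (fun u => C (k⁻¹ • u)) = fun t => s.mix A B C ((k : G)⁻¹ • t) := by
  refine s.mix_eq _ _ _ (fun t => ?_) (fun w => ?_) fun u => ?_
  · rw [← Coord.skip_smul, mix_tail]
  · rw [← Subgroup.coe_inv, head_smul, mix_head]
    rfl
  · rw [← Subgroup.coe_inv, head_smul, mix_head]
    rfl

lemma continuous_mix [TopologicalSpace α] [TopologicalSpace β] {A : β → Coord G (j + 1) 1 → α}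
    {B : β → W → α} {C : β → U → α} (hA : Continuous A) (hB : Continuous B) (hC : Continuous C) :
    Continuous fun z => s.mix (A z) (B z) (C z) := by
  refine continuous_pi fun t => ?_
  rcases s.exists_tail_or_head t with ⟨t, rfl⟩ | ⟨w | u, rfl⟩
  · simp only [mix_tail]
    exact continuous_pi_iff.1 hA t
  · simp only [mix_head]
    exact continuous_pi_iff.1 hB w
  · simp only [mix_head]
    exact continuous_pi_iff.1 hC u

/-- The homotopy exchanging the coordinates of `S^W` with coordinates of `j ρ`, and pinching the
last copy of `ρ`. -/
def swap (τ : ℝ) (r : Coord G (j + 1) (j + 1) → ℝ) (c : W → ℝ) : Coord G (j + 1) (j + 1) → ℝ :=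
  s.mix (pinch K 0 τ (r ∘ tail)) (fun w => rotSnd τ (c w) (r (s.head (Sum.inl w))))
    fun u => r (s.head (Sum.inr u))

/-- The new coordinates of `S^W`. -/
def swapW (τ : ℝ) (r : Coord G (j + 1) (j + 1) → ℝ) (c : W → ℝ) : W → ℝ :=
  fun w => rotFst τ (c w) (r (s.head (Sum.inl w)))

lemma swap_zero (r : Coord G (j + 1) (j + 1) → ℝ) (c : W → ℝ) : s.swap 0 r c = r :=
  s.mix_eq _ _ _ (fun t => by rw [pinch_zero]; rfl) (fun w => by simp [rotSnd]) fun u => rfl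

lemma swapW_zero (r : Coord G (j + 1) (j + 1) → ℝ) (c : W → ℝ) : s.swapW 0 r c = c :=
  funext fun w => by simp [swapW, rotFst]

lemma swap_shift (k : K) (τ : ℝ) (r : Coord G (j + 1) (j + 1) → ℝ) (c : W → ℝ) :
    s.swap τ (shift (k : G) r) (shift k c) = shift (k : G) (s.swap τ r c) := by
  refine Eq.trans ?_ (s.mix_shift _ _ _ k)
  have e : shift (k : G) r ∘ tail = shift (k : G) (r ∘ tail) := by
    funext t
    simp [shift, Coord.skip_smul]
  rw [swap, e, pinch_shift k.2]
  simp only [shift, ← Subgroup.coe_inv, head_smul]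
  rfl

lemma swapW_shift (k : K) (τ : ℝ) (r : Coord G (j + 1) (j + 1) → ℝ) (c : W → ℝ) :
    s.swapW τ (shift (k : G) r) (shift k c) = shift k (s.swapW τ r c) := by
  funext w
  simp only [swapW, shift, ← Subgroup.coe_inv, head_smul]
  rfl

lemma continuous_swap : Continuous fun z : ℝ × (Coord G (j + 1) (j + 1) → ℝ) × (W → ℝ) =>
    s.swap z.1 z.2.1 z.2.2 := by
  refine s.continuous_mix (continuous_pinch.comp (f := fun z : ℝ × (Coord G (j + 1) (j + 1) → ℝ) ×
    (W → ℝ) => (z.1, z.2.1 ∘ tail)) (by fun_prop)) (continuous_pi fun w => ?_) (by fun_prop)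
  exact continuous_rotSnd.comp (f := fun z : ℝ × (Coord G (j + 1) (j + 1) → ℝ) × (W → ℝ) =>
    (z.1, z.2.2 w, z.2.1 (s.head (Sum.inl w)))) (by fun_prop)

lemma continuous_swapW : Continuous fun z : ℝ × (Coord G (j + 1) (j + 1) → ℝ) × (W → ℝ) =>
    s.swapW z.1 z.2.1 z.2.2 :=
  continuous_pi fun w => continuous_rotFst.comp (f := fun z : ℝ × (Coord G (j + 1) (j + 1) → ℝ) ×
    (W → ℝ) => (z.1, z.2.2 w, z.2.1 (s.head (Sum.inl w)))) (by fun_prop)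

lemma le_abs_swap (h0 : 0 ≤ τ) (h1 : τ ≤ 1) {c : W → ℝ}
    (h : (∃ t, 1 ≤ |r t|) ∨ ∃ w, 1 ≤ |c w|) :
    (∃ t, 1 ≤ |s.swap τ r c t|) ∨ ∃ w, 1 ≤ |s.swapW τ r c w| := by
  have hw : ∀ w, 1 ≤ |c w| ∨ 1 ≤ |r (s.head (Sum.inl w))| →
      (∃ t, 1 ≤ |s.swap τ r c t|) ∨ ∃ w, 1 ≤ |s.swapW τ r c w| := fun w h =>
    (le_abs_rot h0 h1 h).symm.imp (fun h => ⟨s.head (Sum.inl w), by rwa [swap, mix_head]⟩)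
      fun h => ⟨w, h⟩
  rcases h with ⟨t, ht⟩ | ⟨w, h⟩
  · rcases s.exists_tail_or_head t with ⟨t, rfl⟩ | ⟨w | u, rfl⟩
    · exact .inl ⟨tail t, by
        rw [swap, mix_tail]
        exact le_abs_pinch h0 ht⟩
    · exact hw w (.inr ht)
    · exact .inl ⟨s.head (.inr u), by rwa [swap, mix_head]⟩
  · exact hw w (.inl h)

variable {X : GPrespectrum G} {l : ℕ}

/-- The homotopy of `exists_swap` on the component of the identity. -/
def swapMap (X : GPrespectrum G) (l : ℕ) (τ : ℝ) (r : Coord G (j + 1) (j + 1) → ℝ) (y : X.level l)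
    (c : W → ℝ) : IndSmash K W (X.level (l + (j + 1))) :=
  smk (iterStruct X l (j + 1) y (collapse ∘ s.swap τ r c)) 1 (s.swapW τ r c)

lemma swapMap_smul (k : K) (τ : ℝ) (r : Coord G (j + 1) (j + 1) → ℝ) (y : X.level l)
    (c : W → ℝ) : s.swapMap X l τ (shift (k : G) r) ((k : G) • y) (shift k c) =
      (k : G) • s.swapMap X l τ r y c := by
  rw [swapMap, swap_shift, swapW_shift, swapMap, ← smk_mul, smul_smk, one_mul, mul_one,
    iterStruct_smul, ← smul_permute]
  rfl

lemma swapMap_of_ge (h0 : 0 ≤ τ) (h1 : τ ≤ 1)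
    (y : X.level l) {c : W → ℝ} (h : (∃ t, 1 ≤ |r t|) ∨ ∃ w, 1 ≤ |c w|) :
    s.swapMap X l τ r y c = (IndSmash K W (X.level (l + (j + 1)))).pt := by
  rcases s.le_abs_swap h0 h1 h with ⟨t, ht⟩ | h
  · rw [swapMap, Rep.infty _ ⟨t, collapse_of_ge ht⟩, smk_pt]
  · exact smk_of_ge _ _ h

variable (X l)

lemma exists_swap [Finite G] : ∃ H : (I × (Coord G (j + 1) (j + 1) → ℝ)) ×
      IndSmash K W (X.level l) → IndSmash K W (X.level (l + (j + 1))), Continuous H ∧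
    (∀ τ r y g c, H ((τ, r), smk y g c) = g • s.swapMap X l τ (shift g⁻¹ r) (g⁻¹ • y) c) ∧
    (∀ z, H (z, (IndSmash K W (X.level l)).pt) = (IndSmash K W (X.level (l + (j + 1)))).pt) ∧
    (∀ τ r x, (∃ t, 1 ≤ |r t|) → H ((τ, r), x) = (IndSmash K W (X.level (l + (j + 1)))).pt) ∧
    ∀ (g : G) τ r x, H ((τ, shift g r), g • x) = g • H ((τ, r), x) := by
  have hpt := (IndSmash K W (X.level (l + (j + 1)))).smul_pt
  obtain ⟨H, hH, hHm, hHb⟩ := exists_smash_lift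
    (P := I × (Coord G (j + 1) (j + 1) → ℝ))
    (h := fun g z => g • s.swapMap X l z.1.1.1 (shift g⁻¹ z.1.1.2) (g⁻¹ • z.1.2) z.2)
    (fun g => by
      refine (continuous_const_smul g).comp ((continuous_smk (K := K) 1).comp (f := fun z :
        ((I × (Coord G (j + 1) (j + 1) → ℝ)) × X.level l) × (W → ℝ) =>
        (iterStruct X l (j + 1) (g⁻¹ • z.1.2) (collapse ∘ s.swap z.1.1.1 (shift g⁻¹ z.1.1.2) z.2),
          s.swapW z.1.1.1 (shift g⁻¹ z.1.1.2) z.2)) ?_)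
      have h1 : Continuous fun z : ((I × (Coord G (j + 1) (j + 1) → ℝ)) × X.level l) ×
          (W → ℝ) => ((z.1.1.1 : ℝ), shift g⁻¹ z.1.1.2, z.2) :=
        (by fun_prop : Continuous fun z : ((I × (Coord G (j + 1) (j + 1) → ℝ)) ×
          X.level l) × (W → ℝ) => (z.1.1.1 : ℝ)).prodMk
          (((continuous_shift g⁻¹).comp (by fun_prop)).prodMk continuous_snd)
      refine Continuous.prodMk (Continuous.eval ((iterStruct X l (j + 1)).continuous.comp
        ((continuous_const_smul g⁻¹).comp (by fun_prop))) ?_) (s.continuous_swapW.comp h1)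
      have h2 := s.continuous_swap.comp h1
      exact continuous_pi fun t => continuous_collapse.comp (continuous_pi_iff.1 h2 t))
    (fun g k w c => by
      have h := s.swapMap_smul k⁻¹ w.1.1 (shift g⁻¹ w.1.2) (g⁻¹ • w.2) (shift k c)
      have e : shift k⁻¹ (shift k c) = c := shift_inv_shift k c
      rw [e, shift_shift] at h
      simp only [mul_inv_rev, mul_smul, ← Subgroup.coe_inv]
      rw [h, smul_smul (k : G), Subgroup.coe_inv, mul_inv_cancel, one_smul])
    (fun g w c h => by
      dsimp only
      rw [s.swapMap_of_ge w.1.1.2.1 w.1.1.2.2 _ (Or.inr h), hpt])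
    (fun g p c => by
      dsimp only
      rw [PtGSpace.smul_pt, swapMap, iterStruct_pt, base_apply, smk_pt, hpt])
  refine ⟨H, hH, fun τ r y g c => hHm _ _ _ _, hHb, fun τ r x h => ?_, fun g τ r x => ?_⟩
  · rcases exists_smk_eq x with rfl | ⟨y, g, c, -, rfl⟩
    · exact hHb _
    · obtain ⟨t, ht⟩ := h
      rw [hHm]
      rw [s.swapMap_of_ge τ.2.1 τ.2.2 _ (Or.inl ⟨g⁻¹ • t, by simpa [shift] using ht⟩), hpt]
  · rcases exists_smk_eq x with rfl | ⟨y, g', c, -, rfl⟩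
    · rw [PtGSpace.smul_pt, hHb, hHb, hpt]
    · rw [smul_smk, hHm, hHm]
      simp only [mul_inv_rev, mul_smul, ← shift_shift, shift_inv_shift, inv_smul_smul]

lemma exists_swap_coeff [Finite G] : ∃ F : (𝕋(G, j + 1, 1) × Torus U) ×
      IndSmash K W (X.level l) → X.level (l + (j + 1)), Continuous F ∧
    (∀ z y c, F (z, smk y 1 c) =
      iterStruct X l (j + 1) y (s.mix z.1 (fun w => collapse (-c w)) z.2)) ∧
    (∀ z y g c, g ∉ K → F (z, smk y g c) = (X.level (l + (j + 1))).pt) ∧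
    (∀ z, F (z, (IndSmash K W (X.level l)).pt) = (X.level (l + (j + 1))).pt) ∧
    (∀ z x, (∃ t, z.1 t = ∞) ∨ (∃ t, z.2 t = ∞) → F (z, x) = (X.level (l + (j + 1))).pt) ∧
    ∀ (k : K) z x, F ((permute (k : G) z.1, shift k z.2), (k : G) • x) = (k : G) • F (z, x) := by
  classical
  have hpt := (X.level (l + (j + 1))).smul_pt
  let B : (𝕋(G, j + 1, 1) × Torus U) × X.level l → (W → ℝ) → X.level (l + (j + 1)) :=
    fun z c => iterStruct X l (j + 1) z.2 (s.mix z.1.1 (fun w => collapse (-c w)) z.1.2)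
  have hBc : Continuous fun z : ((𝕋(G, j + 1, 1) × Torus U) × X.level l) × (W → ℝ) =>
      B z.1 z.2 := by
    refine Continuous.eval ((iterStruct X l (j + 1)).continuous.comp (by fun_prop))
      (s.continuous_mix (by fun_prop) (continuous_pi fun w => ?_) (by fun_prop))
    exact continuous_collapse.comp (by fun_prop)
  have hBk : ∀ (k : K) z y c, B ((permute (k : G) z.1, shift k z.2), (k : G) • y) (shift k c) =
      (k : G) • B (z, y) c := fun k z y c => by
    change iterStruct X l (j + 1) ((k : G) • y) (s.mix _ _ _) = _
    rw [iterStruct_smul, ← smul_permute]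
    exact congrArg _ (s.mix_shift z.1 (fun w => collapse (-c w)) z.2 k)
  obtain ⟨F, hF, hFm, hFb⟩ := exists_smash_lift (K := K) (W := W) (Y := X.level l)
    (h := fun g z => if h : g ∈ K then B z.1 (shift (⟨g, h⟩ : K) z.2) else (X.level (l + (j + 1))).pt)
    (fun g => by
      by_cases h : g ∈ K
      · simp only [dif_pos h]
        exact hBc.comp (continuous_fst.prodMk ((continuous_shift _).comp continuous_snd))
      · simp only [dif_neg h]
        exact continuous_const)
    (fun g k w c => by
      by_cases h : g ∈ K
      · rw [dif_pos h, dif_pos (K.mul_mem h k.2)]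
        exact congrArg (B w) (shift_shift (⟨g, h⟩ : K) k c).symm
      · rw [dif_neg h, dif_neg fun h' => h ((K.mul_mem_cancel_right k.2).1 h')])
    (fun g w c ⟨t, ht⟩ => by
      split_ifs with h
      · refine Rep.infty _ ⟨s.head (Sum.inl ((⟨g, h⟩ : K) • t)), ?_⟩
        rw [mix_head]
        exact collapse_of_ge (by simpa [shift] using ht)
      · rfl)
    (fun g p c => by
      split_ifs
      · exact congrArg (fun f : Rep X _ _ _ => f _) (iterStruct_pt (j + 1))
      · rfl)
  have hF1 : ∀ z y c, F (z, smk y 1 c) = B (z, y) c := fun z y c => by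
    rw [hFm, dif_pos K.one_mem]
    exact congrArg (B (z, y)) (shift_one c)
  have hF0 : ∀ z y g c, g ∉ K → F (z, smk y g c) = (X.level (l + (j + 1))).pt :=
    fun z y g c h => by rw [hFm, dif_neg h]
  have hcase : ∀ x : IndSmash K W (X.level l), x = (IndSmash K W (X.level l)).pt ∨
      (∃ y c, x = smk y 1 c) ∨ ∃ y g c, g ∉ K ∧ x = smk y g c := fun x => by
    rcases exists_smk_eq x with rfl | ⟨y, g, c, -, rfl⟩
    · exact .inl rfl
    · by_cases h : g ∈ K
      · exact .inr (.inl ⟨y, shift (⟨g, h⟩ : K) c, by rw [← smk_mul, one_mul]⟩)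
      · exact .inr (.inr ⟨y, g, c, h, rfl⟩)
  refine ⟨F, hF, hF1, hF0, hFb, fun z x h => ?_, fun k z x => ?_⟩
  · rcases hcase x with rfl | ⟨y, c, rfl⟩ | ⟨y, g, c, hg, rfl⟩
    · exact hFb z
    · rw [hF1]
      rcases h with ⟨t, ht⟩ | ⟨t, ht⟩
      · exact Rep.infty _ ⟨tail t, by rwa [mix_tail]⟩
      · exact Rep.infty _ ⟨s.head (.inr t), by rwa [mix_head]⟩
    · exact hF0 _ _ _ _ hg
  · rcases hcase x with rfl | ⟨y, c, rfl⟩ | ⟨y, g, c, hg, rfl⟩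
    · rw [PtGSpace.smul_pt, hFb, hFb, hpt]
    · rw [smul_smk, mul_one, hF1, ← hBk, ← hF1, ← smk_mul, one_mul]
    · rw [smul_smk, hF0 _ _ _ _ hg, hF0 _ _ _ _ fun h => hg ((K.mul_mem_cancel_left k.2).1 h), hpt]

end Splitting

end

section

variable {G : Type u} [Group G] {K : Subgroup G} {W U : Type u} [MulAction K W] [MulAction K U]
  [Finite W] [Finite U] {j p q l : ℕ} (s : Splitting K W U j) {X : GPrespectrum G}

namespace Coord

lemma skip_inFst (hq : q + (j + 1) = q + 1 + j) (t : Coord G p q) :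
    skip q rfl hq (inFst (j + 1) 1 t) = inFst (j + 1) (j + 1) t := by
  rcases t with t | ⟨i, g⟩
  · rfl
  · exact congrArg (fun i => Sum.inr (i, g)) (Fin.ext (if_pos i.2))

lemma skip_inSnd (hq : q + (j + 1) = q + 1 + j) (t : Coord G (j + 1) 1) :
    skip q rfl hq (inSnd p q t) = inSnd p q (Splitting.tail t) := by
  rcases t with t | ⟨i, g⟩
  · rfl
  · refine congrArg (fun i => Sum.inr (i, g)) (Fin.ext ?_)
    refine (if_neg (show ¬ q + i < q by omega)).trans ?_
    change q + (i : ℕ) + j = q + if (i : ℕ) < 0 then (i : ℕ) else i + j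
    rw [if_neg (by omega)]
    omega

lemma block_eq_newN (hq : q + (j + 1) = q + 1 + j) (x : W ⊕ U) :
    block q hq (by omega) (s.e x) = inSnd p q (s.head x) :=
  congrArg (fun i => Sum.inr (i, (s.e x).2)) (Fin.ext (by
    change q + ((s.e x).1 : ℕ) = q + (0 + ((s.e x).1 : ℕ))
    omega))

end Coord

lemma pinch_inFst (τ : ℝ) (r : Coord G (p + a) (q + 1) → ℝ) :
    pinch K q τ r ∘ Coord.inFst a 1 = r ∘ Coord.inFst a 1 := by
  ext (t | ⟨i, g⟩)
  · rfl
  · exact if_neg (show i ≠ q by omega)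

lemma pinch_inSnd (τ : ℝ) (r : Coord G (p + a) (q + 1) → ℝ) :
    pinch K q τ r ∘ Coord.inSnd p q = pinch K 0 τ (r ∘ Coord.inSnd p q) := by
  ext (t | ⟨i, g⟩)
  · rfl
  · obtain rfl := Subsingleton.elim i 0
    refine (if_pos rfl).trans ?_
    rfl

lemma inOrthant_inSnd {r : Coord G (p + a) (q + 1) → ℝ} :
    InOrthant K q r ↔ InOrthant K 0 (r ∘ Coord.inSnd p q) := by
  refine ⟨fun h i g _ => ?_, fun h i g hi => ?_⟩
  · exact h (Fin.natAdd q i) g (by simp)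
  · obtain rfl : i = Fin.natAdd q 0 := Fin.ext (by simpa using hi)
    exact h 0 g rfl

include s in
lemma exists_after_of_torus [Finite G] (a b : ℕ)
    (x : Rep (X.smash ⟨a, b, induced K 𝕊(K, W)⟩) p q l) (hx : ∀ g : G, g • x = x)
    (h : ∀ f : Torus U → Rep X (p + (j + 1)) (q + 1) (l + (j + 1)), IsTorusMap K.subtype f →
      ∃ m, After (TorusNull K.subtype) m f) : ∃ m, After (ConnBase ⊤) m fun _ => x := by
  let Y := X.smash ⟨a, b, induced K 𝕊(K, W)⟩
  obtain ⟨H, hH, hHm, hHb, hHr, hHg⟩ := s.exists_swap X l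
  obtain ⟨F, hF, hF1, hF0, hFb, hFz, hFk⟩ := s.exists_swap_coeff X l
  have hxg : ∀ (g : G) z, x (permute g z) = g • x z := fun g z => by
    conv_lhs => rw [← hx g]
    exact smul_permute (X := Y) g x z
  have hpt := (IndSmash K W (X.level (l + (j + 1)))).smul_pt
  have hq : q + (j + 1) = q + 1 + j := by omega
  let f : Torus U → Rep X (p + (j + 1)) (q + 1) (l + (j + 1)) := fun u =>
    ⟨⟨fun ζ => F ((ζ ∘ Coord.inSnd p q, u), x (ζ ∘ Coord.inFst (j + 1) 1)),
      hF.comp ((by fun_prop : Continuous fun ζ : Torus (Coord G (p + (j + 1)) (q + 1)) =>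
        (ζ ∘ Coord.inSnd p q, u)).prodMk (x.1.continuous.comp (by fun_prop)))⟩, by
      rintro ζ ⟨t, ht⟩
      rcases Coord.exists_inFst_or_inSnd t with ⟨t, rfl⟩ | ⟨t, rfl⟩
      · exact (congrArg (fun y => F (_, y)) (Rep.infty x ⟨t, ht⟩)).trans (hFb _)
      · exact hFz _ _ (.inl ⟨t, ht⟩)⟩
  have hf : IsTorusMap K.subtype f := by
    refine ⟨continuous_of_uncurry ?_, fun u hu => Rep.ext fun ζ => hFz _ _ (.inr hu),
      fun k u => Rep.ext fun ζ => ?_⟩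
    · exact hF.comp (Continuous.prodMk (by fun_prop) (x.1.continuous.comp (by fun_prop)))
    · obtain ⟨ζ, rfl⟩ : ∃ ζ', permute (k : G) ζ' = ζ :=
        ⟨permute (k : G)⁻¹ ζ, shift_shift_inv (k : G) ζ⟩
      change _ = ((k : G) • f u) _
      rw [smul_permute]
      have e1 : permute (k : G) ζ ∘ Coord.inSnd p q = permute (k : G) (ζ ∘ Coord.inSnd p q) := by
        funext t
        simp [permute, Coord.inSnd_smul]
      have e2 : permute (k : G) ζ ∘ Coord.inFst (j + 1) 1 =
          permute (k : G) (ζ ∘ Coord.inFst (j + 1) 1) := by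
        funext t
        simp [permute, Coord.inFst_smul]
      change F ((permute (k : G) ζ ∘ _, shift k u), x (permute (k : G) ζ ∘ _)) = _
      rw [e1, e2, hxg]
      exact hFk k (ζ ∘ Coord.inSnd p q, u) _
  have hxc : ∀ (g : G) (r : Coord G p q → ℝ), x (collapse ∘ shift g r) = g • x (collapse ∘ r) :=
    fun g r => hxg g (collapse ∘ r)
  obtain ⟨Φ, hΦ, hΦm, hΦb⟩ := exists_descend_collapse (W := I)
    (u := fun z : I × (Coord G (p + (j + 1)) (q + (j + 1)) → ℝ) =>
      H ((z.1, z.2 ∘ Coord.inSnd p q), x (collapse ∘ z.2 ∘ Coord.inFst (j + 1) (j + 1))))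
    (hH.comp (Continuous.prodMk (by fun_prop) (x.1.continuous.comp
      (continuous_pi fun t => continuous_collapse.comp (by fun_prop)))))
    (v₀ := (IndSmash K W (X.level (l + (j + 1)))).pt) (fun τ r ⟨t, ht⟩ => by
      rcases Coord.exists_inFst_or_inSnd t with ⟨t, rfl⟩ | ⟨t, rfl⟩
      · exact (congrArg (fun y => H (_, y)) (Rep.infty (X := Y) x ⟨t, collapse_of_ge ht⟩)).trans
          (hHb _)
      · exact hHr _ _ _ ⟨t, ht⟩)
  have hx0 : ∀ r, _ := fun r =>
    exists_smk_eq (x (collapse ∘ r ∘ Coord.inFst (j + 1) (j + 1)) : IndSmash K W (X.level l))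
  let c : I → Rep Y (p + (j + 1)) (q + (j + 1)) (l + (j + 1)) := fun τ =>
    ⟨⟨fun ζ => Φ (τ, ζ), hΦ.comp (by fun_prop)⟩, fun ζ hζ => hΦb τ ζ hζ⟩
  have hcg : ∀ τ (g : G), g • c τ = c τ := fun τ g => Rep.ext fun ζ => by
    obtain ⟨ζ, rfl⟩ : ∃ ζ', permute g ζ' = ζ := ⟨permute g⁻¹ ζ, shift_shift_inv g ζ⟩
    rw [smul_permute]
    obtain ⟨r, rfl⟩ := collapse_comp_surjective ζ
    refine (congrArg (g • ·) (hΦm τ r)).trans ((hHg g _ _ _).symm.trans (Eq.trans ?_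
      (hΦm τ (shift g r)).symm))
    have e1 : shift g r ∘ Coord.inSnd p q = shift g (r ∘ Coord.inSnd p q) := by
      funext t
      simp [shift, Coord.inSnd_smul]
    have e2 : shift g r ∘ Coord.inFst (j + 1) (j + 1) = shift g (r ∘ Coord.inFst (j + 1) (j + 1)) := by
      funext t
      simp [shift, Coord.inFst_smul]
    dsimp only
    rw [e1, e2, hxc]
    rfl
  have hzero : ∀ (r : Coord G (j + 1) (j + 1) → ℝ) y g d,
      ¬ InOrthant K 0 (shift g⁻¹ r ∘ Splitting.tail) →
      H ((1, r), smk y g d) = (IndSmash K W (X.level (l + (j + 1)))).pt := fun r y g d hn => by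
    obtain ⟨t, ht⟩ := exists_le_abs_pinch hn
    rw [hHm, Splitting.swapMap, Rep.infty _ ⟨Splitting.tail t, ?_⟩, smk_pt, hpt]
    refine collapse_of_ge ?_
    rwa [Splitting.swap, Splitting.mix_tail]
  refine exists_after_of_stabN (j + 1) ?_
  have hpath : FixedPath ⊤ (stabN (j + 1) x) (c 1) := by
    refine ⟨c, continuous_of_uncurry hΦ, Rep.ext fun ζ => ?_, rfl, fun τ g _ => hcg τ g⟩
    obtain ⟨r, rfl⟩ := collapse_comp_surjective ζ
    refine (hΦm 0 r).trans (Eq.trans ?_ (stabN_apply (X := Y) _ _ _).symm)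
    change H (_, x (collapse ∘ r ∘ Coord.inFst (j + 1) (j + 1))) =
      iterStruct Y l (j + 1) (x (collapse ∘ r ∘ Coord.inFst (j + 1) (j + 1))) _
    rcases hx0 r with h0 | ⟨y, g, d, -, h0⟩
    · refine ((congrArg (fun y => H (_, y)) h0).trans (hHb _)).trans
        (Eq.trans ?_ (congrArg (fun y => iterStruct Y l (j + 1) y _) h0).symm)
      exact (congrArg (fun f : Rep Y _ _ _ => f _) (iterStruct_pt (X := Y) (j + 1))).symm
    · refine ((congrArg (fun y => H (_, y)) h0).trans (hHm _ _ _ _ _)).trans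
        (Eq.trans ?_ (congrArg (fun y => iterStruct Y l (j + 1) y _) h0).symm)
      refine Eq.trans ?_ (iterStruct_smash ⟨a, b, induced K 𝕊(K, W)⟩ (j + 1) y
        (Quot.mk _ ⟨g, sphereMap d⟩) _).symm
      rw [Splitting.swapMap, Set.Icc.coe_zero, Splitting.swap_zero, Splitting.swapW_zero, smul_smk,
        mul_one, iterStruct_smul, Rep.smul_apply, inv_inv]
      change smk (g • g⁻¹ • iterStruct X l (j + 1) y (permute g (permute g⁻¹ (collapse ∘ _)))) g d = _
      rw [smul_inv_smul]
      exact congrArg (fun z => smk (iterStruct X l (j + 1) y z) g d) (shift_shift_inv g _)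
  suffices hrel : SpreadRel s q a b _ _ _ _ _ f fun _ => c 1 by
    obtain ⟨m, hm⟩ := hrel.exists_after (h f hf)
    exact ⟨m, hpath.after hm⟩
  refine ⟨rfl, hq, by omega, hcg 1, fun r hr => ?_, fun r hr => ?_⟩
  · have hskip : ∀ r : Coord G (p + (j + 1)) (q + (j + 1)) → ℝ,
      (r ∘ Coord.skip q rfl hq) ∘ Coord.inSnd p q = (r ∘ Coord.inSnd p q) ∘ Splitting.tail :=
      fun r => funext fun t => congrArg r (Coord.skip_inSnd hq t)
    have hold : (r ∘ Coord.skip q rfl hq) ∘ Coord.inFst (j + 1) 1 = r ∘ Coord.inFst (j + 1) (j + 1) :=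
      funext fun t => congrArg r (Coord.skip_inFst hq t)
    rw [inOrthant_inSnd, hskip] at hr
    refine (hΦm 1 r).trans ?_
    change _ = smk (F ((collapse ∘ (pinch K q 1 (r ∘ Coord.skip q rfl hq) ∘ Coord.inSnd p q), _),
      x (collapse ∘ (pinch K q 1 (r ∘ Coord.skip q rfl hq) ∘ Coord.inFst (j + 1) 1)))) 1 _
    rw [pinch_inFst, pinch_inSnd, hskip, hold]
    simp only [Coord.block_eq_newN]
    rcases hx0 r with h0 | ⟨y, g, d, -, h0⟩
    · refine ((congrArg (fun y => H (_, y)) h0).trans (hHb _)).trans (Eq.symm ?_)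
      exact (congrArg (fun y => smk y 1 _) ((congrArg (fun y => F (_, y)) h0).trans (hFb _))).trans
        (smk_pt _ _)
    · refine ((congrArg (fun y => H (_, y)) h0).trans ?_).trans
        (congrArg (fun y => smk (F (_, y)) 1 _) h0).symm
      by_cases hg : g ∈ K
      · have h1 : smk (K := K) y g d = smk y 1 (shift (⟨g, hg⟩ : K) d) := by
          rw [← smk_mul, one_mul]
        rw [h1, hHm, hF1, one_smul, inv_one, shift_one, one_smul]
        simp only [Splitting.swapMap, Splitting.swap, Splitting.comp_mix, Set.Icc.coe_one]
        congr 1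
        · congr 2
          funext w
          simp [rotSnd]
        · funext w
          simp [Splitting.swapW, rotFst]
      · rw [hF0 _ _ _ _ hg, smk_pt]
        have hn : ¬ InOrthant K 0 (shift g⁻¹ (r ∘ Coord.inSnd p q) ∘ Splitting.tail) :=
          fun h => hg (K.inv_mem_iff.1 (InOrthant.mem_of_shift (by omega) hr (g := g⁻¹) (by
            have e : shift g⁻¹ (r ∘ Coord.inSnd p q) ∘ Splitting.tail =
              shift g⁻¹ ((r ∘ Coord.inSnd p q) ∘ Splitting.tail) := by
              funext t
              simp [shift, Coord.skip_smul]
            rwa [e] at h)))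
        exact hzero _ _ _ _ hn
  · have hr' :=
      fun g h => hr g (inOrthant_inSnd.2 (by
        have e : (shift g r ∘ Coord.skip q rfl hq) ∘ Coord.inSnd p q =
            shift g (r ∘ Coord.inSnd p q) ∘ Splitting.tail := by
          funext t
          simp [shift, Coord.skip_inSnd, Coord.inSnd_smul]
        rwa [e]))
    refine (hΦm 1 r).trans ?_
    rcases hx0 r with h0 | ⟨y, g, d, -, h0⟩
    · exact (congrArg (fun y => H (_, y)) h0).trans (hHb _)
    · exact (congrArg (fun y => H (_, y)) h0).trans (hzero _ _ _ _ (hr' g⁻¹))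

end

section

variable {G : Type u} [Group G] [Finite G] {X : GPrespectrum G} {m p q l : ℕ}

lemma exists_torus_sphere_smul (Γ : Type u) [Group Γ] (T : Type u) [MulAction Γ T] [Finite T] :
    ∃ f : Torus T → 𝕊(Γ, T), Continuous f ∧ (∀ c, f (collapse ∘ c) = sphereMap c) ∧
      (∀ ζ, (∃ i, ζ i = ∞) → f ζ = 𝕊(Γ, T).pt) ∧
      ∀ (g : Γ) ζ, f (shift g ζ) = g • f ζ := by
  obtain ⟨f, hf, hfm, hfb⟩ := exists_torus_sphere (T := T)
  refine ⟨f, hf, hfm, hfb, fun g ζ => ?_⟩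
  choose c _ hc using fun t => exists_collapse (ζ t)
  obtain rfl : collapse ∘ c = ζ := funext hc
  exact (hfm (shift g c)).trans ((smul_sphereMap g c).trans
    (congrArg (fun x => g • x) (hfm c).symm))

section PartialMap

variable (L : Subgroup G) (S : Set (Coord G 0 m))

/-- An equivariant pointed map on the smash product of the circles indexed by `S`. -/
structure IsPartialMap (f : 𝕋(G, 0, m) → Rep X p q l) : Prop where
  cont : Continuous f
  dep : ∀ ζ ζ', (∀ t ∈ S, ζ t = ζ' t) → f ζ = f ζ'
  infty : ∀ ζ, (∃ t ∈ S, ζ t = ∞) → f ζ = Rep.base X p q l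
  equi : ∀ g ∈ L, ∀ ζ, f (shift g ζ) = g • f ζ

/-- Null homotopic equivariant pointed maps on the smash product of the circles indexed by `S`. -/
def PartialNull (p q l : ℕ) (f : 𝕋(G, 0, m) → Rep X p q l) : Prop :=
  ∃ H : I × 𝕋(G, 0, m) → Rep X p q l, Continuous H ∧
    (∀ t, IsPartialMap L S fun z => H (t, z)) ∧ (∀ z, H (0, z) = f z) ∧
    ∀ z, H (1, z) = Rep.base X p q l

/-- Null homotopic families of equivariant pointed maps on the smash product of the circles indexed
by `S`. -/
def PartialFamNull (p q l : ℕ) (f : (Fin k → ℝ) × 𝕋(G, 0, m) → Rep X p q l) : Prop :=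
  ∃ N : (I × (Fin k → ℝ)) × 𝕋(G, 0, m) → Rep X p q l, Continuous N ∧
    (∀ t, IsPartialMap L S fun z => N (t, z)) ∧ (∀ z, N ((0, z.1), z.2) = f z) ∧
    (∀ x z, N ((1, x), z) = Rep.base X p q l) ∧
    ∀ t x z, 1 ≤ ‖x‖ → N ((t, x), z) = Rep.base X p q l

variable {L S}

lemma IsPartialMap.stab (hf : IsPartialMap L S f) :
    IsPartialMap L S fun z => stab (f z) where
  cont := Rep.stab.continuous.comp hf.cont
  dep ζ ζ' h := congrArg Rep.stab (hf.dep ζ ζ' h)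
  infty z hz := by rw [hf.infty z hz, stab_base]
  equi γ hγ z := by rw [hf.equi γ hγ, stab_smul]

lemma PartialNull.after_fam (hP : P = p + k) (hQ : Q = q + 0) {f : 𝕋(G, 0, m) → Rep X P Q l}
    (hf : ∀ ζ x, unabs hP hQ (f ζ) (cube G x) = u (x, ζ)) {n : ℕ}
    (h : After (PartialNull L S) n f) : After (PartialFamNull L S) n u := by
  refine h.transport (fun P Q l p q f u => ∃ hP hQ,
    ∀ ζ x, unabs hP hQ (f ζ) (cube G x) = u (x, ζ)) ?_ ?_ ⟨hP, hQ, hf⟩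
  · rintro p q l p' q' f f' ⟨hP, hQ, h⟩
    refine ⟨by omega, by omega, fun ζ s => ?_⟩
    rw [unabs_stab hP hQ, h]
  · rintro p q l p' q' f u ⟨hP, hQ, hf⟩ ⟨H, hH, hHm, hH0, hH1⟩
    refine ⟨fun z => unabs hP hQ (H (z.1.1, z.2)) (cube G z.1.2),
      (continuous_unabs_cube hP hQ).comp ((hH.comp (by fun_prop)).prodMk (by fun_prop)),
      fun t => ⟨?_, fun ζ ζ' h => ?_, fun ζ h => ?_, fun g hg ζ => ?_⟩, fun z => ?_, fun x z => ?_,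
      fun t x z hx => unabs_cube_of_ge hP hQ _ (one_le_norm_iff.1 hx)⟩
    · exact (continuous_unabs_cube hP hQ).comp ((hH.comp (by fun_prop)).prodMk (by fun_prop))
    · exact congrArg (fun y => unabs hP hQ y _) ((hHm t.1).dep _ _ h)
    · exact (congrArg (fun y => unabs hP hQ y _) ((hHm t.1).infty _ h)).trans
        (unabs_base hP hQ _)
    · exact (congrArg (fun y => unabs hP hQ y _) ((hHm t.1).equi g hg ζ)).trans
        (unabs_cube_smul hP hQ _ _ _)
    · dsimp only
      rw [hH0, hf]
    · dsimp only
      rw [hH1, unabs_base]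

variable (X S p q l) in
/-- The space of pointed maps on the smash product of the circles indexed by `S`. -/
abbrev PartialObj : Type u := { φ : C(𝕋(G, 0, m), Rep X p q l) //
  (∀ ζ ζ' : 𝕋(G, 0, m), (∀ t ∈ S, ζ t = ζ' t) → φ ζ = φ ζ') ∧
  ∀ ζ : 𝕋(G, 0, m), (∃ t ∈ S, ζ t = ∞) → φ ζ = Rep.base X p q l }

variable (X p q l) in
/-- The action by conjugation. -/
abbrev partialAction (hS : ∀ g ∈ L, ∀ t ∈ S, g • t ∈ S) : MulAction L (PartialObj X p q l S) where
  smul := fun g φ => ⟨⟨fun ζ => (g : G) • φ.1 (shift (g : G)⁻¹ ζ),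
      (continuous_const_smul _).comp (φ.1.continuous.comp (continuous_shift _))⟩,
    fun ζ ζ' h => congrArg (fun x : Rep X _ _ _ => (g : G) • x) (φ.2.1 _ _ fun t ht =>
      h _ (by simpa using hS g g.2 t ht)),
    fun ζ ⟨t, ht, h⟩ => (congrArg (fun x : Rep X _ _ _ => (g : G) • x) (φ.2.2 _
      ⟨(g : G)⁻¹ • t, hS _ (L.inv_mem g.2) t ht, by simpa [shift] using h⟩)).trans
      (smul_base _)⟩
  one_smul := fun φ => Subtype.ext (ContinuousMap.ext fun ζ => by
    change (1 : G) • φ.1 (shift (1 : G)⁻¹ ζ) = _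
    rw [inv_one, shift_one, one_smul])
  mul_smul := fun g h φ => Subtype.ext (ContinuousMap.ext fun ζ => by
    change ((g : G) * h) • φ.1 (shift ((g : G) * h)⁻¹ ζ) =
      (g : G) • (h : G) • φ.1 (shift (h : G)⁻¹ (shift (g : G)⁻¹ ζ))
    rw [shift_shift, mul_inv_rev, mul_smul])

variable (X p q l) in
/-- The tower of maps on the smash product of the circles indexed by `S`. -/
abbrev partialTower (hS : ∀ g ∈ L, ∀ t ∈ S, g • t ∈ S) : Tower.{u} L where
  obj n := PartialObj X (p + n) (q + n) (l + n) S
  act n := partialAction X (p + n) (q + n) (l + n) hS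
  cont n :=
    letI := partialAction X (p + n) (q + n) (l + n) hS
    ⟨fun g => by
      refine Continuous.subtype_mk (ContinuousMap.continuous_of_continuous_uncurry _ ?_) _
      exact (continuous_const_smul (g : G)).comp (f := fun z :
        PartialObj X (p + n) (q + n) (l + n) S × 𝕋(G, 0, m) => z.1.1 (shift (g : G)⁻¹ z.2))
        (Continuous.eval (continuous_subtype_val.comp continuous_fst)
          ((continuous_shift (g : G)⁻¹).comp continuous_snd))⟩
  pt n := ⟨ContinuousMap.const _ (Rep.base X _ _ _), fun _ _ _ => rfl, fun _ _ => rfl⟩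
  smul_pt n g := Subtype.ext (ContinuousMap.ext fun ζ => smul_base (g : G))
  step n := ⟨fun φ => ⟨Rep.stab.comp φ.1, fun ζ ζ' h => congrArg stab (φ.2.1 ζ ζ' h),
      fun ζ h => (congrArg stab (φ.2.2 ζ h)).trans stab_base⟩,
    Continuous.subtype_mk ((ContinuousMap.continuous_postcomp _).comp continuous_subtype_val) _⟩
  step_pt n := Subtype.ext (ContinuousMap.ext fun ζ => stab_base)
  step_smul n g φ := Subtype.ext (ContinuousMap.ext fun ζ => stab_smul (g : G) _)

variable {hS : ∀ g ∈ L, ∀ t ∈ S, g • t ∈ S}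

lemma partialTower_map_apply (h : n ≤ n') (φ : (partialTower X p q l hS).obj n) (ζ) :
    ((partialTower X p q l hS).map h φ).1 ζ = (towerOf X L.subtype p q l).map h (φ.1 ζ) := by
  induction n', h using Nat.le_induction with
  | base => rw [Tower.map_refl, Tower.map_refl]
  | succ k hk ih =>
    rw [Tower.map_succ _ hk, Tower.map_succ _ hk, ← ih]
    rfl

lemma piTriv_partialTower (K : Subgroup L)
    (h : ∀ (n : ℕ) (f : 𝕋(G, 0, m) → Rep X (p + n + k) (q + n) (l + n)),
      IsPartialMap (K.map L.subtype) S f → ∃ j, After (PartialNull (K.map L.subtype) S) j f) :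
    (partialTower X p q l hS).PiTriv K k := by
  intro n u hu hu1 huf
  have hc : Continuous fun z : 𝕋(G, 0, m) × (Fin k → ℝ) => (u z.2).1 z.1 :=
    Continuous.eval (continuous_subtype_val.comp (hu.comp continuous_snd)) continuous_fst
  obtain ⟨F, hF, hFf⟩ := exists_absorb_cube (P := p + n + k) rfl (Q := q + n) (q := q + n) rfl hc
    (by
      intro ζ x hx
      dsimp only
      rw [hu1 x (one_le_norm_iff.2 hx)]
      rfl)
  obtain ⟨j, hj⟩ := h n F ⟨hF, fun ζ ζ' h => unabs_cube_ext rfl rfl fun x => by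
      rw [hFf, hFf]
      exact (u x).2.1 ζ ζ' h, fun ζ h => unabs_cube_ext rfl rfl fun x => by
      exact (hFf ζ x).trans (((u x).2.2 ζ h).trans (unabs_base rfl rfl _).symm), by
      rintro _ ⟨g, hg, rfl⟩ ζ
      refine unabs_cube_ext rfl rfl fun x => ?_
      rw [hFf, unabs_cube_smul, hFf]
      have := congrArg (fun φ => φ.1 (shift g ζ))
        (huf x g hg)
      refine this.symm.trans ?_
      change (g : G) • (u x).1 (shift (g : G)⁻¹ (shift (g : G) ζ)) = _
      rw [shift_inv_shift]
      rfl⟩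
  have hj := PartialNull.after_fam (u := fun z => (u z.1).1 z.2) rfl rfl hFf hj
  obtain ⟨n', hn, N, hN, hNm, hN0, hN1, hNb⟩ := hj.exists_map L.subtype
  refine ⟨n', hn, fun z => ⟨⟨fun ζ => N ((projIcc 0 1 zero_le_one z.1, z.2), ζ), by fun_prop⟩,
    (hNm _).dep, (hNm _).infty⟩, ?_, fun x => ?_, fun x => ?_, fun t x hx => ?_, fun t x g hg => ?_⟩
  · exact Continuous.subtype_mk (ContinuousMap.continuous_of_continuous_uncurry _ (by
      change Continuous fun z : (ℝ × (Fin k → ℝ)) × 𝕋(G, 0, m) =>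
        N ((projIcc 0 1 zero_le_one z.1.1, z.1.2), z.2)
      fun_prop)) _
  · refine Subtype.ext (ContinuousMap.ext fun ζ => ?_)
    rw [partialTower_map_apply]
    refine Eq.trans ?_ (hN0 (x, ζ))
    simp
  · refine Subtype.ext (ContinuousMap.ext fun ζ => ?_)
    refine Eq.trans ?_ (hN1 x ζ)
    simp
  · exact Subtype.ext (ContinuousMap.ext fun ζ => hNb _ x ζ hx)
  · refine Subtype.ext (ContinuousMap.ext fun ζ => ?_)
    refine ((hNm _).equi g (Subgroup.mem_map_of_mem L.subtype hg) (shift (g : G)⁻¹ ζ)).symm.trans ?_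
    exact congrArg (fun ζ => N (_, ζ)) (shift_shift_inv (g : G) ζ)

end PartialMap

end

section

variable {G : Type u} [Group G] [Finite G] {X : GPrespectrum G} {m p q l : ℕ} {L : Subgroup G}
  {S : Set (Coord G 0 m)}

open Classical in
/-- Change the coordinates in `O` to the point of the circle with parameter `s`. -/
def setOn (O : Set (Coord G 0 m)) (s : I) (ζ : 𝕋(G, 0, m)) :
    𝕋(G, 0, m) := fun t => if t ∈ O then collapse (2 * (s : ℝ) - 1) else ζ t

lemma setOn_of_mem {s : I} {ζ : 𝕋(G, 0, m)} {t}
    (h : t ∈ O) : setOn O s ζ t = collapse (2 * (s : ℝ) - 1) := if_pos h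

lemma setOn_of_notMem {s : I} {ζ : 𝕋(G, 0, m)} {t}
    (h : t ∉ O) : setOn O s ζ t = ζ t := if_neg h

lemma continuous_setOn (O : Set (Coord G 0 m)) :
    Continuous fun z : I × 𝕋(G, 0, m) => setOn O z.1 z.2 := by
  refine continuous_pi fun t => ?_
  by_cases h : t ∈ O
  · simp only [setOn_of_mem h]
    exact continuous_collapse.comp (by fun_prop)
  · simp only [setOn_of_notMem h]
    fun_prop

lemma smul_mem_orbit_iff (hg : g ∈ L) {b t : Coord G 0 m} :
    g • t ∈ MulAction.orbit L b ↔ t ∈ MulAction.orbit L b := by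
  refine ⟨fun h => ?_, fun h => MulAction.mem_orbit_of_mem_orbit (⟨g, hg⟩ : L) h⟩
  have := MulAction.mem_orbit_of_mem_orbit (⟨g, hg⟩ : L)⁻¹ h
  rwa [show (⟨g, hg⟩ : L)⁻¹ • g • t = t from inv_smul_smul g t] at this

lemma shift_setOn {g : G} (hg : g ∈ L) (b : Coord G 0 m) (s : I) (ζ) :
    setOn (MulAction.orbit L b) s (shift g ζ) = shift g (setOn (MulAction.orbit L b) s ζ) := by
  funext t
  have h : g⁻¹ • t ∈ MulAction.orbit L b ↔ t ∈ MulAction.orbit L b :=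
    smul_mem_orbit_iff (L.inv_mem hg)
  by_cases ht : t ∈ MulAction.orbit L b
  · rw [setOn_of_mem ht, shift, setOn_of_mem (h.2 ht)]
  · rw [setOn_of_notMem ht, shift, shift, setOn_of_notMem fun h' => ht (h.1 h')]

lemma IsPartialMap.exists_orbit_extend {f : 𝕋(G, 0, m) → Rep X (p + 1) q l}
    (hf : IsPartialMap L S f) (hS : ∀ g ∈ L, ∀ t ∈ S, g • t ∈ S) {b : Coord G 0 m}
    (hO : Disjoint S (MulAction.orbit L b))
    (hL : ∀ k, ∀ w : MulAction.orbit L b → Fin (k + 2), Function.Surjective w →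
      (partialTower X (p + 1) q l hS).PiTriv (cellStab L w) k) :
    ∃ (n : ℕ) (f' : 𝕋(G, 0, m) → Rep X (p + n) (q + n) (l + n)),
      IsPartialMap L (S ∪ MulAction.orbit L b) f' ∧
      ∀ (hP : p + 1 + n = p + n + 1) ζ s, unabs hP (q := q + n) rfl
        ((towerOf X L.subtype (p + 1) q l).map (Nat.zero_le n) (f ζ)) (circ G s) =
          f' (setOn (MulAction.orbit L b) s ζ) := by
  set O := MulAction.orbit L b with hOdef
  have hset : ∀ s ζ, f (setOn O s ζ) = f ζ := fun s ζ => hf.dep _ _ fun t ht =>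
    setOn_of_notMem fun h => hO.ne_of_mem ht h rfl
  have hcirc : ∀ s, circ G s = fun _ => collapse (2 * (s : ℝ) - 1) := fun s => by
    funext t
    rcases t with t | ⟨t, g⟩
    · rfl
    · exact t.elim0
  have hb : b ∈ O := MulAction.mem_orbit_self b
  rcases subsingleton_or_nontrivial O with hsub | hnt
  · have hOb : ∀ t ∈ O, t = b := fun t ht =>
      congrArg Subtype.val (Subsingleton.elim (⟨t, ht⟩ : O) ⟨b, hb⟩)
    have hP : p + 1 = p + 1 := rfl
    have hQ : q = q + 0 := rfl
    refine ⟨0, fun ζ => unabs hP hQ (f ζ) fun _ => ζ b, ⟨?_, fun ζ ζ' h => ?_, ?_,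
      fun g hg ζ => ?_⟩, fun hP ζ s => ?_⟩
    · exact (continuous_unabs hP hQ).comp (hf.cont.prodMk
        (continuous_pi fun _ => continuous_apply b))
    · rw [hf.dep ζ ζ' fun t ht => h t (Or.inl ht), h b (Or.inr hb)]
    · rintro ζ ⟨t, ht | ht, h⟩
      · rw [hf.infty ζ ⟨t, ht, h⟩]
        exact unabs_base hP hQ _
      · rw [hOb t ht] at h
        exact unabs_infty hP hQ _ ⟨Sum.inl 0, h⟩
    · have e : shift g ζ b = ζ b :=
        congrArg ζ (hOb _ ((smul_mem_orbit_iff (L.inv_mem hg)).2 hb))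
      rw [hf.equi g hg, e]
      exact unabs_smul hP hQ g (f ζ) fun _ => ζ b
    · rw [Tower.map_refl, hcirc]
      dsimp only
      rw [hset, setOn_of_mem hb]
  · let φ₀ : (partialTower X (p + 1) q l hS).obj 0 := ⟨⟨f, hf.cont⟩, hf.dep, hf.infty⟩
    have hφ₀ : ∀ g : L, (partialAction X (p + 1) q l hS).toSMul.smul g φ₀ = φ₀ := fun g => Subtype.ext (ContinuousMap.ext fun ζ => by
      change (g : G) • f (shift (g : G)⁻¹ ζ) = f ζ
      rw [← hf.equi g g.2, shift_shift_inv])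
    have hdom : ∀ z ∈ skelDom (T := O) (Fin 0 → ℝ) ∅ 0, z.2 = 0 := by
      rintro z ⟨⟨-, ⟨t, ht⟩, t', ht'⟩, -, -, h | h | h | h⟩
      · exact h.elim
      · refine absurd ⟨![t, t'], ?_⟩ h
        intro i j hij
        fin_cases i <;> fin_cases j <;> simp_all
      · rw [Subsingleton.elim z.1.2 0, norm_zero] at h
        norm_num at h
      · exact h
    obtain ⟨n, hn, h, hh, he⟩ := exists_extend (T := O) (F := Fin 0 → ℝ) (n := 0) isSubcomplex_empty
      (L := partialTower X (p + 1) q l hS) (h := fun _ => φ₀) (k := 0)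
      ⟨continuousOn_const, fun g z _ => (hφ₀ g).symm, fun z hz h1 => by
        rw [hdom z hz] at h1
        norm_num at h1⟩ fun k _ w hw _ => by simpa using hL k w hw
    have hP : p + 1 + n = p + n + 1 := by omega
    have hmem : ∀ (y : Poly O) (β : J), ((y.1, (0 : Fin 0 → ℝ)), (β : ℝ)) ∈
        skelDom (Fin 0 → ℝ) univ 0 := fun y β => ⟨y.2, by simp, β.2, Or.inl trivial⟩
    have h0 : ∀ (y : Poly O) ζ, (h ((y.1, 0), 0)).1 ζ =
        (towerOf X L.subtype (p + 1) q l).map (Nat.zero_le n) (f ζ) := fun y ζ => by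
      rw [he _ ⟨y.2, by simp, by simp, Or.inr (Or.inr (Or.inr rfl))⟩]
      exact partialTower_map_apply hn φ₀ ζ
    let u : 𝕋(G, 0, m) × (Poly O × J × Icc (-1 : ℝ) 1) →
        Rep X (p + n) (q + n) (l + n) := fun z => unabs hP (q := q + n) rfl
      ((h ((z.2.1.1, 0), z.2.2.1)).1 z.1) (cube G fun _ : Fin 1 => (z.2.2.2 : ℝ))
    have hu : Continuous u := by
      refine (continuous_unabs_cube hP rfl).comp (Continuous.prodMk (Continuous.eval
        (continuous_subtype_val.comp ?_) continuous_fst) (by fun_prop))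
      exact hh.cont.comp_continuous (by fun_prop) fun z => hmem z.2.1 z.2.2.1
    have hub : ∀ ζ (y : Poly O) (β : J) (a : Icc (-1 : ℝ) 1),
        ((β : ℝ) = 1 ∨ |(a : ℝ)| = 1) → u (ζ, (y, β, a)) = Rep.base X _ _ _ := by
      rintro ζ y β a (hβ | ha)
      · change unabs hP _ ((h ((y.1, 0), (β : ℝ))).1 ζ) _ = _
        rw [hh.one _ (hmem y β) hβ]
        exact unabs_base hP rfl _
      · exact unabs_cube_of_ge hP rfl _ ⟨0, ha.ge⟩
    have : CompactSpace (Poly O) := isCompact_iff_compactSpace.1 isCompact_poly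
    obtain ⟨Q, hQ, hQu⟩ := exists_descend continuous_polarMap polarMap_surjective hu (by
      rintro ζ ⟨y, β, a⟩ ⟨y', β', a'⟩ hpol
      rcases polarMap_eq hpol with ⟨h1, h1'⟩ | ⟨rfl, rfl, rfl | hβ⟩
      · rw [hub _ _ _ _ h1, hub _ _ _ _ h1']
      · rfl
      · change unabs hP _ ((h ((y.1, 0), (β : ℝ))).1 ζ) _ =
          unabs hP _ ((h ((y'.1, 0), (β : ℝ))).1 ζ) _
        rw [hβ, h0, h0])
    obtain ⟨π, hπ, hπm, hπb, hπs⟩ : ∃ π : Torus O → OnePoint (O → ℝ), Continuous π ∧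
        (∀ c, π (collapse ∘ c) = sphereMap c) ∧ (∀ ζ, (∃ i, ζ i = ∞) → π ζ = ∞) ∧
        ∀ (g : L) ζ y β a, π ζ = polarMap (y, β, a) →
          π (shift g ζ) = polarMap (⟨shift g y.1, shift_mem_poly g y.2⟩, β, a) := by
      obtain ⟨π, h1, h2, h3, h4⟩ := exists_torus_sphere_smul L O
      refine ⟨π, h1, h2, h3, fun g ζ y β a h => (h4 g ζ).trans (Eq.trans ?_
        (smul_polarMap g y β a).symm)⟩
      exact congrArg (fun x : repSphere (permRep L O) => g • x) h
    have hQb : ∀ ζ, Q (ζ, ∞) = Rep.base X _ _ _ := fun ζ => by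
      obtain ⟨y, hy⟩ := poly_nonempty (T := O)
      rw [← polarMap_of_ge (y := ⟨y, hy⟩) (b := 1) (a := ⟨0, by simp⟩) (Or.inl rfl), hQu]
      exact hub _ _ _ _ (Or.inl rfl)
    refine ⟨n, fun ζ => Q (ζ, π fun t => ζ t), ⟨hQ.comp (continuous_id.prodMk (hπ.comp
      (by fun_prop))), fun ζ ζ' hζ => ?_, ?_, fun g hg ζ => ?_⟩, fun _ ζ s => ?_⟩
    · have e : (fun t : O => ζ t) = fun t : O => ζ' t := funext fun t => hζ t (Or.inr t.2)
      rw [e]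
      obtain ⟨⟨y, β, a⟩, hy⟩ := polarMap_surjective (π fun t : O => ζ' t)
      rw [← hy, hQu, hQu]
      exact congrArg (fun x => unabs hP _ x _)
        ((h ((y.1, 0), β)).2.1 ζ ζ' fun t ht => hζ t (Or.inl ht))
    · rintro ζ ⟨t, ht | ht, hinf⟩
      · obtain ⟨⟨y, β, a⟩, hy⟩ := polarMap_surjective (π fun t : O => ζ t)
        rw [← hy, hQu]
        exact (congrArg (fun x => unabs hP _ x _) ((h ((y.1, 0), β)).2.2 ζ ⟨t, ht, hinf⟩)).trans
          (unabs_base hP rfl _)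
      · exact (congrArg (fun x => Q (ζ, x)) (hπb _ ⟨⟨t, ht⟩, hinf⟩)).trans (hQb ζ)
    · obtain ⟨⟨y, β, a⟩, hy⟩ := polarMap_surjective (π fun t : O => ζ t)
      have e : π (fun t : O => shift g ζ t) =
          polarMap (⟨shift (⟨g, hg⟩ : L) y.1, shift_mem_poly _ y.2⟩, β, a) :=
        hπs ⟨g, hg⟩ (fun t : O => ζ t) y β a hy.symm
      rw [← hy, hQu]
      refine (congrArg (fun x => Q (shift g ζ, x)) e).trans ((hQu _ _).trans ?_)
      refine Eq.trans ?_ (unabs_cube_smul hP rfl g _ _)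
      have h1 := hh.equi ⟨g, hg⟩ _ (hmem y β)
      have h2 := congrArg (fun φ : (partialTower X (p + 1) q l hS).obj n => φ.1 (shift g ζ)) h1
      refine congrArg (fun x => unabs hP _ x _) (h2.trans ?_)
      exact congrArg (fun z => g • (h ((y.1, 0), β)).1 z) (shift_inv_shift g ζ)
    · obtain ⟨y, hy⟩ := poly_nonempty (T := O)
      have e : (fun t : O => setOn O s ζ t) = collapse ∘ fun _ => 2 * (s : ℝ) - 1 :=
        funext fun t => setOn_of_mem t.2
      have hs : 2 * (s : ℝ) - 1 ∈ Icc (-1 : ℝ) 1 := ⟨by linarith [s.2.1], by linarith [s.2.2]⟩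
      have e2 : sphereMap (fun _ : O => 2 * (s : ℝ) - 1) =
          polarMap (⟨y, hy⟩, (0 : J), ⟨2 * (s : ℝ) - 1, hs⟩) := by
        rcases polar_cases 0 (⟨2 * (s : ℝ) - 1, hs⟩ : Icc (-1 : ℝ) 1) with h | ⟨h, h'⟩
        · rw [polarMap_of_ge h]
          refine sphereMap_eq_infty.2 ⟨⟨b, hb⟩, ?_⟩
          rcases h with h | h
          · norm_num at h
          · exact h.ge
        · rw [polarMap_of_lt h h', sphereMap_of_lt fun _ => h']
          refine congrArg _ (funext fun t => ?_)
          simp [stretch]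
      dsimp only
      rw [e]
      refine Eq.symm ((congrArg (fun x => Q (setOn O s ζ, x)) ((hπm _).trans e2)).trans
        ((hQu _ _).trans ?_))
      change unabs hP _ ((h ((y, 0), (0 : ℝ))).1 (setOn O s ζ)) (circ G s) = _
      rw [h0 ⟨y, hy⟩, hset]

end

section

variable {G : Type u} [Group G] [Finite G] {X : GPrespectrum G} {m p q l : ℕ} {L : Subgroup G}
  {S : Set (Coord G 0 m)}

lemma PartialNull.after_of_orbit (hO : Disjoint S (MulAction.orbit L b))
    {P Q : ℕ} (hP : P = p + 1) (hQ : Q = q + 0) {f : 𝕋(G, 0, m) → Rep X P Q l}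
    {f' : 𝕋(G, 0, m) → Rep X p q l}
    (hff' : ∀ ζ s, unabs hP hQ (f ζ) (circ G s) = f' (setOn (MulAction.orbit L b) s ζ)) {n : ℕ}
    (h : After (PartialNull L (S ∪ MulAction.orbit L b)) n f') : After (PartialNull L S) n f := by
  refine h.transport (fun p q l P Q f' f => ∃ hP hQ,
    ∀ ζ s, unabs hP hQ (f ζ) (circ G s) = f' (setOn (MulAction.orbit L b) s ζ)) ?_ ?_
    ⟨hP, hQ, hff'⟩
  · rintro p q l P Q f' f ⟨hP, hQ, h⟩
    refine ⟨by omega, by omega, fun ζ s => ?_⟩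
    rw [unabs_stab hP hQ, h]
  · rintro p q l P Q f' f ⟨hP, hQ, hff'⟩ ⟨H, hH, hHm, hH0, hH1⟩
    have hinf : ∀ t ζ s, s = 0 ∨ s = 1 → H (t, setOn (MulAction.orbit L b) s ζ) = Rep.base X p q l :=
      fun t ζ s hs => (hHm t).infty _ ⟨b, Or.inr (MulAction.mem_orbit_self b), by
        rw [setOn_of_mem (MulAction.mem_orbit_self b)]
        refine collapse_of_ge ?_
        rcases hs with rfl | rfl <;> norm_num⟩
    obtain ⟨F, hF, hFf⟩ := exists_absorb_circ hP hQ (W := I × 𝕋(G, 0, m))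
      (f := fun z => H (z.1.1, setOn (MulAction.orbit L b) z.2 z.1.2))
      (hH.comp (Continuous.prodMk (by fun_prop) ((continuous_setOn _).comp
        (f := fun z : (I × 𝕋(G, 0, m)) × I => (z.2, z.1.2))
        (by fun_prop)))) (fun z => hinf _ _ _ (Or.inl rfl)) fun z => hinf _ _ _ (Or.inr rfl)
    refine ⟨F, hF, fun t => ⟨hF.comp (by fun_prop), fun ζ ζ' h => ?_, fun ζ ⟨x, hx, h⟩ => ?_,
      fun g hg ζ => ?_⟩, fun ζ => ?_, fun ζ => ?_⟩ <;>
      refine unabs_circ_ext hP hQ fun s => ?_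
    · rw [hFf, hFf]
      refine (hHm t).dep _ _ fun x hx => ?_
      by_cases hxO : x ∈ MulAction.orbit L b
      · rw [setOn_of_mem hxO, setOn_of_mem hxO]
      · rw [setOn_of_notMem hxO, setOn_of_notMem hxO]
        exact h x (hx.resolve_right hxO)
    · rw [hFf, unabs_base]
      refine (hHm t).infty _ ⟨x, Or.inl hx, ?_⟩
      rw [setOn_of_notMem fun h' => hO.ne_of_mem hx h' rfl]
      exact h
    · rw [hFf, unabs_circ_smul, hFf, shift_setOn hg]
      exact (hHm t).equi g hg _
    · rw [hFf, hff']
      exact hH0 _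
    · rw [hFf, unabs_base]
      exact hH1 _

lemma IsPartialMap.exists_after_univ (hX : Concentrated X)
    {f : 𝕋(G, 0, m) → Rep X p q l} (hf : IsPartialMap L univ f) (hq : q + m = X.d + l)
    (hp : p < X.e + l) : ∃ n, After (PartialNull L univ) n f := by
  obtain ⟨F, hF, hFf⟩ := exists_absorb rfl rfl
    (f := fun z : Unit × 𝕋(G, 0, m) => f z.2) (hf.cont.comp continuous_snd)
    fun _ ζ ⟨t, ht⟩ => hf.infty ζ ⟨t, trivial, ht⟩
  obtain ⟨n, hn⟩ := exists_after_connBase hX L (x := F ()) (fun g hg => by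
    refine unabs_ext (p := p) (j := 0) rfl rfl fun ζ => ?_
    obtain ⟨ζ, rfl⟩ : ∃ ζ', permute g ζ' = ζ := ⟨permute g⁻¹ ζ, shift_shift_inv g ζ⟩
    rw [unabs_smul, hFf, hFf]
    exact (hf.equi g hg ζ).symm) hq hp.ne
  refine ⟨n, hn.transport (fun P Q l p q F f => ∃ (hP : P = p + 0) (hQ : Q = q + m),
    ∀ ζ, unabs hP hQ (F ()) ζ = f ζ) ?_ ?_ ⟨rfl, rfl, fun ζ => hFf () ζ⟩⟩
  · rintro P Q l p q F f ⟨hP, hQ, h⟩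
    refine ⟨by omega, by omega, fun ζ => ?_⟩
    rw [unabs_stab hP hQ, h]
  · rintro P Q l p q F f ⟨hP, hQ, h⟩ ⟨c, hc, hc0, hc1, hcL⟩
    have hcont : Continuous fun z : I × 𝕋(G, 0, m) =>
      unabs hP hQ (c z.1) z.2 :=
      (continuous_unabs hP hQ).comp ((hc.comp continuous_fst).prodMk continuous_snd)
    refine ⟨fun z => unabs hP hQ (c z.1) z.2, hcont, fun t => ⟨hcont.comp (f := fun ζ => (t, ζ))
      (by fun_prop), fun ζ ζ' h => ?_, fun ζ ⟨x, _, h⟩ => unabs_infty hP hQ _ ⟨x, h⟩,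
      fun g hg ζ => ?_⟩, fun ζ => ?_, fun ζ => ?_⟩
    · rw [show ζ = ζ' from funext fun t => h t trivial]
    · dsimp only
      conv_lhs => rw [← hcL t g hg]
      exact unabs_smul hP hQ g (c t) ζ
    · dsimp only
      rw [hc0, h]
    · dsimp only
      rw [hc1, unabs_base]

lemma IsPartialMap.exists_after_of_lt (hX : Concentrated X) (N : ℕ) : ∀ {p q l : ℕ}
    {L : Subgroup G} {S : Set (Coord G 0 m)} {f : 𝕋(G, 0, m) → Rep X p q l} {α : Type u}
    {w : Coord G 0 m → α}, Nat.card L + Sᶜ.ncard ≤ N → (∀ g ∈ L, ∀ t ∈ S, g • t ∈ S) →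
    (∀ g ∈ L, ∀ t, w (g • t) = w t) → IsPartialMap L S f → q + m = X.d + l →
    p < X.e + l + (w '' Sᶜ).ncard → ∃ n, After (PartialNull L S) n f := by
  classical
  induction N with
  | zero =>
    intro p q l L S f α w hN
    have : 0 < Nat.card L := Nat.card_pos
    omega
  | succ N ih =>
    intro p q l L S f α w hN hS hw hf hq hp
    by_cases hSu : S = univ
    · subst hSu
      exact hf.exists_after_univ hX hq (by simpa using hp)
    obtain ⟨b, hb⟩ := (ne_univ_iff_exists_notMem S).1 hSu
    have hbO : b ∈ MulAction.orbit L b := MulAction.mem_orbit_self b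
    have hsmul : ∀ {g : G} {t}, g ∈ L → (g • t ∈ MulAction.orbit L b ↔ t ∈ MulAction.orbit L b) := fun hg => by
      rw [smul_mem_orbit_iff hg]
    have hOrb : ∀ t ∈ MulAction.orbit L b, ∃ g : L, g • b = t := fun _ ht => ht
    have hO : Disjoint S (MulAction.orbit L b) := by
      rw [Set.disjoint_left]
      intro t ht h
      obtain ⟨g, rfl⟩ := hOrb t h
      have := hS _ (L.inv_mem g.2) _ ht
      exact hb (by rwa [show (g : G)⁻¹ • g • b = b from inv_smul_smul (g : G) b] at this)
    have hfin : ∀ A : Set (Coord G 0 m), A.Finite := fun A => A.toFinite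
    have hcompl : Sᶜ = MulAction.orbit L b ∪ (S ∪ MulAction.orbit L b)ᶜ := by
      ext t
      have : t ∈ MulAction.orbit L b → t ∉ S := fun h h' => hO.ne_of_mem h' h rfl
      simp only [mem_compl_iff, mem_union]
      tauto
    have hcard1 : (w '' Sᶜ).ncard ≤ 1 + (w '' (S ∪ MulAction.orbit L b)ᶜ).ncard := by
      have : w '' Sᶜ ⊆ insert (w b) (w '' (S ∪ MulAction.orbit L b)ᶜ) := by
        rw [hcompl, image_union]
        refine union_subset ?_ (subset_insert _ _)
        rintro _ ⟨_, ⟨g, rfl⟩, rfl⟩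
        exact Or.inl (hw g g.2 b)
      have h1 := ncard_le_ncard this (((hfin _).image w).insert _)
      have h2 := ncard_insert_le (w b) (w '' (S ∪ MulAction.orbit L b)ᶜ)
      omega
    obtain ⟨n, f', hf', hff'⟩ := hf.stab.exists_orbit_extend hS hO fun k v hv => by
      refine piTriv_partialTower _ fun n f₁ hf₁ => ?_
      have hK : Nat.card ((cellStab L v).map L.subtype) < Nat.card L := by
        rw [Subgroup.card_map_of_injective L.subtype_injective]
        have hne : cellStab L v ≠ ⊤ := fun h => by
          have hconst : ∀ t, v t = v ⟨b, hbO⟩ := by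
            rintro ⟨t, ht⟩
            obtain ⟨g, rfl⟩ := hOrb t ht
            have hg : g⁻¹ ∈ cellStab L v := h ▸ Subgroup.mem_top _
            have := congrFun (mem_cellStab.1 hg) ⟨b, hbO⟩
            rw [shift, inv_inv] at this
            exact this
          obtain ⟨t, ht⟩ := hv 0
          obtain ⟨t', ht'⟩ := hv 1
          rw [hconst] at ht ht'
          exact absurd (ht.symm.trans ht') (by simp)
        exact lt_of_le_of_ne (Subgroup.card_le_card_group _) fun h =>
          hne (Subgroup.eq_top_of_card_eq _ h)
      let w' : Coord G 0 m → α ⊕ Fin (k + 2) := fun t =>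
        if h : t ∈ MulAction.orbit L b then Sum.inr (v ⟨t, h⟩) else Sum.inl (w t)
      have hcard2 : k + 2 + (w '' (S ∪ MulAction.orbit L b)ᶜ).ncard ≤ (w' '' Sᶜ).ncard := by
        have e : w' '' Sᶜ = Sum.inr '' univ ∪ Sum.inl '' (w '' (S ∪ MulAction.orbit L b)ᶜ) := by
          rw [hcompl, image_union]
          congr 1
          · ext x
            constructor
            · rintro ⟨t, ht, rfl⟩
              exact ⟨v ⟨t, ht⟩, trivial, Eq.symm (dif_pos ht : w' t = _)⟩
            · rintro ⟨i, -, rfl⟩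
              obtain ⟨t, rfl⟩ := hv i
              exact ⟨t, t.2, (dif_pos t.2 : w' t = _)⟩
          · rw [← image_comp]
            exact image_congr fun t ht => (dif_neg (fun h => ht (Or.inr h)) : w' t = _)
        rw [e, ncard_union_eq, ncard_image_of_injective _ Sum.inr_injective,
          ncard_image_of_injective _ Sum.inl_injective, ncard_univ, Nat.card_fin]
        · rw [Set.disjoint_left]
          rintro _ ⟨i, -, rfl⟩ ⟨a, -, h⟩
          exact absurd h (by simp)
      refine ih (w := w') (by omega) (fun g hg t ht => ?_) (fun g hg t => ?_) hf₁ (by omega)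
        (by omega)
      · obtain ⟨g, -, rfl⟩ := hg
        exact hS g g.2 t ht
      · obtain ⟨g, hg, rfl⟩ := hg
        by_cases h : t ∈ MulAction.orbit L b
        · have h' : (g : G) • t ∈ MulAction.orbit L b := (hsmul g.2).2 h
          have := congrFun (mem_cellStab.1 hg) ⟨(g : G) • t, h'⟩
          refine (dif_pos h' : w' ((g : G) • t) = _).trans (Eq.trans (congrArg Sum.inr
            (this.symm.trans (congrArg v (Subtype.ext ?_)))) (dif_pos h : w' t = _).symm)
          exact inv_smul_smul (g : G) t
        · have h' : (g : G) • t ∉ MulAction.orbit L b := fun h' => h ((hsmul g.2).1 h')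
          exact (dif_neg h' : w' ((g : G) • t) = _).trans (Eq.trans (congrArg Sum.inl
            (hw g g.2 t)) (dif_neg h : w' t = _).symm)
    have hlt :=
      ncard_lt_ncard ⟨compl_subset_compl.2 subset_union_left, fun h => h hb (.inr hbO)⟩ (hfin _)
    obtain ⟨k, hk⟩ := ih (by omega) (fun g hg t ht => ht.imp (hS g hg t)
      (hsmul hg).2) hw hf' (by omega) (by omega)
    obtain ⟨j, hj⟩ := exists_after L.subtype (Nat.zero_le n)
      (N := fun P Q l f => ∃ k, After (PartialNull L S) k f) (fun ζ => Rep.stab (f ζ))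
      ⟨k, PartialNull.after_of_orbit hO (by omega) rfl (hff' (by omega)) hk⟩
    have key : ∀ j {p q l : ℕ} (f : 𝕋(G, 0, m) → Rep X p q l),
        After (fun P Q l f => ∃ k, After (PartialNull L S) k f) j f →
        ∃ n, After (PartialNull L S) n f := by
      intro j
      induction j with
      | zero => exact fun f h => h
      | succ j ih =>
        intro p q l f h
        obtain ⟨n, hn⟩ := ih (fun x => Rep.stab (f x)) h
        exact ⟨n + 1, hn⟩
    exact key (j + 1) f hj

end

section SliceCells

variable {G : Type u} [Group G] [Finite G] {X : GPrespectrum G} {p q l m : ℕ}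

/-- The splitting of `m ρ_G` into the multiples of `ρ_K` and their complement. -/
def Splitting.coord (K : Subgroup G) (m : ℕ) : Splitting K (Coord K 0 m) (CoCoord K m) m where
  e := Equiv.ofBijective (Sum.elim (Sum.elim Fin.elim0 (Prod.map id Subtype.val)) Subtype.val) <| by
    refine ⟨?_, fun x => ?_⟩
    · rintro ((i | ⟨i, k⟩) | u) ((i' | ⟨i', k'⟩) | u') h
      all_goals try first | exact i.elim0 | exact i'.elim0
      · obtain ⟨rfl, h⟩ := Prod.ext_iff.1 h
        rw [Subtype.ext (a1 := k) (a2 := k') h]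
        rfl
      · exact absurd (show u'.1.2 ∈ K from (congrArg Prod.snd h : (k : G) = _) ▸ k.2) u'.2
      · exact absurd (show u.1.2 ∈ K from (congrArg Prod.snd h : _ = (k' : G)) ▸ k'.2) u.2
      · exact congrArg Sum.inr (Subtype.ext h)
    · by_cases h : x.2 ∈ K
      · exact ⟨Sum.inl (Sum.inr (x.1, ⟨x.2, h⟩)), rfl⟩
      · exact ⟨Sum.inr ⟨x, h⟩, rfl⟩
  smul_inl k w := by
    rcases w with i | w
    · exact i.elim0
    · rfl
  smul_inr k u := rfl

/-- The splitting with the summands interchanged. -/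
def Splitting.symm {K : Subgroup G} {W U : Type u} [MulAction K W] [MulAction K U]
    (s : Splitting K W U m) : Splitting K U W m where
  e := (Equiv.sumComm U W).trans s.e
  smul_inl := s.smul_inr
  smul_inr := s.smul_inl

lemma IsTorusMap.exists_after_of_lt (hX : Concentrated X) {K : Subgroup G}
    {f : Torus (CoCoord K m) → Rep X p q l} (hf : IsTorusMap K.subtype f) (hq : q + m = X.d + l)
    (hp : p < X.e + l) : ∃ n, After (TorusNull K.subtype) n f := by
  let i : CoCoord K m → Coord G 0 m := fun u => Sum.inr u.1
  have hi : Function.Injective i := fun u u' h => Subtype.ext (Sum.inr_injective h)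
  let e : Torus (CoCoord K m) → 𝕋(G, 0, m) := fun ζ => Function.extend i ζ fun _ => ∞
  have he : ∀ ζ u, e ζ (i u) = ζ u := fun ζ u => hi.extend_apply ζ _ u
  have hec : Continuous e := continuous_pi fun t => by
    by_cases h : ∃ u, i u = t
    · obtain ⟨u, rfl⟩ := h
      exact (continuous_apply u).congr fun ζ => (he ζ u).symm
    · exact continuous_const.congr fun ζ => (Function.extend_apply' ζ (fun _ => ∞) t h).symm
  obtain ⟨n, hn⟩ := IsPartialMap.exists_after_of_lt (L := K) (S := range i)
    (f := fun ζ => f (ζ ∘ i)) (w := fun _ => PUnit.unit) hX _ le_rfl (by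
      rintro g hg _ ⟨u, rfl⟩
      exact ⟨(⟨g, hg⟩ : K) • u, rfl⟩) (fun _ _ _ => rfl)
    ⟨hf.cont.comp (by fun_prop), fun ζ ζ' h => congrArg f (funext fun u => h _ ⟨u, rfl⟩),
      by
        rintro ζ ⟨_, ⟨u, rfl⟩, h⟩
        exact hf.infty _ ⟨u, h⟩, fun g hg ζ => hf.equi ⟨g, hg⟩ (ζ ∘ i)⟩ hq (by omega)
  have key : ∀ n {p q l : ℕ} {f : 𝕋(G, 0, m) → Rep X p q l},
      After (PartialNull K (range i)) n f → After (TorusNull K.subtype) n fun ζ => f (e ζ) := by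
    intro n
    induction n with
    | zero =>
      rintro p q l f ⟨H, hH, hHm, h0, h1⟩
      refine ⟨fun z => H (z.1, e z.2), hH.comp (by fun_prop), fun t => ⟨hH.comp (by fun_prop), ?_, fun γ ζ => ?_⟩, fun ζ => h0 _, fun ζ => h1 _⟩
      · rintro ζ ⟨u, hu⟩
        exact (hHm t).infty _ ⟨_, ⟨u, rfl⟩, (he ζ u).trans hu⟩
      · refine ((hHm t).dep _ (shift γ (e ζ)) ?_).trans ((hHm t).equi γ γ.2 (e ζ))
        rintro _ ⟨u, rfl⟩
        exact (he _ u).trans (he ζ (γ⁻¹ • u)).symm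
    | succ n ih => exact fun h => ih h
  have := key n hn
  rw [show (fun ζ => f (e ζ ∘ i)) = f from funext fun ζ => congrArg f (funext (he ζ))] at this
  exact ⟨n, this⟩

lemma exists_torus_quotient (Γ : Type u) [Group Γ] (T : Type u) [MulAction Γ T] [Finite T]
    [Nonempty T] : ∃ π : Torus T → 𝕊(Γ, T), Continuous π ∧ Function.Surjective π ∧
      (∀ ζ, (∃ t, ζ t = ∞) → π ζ = 𝕊(Γ, T).pt) ∧
      (∀ ζ ζ', π ζ = π ζ' → ζ = ζ' ∨ (∃ t, ζ t = ∞) ∧ ∃ t, ζ' t = ∞) ∧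
      ∀ (g : Γ) ζ, π (shift g ζ) = g • π ζ := by
  obtain ⟨π, hπ, hπs, hπi, hπg⟩ := exists_torus_sphere_smul Γ T
  have hcol : ∀ ζ : Torus T, ∃ c, collapse ∘ c = ζ := fun ζ => by
    choose c _ hc using fun t => exists_collapse (ζ t)
    exact ⟨c, funext hc⟩
  refine ⟨π, hπ, fun x => ?_, hπi, fun ζ ζ' h => ?_, hπg⟩
  · change OnePoint (T → ℝ) at x
    rcases x with _ | x
    · exact ⟨fun _ => ∞, hπi _ ⟨Classical.arbitrary T, rfl⟩⟩
    ·
      obtain ⟨c, -, hc⟩ := exists_sphereMap_eq x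
      exact ⟨collapse ∘ c, (hπs c).trans hc⟩
  · obtain ⟨c, rfl⟩ := hcol ζ
    obtain ⟨c', rfl⟩ := hcol ζ'
    by_cases hi : sphereMap c = ∞
    · obtain ⟨t, ht⟩ := sphereMap_eq_infty.1 hi
      obtain ⟨t', ht'⟩ := sphereMap_eq_infty.1 ((hπs c').symm.trans (h.symm.trans ((hπs c).trans hi)))
      exact .inr ⟨⟨t, collapse_of_ge ht⟩, t', collapse_of_ge ht'⟩
    · rw [sphereMap_inj ((hπs c).symm.trans (h.trans (hπs c'))) hi]
      exact .inl rfl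

lemma IsTorusMap.null {Γ : Type u} [Group Γ] [Finite Γ] [Nontrivial Γ] {n : ℕ} {ι : Γ →* G}
    {M : Type*} [AddCommGroup M] (c : ZeroCoeff X M) (hX : Concentrated X) (hq : q = X.d + l)
    (hM : NoTorsion M)
    {f : Torus (Coord Γ 0 (n + 1)) → Rep X (p + 1) q l} (hf : IsTorusMap ι f) {i : ℕ} (hi : 0 < i)
    (hi' : i < 4) (hp : p + 1 + i = X.e + l) (h3 : Nat.card Γ ≠ 3) :
    ∃ m, After (TorusNull ι) m f := by
  have hq0 : q = q + 0 := rfl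
  have : Nonempty (Coord Γ 0 (n + 1)) := ⟨.inr (0, 1)⟩
  obtain ⟨π, hπ, hsurj, hπi, hπe, hπg⟩ := exists_torus_quotient Γ (Coord Γ 0 (n + 1))
  obtain ⟨F, hF, hFf⟩ := exists_descend hπ hsurj
    (g := fun z => unabs (p := p) (j := 1) rfl hq0 (f z.2) (circ G z.1))
    ((continuous_unabs_circ rfl hq0).comp ((hf.cont.comp continuous_snd).prodMk
      continuous_fst)) fun s ζ ζ' h => by
        dsimp only
        rcases hπe _ _ h with rfl | ⟨h1, h2⟩
        · rfl
        · rw [hf.infty _ h1, hf.infty _ h2]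
  obtain ⟨m, hm⟩ := IsLoopMap.null c hX hq hM n.succ_pos ⟨hF, fun x => by
    obtain ⟨ζ, rfl⟩ := hsurj x
    exact (hFf 0 ζ).trans (unabs_circ_zero rfl hq0 _), fun x => by
    obtain ⟨ζ, rfl⟩ := hsurj x
    exact (hFf 1 ζ).trans (unabs_circ_one rfl hq0 _), fun s => by
    have h := hπi (fun _ => ∞) ⟨.inr (0, 1), rfl⟩
    refine (congrArg (fun x => F (s, x)) h.symm).trans ((hFf s _).trans ?_)
    dsimp only
    rw [hf.infty _ ⟨Sum.inr (0, 1), rfl⟩, unabs_base], fun g s x => by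
    obtain ⟨ζ, rfl⟩ := hsurj x
    rw [← hπg, hFf, hFf]
    dsimp only
    rw [hf.equi, unabs_circ_smul]⟩ hi hi' hp fun h => h3 h.1
  refine ⟨m, hm.transport (N' := TorusNull ι) (fun p q l P Q F f => ∃ hP hQ,
    IsTorusMap ι f ∧ ∀ s ζ, unabs hP hQ (f ζ) (circ G s) = F (s, π ζ)) ?_ ?_
    ⟨rfl, hq0, hf, fun s ζ => (hFf s ζ).symm⟩⟩
  · rintro p q l P Q F f ⟨hP, hQ, hf, h⟩
    refine ⟨by omega, by omega, hf.stab, fun s ζ => ?_⟩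
    rw [unabs_stab hP hQ, h]
  · rintro p q l P Q F f ⟨hP, hQ, hf, h⟩ ⟨H, hH, hHm, h0, h1⟩
    obtain ⟨E, hE, hEH⟩ := exists_absorb_circ hP hQ
      (f := fun z : (I × Torus (Coord Γ 0 (n + 1))) × I =>
        H (z.1.1, (z.2, π z.1.2))) (hH.comp (by fun_prop)) (fun w => (hHm w.1).zero _)
      fun w => (hHm w.1).one _
    refine ⟨E, hE, fun t => ⟨hE.comp (by fun_prop), fun ζ hζ =>
      unabs_circ_ext hP hQ fun s => ?_, fun γ ζ => unabs_circ_ext hP hQ fun s => ?_⟩,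
      fun ζ => unabs_circ_ext hP hQ fun s => ?_, fun ζ => unabs_circ_ext hP hQ fun s => ?_⟩
    · rw [hEH, unabs_base]
      dsimp only
      rw [hπi ζ hζ]
      exact (hHm t).pt s
    · rw [unabs_circ_smul, hEH, hEH]
      dsimp only
      rw [hπg]
      exact (hHm t).equi γ s _
    · rw [hEH, h]
      exact h0 _
    · rw [hEH, unabs_base]
      exact h1 _

lemma subsingleton_homotopyGroup_smash_inducedSphere {M : Type*} [AddCommGroup M]
    (c : ZeroCoeff X M) (hX : Concentrated X)
    (hM : NoTorsion M) (m : ℤ) (K : Subgroup G) (hK : K ≠ ⊥)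
    (hK3 : Nat.card K ≠ 3) {i : ℕ} (hi : 0 < i) (hi' : i < 4) :
    Subsingleton (homotopyGroup (-i) (X.smash (inducedSphere K m))) := by
  rcases m with m | m
  · refine subsingleton_homotopyGroup i
      fun p q l x hx hq hp => exists_after_of_torus (Splitting.coord K m) 0 0 x hx fun f hf => ?_
    replace hq : q = X.d + l := hq
    replace hp : p + i = X.e + l := hp
    exact hf.exists_after_of_lt hX (by omega) (by omega)
  · have : Nontrivial K := (Subgroup.nontrivial_iff_ne_bot K).2 hK
    refine subsingleton_homotopyGroup i
      fun p q l x hx hq hp => exists_after_of_torus (Splitting.coord K (m + 1)).symm (m + 1) 0 x hx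
        fun f hf => ?_
    replace hq : q = X.d + (m + 1) + l := hq
    replace hp : p + i = X.e + l := hp
    exact IsTorusMap.null (p := p + (m + 1)) c hX (by omega) hM hf hi hi' (by omega) hK3

end SliceCells

section StableHom

variable {G : Type u} [Group G] {X : GPrespectrum G}

lemma exists_stableHom {A A' : PtGSpace G} [LocallyCompactSpace A]
    [LocallyCompactSpace A'] (N₀ : ℕ) (D : ∀ N, C(StageMap X k A N, StageMap X k' A' (N₀ + N)))
    (hb : ∀ N, D N (stageBase X k A N) = stageBase X k' A' (N₀ + N))
    (hs : ∀ N φ, D (N + 1) (stabilize X A _ _ _ φ) = stabilize X A' _ _ _ (D N φ)) :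
    ∃ θ : stableMaps k A X →* stableMaps k' A' X, ∀ N (γ : Path (stageBase X k A N) _),
      ∃ γ' : Path (stageBase X k' A' (N₀ + N)) _, (∀ s, γ' s = D N (γ s)) ∧
        θ (cls X k A N (fromPath (.mk γ))) =
        cls X k' A' (N₀ + N) (fromPath (.mk γ')) := by
  let E : ∀ N, GrpCat.of (FundamentalGroup (StageMap X k A N) (stageBase X k A N)) ⟶
      stableMaps k' A' X := fun N =>
    GrpCat.ofHom ((cls X k' A' (N₀ + N)).comp (FundamentalGroup.mapOfEq (D N) (hb N)))
  have hE : ∀ N (γ : Path (stageBase X k A N) (stageBase X k A N)), (E N).hom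
      (fromPath (.mk γ)) = cls X k' A' (N₀ + N) (fromPath (.mk
        ((γ.map (D N).continuous).cast (hb N).symm (hb N).symm))) := fun N γ =>
    congrArg (cls X k' A' (N₀ + N)) (FundamentalGroup.mapOfEq_apply (D N) (hb N) _)
  let s : Cocone (stableSeq k A X) := ⟨stableMaps k' A' X, NatTrans.ofSequence E fun N => by
    refine GrpCat.hom_ext (MonoidHom.ext fun a => ?_)
    obtain ⟨γ, rfl⟩ := Quotient.mk_surjective a
    have h := stableSeq_map_succ N (fromPath (.mk γ))
    rw [FundamentalGroup.mapOfEq_apply] at h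
    exact (congrArg (E (N + 1)).hom h).trans ((hE (N + 1) _).trans
      ((cls_succ (N₀ + N) _ _ fun s => hs N _).trans (hE N γ).symm))⟩
  refine ⟨GrpCat.Hom.hom ((GrpCat.FilteredColimits.colimitCoconeIsColimit.{0, u}
    (stableSeq k A X)).desc s), fun N γ => ⟨(γ.map (D N).continuous).cast (hb N).symm (hb N).symm,
      fun s => rfl, ?_⟩⟩
  exact (DFunLike.congr_fun (congrArg GrpCat.Hom.hom
    ((GrpCat.FilteredColimits.colimitCoconeIsColimit.{0, u} (stableSeq k A X)).fac s N)) _).trans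
    (hE N γ)

lemma exists_underlyingHom {j : ℕ} (hj : 0 < j) {k : ℤ} (hk : k = -j) {A : PtGSpace G}
    [LocallyCompactSpace A] [T2Space A] {c : 𝕋(G, j, 0) → A} (hc : Continuous c)
    (hcs : Function.Surjective c) (hci : ∀ ζ, (∃ t, ζ t = ∞) → c ζ = A.pt)
    (hce : ∀ ζ ζ', c ζ = c ζ' → ζ = ζ' ∨ (∃ t, ζ t = ∞) ∧ ∃ t, ζ' t = ∞) :
    ∃ θ : stableMaps k A X →* stableMaps 0 (orbit (⊥ : Subgroup G)) X, ∀ N (γ : Path _ _),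
      θ (cls X k A N (fromPath (.mk γ))) = 1 →
        ∃ m, After (LoopNull ((MonoidHom.id G).comp (⊥ : Subgroup G).subtype) A.pt) m
          (MapSpace.loopRep γ) := by
  have hl : ∀ N, (1 - k).toNat + N = (1 - (0 : ℤ)).toNat + (j + N) := fun N => by omega
  have hP : ∀ N, X.e + ((0 : ℤ) - 1).toNat + (j + N) = X.e + (k - 1).toNat + N + j := fun N => by
    omega
  have hQ : ∀ N, X.d + (1 - (0 : ℤ)).toNat + (j + N) = X.d + (1 - k).toNat + N + 0 := fun N => by
    omega
  have key : ∀ N, ∃ E : StageMap X k A N → ZeroRep X (j + N), Continuous E ∧ ∀ φ ζ,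
      unabs (hP N) (hQ N) (E φ) ζ = castRep rfl rfl (hl N) (MapSpace.rep φ (c ζ)) :=
    fun N => exists_absorb (hP N) (hQ N)
      (f := fun z => castRep rfl rfl (hl N) (MapSpace.rep z.1 (c z.2)))
      ((castRep rfl rfl (hl N)).continuous.comp (MapSpace.continuous_rep.comp
        (f := fun z : StageMap X k A N × 𝕋(G, j, 0) => (z.1, c z.2)) (by fun_prop)))
      fun φ ζ h => by
        dsimp only
        rw [hci ζ h, MapSpace.rep_pt, castRep_base]
  choose E hE hEc using key
  obtain ⟨θ, hθ⟩ := exists_stableHom (k' := 0)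
    (A' := orbit (⊥ : Subgroup G)) j (fun N => (freeExt (j + N)).comp ⟨E N, hE N⟩) (fun N => by
      refine (congrArg (freeExt (j + N)) (unabs_ext (hP N) (hQ N) fun ζ => ?_)).trans
        (freeExt_base _)
      refine (hEc N _ ζ).trans ?_
      rw [MapSpace.rep_base, castRep_base, unabs_base])
    fun N φ => rep_ext_coset ((rep_freeExt _).trans (Eq.trans
      (unabs_ext (hP (N + 1)) (hQ (N + 1)) fun ζ => (hEc (N + 1) _ ζ).trans (Eq.trans
        ((castRep_stab rfl rfl (hl N) rfl rfl (hl (N + 1)) _).trans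
          (congrArg stab (hEc N φ ζ).symm))
        (unabs_stab (hP N) (hQ N) (hP (N + 1)) (hQ (N + 1)) (E N φ) ζ).symm))
      (congrArg stab (rep_freeExt (E N φ)).symm)))
  refine ⟨θ, fun N γ h => ?_⟩
  obtain ⟨δ, hδ, hδθ⟩ := hθ N γ
  obtain ⟨m, hm⟩ := (cls_eq_one_iff δ).1 (hδθ.symm.trans h)
  refine ⟨m, (after_castRep rfl rfl (hl N)).1 (hm.transport (fun p q l p' q' f f' =>
      ∃ hP hQ, ∀ s ζ, unabs hP hQ (f (s, coset ⊥)) ζ = f' (s, c ζ))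
      ?_ ?_ ⟨hP N, hQ N, fun s ζ => ?_⟩)⟩
  · rintro p q l p' q' f f' ⟨hP, hQ, h⟩
    refine ⟨by omega, by omega, fun s ζ => ?_⟩
    rw [unabs_stab hP hQ, h]
  · rintro p q l p' q' f f' ⟨hP, hQ, h⟩ ⟨H, hH, hHl, h0, h1⟩
    obtain ⟨g, hg, hgH⟩ := exists_descend (W := I × I) hc hcs
      (g := fun z => unabs hP hQ (H (z.1.1, (z.1.2, coset ⊥))) z.2)
      ((continuous_unabs hP hQ).comp ((hH.comp (by fun_prop)).prodMk continuous_snd))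
      fun w ζ ζ' h => by
        dsimp only
        rcases hce ζ ζ' h with rfl | ⟨h1, h2⟩
        · rfl
        · rw [unabs_infty hP hQ _ h1, unabs_infty hP hQ _ h2]
    have hinf : c (fun _ => ∞) = A.pt := hci _ ⟨Sum.inl ⟨0, hj⟩, rfl⟩
    refine ⟨fun z => g ((z.1, z.2.1), z.2.2), hg.comp (by fun_prop), fun t =>
      ⟨hg.comp (by fun_prop), fun x => ?_, fun x => ?_, fun s => ?_, fun b s x => ?_⟩, ?_, ?_⟩
    · obtain ⟨ζ, rfl⟩ := hcs x
      refine (hgH _ ζ).trans ?_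
      dsimp only
      rw [(hHl t).zero, unabs_base]
    · obtain ⟨ζ, rfl⟩ := hcs x
      refine (hgH _ ζ).trans ?_
      dsimp only
      rw [(hHl t).one, unabs_base]
    · dsimp only
      rw [← hinf, hgH]
      exact unabs_infty hP hQ _ ⟨Sum.inl ⟨0, hj⟩, rfl⟩
    · obtain rfl : b = 1 := Subsingleton.elim _ _
      rw [one_smul, map_one, one_smul]
    · rintro ⟨s, x⟩
      obtain ⟨ζ, rfl⟩ := hcs x
      refine (hgH _ ζ).trans ?_
      dsimp only
      rw [h0, h]
    · rintro ⟨s, x⟩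
      obtain ⟨ζ, rfl⟩ := hcs x
      refine (hgH _ ζ).trans ?_
      dsimp only
      rw [h1, unabs_base]
  · refine Eq.trans ?_ (hEc N (γ s) ζ)
    refine congrArg (fun x => unabs (hP N) (hQ N) x ζ) ?_
    change MapSpace.rep (δ s) _ = _
    rw [hδ]
    exact rep_freeExt _

end StableHom

lemma nonempty_mulEquiv_int [Group A] [Nontrivial A] (θ : A →* Multiplicative ℤ)
    (hθ : Function.Injective θ) : Nonempty (A ≃* Multiplicative ℤ) := by
  have : IsCyclic A := isCyclic_of_injective θ hθ
  have hA : Nat.card A = 0 := by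
    refine Nat.card_eq_zero.2 (Or.inr ((not_finite_iff_infinite).1 fun hf => ?_))
    obtain ⟨a, ha⟩ := exists_ne (1 : A)
    have h : Nat.card A • Multiplicative.toAdd (θ a) = 0 := by
      rw [← toAdd_pow, ← map_pow, pow_card_eq_one', map_one, toAdd_one]
    rcases smul_eq_zero.1 h with h | h
    · exact Nat.card_pos.ne' h
    · exact ha (hθ ((Multiplicative.toAdd.injective h).trans (map_one θ).symm))
  have e := (zmodCyclicMulEquiv (G := A) inferInstance).symm
  rw [hA] at e
  exact ⟨e⟩

section Hexagon

variable {Γ : Type w} [Group Γ] [Finite Γ] {L : Tower.{v} Γ} {M : Type*} [AddCommGroup M]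

lemma exists_hexagon (h3 : Nat.card Γ = 3) (e : L.EM1 M)
    (hM : NoTorsion M) (m : M) :
    ∃ (n : ℕ) (φ : (Coord Γ 0 1 → ℝ) → L.obj n), ContinuousOn φ (Poly (Coord Γ 0 1)) ∧
      (∀ (g : Γ), ∀ y ∈ Poly (Coord Γ 0 1), φ (shift g y) = g • φ y) ∧
      ((∃ (n' : ℕ) (h : n ≤ n') (H : (Coord Γ 0 1 → ℝ) × ℝ → L.obj n'),
        ContinuousOn H (Poly (Coord Γ 0 1) ×ˢ J) ∧
        (∀ y ∈ Poly (Coord Γ 0 1), H (y, 0) = L.map h (φ y)) ∧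
        ∀ y ∈ Poly (Coord Γ 0 1), H (y, 1) = L.pt n') → m = 0) := by
  classical
  have : Fact (Nat.Prime 3) := ⟨Nat.prime_three⟩
  have : Nontrivial Γ := Finite.one_lt_card_iff_nontrivial.1 (by omega)
  obtain ⟨g, hg⟩ := exists_ne (1 : Γ)
  have hg3 : g ^ 3 = 1 := h3 ▸ pow_card_eq_one'
  have hcases : ∀ h k : Γ, k = h ∨ k = h * g ∨ k = h * g ^ 2 := fun h k => by
    obtain ⟨i, hi⟩ := mem_powers_of_prime_card h3 hg (g' := h⁻¹ * k)
    have hi : g ^ (i % 3) = h⁻¹ * k := by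
      rw [← hi, ← orderOf_eq_prime hg3 hg]
      exact pow_mod_orderOf g i
    have : i % 3 < 3 := Nat.mod_lt _ (by omega)
    rw [eq_inv_mul_iff_mul_eq] at hi
    interval_cases i % 3 <;> simp_all
  let t : Γ → Coord Γ 0 1 := fun h => Sum.inr (0, h)
  have ht : ∀ x, ∃ h, t h = x := fun x => by
    rcases x with x | ⟨x, h⟩
    · exact x.elim0
    · exact ⟨h, by rw [Subsingleton.elim x 0]⟩
  have htg : ∀ (a h : Γ) (y : Coord Γ 0 1 → ℝ), shift a y (t (a * h)) = y (t h) := fun a h y =>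
    congrArg (fun h => y (t h)) (inv_mul_cancel_left a h)
  have e3 : ∀ h : Γ, h * g ^ 2 * g = h := fun h => by rw [mul_assoc, ← pow_succ, hg3, mul_one]
  have e3' : ∀ h : Γ, h * g * g ^ 2 = h := fun h => by rw [mul_assoc, ← pow_succ', hg3, mul_one]
  obtain ⟨n, u, hu, hu0, hu1, huf, hκ⟩ := e.surj m
  let E : (Coord Γ 0 1 → ℝ) → Γ → Prop := fun y h => y (t h) = 1 ∧ y (t (h * g ^ 2)) = 0
  let φ : (Coord Γ 0 1 → ℝ) → L.obj n := fun y =>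
    if h : ∃ h, E y h then u (y (t (h.choose * g))) else L.pt n
  have hφ : ∀ y h, E y h → φ y = u (y (t (h * g))) := fun y h hE => by
    have hex : ∃ h, E y h := ⟨h, hE⟩
    refine (dif_pos hex).trans ?_
    obtain ⟨h1, h0⟩ := hex.choose_spec
    rcases hcases h hex.choose with hc | hc | hc
    · rw [hc]
    · rw [hc, e3', hE.1] at h0
      exact absurd h0 one_ne_zero
    · rw [hc, hE.2] at h1
      exact absurd h1 zero_ne_one
  have hφ' : ∀ y h, y (t h) = 1 → y (t (h * g)) = 0 → φ y = L.pt n := fun y h h1 h0 => by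
    by_cases hex : ∃ h, E y h
    · obtain ⟨k, hk⟩ := hex
      rw [hφ y k hk]
      rcases hcases h k with rfl | rfl | rfl
      · rw [h0, hu0]
      · rw [hk.1] at h0
        exact absurd h0 one_ne_zero
      · rw [e3, h1, hu1]
    · exact dif_neg hex
  have hcov : ∀ y ∈ Poly (Coord Γ 0 1), ∃ h, E y h ∨ (y (t h) = 1 ∧ y (t (h * g)) = 0) := by
    rintro y ⟨-, ⟨s, hs⟩, r, hr⟩
    obtain ⟨h, rfl⟩ := ht r
    obtain ⟨k, rfl⟩ := ht s
    rcases hcases h k with rfl | rfl | rfl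
    · exact absurd (hs.symm.trans hr) zero_ne_one
    · exact ⟨h, Or.inr ⟨hr, hs⟩⟩
    · exact ⟨h, Or.inl ⟨hr, hs⟩⟩
  have hc : ContinuousOn φ (Poly (Coord Γ 0 1)) := by
    have hev : ∀ h, Continuous fun y : Coord Γ 0 1 → ℝ => y (t h) := fun h => continuous_apply _
    refine ((locallyFinite_of_finite fun i : Γ ⊕ Γ => i.elim (fun h => {y | E y h})
      fun h => {y | y (t h) = 1 ∧ y (t (h * g)) = 0}).continuousOn_iUnion ?_ ?_).mono fun y hy => ?_
    · rintro (h | h)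
      · exact (isClosed_eq (hev _) continuous_const).inter (isClosed_eq (hev _) continuous_const)
      · exact (isClosed_eq (hev _) continuous_const).inter (isClosed_eq (hev _) continuous_const)
    · rintro (h | h)
      · exact (hu.comp (hev _)).continuousOn.congr fun y hy => hφ y h hy
      · exact continuousOn_const.congr fun y hy => hφ' y h hy.1 hy.2
    · obtain ⟨h, hh | hh⟩ := hcov y hy
      · exact mem_iUnion.2 ⟨Sum.inl h, hh⟩
      · exact mem_iUnion.2 ⟨Sum.inr h, hh⟩
  have heq : ∀ (a : Γ), ∀ y ∈ Poly (Coord Γ 0 1), φ (shift a y) = a • φ y := fun a y hy => by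
    obtain ⟨h, hh | hh⟩ := hcov y hy
    · rw [hφ y h hh, hφ (shift a y) (a * h) ⟨(htg a h y).trans hh.1, by
        rw [mul_assoc, htg]; exact hh.2⟩, mul_assoc, htg]
      exact (huf _ a trivial).symm
    · rw [hφ' y h hh.1 hh.2, hφ' (shift a y) (a * h) ((htg a h y).trans hh.1) (by
        rw [mul_assoc, htg]; exact hh.2), L.smul_pt]
  refine ⟨n, φ, hc, heq, ?_⟩
  rintro ⟨n', hn, H, hH, hH0, hH1⟩
  have hcard : Nat.card (Coord Γ 0 1) = 3 := by
    rw [← h3]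
    exact (Nat.card_congr (Equiv.ofBijective t ⟨fun h k hk =>
      congrArg Prod.snd (Sum.inr_injective hk), ht⟩)).symm
  have hind : ∀ A, Proper A → φ (ind A) = L.pt n := fun A hA => by
    obtain ⟨h, hh | hh⟩ := hcov _ hA.ind_mem_poly
    · rw [hφ _ h hh]
      by_cases h' : t (h * g) ∈ A
      · rw [ind_mem h', hu1]
      · rw [ind_notMem h', hu0]
    · exact hφ' _ h hh.1 hh.2
  let V : VertexPaths L φ :=
    { path := fun _ _ => L.pt n
      cont := fun _ => continuous_const
      zero := fun A hA => (hind A hA).symm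
      one := fun _ => rfl
      smul := fun g _ _ _ => (L.smul_pt n g).symm }
  have hcoc : ∀ {A B : Set (Coord Γ 0 1)} (hA : A.Nonempty) (hAB : A ⊆ B) (hB : B ≠ univ)
      {v : ℝ → L.obj n} (hv : Continuous v) (hv0 : v 0 = L.pt n) (hv1 : v 1 = L.pt n),
      (∀ x : ℝ, φ ((1 - x) • ind A + x • ind B) = v x) →
      V.coc e hc A B = e.κ n (qseg v hv 0 1 hv0 hv1) := by
    intro A B hA hAB hB v hv hv0 hv1 hφv
    rw [V.coc_eq e hc hA hAB hB, ← Quotient.refl_trans (qseg v hv 0 1 hv0 hv1),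
      ← Quotient.trans_refl (qseg v hv 0 1 hv0 hv1)]
    unfold VertexPaths.cls VertexPaths.edge qseg qline
    simp only [← Quotient.mk_symm, ← Quotient.mk_trans,
      ← Quotient.mk_refl]
    congr 2
    ext x
    simp only [Path.trans_apply, Path.symm_apply]
    split_ifs
    · rfl
    · refine (hφv _).trans (congrArg v ?_)
      simp
    · rfl
  have hne : ∀ {h k : Γ}, h ≠ k → t h ≠ t k := fun h h' =>
    h (congrArg Prod.snd (Sum.inr_injective h'))
  have hg2 : g ^ 2 ≠ 1 := fun h => hg (by rw [pow_succ, h, one_mul] at hg3; exact hg3)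
  have hgg : g ^ 2 ≠ g := fun h => hg (by rwa [pow_two, mul_eq_left] at h)
  have hB : ({t 1, t g} : Set (Coord Γ 0 1)) ≠ univ := (ne_univ_iff_exists_notMem _).2
    ⟨t (g ^ 2), by simpa using ⟨hne hg2, hne hgg⟩⟩
  have hB' : ({t 1, t (g ^ 2)} : Set (Coord Γ 0 1)) ≠ univ := (ne_univ_iff_exists_notMem _).2
    ⟨t g, by simpa using ⟨hne hg, hne hgg.symm⟩⟩
  have hA : ({t 1} : Set (Coord Γ 0 1)).Nonempty := ⟨_, rfl⟩
  have hAB : ({t 1} : Set (Coord Γ 0 1)) ⊆ {t 1, t g} := by simp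
  have hAB' : ({t 1} : Set (Coord Γ 0 1)) ⊆ {t 1, t (g ^ 2)} := by simp
  have hm : V.coc e hc {t 1} {t 1, t g} = m := by
    rw [← hκ]
    refine hcoc hA hAB hB hu hu0 hu1 fun x => ?_
    rw [hφ _ 1 ⟨?_, ?_⟩]
    · simp [ind, (hne hg)]
    · simp [ind]
    · simp [ind, (hne hg2), (hne hgg)]
  have hm' : V.coc e hc {t 1} {t 1, t (g ^ 2)} = 0 := by
    rw [← e.κ_refl n]
    refine (hcoc hA hAB' hB' (v := fun _ => L.pt n) continuous_const rfl rfl fun x => ?_).trans rfl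
    refine hφ' _ 1 ?_ ?_
    · simp [ind]
    · simp [ind, (hne hg), (hne hgg.symm)]
  have hφn : ∀ y, L.map hn (φ y) = L.map hn (φ y) := fun _ => rfl
  have hc' : ContinuousOn (fun y => L.map hn (φ y)) (Poly (Coord Γ 0 1)) :=
    (L.map hn).continuous.comp_continuousOn hc
  obtain ⟨ψ, hψ⟩ := (V.map hn hφn).exists_potential_of_null e hc' hH hH0 hH1
  have hψ' : IsPotential (V.coc e hc) ψ := fun A B hA hAB hB => by
    rw [hψ A B hA hAB hB, V.coc_map e hc hn hφn hc' hA hAB hB]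
  have hinv := hψ'.invariant hcard.ge hM (fun a A B hA hAB hB => V.coc_shift e hc heq a A B hA hAB hB)
    (g ^ 2) ⟨_, .inl rfl⟩ hB
  have hs : shiftSet (g ^ 2) {t 1, t g} = {t 1, t (g ^ 2)} := by
    ext x
    obtain ⟨h, rfl⟩ := ht x
    have hiff : ∀ {h k}, t h = t k ↔ h = k := ⟨fun h => by_contra fun h' => hne h' h, fun h => h ▸ rfl⟩
    change t ((g ^ 2)⁻¹ * h) = t 1 ∨ t ((g ^ 2)⁻¹ * h) = t g ↔ t h = t 1 ∨ t h = t (g ^ 2)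
    rw [hiff, hiff, hiff, hiff, inv_mul_eq_iff_eq_mul, inv_mul_eq_iff_eq_mul, mul_one, ← pow_succ,
      hg3, or_comm]
  rw [hs] at hinv
  rw [← hm, ← hψ' _ _ hA hAB hB, ← hinv, hψ' _ _ hA hAB' hB', hm']

end Hexagon

instance {G T : Type u} [Group G] [MulAction G T] [Finite T] : T2Space 𝕊(G, T) :=
  inferInstanceAs (T2Space (OnePoint (T → ℝ)))

section OrderThree

variable {G : Type u} [Group G] [Finite G] {X : GPrespectrum G} {M : Type*} [AddCommGroup M]

lemma LoopNull.restrict {A : PtGSpace G} {p q l m : ℕ} {f : I × A → Rep X p q l}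
    (K : Subgroup G) (h : After (LoopNull (MonoidHom.id G) A.pt) m f) :
    After (LoopNull ((MonoidHom.id G).comp K.subtype) A.pt) m f := by
  refine h.transport (fun p q l p' q' f f' => ∃ hp hq,
    ∀ w, castRep hp hq rfl (f w) = f' w) ?_ ?_ ⟨rfl, rfl, fun w => rfl⟩
  · rintro p q l p' q' f f' ⟨rfl, rfl, h⟩
    exact ⟨rfl, rfl, fun w => congrArg stab (h w)⟩
  · rintro p q l p' q' f f' ⟨rfl, rfl, h⟩ ⟨H, hH, hHl, h0, h1⟩
    exact ⟨H, hH, fun t => ⟨(hHl t).cont, (hHl t).zero, (hHl t).one, (hHl t).pt,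
      fun g s a => (hHl t).equi g s a⟩, fun w => (h0 w).trans (h w), h1⟩

lemma ZeroCoeff.exists_injective (c : ZeroCoeff X M) (hX : Concentrated X)
    (hM : NoTorsion M) (h3 : Nat.card G = 3) :
    ∃ θ : stableMaps (-3) (regSphere G 1) X →* Multiplicative M, Function.Injective θ := by
  have hcard : Nat.card (Coord G 0 1) = 3 := by rw [card_coord, h3]
  have hcard' : Nat.card (Coord G 3 0) = 3 := by simp [card_coord]
  obtain ⟨σ⟩ : Nonempty (Coord G 0 1 ≃ Coord G 3 0) := Finite.card_eq.1 (hcard.trans hcard'.symm)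
  have : Nonempty (Coord G 0 1) := Finite.card_pos_iff.1 (by omega)
  obtain ⟨π, hπ, hπs, hπi, hπe, -⟩ := exists_torus_quotient G (Coord G 0 1)
  have hσ : ∀ ζ : 𝕋(G, 3, 0), (∃ t, ζ (σ t) = ∞) ↔ ∃ t, ζ t = ∞ := fun ζ =>
    (σ.surjective.exists (p := fun t => ζ t = ∞)).symm
  obtain ⟨θ, hθ⟩ := exists_underlyingHom (by omega) rfl (hπ.comp (by fun_prop))
    (fun x => by
      obtain ⟨ζ, rfl⟩ := hπs x
      exact ⟨fun t => ζ (σ.symm t), congrArg π (funext fun t => congrArg ζ (σ.symm_apply_apply t))⟩)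
    (fun ζ h => hπi _ ((hσ ζ).2 h)) fun ζ ζ' h => (hπe _ _ h).imp (fun h => funext fun t => by
        obtain ⟨t, rfl⟩ := σ.surjective t
        exact congrFun h t) (And.imp (hσ ζ).1 (hσ ζ').1)
  refine ⟨(c.φ ⊥).toMonoidHom.comp θ, (c.φ ⊥).injective.comp
    ((injective_iff_map_eq_one θ).2 fun x hx => ?_)⟩
  obtain ⟨N, γ, rfl⟩ := exists_cls X (-3) (regSphere G 1) x
  obtain ⟨m, hm⟩ := hθ N γ hx
  refine (cls_eq_one_iff γ).2 ((MapSpace.isLoopMap_loopRep γ).null_three c hX (by omega) (by omega)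
    hM (.inr (.inr ⟨by omega, fun F _ hF => ?_⟩)))
  exact hF.polarNull ⊥ hm

lemma ZeroCoeff.nontrivial (c : ZeroCoeff X M) [Nontrivial M] (hX : Concentrated X)
    (hM : NoTorsion M) (h3 : Nat.card G = 3) :
    Nontrivial (stableMaps (-3) (regSphere G 1) X) := by
  have hcard : Nat.card (Coord G 0 1) = 3 := by rw [card_coord, h3]
  have : Nontrivial (Coord G 0 1) := Finite.one_lt_card_iff_nontrivial.1 (by omega)
  obtain ⟨m₀, hm₀⟩ := exists_ne (0 : M)
  let p := X.e + ((-3 : ℤ) - 1).toNat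
  let Q := X.d + (1 - (-3 : ℤ)).toNat
  let l := (1 - (-3 : ℤ)).toNat
  obtain ⟨n, φ, hφ, hφe, hφn⟩ := exists_hexagon h3 ((loopsIso (MonoidHom.id G) (p + 2) Q l).em1
    (c.em1 (by omega) rfl (MonoidHom.id G) hX)) hM m₀
  let φ' : (Coord G 0 1 → ℝ) → (towerOf X (MonoidHom.id G) (p + 2) Q l).Loop n := φ
  let F : (Coord G 0 1 → ℝ) × ℝ → Rep X (p + 2 + n) (Q + n) (l + n) := fun z =>
    φ' z.1 (projIcc 0 1 zero_le_one z.2)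
  have hF0 : ∀ y, F (y, 0) = Rep.base X _ _ _ := fun y =>
    (congrArg (φ' y) (projIcc_left _)).trans (φ' y).zero
  have hF1 : ∀ y, F (y, 1) = Rep.base X _ _ _ := fun y =>
    (congrArg (φ' y) (projIcc_right _)).trans (φ' y).one
  have hF : ContinuousOn F (Poly (Coord G 0 1) ×ˢ J) := by
    have h : ContinuousOn (fun z : (Coord G 0 1 → ℝ) × ℝ => (φ' z.1, projIcc (0 : ℝ) 1 zero_le_one z.2))
        (Poly (Coord G 0 1) ×ˢ J) :=
      (ContinuousOn.comp (t := Poly (Coord G 0 1)) (f := Prod.fst) hφ (by fun_prop) fun z hz => hz.1).prodMk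
        (Continuous.continuousOn (by fun_prop))
    exact (continuous_eval (F := (towerOf X (MonoidHom.id G) (p + 2) Q l).Loop n)).comp_continuousOn h
  have hFe : IsPolarHtpy (towerOf X (MonoidHom.id G) (p + 2 + n) (Q + n) (l + n)) ⊤ (n := 0)
      (fun z => F z.1) F F :=
    { cont := hF.comp (by fun_prop) fun z hz => hz.1
      equi := fun g _ y hy b _ t _ => DFunLike.congr_fun (hφe g y hy) _
      left := fun y _ b _ => rfl
      right := fun y _ b _ => rfl
      one := fun y _ t _ => hF1 y
      zero := fun y _ y' _ t _ => (hF0 y).trans (hF0 y').symm }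
  have hp2 : p + 2 + n = p + n + 2 := by omega
  obtain ⟨h, -, hhl, hh⟩ := hFe.exists_loopHtpy hp2 (q' := Q + n) rfl
  obtain ⟨γ, hγ⟩ := MapSpace.exists_loopRep_eq (hhl 0)
  refine ⟨cls X (-3) (regSphere G 1) n (fromPath (.mk γ)), 1, fun hone => hm₀ (hφn ?_)⟩
  obtain ⟨m, hm⟩ := (cls_eq_one_iff γ).1 hone
  have hm' := LoopNull.restrict ⊥ hm
  rw [hγ] at hm'
  exact exists_null_loops
    (piTriv_towerOf _ hX rfl ⊥ (by omega)) poly_nonempty (fun y _ => hF0 y)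
    (PolarRel.polarNull (hh 0) ⊥ hm') fun y _ t => congrArg (φ' y) (projIcc_val _ t).symm

end OrderThree

section Suspension

variable {G : Type u} [Group G] {X : GPrespectrum G} {A A' : PtGSpace G} {j : ℕ}

/-- The point `A` is the smash product of `A'` and a sphere of dimension `j`. -/
structure IsSmashSphere (c : 𝕋(G, j, 0) × A' → A) : Prop where
  cont : Continuous c
  surj : Function.Surjective c
  infty : ∀ ζ a, (∃ t, ζ t = ∞) → c (ζ, a) = A.pt
  pt : ∀ ζ, c (ζ, A'.pt) = A.pt
  eq : ∀ ζ a ζ' a', c (ζ, a) = c (ζ', a') → (ζ, a) = (ζ', a') ∨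
    (((∃ t, ζ t = ∞) ∨ a = A'.pt) ∧ ((∃ t, ζ' t = ∞) ∨ a' = A'.pt))
  equi : ∀ (g : G) ζ a, c (ζ, g • a) = g • c (ζ, a)

variable {c : 𝕋(G, j, 0) × A' → A} (hc : IsSmashSphere c)

lemma permute_coord_zero (g : G) (ζ : 𝕋(G, j, 0)) : permute g ζ = ζ := by
  ext (t | ⟨t, -⟩)
  · rfl
  · exact t.elim0

include hc

lemma IsSmashSphere.exists_descend [CompactSpace A'] [T2Space A] [TopologicalSpace W]
    (hP : P = p + j) (hQ : Q = q + 0) {H : W × (I × A') → Rep X P Q l}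
    (hH : Continuous H) (hl : ∀ w, IsLoopMap (MonoidHom.id G) A'.pt fun z => H (w, z)) :
    ∃ H' : W × (I × A) → Rep X p q l, Continuous H' ∧
      (∀ w, IsLoopMap (MonoidHom.id G) A.pt fun z => H' (w, z)) ∧
      ∀ w s ζ a, H' (w, s, c (ζ, a)) = unabs hP hQ (H (w, s, a)) ζ := by
  have hpt : ∀ w s ζ a, ((∃ t, ζ t = ∞) ∨ a = A'.pt) →
      unabs hP hQ (H (w, s, a)) ζ = Rep.base X p q l := by
    rintro w s ζ a (h | rfl)
    · exact unabs_infty hP hQ _ h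
    · exact (congrArg (unabs hP hQ · ζ) ((hl w).pt s)).trans (unabs_base hP hQ ζ)
  obtain ⟨f, hf, hfc⟩ := GStable.exists_descend (W := W × I) hc.cont hc.surj
    (g := fun z => unabs hP hQ (H (z.1.1, z.1.2, z.2.2)) z.2.1)
    ((continuous_unabs hP hQ).comp ((hH.comp (by fun_prop)).prodMk (by fun_prop))) (by
      rintro ⟨w, s⟩ ⟨ζ, a⟩ ⟨ζ', a'⟩ h
      rcases hc.eq _ _ _ _ h with h | ⟨h, h'⟩
      · rw [h]
      · exact (hpt w s ζ a h).trans (hpt w s ζ' a' h').symm)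
  refine ⟨fun z => f ((z.1, z.2.1), z.2.2), hf.comp (by fun_prop), fun w =>
    ⟨hf.comp (by fun_prop), fun x => ?_, fun x => ?_, fun s => ?_, fun g s x => ?_⟩,
    fun w s ζ a => hfc (w, s) (ζ, a)⟩
  · obtain ⟨⟨ζ, a⟩, rfl⟩ := hc.surj x
    exact (hfc (w, 0) (ζ, a)).trans
      ((congrArg (unabs hP hQ · ζ) ((hl w).zero a)).trans (unabs_base hP hQ ζ))
  · obtain ⟨⟨ζ, a⟩, rfl⟩ := hc.surj x
    exact (hfc (w, 1) (ζ, a)).trans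
      ((congrArg (unabs hP hQ · ζ) ((hl w).one a)).trans (unabs_base hP hQ ζ))
  · obtain ⟨⟨ζ, a⟩, h⟩ := hc.surj A.pt
    rw [← hc.pt ζ]
    exact (hfc (w, s) _).trans (hpt w s ζ _ (.inr rfl))
  · obtain ⟨⟨ζ, a⟩, rfl⟩ := hc.surj x
    refine (congrArg (fun x => f ((w, s), x)) (hc.equi g ζ a).symm).trans ((hfc (w, s) _).trans
      (Eq.trans ?_ (congrArg (g • ·) (hfc (w, s) (ζ, a)).symm)))
    refine Eq.trans ?_ (unabs_smul hP hQ g (H (w, s, a)) ζ)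
    rw [permute_coord_zero]
    exact congrArg (unabs hP hQ · ζ) ((hl w).equi g s a)

lemma IsSmashSphere.nonempty_mulEquiv [LocallyCompactSpace A] [CompactSpace A']
    [LocallyCompactSpace A'] [T2Space A] {k k' : ℤ} (hk : k = k' - j) (hk' : k' ≤ 0) :
    Nonempty (stableMaps k A X ≃* stableMaps k' A' X) := by
  have hl : ∀ N, (1 - k).toNat + N = (1 - k').toNat + (j + N) := fun N => by omega
  have hP : ∀ N, X.e + (k' - 1).toNat + (j + N) = X.e + (k - 1).toNat + N + j := fun N => by
    omega
  have hQ : ∀ N, X.d + (1 - k').toNat + (j + N) = X.d + (1 - k).toNat + N + 0 := fun N => by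
    omega
  have key : ∀ N, ∃ D : C(StageMap X k A N, StageMap X k' A' (j + N)), ∀ φ ζ a,
      unabs (hP N) (hQ N) (MapSpace.rep (D φ) a) ζ =
        castRep rfl rfl (hl N) (MapSpace.rep φ (c (ζ, a))) := fun N => by
    have hinf : ∀ (φ : StageMap X k A N) ζ a, c (ζ, a) = A.pt →
        castRep rfl rfl (hl N) (MapSpace.rep φ (c (ζ, a))) = Rep.base X _ _ _ :=
      fun φ ζ a h => by rw [h, MapSpace.rep_pt, castRep_base]
    obtain ⟨E, hE, hEc⟩ := exists_absorb (hP N) (hQ N) (W := StageMap X k A N × A')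
      (f := fun z => castRep rfl rfl (hl N) (MapSpace.rep z.1.1 (c (z.2, z.1.2))))
      ((castRep rfl rfl (hl N)).continuous.comp (MapSpace.continuous_rep.comp
        (f := fun z : (StageMap X k A N × A') × 𝕋(G, j, 0) => (z.1.1, c (z.2, z.1.2)))
        ((by fun_prop : Continuous fun z : (StageMap X k A N × A') × 𝕋(G, j, 0) =>
          z.1.1).prodMk (hc.cont.comp (by fun_prop)))))
      fun z ζ h => hinf _ _ _ (hc.infty ζ _ h)
    obtain ⟨D, hD, hDE⟩ := MapSpace.exists_rep_eq hE
      (fun φ => unabs_ext (hP N) (hQ N) fun ζ => (hEc _ ζ).trans (hinf _ _ _ (hc.pt ζ)))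
      fun g φ a => unabs_ext (hP N) (hQ N) fun ζ => by
        refine (hEc _ ζ).trans ?_
        dsimp only
        have h := unabs_smul (hP N) (hQ N) g (E (φ, a)) ζ
        rw [permute_coord_zero] at h
        rw [h, hc.equi, MapSpace.rep_smul, castRep_smul, hEc]
    exact ⟨⟨D, hD⟩, fun φ ζ a => (congrArg (unabs (hP N) (hQ N) · ζ) (hDE φ a)).trans
      (hEc (φ, a) ζ)⟩
  choose D hDc using key
  obtain ⟨θ, hθ⟩ := exists_stableHom j D (fun N => MapSpace.rep_ext fun a =>
    unabs_ext (hP N) (hQ N) fun ζ => (hDc N _ ζ a).trans (by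
      rw [MapSpace.rep_base, castRep_base, MapSpace.rep_base, unabs_base]))
    fun N φ => MapSpace.rep_ext fun a => unabs_ext (hP (N + 1)) (hQ (N + 1)) fun ζ =>
      (hDc (N + 1) _ ζ a).trans (Eq.trans
        ((castRep_stab rfl rfl (hl N) rfl rfl (hl (N + 1)) _).trans
          (congrArg stab (hDc N φ ζ a).symm))
        (unabs_stab (hP N) (hQ N) (hP (N + 1)) (hQ (N + 1)) _ ζ).symm)
  refine ⟨MulEquiv.ofBijective θ ⟨(injective_iff_map_eq_one θ).2 fun x hx => ?_, fun x => ?_⟩⟩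
  · obtain ⟨N, γ, rfl⟩ := exists_cls X k A x
    obtain ⟨γ', hγ', h⟩ := hθ N γ
    obtain ⟨m, hm⟩ := (cls_eq_one_iff γ').1 (h.symm.trans hx)
    refine (cls_eq_one_iff γ).2 ⟨m, (after_castRep rfl rfl (hl N)).1 (hm.transport (fun p q l p' q' f f' =>
        ∃ hP hQ, ∀ s ζ a,
          unabs hP hQ (f (s, a)) ζ = f' (s, c (ζ, a))) ?_ ?_ ⟨hP N, hQ N, fun s ζ a => ?_⟩)⟩
    · rintro p q l p' q' f f' ⟨hP, hQ, h⟩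
      refine ⟨by omega, by omega, fun s ζ a => ?_⟩
      rw [unabs_stab hP hQ, h]
    · rintro p q l p' q' f f' ⟨hP, hQ, h⟩ ⟨H, hH, hHl, h0, h1⟩
      obtain ⟨H', hH', hHl', hc'⟩ := hc.exists_descend hP hQ hH hHl
      refine ⟨H', hH', hHl', ?_, ?_⟩
      · rintro ⟨s, x⟩
        obtain ⟨⟨ζ, a⟩, rfl⟩ := hc.surj x
        rw [hc', h0, h]
      · rintro ⟨s, x⟩
        obtain ⟨⟨ζ, a⟩, rfl⟩ := hc.surj x
        rw [hc', h1, unabs_base]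
    · refine Eq.trans ?_ (hDc N (γ s) ζ a)
      exact congrArg (fun x => unabs (hP N) (hQ N) (MapSpace.rep x a) ζ) (hγ' s)
  · obtain ⟨N, γ', rfl⟩ := ZeroCoeff.exists_cls_ge k' A' j x
    obtain ⟨H, -, hl', hHc⟩ := hc.exists_descend (W := Unit) (hP N) (hQ N)
      (H := fun z => MapSpace.loopRep γ' z.2) ((MapSpace.isLoopMap_loopRep γ').cont.comp
        (by fun_prop)) fun _ => MapSpace.isLoopMap_loopRep γ'
    obtain ⟨γ, hγ⟩ := MapSpace.exists_loopRep_eq (l := (1 - k).toNat + N)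
      (f := fun z => castRep rfl rfl (hl N).symm (H ((), z)))
      ⟨(castRep rfl rfl (hl N).symm).continuous.comp (hl' ()).cont,
        fun a => by rw [(hl' ()).zero, castRep_base],
        fun a => by rw [(hl' ()).one, castRep_base],
        fun s => by rw [(hl' ()).pt, castRep_base],
        fun g s a => by rw [(hl' ()).equi, castRep_smul]⟩
    obtain ⟨γ'', hγ'', h⟩ := hθ N γ
    refine ⟨cls X k A N (fromPath (.mk γ)), h.trans ?_⟩
    congr 3
    refine Path.ext (funext fun s => MapSpace.rep_ext fun a => unabs_ext (hP N) (hQ N) fun ζ => ?_)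
    rw [hγ'', hDc]
    have h := congrFun hγ (s, c (ζ, a))
    refine (congrArg (castRep rfl rfl (hl N)) h).trans ?_
    rw [castRep_castRep, castRep_rfl, hHc]
    rfl

end Suspension

section Reduced

lemma continuous_map₂_prodMk (V W : Type*) [TopologicalSpace V] [TopologicalSpace W] [T2Space V]
    [T2Space W] [LocallyCompactSpace V] [LocallyCompactSpace W] :
    Continuous (Y := OnePoint (V × W)) fun z : OnePoint V × OnePoint W =>
      Option.map₂ Prod.mk z.1 z.2 := by
  let i : V × W → OnePoint V × OnePoint W := fun z => (z.1, z.2)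
  have hi : Topology.IsOpenEmbedding i :=
    OnePoint.isOpenEmbedding_coe.prodMap OnePoint.isOpenEmbedding_coe
  refine continuous_def.2 fun U hU => ?_
  obtain ⟨hU1, hU2⟩ := OnePoint.isOpen_def.1 hU
  by_cases h : ∞ ∈ U
  · rw [← isClosed_compl_iff]
    convert ((hU1 h).image hi.continuous).isClosed
    ext ⟨_ | v, _ | w⟩
    iterate 3 exact iff_of_false (fun h' => h' h) (by rintro ⟨y, -, ⟨⟩⟩)
    change _ ↔ i (v, w) ∈ _
    rw [hi.injective.mem_set_image]
    rfl
  · convert hi.isOpenMap _ hU2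
    ext ⟨_ | v, _ | w⟩
    iterate 3 exact iff_of_false h (by rintro ⟨y, -, ⟨⟩⟩)
    change _ ↔ i (v, w) ∈ _
    rw [hi.injective.mem_set_image]
    rfl

variable {G : Type u} [Group G] [Finite G]

instance : CompactSpace (reducedRegSphere G) := inferInstanceAs (CompactSpace (OnePoint (sumZero G)))

lemma exists_isSmashSphere_regSphere : ∃ c : 𝕋(G, 1, 0) × reducedRegSphere G →
    regSphere G 1, IsSmashSphere c := by
  let _ := Fintype.ofFinite G
  have hcard : (Fintype.card G : ℝ) ≠ 0 := Nat.cast_ne_zero.2 Fintype.card_ne_zero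
  have hmem : ∀ v : G → ℝ, v ∈ sumZero G ↔ ∑ g, v g = 0 := fun v => by
    simp [sumZero, LinearMap.mem_ker, LinearMap.sum_apply]
  let e : (sumZero G × ℝ) ≃ₜ (Coord G 0 1 → ℝ) :=
    { toFun := fun z t => Sum.elim (fun i => i.elim0) (fun x => z.1.1 x.2 + z.2) t
      invFun := fun x => (⟨fun g => x (Sum.inr (0, g)) - (∑ g, x (Sum.inr (0, g))) / Fintype.card G,
        (hmem _).2 (by
          rw [Finset.sum_sub_distrib, Finset.sum_const, nsmul_eq_mul, Finset.card_univ,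
            mul_div_cancel₀ _ hcard, sub_self])⟩, (∑ g, x (Sum.inr (0, g))) / Fintype.card G)
      left_inv := fun z => by
        have h : (∑ g, (z.1.1 g + z.2)) / Fintype.card G = z.2 := by
          rw [Finset.sum_add_distrib, (hmem _).1 z.1.2, Finset.sum_const, nsmul_eq_mul,
            Finset.card_univ, zero_add, mul_div_cancel_left₀ _ hcard]
        refine Prod.ext (Subtype.ext (funext fun g => ?_)) h
        change z.1.1 g + z.2 - (∑ g, (z.1.1 g + z.2)) / Fintype.card G = _
        rw [h, add_sub_cancel_right]
      right_inv := fun x => funext fun t => by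
        rcases t with t | ⟨t, g⟩
        · exact t.elim0
        · obtain rfl := Subsingleton.elim 0 t
          exact sub_add_cancel _ _
      continuous_toFun := continuous_pi fun t => by
        rcases t with t | ⟨t, g⟩
        · exact t.elim0
        · exact ((continuous_apply g).comp (continuous_subtype_val.comp continuous_fst)).add
            continuous_snd
      continuous_invFun := by fun_prop }
  have : ProperSpace (sumZero G) := FiniteDimensional.proper_real _
  let t₀ : Coord G 1 0 := .inl 0
  have ht : ∀ t : Coord G 1 0, t = t₀ := fun t => by
    rcases t with t | ⟨t, -⟩
    · exact congrArg Sum.inl (Subsingleton.elim t 0)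
    · exact t.elim0
  have hinf : ∀ ζ : 𝕋(G, 1, 0), (∃ t, ζ t = ∞) ↔ ζ t₀ = ∞ :=
    fun ζ => ⟨fun ⟨t, h⟩ => ht t ▸ h, fun h => ⟨_, h⟩⟩
  let s : OnePoint (sumZero G) × OnePoint ℝ → OnePoint (sumZero G × ℝ) :=
    fun z => Option.map₂ .mk z.1 z.2
  have hs : ∀ a r, s (a, r) = ∞ ↔ r = ∞ ∨ a = ∞ := fun a r => by
    rcases a with _ | a <;> rcases r with _ | r
    · exact iff_of_true rfl (.inl rfl)
    · exact iff_of_true rfl (.inr rfl)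
    · exact iff_of_true rfl (.inl rfl)
    · exact iff_of_false nofun nofun
  refine ⟨fun z => e.onePointCongr (s (z.2, z.1 t₀)), ⟨e.onePointCongr.continuous.comp
    ((continuous_map₂_prodMk (sumZero G) ℝ).comp (by fun_prop)), fun x => ?_, fun ζ a h => ?_,
    fun ζ => rfl, fun ζ a ζ' a' h => ?_, fun g ζ a => ?_⟩⟩
  · obtain ⟨_ | y, rfl⟩ := e.onePointCongr.surjective x
    · exact ⟨(fun _ => ∞, ∞), rfl⟩
    · exact ⟨(fun _ => y.2, (y.1 : OnePoint (sumZero G))), rfl⟩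
  · exact congrArg e.onePointCongr ((hs _ _).2 (.inl ((hinf ζ).1 h)))
  · have h : s (a, ζ t₀) = s (a', ζ' t₀) := e.onePointCongr.injective h
    rw [hinf, hinf]
    by_cases h1 : s (a, ζ t₀) = ∞
    · exact .inr ⟨(hs _ _).1 h1, (hs _ _).1 (h ▸ h1)⟩
    · left
      have hζ : ∀ ζ : 𝕋(G, 1, 0), ζ = fun _ => ζ t₀ := fun ζ => funext fun t => by rw [ht t]
      rw [hζ ζ, hζ ζ']
      generalize ζ t₀ = r at *
      generalize ζ' t₀ = r' at *
      rcases a with _ | a <;> rcases r with _ | r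
      iterate 3 exact (h1 rfl).elim
      rcases a' with _ | a' <;> rcases r' with _ | r'
      iterate 3 exact nomatch h
      cases h
      rfl
  · change e.onePointCongr (s (OnePoint.map (reducedRegRep G g) a, permute g ζ t₀)) = 
      OnePoint.map (permRep G (Coord G 0 1) g) (e.onePointCongr (s (a, ζ t₀)))
    rw [permute_coord_zero]
    generalize ζ t₀ = r
    rcases a with _ | a <;> rcases r with _ | r
    iterate 3 rfl
    refine congrArg some (funext fun t => ?_)
    rcases t with t | ⟨t, h⟩
    · exact t.elim0
    · rfl

lemma exists_isSmashSphere_orbit_top :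
    ∃ c : 𝕋(G, 0, 0) × orbit (⊤ : Subgroup G) → regSphere G 0, IsSmashSphere c := by
  have := QuotientGroup.subsingleton_quotient_top (G := G)
  have : IsEmpty (Coord G 0 0) := inferInstanceAs (IsEmpty (Fin 0 ⊕ Fin 0 × G))
  let f : Option (G ⧸ (⊤ : Subgroup G)) → Option (Coord G 0 0 → ℝ) := Option.map fun _ => isEmptyElim
  refine ⟨fun z => f z.2, (continuous_of_discreteTopology (α := orbit ⊤) (β := regSphere G 0) (f := f)).comp continuous_snd,
    fun x => ?_, fun ζ a h => isEmptyElim h.choose, fun ζ => rfl, fun ζ a ζ' a' h => ?_, fun g ζ a => ?_⟩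
  · rcases x with _ | x
    · exact ⟨(isEmptyElim, none), rfl⟩
    · exact ⟨(isEmptyElim, coset ⊤), congrArg some (Subsingleton.elim _ _)⟩
  · left
    rcases a with _ | a <;> rcases a' with _ | a'
    · rw [Subsingleton.elim ζ ζ']
    · cases h
    · cases h
    · rw [Subsingleton.elim ζ ζ', Subsingleton.elim a a']
  · rcases a with _ | a
    · rfl
    · exact congrArg some (Subsingleton.elim _ _)

end Reduced

section EilenbergMacLane

variable {G : Type u} [Group G] {X : GPrespectrum G} {M : Type} [AddCommGroup M]

lemma IsEilenbergMacLane.exists_zeroCoeff (h : IsEilenbergMacLane X M) :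
    Nonempty (ZeroCoeff X M) :=
  h.coeff.elim fun φ hφ => ⟨⟨φ, hφ⟩⟩

lemma IsEilenbergMacLane.subsingleton_cohomology [Finite G] [Nontrivial G]
    (h : IsEilenbergMacLane X M) (hM : NoTorsion M) {n i : ℕ}
    (hi : 0 < i) (hi' : i < 4) (h3 : ¬ (Nat.card G = 3 ∧ n = 1 ∧ i = 3)) :
    Subsingleton (cohomology X i (regSphere G n)) := by
  obtain ⟨c⟩ := h.exists_zeroCoeff
  rcases n.eq_zero_or_pos with rfl | hn
  · obtain ⟨e, he⟩ := exists_isSmashSphere_orbit_top (G := G)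
    have : Finite (orbit (⊤ : Subgroup G)) := inferInstanceAs (Finite (Option (G ⧸ _)))
    obtain ⟨θ⟩ := he.nonempty_mulEquiv (k := -i) (k' := -i) (by simp) (by omega)
    have := h.vanish ⊤ (-i) (by omega)
    exact θ.toEquiv.subsingleton
  refine subsingleton_of_forall_eq 1 fun x => ?_
  obtain ⟨N, γ, rfl⟩ := exists_cls X (-i) (regSphere G n) x
  exact (cls_eq_one_iff γ).2 ((MapSpace.isLoopMap_loopRep γ).null c h.vanish (by omega) hM hn hi
    hi' (by omega) h3)

lemma IsEilenbergMacLane.cohomology_three [Finite G] (h : IsEilenbergMacLane X ℤ)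
    (h3 : Nat.card G = 3) : Nonempty (cohomology X 3 (regSphere G 1) ≃* Multiplicative ℤ) := by
  obtain ⟨c⟩ := h.exists_zeroCoeff
  have hM : ∀ (n : ℕ) (m : ℤ), n ≠ 0 → n • m = 0 → m = 0 := fun n m hn hm =>
    (smul_eq_zero.1 hm).resolve_left hn
  have := c.nontrivial h.vanish hM h3
  obtain ⟨θ, hθ⟩ := c.exists_injective h.vanish hM h3
  exact nonempty_mulEquiv_int (A := stableMaps (-3) (regSphere G 1) X) θ hθ

lemma nonempty_cohomology_mulEquiv [Finite G] :
    Nonempty (cohomology X 3 (regSphere G 1) ≃* cohomology X 2 (reducedRegSphere G)) := by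
  obtain ⟨c, hc⟩ := exists_isSmashSphere_regSphere (G := G)
  exact hc.nonempty_mulEquiv rfl (by omega)

lemma intLocTwo_eq_zero (n : ℕ) (m : IntLocTwo) (hn : n ≠ 0) (h : n • m = 0) : m = 0 := by
  have hle : oddIntegers ≤ nonZeroDivisors ℤ := le_nonZeroDivisors_of_noZeroDivisors fun h =>
    (Int.not_odd_iff_even.2 Even.zero) h
  have : IsDomain IntLocTwo := IsLocalization.isDomain_localization hle
  rw [nsmul_eq_mul] at h
  refine (mul_eq_zero.1 h).resolve_left fun h0 => hn ?_
  have hi := IsLocalization.injective IntLocTwo hle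
  have : algebraMap ℤ IntLocTwo n = algebraMap ℤ IntLocTwo 0 := by
    rw [map_natCast, map_zero, h0]
  exact_mod_cast hi this

lemma IsEilenbergMacLane.subsingleton_slice [Finite G] (h : IsEilenbergMacLane X M)
    (hM : NoTorsion M) (hr : Nat.card G = 2 ^ r)
    {S : SliceCell G} (hS : S.IsIsotropic) (hd : Even S.dim) {k : ℤ} (hk : -4 < k) (hk' : k < 0) :
    Subsingleton (homotopyGroup k (X.smash S.spectrum)) := by
  obtain ⟨c⟩ := h.exists_zeroCoeff
  have hcard : ∀ K : Subgroup G, K ≠ ⊥ → ∃ j, Nat.card K = 2 ^ (j + 1) := fun K hK => by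
    obtain ⟨j, -, hj⟩ := (Nat.dvd_prime_pow Nat.prime_two).1 (hr ▸ K.card_subgroup_dvd_card)
    rcases j with - | j
    · exact (hK (Subgroup.card_eq_one.1 hj)).elim
    · exact ⟨j, hj⟩
  rcases S with ⟨m, K⟩ | ⟨m, K⟩
  · obtain ⟨j, hj⟩ := hcard K hS
    obtain ⟨i, rfl⟩ : ∃ i : ℕ, k = -i := ⟨k.natAbs, by omega⟩
    exact subsingleton_homotopyGroup_smash_inducedSphere c h.vanish hM m K hS
      (by rw [hj, pow_succ]; omega) (by omega) (by omega)
  · obtain ⟨j, hj⟩ := hcard K hS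
    refine (Int.not_even_iff_odd.2 ?_ hd).elim
    rw [SliceCell.dim, hj, pow_succ]
    exact Even.sub_odd ⟨m * 2 ^ j, by push_cast; ring⟩ odd_one

end EilenbergMacLane

end GStable

end

theorem mainTheorem11 :
    (∀ (G : Type u) [Group G] [Finite G] [Nontrivial G] (HZ : GStable.GPrespectrum G),
      GStable.IsEilenbergMacLane HZ ℤ →
        (∀ n i : ℕ, 0 < i → i < 4 → ¬ (Nat.card G = 3 ∧ n = 1 ∧ i = 3) →
          Subsingleton (GStable.cohomology HZ i (GStable.regSphere G n))) ∧
        (Nat.card G = 3 →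
          Nonempty (GStable.cohomology HZ 3 (GStable.regSphere G 1) ≃* Multiplicative ℤ) ∧
          Nonempty (GStable.cohomology HZ 2 (GStable.reducedRegSphere G) ≃* Multiplicative ℤ))) ∧
    (∀ (G : Type u) [Group G] [Finite G] [IsCyclic G] (r : ℕ), 0 < r → Nat.card G = 2 ^ r →
      ∀ HM : GStable.GPrespectrum G,
        (GStable.IsEilenbergMacLane HM ℤ ∨ GStable.IsEilenbergMacLane HM GStable.IntLocTwo) →
        ∀ S : GStable.SliceCell G, S.IsIsotropic → Even S.dim →
          ∀ k : ℤ, -4 < k → k < 0 →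
            Subsingleton (GStable.homotopyGroup k (HM.smash S.spectrum))) := by
  have hZ : ∀ (n : ℕ) (m : ℤ), n ≠ 0 → n • m = 0 → m = 0 := fun n m hn hm =>
    (smul_eq_zero.1 hm).resolve_left hn
  refine ⟨fun G _ _ _ HZ h => ⟨fun n i hi hi' h3 => h.subsingleton_cohomology hZ hi hi' h3,
    fun h3 => ⟨h.cohomology_three h3, ?_⟩⟩, fun G _ _ _ r _ hr HM h S hS hd k hk hk' => ?_⟩
  · obtain ⟨e⟩ := GStable.nonempty_cohomology_mulEquiv (X := HZ)
    obtain ⟨e'⟩ := h.cohomology_three h3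
    exact ⟨e.symm.trans e'⟩
  · rcases h with h | h
    · exact h.subsingleton_slice hZ hr hS hd hk hk'
    · exact h.subsingleton_slice GStable.intLocTwo_eq_zero hr hS hd hk hk'
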